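/- \textbf{Setting.} An instance of the Generalized Euclidean Traveling Salesman Problem (GETSP) consists of $n$ distinct inner points $V=\{v_1,\dots,v_n\}$ and $m$ terminal pairs $T=\{(t_1,t_1'),\dots,(t_m,t_m')\}$ of points in the Euclidean plane. A solution is a family of $m$ paths, the $i$-th leading from $t_i$ to $t_i'$ and visiting between its ends a sequence of distinct inner points, such that every inner point is included in exactly one of the paths. It is optimal if its total length is minimal. It is part of the definition of an instance that in every optimal solution no path intersects itself and no two paths intersect, except possibly at their ends. A path is redundant if it is just the edge from $t_i$ to $t_i'$, with no inner point on it. The size of an instance is $n+2m$. In $k$-ETSP we are given $N$ distinct points in the plane, exactly $k$ of which lie in the interior of the convex hull of all of them (the inner points; the others are the outer points), and we want a shortest closed tour that visits every point exactly once. Algorithms are programs for a real RAM (unit-cost arithmetic, square roots and comparisons of reals; integer registers of $O(\log(\text{input size}))$ bits). \textbf{Theorem.} (1) There is an algorithm that, given an instance of GETSP with $n$ inner points and $m\ge n^2$ terminal pairs, finds a set $T_0\subseteq T$ of exactly $m-n^2$ terminal pairs such that in some optimal solution the paths built on the pairs of $T_0$ are all redundant. It runs in $O(mn^2+n^6)$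 time and $O(m)$ space (where, in these two bounds, $n$ and $m$ are to be read as $\max(n,1)$ and $\max(m,1)$). (2) $k$-ETSP admits a quadratic bikernel: there is a polynomial-time algorithm that, given an instance of $k$-ETSP with $N$ points, computes a cyclic order $x_1,\dots,x_{N-k}$ of the outer points and an instance $J$ of GETSP whose inner points are the $k$ inner points and whose terminal pairs are at most $k^2$ of the pairs $(x_i,x_{i+1})$, indices taken cyclically (so that the size of $J$ is at most $k+2k^2$), together with the total length $c$ of the edges $x_ix_{i+1}$ for all other $i$, such that \begin{itemize} \item for every real $b$, there is a tour of length at most $b$ if and only if $J$ has a solution of total length at most $b-c$; \item for every optimal solution of $J$, its paths together with the edges $x_ix_{i+1}$ for all other $i$ form an optimal tour. \end{itemize} -/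

import Mathlib

namespace GETSPReduction

/-! ### Polygonal paths in the Euclidean plane -/

/-- The Euclidean plane. -/
abbrev Plane := EuclideanSpace ℝ (Fin 2)

/-- Length of the polygonal path through a list of points. -/
noncomputable def polyLength : List Plane → ℝ
  | p :: q :: l => dist p q + polyLength (q :: l)
  | _ => 0

/-- The set of points covered by the edges of the polygonal path `p`. -/
def trace (p : List Plane) : Set Plane :=
  {x | ∃ (i : ℕ) (h : i + 1 < p.length), x ∈ segment ℝ p[i] p[i + 1]}

/-- `x` is the first or the last point of `p`. -/
def IsEnd (p : List Plane) (x : Plane) : Prop :=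
  p.head? = some x ∨ p.getLast? = some x

/-- The path `p` has no self-intersections: two of its edges share at most the vertex in which the
first edge is followed by the second one. (If the path is closed, then its common first and last
point does not count as a self-intersection.) -/
def SelfAvoiding (p : List Plane) : Prop :=
  ∀ (i j : ℕ) (hij : i < j) (hj : j + 1 < p.length), ∀ x : Plane,
    x ∈ segment ℝ (p[i]'(by omega)) (p[i + 1]'(by omega)) →
    x ∈ segment ℝ (p[j]'(by omega)) (p[j + 1]'hj) →
    (j = i + 1 ∧ x = p[j]'(by omega)) ∨ (p.head? = some x ∧ p.getLast? = some x)

/-- Two paths intersect at most in points that are ends of both of them. -/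
def MeetOnlyAtEnds (p q : List Plane) : Prop :=
  ∀ x ∈ trace p ∩ trace q, IsEnd p x ∧ IsEnd q x

/-! ### The generalized Euclidean traveling salesman problem -/

/-- A family `R` of routes gives, for every terminal pair, the sequence of inner points that its
path visits between its ends. It is a solution if no path visits a point twice and every inner
point is included in exactly one of the paths. -/
def IsSolution {n m : ℕ} (R : Fin m → List (Fin n)) : Prop :=
  (∀ j, (R j).Nodup) ∧ ∀ v, ∃! j, v ∈ R j

/-- The data of an instance: `n` inner points and `m` terminal pairs. -/
structure Points (n m : ℕ) where
  inner : Fin n → Plane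
  pair : Fin m → Plane × Plane

namespace Points

variable {n m : ℕ}

/-- The path built on the `j`-th terminal pair. It is redundant (a direct edge) iff `R j = []`. -/
def path (D : Points n m) (R : Fin m → List (Fin n)) (j : Fin m) : List Plane :=
  (D.pair j).1 :: ((R j).map D.inner ++ [(D.pair j).2])

/-- Total length of the paths. -/
noncomputable def cost (D : Points n m) (R : Fin m → List (Fin n)) : ℝ :=
  ∑ j, polyLength (D.path R j)

def IsOptimal (D : Points n m) (R : Fin m → List (Fin n)) : Prop :=
  IsSolution R ∧ ∀ R' : Fin m → List (Fin n), IsSolution R' → D.cost R ≤ D.cost R'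

end Points

/-- An instance of GETSP: the inner points are distinct, and in every optimal solution the paths
have no self-intersections and intersect each other at most at their ends. -/
structure GETSP (n m : ℕ) extends Points n m where
  inner_injective : Function.Injective inner
  selfAvoiding : ∀ R, toPoints.IsOptimal R → ∀ j, SelfAvoiding (toPoints.path R j)
  meetOnlyAtEnds : ∀ R, toPoints.IsOptimal R → ∀ i j, i ≠ j →
    MeetOnlyAtEnds (toPoints.path R i) (toPoints.path R j)

/-! ### The real RAM

Programs work on arrays of natural numbers and arrays of real numbers, each named by a number (so a
program uses finitely many arrays). A machine has two limits: every array has `mem` cells, and every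
integer that occurs is at most `word`. A program that exceeds a limit is stuck and has no execution.
Thus a program that runs with `mem = S` uses `O(S)` memory cells in total. There is no way to turn a
real number into an integer, except by comparisons. -/

structure Limits where
  mem : ℕ
  word : ℕ

structure Store where
  int : ℕ → ℕ → ℕ
  real : ℕ → ℕ → ℝ

/-- An integer is usable if it fits into a word. -/
def Limits.fit (L : Limits) (v : ℕ) : Option ℕ := if v ≤ L.word then some v else none

/-- An array index is usable if it is in the available memory. -/
def Limits.addr (L : Limits) (i : ℕ) : Option ℕ := if i < L.mem then some i else none

inductive IntExpr where
  | lit (c : ℕ)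
  | load (a : ℕ) (i : IntExpr)
  | add (e f : IntExpr)
  | sub (e f : IntExpr)
  | mul (e f : IntExpr)
  | div (e f : IntExpr)

def IntExpr.eval (L : Limits) (s : Store) : IntExpr → Option ℕ
  | .lit c => L.fit c
  | .load a i => do
      let j ← i.eval L s
      let k ← L.addr j
      L.fit (s.int a k)
  | .add e f => do L.fit ((← e.eval L s) + (← f.eval L s))
  | .sub e f => do L.fit ((← e.eval L s) - (← f.eval L s))
  | .mul e f => do L.fit ((← e.eval L s) * (← f.eval L s))
  | .div e f => do L.fit ((← e.eval L s) / (← f.eval L s))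

/-- Real expressions. The conventions `x / 0 = 0` and `√x = 0` for `x < 0` are harmless, since a
program can test for these cases. -/
inductive RealExpr where
  | ofInt (e : IntExpr)
  | load (a : ℕ) (i : IntExpr)
  | add (e f : RealExpr)
  | sub (e f : RealExpr)
  | mul (e f : RealExpr)
  | div (e f : RealExpr)
  | sqrt (e : RealExpr)

noncomputable def RealExpr.eval (L : Limits) (s : Store) : RealExpr → Option ℝ
  | .ofInt e => do return ((← e.eval L s : ℕ) : ℝ)
  | .load a i => do
      let j ← i.eval L s
      let k ← L.addr j
      return s.real a k
  | .add e f => do return (← e.eval L s) + (← f.eval L s)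
  | .sub e f => do return (← e.eval L s) - (← f.eval L s)
  | .mul e f => do return (← e.eval L s) * (← f.eval L s)
  | .div e f => do return (← e.eval L s) / (← f.eval L s)
  | .sqrt e => do return Real.sqrt (← e.eval L s)

inductive BoolExpr where
  | intLe (e f : IntExpr)
  | realLe (e f : RealExpr)
  | not (b : BoolExpr)
  | and (b c : BoolExpr)

noncomputable def BoolExpr.eval (L : Limits) (s : Store) : BoolExpr → Option Bool
  | .intLe e f => do return decide ((← e.eval L s) ≤ (← f.eval L s))
  | .realLe e f => do return decide ((← e.eval L s) ≤ (← f.eval L s))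
  | .not b => do return !(← b.eval L s)
  | .and b c => do return (← b.eval L s) && (← c.eval L s)

/-- Programs. `intStore a i e` is the assignment `a[i] := e` for an integer array `a`, and
`realStore a i e` is the same for a real array. -/
inductive Prog where
  | intStore (a : ℕ) (i e : IntExpr)
  | realStore (a : ℕ) (i : IntExpr) (e : RealExpr)
  | seq (p q : Prog)
  | ite (b : BoolExpr) (p q : Prog)
  | loop (b : BoolExpr) (p : Prog)

def Store.setInt (s : Store) (a i v : ℕ) : Store :=
  { s with int := Function.update s.int a (Function.update (s.int a) i v) }

noncomputable def Store.setReal (s : Store) (a i : ℕ) (v : ℝ) : Store :=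
  { s with real := Function.update s.real a (Function.update (s.real a) i v) }

/-- `Exec L p s t s'`: on a machine with limits `L`, the program `p` started in `s` halts after `t`
steps in `s'`. Every assignment and every test is one step. -/
inductive Exec (L : Limits) : Prog → Store → ℕ → Store → Prop
  | intStore {s : Store} {a : ℕ} {i e : IntExpr} {j v : ℕ} :
      i.eval L s = some j → j < L.mem → e.eval L s = some v →
      Exec L (.intStore a i e) s 1 (s.setInt a j v)
  | realStore {s : Store} {a : ℕ} {i : IntExpr} {e : RealExpr} {j : ℕ} {v : ℝ} :
      i.eval L s = some j → j < L.mem → e.eval L s = some v →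
      Exec L (.realStore a i e) s 1 (s.setReal a j v)
  | seq {p q : Prog} {s s' s'' : Store} {t t' : ℕ} :
      Exec L p s t s' → Exec L q s' t' s'' → Exec L (.seq p q) s (t + t') s''
  | ite_true {b : BoolExpr} {p q : Prog} {s s' : Store} {t : ℕ} :
      b.eval L s = some true → Exec L p s t s' → Exec L (.ite b p q) s (1 + t) s'
  | ite_false {b : BoolExpr} {p q : Prog} {s s' : Store} {t : ℕ} :
      b.eval L s = some false → Exec L q s t s' → Exec L (.ite b p q) s (1 + t) s'
  | loop_true {b : BoolExpr} {p : Prog} {s s' s'' : Store} {t t' : ℕ} :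
      b.eval L s = some true → Exec L p s t s' → Exec L (.loop b p) s' t' s'' →
      Exec L (.loop b p) s (1 + t + t') s''
  | loop_false {b : BoolExpr} {p : Prog} {s : Store} :
      b.eval L s = some false → Exec L (.loop b p) s 1 s

/-! ### Encoding of instances -/

/-- A finite sequence of reals as the content of an array, padded with zeros. -/
noncomputable def tab {n : ℕ} (f : Fin n → ℝ) (i : ℕ) : ℝ := if h : i < n then f ⟨i, h⟩ else 0

/-- The input store of an instance of GETSP. The integer cells `0[0]` and `1[0]` hold `n` and `m`;
the real arrays `0, 1` hold the coordinates of the inner points, and `2, 3` and `4, 5` those of the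
first and the second points of the terminal pairs. Everything else is zero. -/
noncomputable def Points.input {n m : ℕ} (D : Points n m) : Store where
  int a i := if a = 0 ∧ i = 0 then n else if a = 1 ∧ i = 0 then m else 0
  real a i := match a with
    | 0 => tab (fun v => D.inner v 0) i
    | 1 => tab (fun v => D.inner v 1) i
    | 2 => tab (fun j => (D.pair j).1 0) i
    | 3 => tab (fun j => (D.pair j).1 1) i
    | 4 => tab (fun j => (D.pair j).2 0) i
    | 5 => tab (fun j => (D.pair j).2 1) i
    | _ => 0

/-- The store `s` holds the instance `D` in the cells described above. -/
def Points.StoredIn {n m : ℕ} (D : Points n m) (s : Store) : Prop :=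
  s.int 0 0 = n ∧ s.int 1 0 = m ∧
  (∀ v : Fin n, s.real 0 v = D.inner v 0 ∧ s.real 1 v = D.inner v 1) ∧
  ∀ j : Fin m, s.real 2 j = (D.pair j).1 0 ∧ s.real 3 j = (D.pair j).1 1 ∧
    s.real 4 j = (D.pair j).2 0 ∧ s.real 5 j = (D.pair j).2 1

/-! ### The Euclidean traveling salesman problem and its bikernel -/

section ETSP

variable {N : ℕ}

/-- The (indices of the) points that lie strictly inside the convex hull of all points. -/
def innerSet (V : Fin N → Plane) : Set (Fin N) :=
  {i | V i ∈ interior (convexHull ℝ (Set.range V))}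

/-- The parameter `k` of `k`-ETSP: the number of inner points. -/
noncomputable def innerCount (V : Fin N → Plane) : ℕ := (innerSet V).ncard

/-- A tour visits every point exactly once (and then returns to the first point). -/
def IsTour (l : List (Fin N)) : Prop := l.Nodup ∧ ∀ i, i ∈ l

/-- Length of the closed polygon through a list of points. -/
noncomputable def tourLength (V : Fin N → Plane) : List (Fin N) → ℝ
  | [] => 0
  | a :: l => polyLength ((a :: (l ++ [a])).map V)

def IsOptimalTour (V : Fin N → Plane) (l : List (Fin N)) : Prop :=
  IsTour l ∧ ∀ l', IsTour l' → tourLength V l ≤ tourLength V l'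

/-- The input store of an instance of ETSP: the integer cell `0[0]` holds the number of points, and
the real arrays `0, 1` hold their coordinates. -/
noncomputable def tspInput (V : Fin N → Plane) : Store where
  int a i := if a = 0 ∧ i = 0 then N else 0
  real a i := match a with
    | 0 => tab (fun v => V v 0) i
    | 1 => tab (fun v => V v 1) i
    | _ => 0

/-- A reduction of the ETSP instance `V` to a GETSP instance: a cyclic order `outer` of the points
that are not inner, and an instance of GETSP whose inner points are the inner points of `V`
and whose terminal pairs are some of the pairs of cyclically consecutive outer points. The edges
between the other consecutive outer points are fixed. -/
structure Kernel (V : Fin N → Plane) where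
  m : ℕ
  inst : GETSP (innerCount V) m
  innerIdx : Fin (innerCount V) → Fin N
  outer : Fin (N - innerCount V) → Fin N
  kept : Fin m → Fin (N - innerCount V)
  innerIdx_injective : Function.Injective innerIdx
  range_innerIdx : Set.range innerIdx = innerSet V
  outer_injective : Function.Injective outer
  range_outer : Set.range outer = (innerSet V)ᶜ
  kept_injective : Function.Injective kept
  inst_inner : ∀ v, inst.inner v = V (innerIdx v)
  inst_pair : ∀ j, inst.pair j = (V (outer (kept j)), V (outer (finRotate _ (kept j))))

namespace Kernel

variable {V : Fin N → Plane}

/-- Total length of the fixed edges. -/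
noncomputable def fixedLength (K : Kernel V) : ℝ :=
  ∑ i with ∀ j, K.kept j ≠ i, dist (V (K.outer i)) (V (K.outer (finRotate _ i)))

/-- The tour made of the fixed edges and of the paths of a solution of the GETSP instance. -/
noncomputable def tour (K : Kernel V) (R : Fin K.m → List (Fin (innerCount V))) : List (Fin N) :=
  (List.ofFn fun i => K.outer i ::
    (List.ofFn fun j => if K.kept j = i then (R j).map K.innerIdx else []).flatten).flatten

/-- The store `s` holds the reduction: the GETSP instance, the three index sequences, and the
total length of the fixed edges. -/
def StoredIn (K : Kernel V) (s : Store) : Prop :=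
  K.inst.toPoints.StoredIn s ∧
  (∀ i : Fin (N - innerCount V), s.int 2 i = K.outer i) ∧
  (∀ j : Fin K.m, s.int 3 j = K.kept j) ∧
  (∀ v : Fin (innerCount V), s.int 4 v = K.innerIdx v) ∧
  s.real 6 0 = K.fixedLength

/-- The reduction is correct, both for the decision problem and for the optimization problem. -/
def Correct (K : Kernel V) : Prop :=
  (∀ b : ℝ, (∃ l, IsTour l ∧ tourLength V l ≤ b) ↔
    ∃ R, IsSolution R ∧ K.inst.cost R ≤ b - K.fixedLength) ∧
  ∀ R, K.inst.IsOptimal R → IsOptimalTour V (K.tour R)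

end Kernel

end ETSP

end GETSPReduction

open GETSPReduction

/-!
**Redundant terminal pairs.** Give every ordered pair `x = (u, v)` of inner points a row and every
terminal pair `j = (t, t')` a column, with the cost `c x j = |tu| + |uv| + |vt'| - |tt'| ≥ 0`. Up to
a summand that depends only on the route, `c x j` is the additional length that arises if a route
from `u` to `v` is put on the terminal pair `j`. Let `mu` be a matching of all `n ^ 2` rows of least
cost. Linear programming duality certifies it by potentials `IsPotential`. The nonredundant paths of
an optimal solution use pairwise different rows, so they form a partial matching. An exchange
argument (`exists_insert`, `exists_matching_not_free`) moves this partial matching to columns of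
`mu` without additional cost: a row on a free column is taken out and inserted again at its column
under `mu`, and a row that is displaced there is moved on in the same way. Hence some optimal
solution is redundant on the `m - n ^ 2` free columns (`Points.exists_isOptimal_redundant`).

The program computes `mu` with the Hungarian method, one row per phase. The full cost matrix would
need too much time in each phase and too much space, so the columns are divided into blocks of
`n ^ 2`. For every row and every block the best free column is stored, which takes `O(m)` cells.
In a phase, each row needs only its best free column besides the columns that are matched already,
so that the search takes `O(n ^ 4)` steps after the table has been read. Afterwards a single column
is no longer free, and only its block has to be updated. This gives `matchingProg_correct`.

**The bikernel.** An optimal tour of points that are not on one line does not cross or touch itself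
(`IsShortest.noncrossing`): if two edges meet, then the tour is shortened by reversing one of the
parts between them, unless the edges overlap, and then moving one visit after the other shows that
all points are on one line. Let `b` be the successor of `a` on the hull, and suppose that the tour
visits boundary points `y`, `z` in the cyclic order `a, y, b, z`. One of `y, z` can be paired with
`a` and the other one with `b` such that two disjoint parts of the tour join points that alternate
on the boundary. That is impossible: on the product of two disjoint polygonal paths the argument of
the difference of the points is a function, so its changes along the boundary of the product add up
to zero (`wind_boundary`), but the position of the ends on the boundary makes all of them turns in
the same direction (`not_disjoint_trace`). So neighbours on the hull are neighbours among the outer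
points on the tour, and walking along the hull yields the order in which an optimal tour visits the
outer points (`optOrder_of_hullStep`). If all points are on one line, then all points are outer and
the order along the line is optimal (`optOrder_of_oneLine`).

With the pairs of consecutive outer points as terminal pairs, solutions correspond to tours, with
the same lengths, and the optimum is attained by an optimal tour. If there are at least `k ^ 2`
pairs, then all but `k ^ 2` of them are redundant in some optimal solution and can be fixed. A
solution for the remaining pairs is a tour together with the fixed edges, and the optimum does not
change (`Selection.kernel_correct`). The paths of its optimal solutions are parts of an optimal
tour, so they do not intersect.

**Programs.** `Run` is an execution without limits, and `Tri` a logic for total correctness with a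
time bound. If all stored integers are at most `B`, then a static check of the program bounds all
array indices and intermediate values, so `Run.exec` turns a `Run` into an `Exec`.
-/


set_option linter.unusedSimpArgs false

namespace GETSPReduction

/-! ### Program logic for the real RAM -/

instance : Add IntExpr := ⟨.add⟩
instance : Sub IntExpr := ⟨.sub⟩
instance : Mul IntExpr := ⟨.mul⟩
instance : Div IntExpr := ⟨.div⟩
instance : Add RealExpr := ⟨.add⟩
instance : Sub RealExpr := ⟨.sub⟩
instance : Mul RealExpr := ⟨.mul⟩

/-- The value of an integer expression on a machine without limits. -/
def IntExpr.val (s : Store) : IntExpr → ℕ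
  | .lit c => c
  | .load a i => s.int a (i.val s)
  | .add e f => e.val s + f.val s
  | .sub e f => e.val s - f.val s
  | .mul e f => e.val s * f.val s
  | .div e f => e.val s / f.val s

/-- The value of a real expression on a machine without limits. -/
noncomputable def RealExpr.val (s : Store) : RealExpr → ℝ
  | .ofInt e => (e.val s : ℝ)
  | .load a i => s.real a (i.val s)
  | .add e f => e.val s + f.val s
  | .sub e f => e.val s - f.val s
  | .mul e f => e.val s * f.val s
  | .div e f => e.val s / f.val s
  | .sqrt e => Real.sqrt (e.val s)

/-- The truth value of a test on a machine without limits. -/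
def BoolExpr.val (s : Store) : BoolExpr → Prop
  | .intLe e f => e.val s ≤ f.val s
  | .realLe e f => e.val s ≤ f.val s
  | .not b => ¬ b.val s
  | .and b c => b.val s ∧ c.val s

section ValSimp
variable (s : Store)
@[simp] theorem IntExpr.val_lit (c : ℕ) : (IntExpr.lit c).val s = c := rfl
@[simp] theorem IntExpr.val_load (a : ℕ) (i : IntExpr) :
    (IntExpr.load a i).val s = s.int a (i.val s) := rfl
@[simp] theorem IntExpr.val_add (e f : IntExpr) : (e + f).val s = e.val s + f.val s := rfl
@[simp] theorem IntExpr.val_sub (e f : IntExpr) : (e - f).val s = e.val s - f.val s := rfl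
@[simp] theorem IntExpr.val_mul (e f : IntExpr) : (e * f).val s = e.val s * f.val s := rfl
@[simp] theorem IntExpr.val_div (e f : IntExpr) : (e / f).val s = e.val s / f.val s := rfl
@[simp] theorem RealExpr.val_ofInt (e : IntExpr) :
    (RealExpr.ofInt e).val s = (e.val s : ℝ) := rfl
@[simp] theorem RealExpr.val_load (a : ℕ) (i : IntExpr) :
    (RealExpr.load a i).val s = s.real a (i.val s) := rfl
@[simp] theorem RealExpr.val_add (e f : RealExpr) : (e + f).val s = e.val s + f.val s := rfl
@[simp] theorem RealExpr.val_sub (e f : RealExpr) : (e - f).val s = e.val s - f.val s := rfl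
@[simp] theorem RealExpr.val_mul (e f : RealExpr) : (e * f).val s = e.val s * f.val s := rfl
@[simp] theorem RealExpr.val_sqrt (e : RealExpr) :
    (RealExpr.sqrt e).val s = Real.sqrt (e.val s) := rfl
@[simp] theorem BoolExpr.val_intLe (e f : IntExpr) :
    (BoolExpr.intLe e f).val s ↔ e.val s ≤ f.val s := Iff.rfl
@[simp] theorem BoolExpr.val_realLe (e f : RealExpr) :
    (BoolExpr.realLe e f).val s ↔ e.val s ≤ f.val s := Iff.rfl
@[simp] theorem BoolExpr.val_not (b : BoolExpr) : (BoolExpr.not b).val s ↔ ¬ b.val s := Iff.rfl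
@[simp] theorem BoolExpr.val_and (b c : BoolExpr) :
    (BoolExpr.and b c).val s ↔ b.val s ∧ c.val s := Iff.rfl

@[simp] theorem Store.setInt_int (a i v b j : ℕ) :
    (s.setInt a i v).int b j = if b = a ∧ j = i then v else s.int b j := by
  simp only [Store.setInt, Function.update_apply]
  split_ifs <;> simp_all

@[simp] theorem Store.setInt_real (a i v : ℕ) : (s.setInt a i v).real = s.real := rfl

@[simp] theorem Store.setReal_real (a i b j : ℕ) (v : ℝ) :
    (s.setReal a i v).real b j = if b = a ∧ j = i then v else s.real b j := by
  simp only [Store.setReal, Function.update_apply]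
  split_ifs <;> simp_all

@[simp] theorem Store.setReal_int (a i : ℕ) (v : ℝ) : (s.setReal a i v).int = s.int := rfl

theorem Store.setInt_int_ne {a b : ℕ} (h : b ≠ a) (i v : ℕ) :
    (s.setInt a i v).int b = s.int b := by
  funext j; simp [h]

theorem Store.setReal_real_ne {a b : ℕ} (h : b ≠ a) (i : ℕ) (v : ℝ) :
    (s.setReal a i v).real b = s.real b := by
  funext j; simp [h]
end ValSimp

/-- Execution on a machine without limits, except that every integer that is stored must be at
most `B`. -/
inductive Run (B : ℕ) : Prog → Store → ℕ → Store → Prop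
  | intStore {s : Store} {a : ℕ} {i e : IntExpr} :
      e.val s ≤ B → Run B (.intStore a i e) s 1 (s.setInt a (i.val s) (e.val s))
  | realStore {s : Store} {a : ℕ} {i : IntExpr} {e : RealExpr} :
      Run B (.realStore a i e) s 1 (s.setReal a (i.val s) (e.val s))
  | seq {p q : Prog} {s s' s'' : Store} {t t' : ℕ} :
      Run B p s t s' → Run B q s' t' s'' → Run B (.seq p q) s (t + t') s''
  | ite_true {b : BoolExpr} {p q : Prog} {s s' : Store} {t : ℕ} :
      b.val s → Run B p s t s' → Run B (.ite b p q) s (1 + t) s'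
  | ite_false {b : BoolExpr} {p q : Prog} {s s' : Store} {t : ℕ} :
      ¬ b.val s → Run B q s t s' → Run B (.ite b p q) s (1 + t) s'
  | loop_true {b : BoolExpr} {p : Prog} {s s' s'' : Store} {t t' : ℕ} :
      b.val s → Run B p s t s' → Run B (.loop b p) s' t' s'' →
      Run B (.loop b p) s (1 + t + t') s''
  | loop_false {b : BoolExpr} {p : Prog} {s : Store} :
      ¬ b.val s → Run B (.loop b p) s 1 s

/-- A syntactic bound: if every stored integer is at most `B ≥ 1`, then the expression is at most
`lin * B`. There is none for expressions with relevant products. -/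
def IntExpr.lin : IntExpr → Option ℕ
  | .lit c => some c
  | .load _ _ => some 1
  | .add e f => do return (← e.lin) + (← f.lin)
  | .sub e _ => e.lin
  | .mul _ _ => none
  | .div e _ => e.lin

/-- The number of nodes of an expression. It bounds the degree of the value of the expression as
a polynomial in the stored integers. -/
def IntExpr.size : IntExpr → ℕ
  | .lit _ => 1
  | .load _ i => i.size + 1
  | .add e f => e.size + f.size
  | .sub e f => e.size + f.size
  | .mul e f => e.size + f.size
  | .div e f => e.size + f.size

/-- An array index passes the check if it is of linear size with coefficient at most `K`. -/
def IntExpr.okIdx (K : ℕ) (i : IntExpr) : Bool :=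
  match i.lin with
  | some c => decide (c ≤ K)
  | none => false

/-- A static check of an expression: constants are at most `K`, and array indices are of linear
size. -/
def IntExpr.ok (K : ℕ) : IntExpr → Bool
  | .lit c => decide (c ≤ K)
  | .load _ i => i.ok K && i.okIdx K
  | .add e f => e.ok K && f.ok K
  | .sub e f => e.ok K && f.ok K
  | .mul e f => e.ok K && f.ok K
  | .div e f => e.ok K && f.ok K

/-- The static check for real expressions; `S` bounds the size of the integer expressions. -/
def RealExpr.ok (K S : ℕ) : RealExpr → Bool
  | .ofInt e => e.ok K && decide (e.size ≤ S)
  | .load _ i => i.ok K && i.okIdx K && decide (i.size ≤ S)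
  | .add e f => e.ok K S && f.ok K S
  | .sub e f => e.ok K S && f.ok K S
  | .mul e f => e.ok K S && f.ok K S
  | .div e f => e.ok K S && f.ok K S
  | .sqrt e => e.ok K S

/-- The static check for tests. -/
def BoolExpr.ok (K S : ℕ) : BoolExpr → Bool
  | .intLe e f => e.ok K && f.ok K && decide (e.size ≤ S) && decide (f.size ≤ S)
  | .realLe e f => e.ok K S && f.ok K S
  | .not b => b.ok K S
  | .and b c => b.ok K S && c.ok K S

/-- The static check for programs. -/
def Prog.ok (K S : ℕ) : Prog → Bool
  | .intStore _ i e => i.ok K && i.okIdx K && decide (i.size ≤ S) && e.ok K && decide (e.size ≤ S)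
  | .realStore _ i e => i.ok K && i.okIdx K && decide (i.size ≤ S) && e.ok K S
  | .seq p q => p.ok K S && q.ok K S
  | .ite b p q => b.ok K S && p.ok K S && q.ok K S
  | .loop b p => b.ok K S && p.ok K S

/-- All stored integers are at most `B`. -/
def Store.Bdd (s : Store) (B : ℕ) : Prop := ∀ a i, s.int a i ≤ B

section Static
variable {L : Limits} {B K S : ℕ} {s : Store}

theorem IntExpr.val_le_lin (hs : s.Bdd B) (hB : 1 ≤ B) :
    ∀ (e : IntExpr) (c : ℕ), e.lin = some c → e.val s ≤ c * B
  | .lit c, c', h => by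
      simp only [lin, Option.some.injEq] at h; subst h
      exact Nat.le_mul_of_pos_right _ hB
  | .load a i, c, h => by
      simp only [lin, Option.some.injEq] at h; subst h
      simpa [val] using hs _ _
  | .add e f, c, h => by
      simp only [lin, Option.bind_eq_bind, Option.bind_eq_some_iff] at h
      obtain ⟨a, ha, b, hb, h⟩ := h
      simp only [Option.pure_def, Option.some.injEq] at h; subst h
      have := val_le_lin hs hB e a ha
      have := val_le_lin hs hB f b hb
      simp only [val, add_mul]; omega
  | .sub e f, c, h => (Nat.sub_le _ _).trans (val_le_lin hs hB e c h)
  | .mul e f, c, h => by simp [lin] at h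
  | .div e f, c, h => (Nat.div_le_self _ _).trans (val_le_lin hs hB e c h)

theorem IntExpr.size_pos : ∀ e : IntExpr, 1 ≤ e.size
  | .lit _ => le_rfl
  | .load _ i => by simp [size]
  | .add e f | .sub e f | .mul e f | .div e f => by
      have := size_pos e; simp only [size]; omega

theorem IntExpr.val_le_pow (hs : s.Bdd B) (hB : 2 ≤ B) (hK : K ≤ B) :
    ∀ e : IntExpr, e.ok K → e.val s ≤ B ^ e.size
  | .lit c, h => by
      simp only [ok, decide_eq_true_eq] at h
      simpa [val, size] using h.trans hK
  | .load a i, h => (hs _ _).trans (Nat.le_self_pow (by simp [size]) _)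
  | .add e f, h => by
      simp only [ok, Bool.and_eq_true] at h
      have h1 := val_le_pow hs hB hK e h.1
      have h2 := val_le_pow hs hB hK f h.2
      have p1 : B ≤ B ^ e.size := Nat.le_self_pow (by have := e.size_pos; omega) _
      have p2 : B ≤ B ^ f.size := Nat.le_self_pow (by have := f.size_pos; omega) _
      simp only [val, size, pow_add]
      nlinarith
  | .sub e f, h => by
      simp only [ok, Bool.and_eq_true] at h
      exact (Nat.sub_le _ _).trans ((val_le_pow hs hB hK e h.1).trans
        (Nat.pow_le_pow_right (by omega) (by simp [size])))
  | .mul e f, h => by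
      simp only [ok, Bool.and_eq_true] at h
      simp only [val, size, pow_add]
      exact Nat.mul_le_mul (val_le_pow hs hB hK e h.1) (val_le_pow hs hB hK f h.2)
  | .div e f, h => by
      simp only [ok, Bool.and_eq_true] at h
      exact (Nat.div_le_self _ _).trans ((val_le_pow hs hB hK e h.1).trans
        (Nat.pow_le_pow_right (by omega) (by simp [size])))

theorem IntExpr.okIdx_lt (hs : s.Bdd B) (hB : 2 ≤ B) (hm : K * B < L.mem) {i : IntExpr}
    (h : i.okIdx K) : i.val s < L.mem := by
  unfold okIdx at h
  split at h
  · rename_i c hc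
    have := val_le_lin hs (by omega) i c hc
    simp only [decide_eq_true_eq] at h
    exact (this.trans (Nat.mul_le_mul_right _ h)).trans_lt hm
  · simp at h

theorem IntExpr.eval_eq (hs : s.Bdd B) (hB : 2 ≤ B) (hK : K ≤ B) (hm : K * B < L.mem)
    (hw : B ^ S ≤ L.word) :
    ∀ e : IntExpr, e.ok K → e.size ≤ S → e.eval L s = some (e.val s) := by
  have key : ∀ e : IntExpr, e.ok K → e.size ≤ S → L.fit (e.val s) = some (e.val s) := by
    intro e he hS
    have := (val_le_pow hs hB hK e he).trans
      ((Nat.pow_le_pow_right (by omega) hS).trans hw)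
    simp [Limits.fit, this]
  intro e
  induction e with
  | lit c => intro h hS; exact key _ h hS
  | load a i ih =>
    intro h hS
    have h' := h
    simp only [ok, Bool.and_eq_true] at h
    have h1 := ih h.1 (by simp only [size] at hS; omega)
    have h2 := okIdx_lt (L := L) hs hB hm h.2
    have h3 := key _ h' hS
    simp only [val] at h3
    simp [eval, h1, Limits.addr, h2, h3, val]
  | add e f ihe ihf | sub e f ihe ihf | mul e f ihe ihf | div e f ihe ihf =>
    intro h hS
    have h3 := key _ h hS
    simp only [ok, Bool.and_eq_true] at h
    have h1 := ihe h.1 (by simp only [size] at hS; omega)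
    have h2 := ihf h.2 (by simp only [size] at hS; omega)
    simp only [val] at h3
    simp [eval, h1, h2, h3, val]

theorem RealExpr.eval_eq (hs : s.Bdd B) (hB : 2 ≤ B) (hK : K ≤ B) (hm : K * B < L.mem)
    (hw : B ^ S ≤ L.word) (e : RealExpr) (he : e.ok K S) : e.eval L s = some (e.val s) := by
  induction e with
  | ofInt e =>
    simp only [ok, Bool.and_eq_true, decide_eq_true_eq] at he
    simp [eval, val, IntExpr.eval_eq hs hB hK hm hw e he.1 he.2]
  | load a i =>
    simp only [ok, Bool.and_eq_true, decide_eq_true_eq] at he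
    simp [eval, val, IntExpr.eval_eq hs hB hK hm hw i he.1.1 he.2, Limits.addr,
      IntExpr.okIdx_lt (L := L) hs hB hm he.1.2]
  | add e f ihe ihf | sub e f ihe ihf | mul e f ihe ihf | div e f ihe ihf =>
    simp only [ok, Bool.and_eq_true] at he
    simp [eval, val, ihe he.1, ihf he.2]
  | sqrt e ih => simp [eval, val, ih he]

open Classical in
theorem BoolExpr.eval_eq (hs : s.Bdd B) (hB : 2 ≤ B) (hK : K ≤ B) (hm : K * B < L.mem)
    (hw : B ^ S ≤ L.word) (b : BoolExpr) (hb : b.ok K S) :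
    b.eval L s = some (decide (b.val s)) := by
  induction b with
  | intLe e f =>
    simp only [ok, Bool.and_eq_true, decide_eq_true_eq] at hb
    simp [eval, val, IntExpr.eval_eq hs hB hK hm hw e hb.1.1.1 hb.1.2,
      IntExpr.eval_eq hs hB hK hm hw f hb.1.1.2 hb.2]
    congr
  | realLe e f =>
    simp only [ok, Bool.and_eq_true] at hb
    simp [eval, val, RealExpr.eval_eq hs hB hK hm hw e hb.1,
      RealExpr.eval_eq hs hB hK hm hw f hb.2]
    congr
  | not b ih =>
    by_cases h : b.val s <;> simp [eval, val, ih hb, h]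
  | and b c ihb ihc =>
    simp only [ok, Bool.and_eq_true] at hb
    by_cases h : b.val s <;> by_cases h' : c.val s <;>
      simp [eval, val, ihb hb.1, ihc hb.2, h, h']

theorem Run.bdd {p : Prog} {s s' : Store} {t : ℕ} (h : Run B p s t s') (hs : s.Bdd B) :
    s'.Bdd B := by
  induction h with
  | intStore he =>
    intro b j; simp only [Store.setInt_int]; split_ifs
    exacts [he, hs _ _]
  | realStore => exact hs
  | seq _ _ ih1 ih2 => exact ih2 (ih1 hs)
  | ite_true _ _ ih => exact ih hs
  | ite_false _ _ ih => exact ih hs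
  | loop_true _ _ _ ih1 ih2 => exact ih2 (ih1 hs)
  | loop_false _ => exact hs

/-- A run without limits is an execution on every machine whose limits are large enough for the
static check. -/
theorem Run.exec {p : Prog} {s s' : Store} {t : ℕ} (h : Run B p s t s') (hs : s.Bdd B)
    (hB : 2 ≤ B) (hK : K ≤ B) (hm : K * B < L.mem) (hw : B ^ S ≤ L.word) (hp : p.ok K S) :
    Exec L p s t s' := by
  induction h with
  | intStore he =>
    simp only [Prog.ok, Bool.and_eq_true, decide_eq_true_eq] at hp
    exact .intStore (IntExpr.eval_eq hs hB hK hm hw _ hp.1.1.1.1 hp.1.1.2)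
      (IntExpr.okIdx_lt hs hB hm hp.1.1.1.2) (IntExpr.eval_eq hs hB hK hm hw _ hp.1.2 hp.2)
  | realStore =>
    simp only [Prog.ok, Bool.and_eq_true, decide_eq_true_eq] at hp
    exact .realStore (IntExpr.eval_eq hs hB hK hm hw _ hp.1.1.1 hp.1.2)
      (IntExpr.okIdx_lt hs hB hm hp.1.1.2) (RealExpr.eval_eq hs hB hK hm hw _ hp.2)
  | seq h1 h2 ih1 ih2 =>
    simp only [Prog.ok, Bool.and_eq_true] at hp
    exact .seq (ih1 hs hp.1) (ih2 (h1.bdd hs) hp.2)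
  | ite_true hb _ ih =>
    simp only [Prog.ok, Bool.and_eq_true] at hp
    exact .ite_true (by simp [BoolExpr.eval_eq hs hB hK hm hw _ hp.1.1, hb]) (ih hs hp.1.2)
  | ite_false hb _ ih =>
    simp only [Prog.ok, Bool.and_eq_true] at hp
    exact .ite_false (by simp [BoolExpr.eval_eq hs hB hK hm hw _ hp.1.1, hb]) (ih hs hp.2)
  | loop_true hb h1 h2 ih1 ih2 =>
    have hp' := hp
    simp only [Prog.ok, Bool.and_eq_true] at hp
    exact .loop_true (by simp [BoolExpr.eval_eq hs hB hK hm hw _ hp.1, hb]) (ih1 hs hp.2)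
      (ih2 (h1.bdd hs) hp')
  | loop_false hb =>
    simp only [Prog.ok, Bool.and_eq_true] at hp
    exact .loop_false (by simp [BoolExpr.eval_eq hs hB hK hm hw _ hp.1, hb])

end Static

/-- The integer array `a` is written by the program. -/
def Prog.wI (a : ℕ) : Prog → Bool
  | .intStore b _ _ => a == b
  | .realStore _ _ _ => false
  | .seq p q => p.wI a || q.wI a
  | .ite _ p q => p.wI a || q.wI a
  | .loop _ p => p.wI a

/-- The real array `a` is written by the program. -/
def Prog.wR (a : ℕ) : Prog → Bool
  | .intStore _ _ _ => false
  | .realStore b _ _ => a == b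
  | .seq p q => p.wR a || q.wR a
  | .ite _ p q => p.wR a || q.wR a
  | .loop _ p => p.wR a

/-- The stores agree on all arrays that are not written by `p`. -/
def Same (p : Prog) (s s' : Store) : Prop :=
  (∀ a, p.wI a = false → s'.int a = s.int a) ∧ ∀ a, p.wR a = false → s'.real a = s.real a

theorem Same.refl (p : Prog) (s : Store) : Same p s s := ⟨fun _ _ => rfl, fun _ _ => rfl⟩

theorem Same.trans {p : Prog} {s s' s'' : Store} (h : Same p s s') (h' : Same p s' s'') :
    Same p s s'' :=
  ⟨fun a ha => (h'.1 a ha).trans (h.1 a ha), fun a ha => (h'.2 a ha).trans (h.2 a ha)⟩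

theorem Same.mono {p q : Prog} {s s' : Store} (h : Same p s s')
    (hI : ∀ a, q.wI a = false → p.wI a = false) (hR : ∀ a, q.wR a = false → p.wR a = false) :
    Same q s s' :=
  ⟨fun a ha => h.1 a (hI a ha), fun a ha => h.2 a (hR a ha)⟩

theorem Run.same {B : ℕ} {p : Prog} {s s' : Store} {t : ℕ} (h : Run B p s t s') :
    Same p s s' := by
  induction h with
  | intStore _ =>
    refine ⟨fun b hb => Store.setInt_int_ne _ ?_ _ _, fun _ _ => rfl⟩
    rintro rfl; simp [Prog.wI] at hb
  | realStore =>
    refine ⟨fun _ _ => rfl, fun b hb => Store.setReal_real_ne _ ?_ _ _⟩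
    rintro rfl; simp [Prog.wR] at hb
  | seq _ _ ih1 ih2 =>
    exact (ih1.mono (by simp +contextual [Prog.wI]) (by simp +contextual [Prog.wR])).trans
      (ih2.mono (by simp +contextual [Prog.wI]) (by simp +contextual [Prog.wR]))
  | ite_true _ _ ih =>
    exact ih.mono (by simp +contextual [Prog.wI]) (by simp +contextual [Prog.wR])
  | ite_false _ _ ih =>
    exact ih.mono (by simp +contextual [Prog.wI]) (by simp +contextual [Prog.wR])
  | loop_true _ _ _ ih1 ih2 =>
    exact (ih1.mono (by simp [Prog.wI]) (by simp [Prog.wR])).trans ih2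
  | loop_false _ => exact .refl _ _

/-- Total correctness with a time bound: started in `s`, the program `p` halts after at most `T`
steps in a store that satisfies `Q`. By `Run.same`, that store agrees with `s` on all arrays that `p`
does not write; the rules for composed programs provide this as a hypothesis `Same`. -/
def Tri (B : ℕ) (p : Prog) (s : Store) (T : ℕ) (Q : Store → Prop) : Prop :=
  ∃ t s', Run B p s t s' ∧ t ≤ T ∧ Q s'

namespace Tri

variable {B T T₁ T₂ : ℕ} {p q : Prog} {s : Store} {Q Q' : Store → Prop}

theorem conseq (h : Tri B p s T Q) (hT : T ≤ T₁) (hQ : ∀ s', Same p s s' → Q s' → Q' s') :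
    Tri B p s T₁ Q' := by
  obtain ⟨t, s', hr, ht, hq⟩ := h
  exact ⟨t, s', hr, ht.trans hT, hQ s' hr.same hq⟩

theorem time (h : Tri B p s T Q) (hT : T ≤ T₁) : Tri B p s T₁ Q :=
  h.conseq hT fun _ _ h => h

theorem int {a : ℕ} {i e : IntExpr} (he : e.val s ≤ B)
    (hQ : Q (s.setInt a (i.val s) (e.val s))) : Tri B (.intStore a i e) s 1 Q :=
  ⟨1, _, .intStore he, le_rfl, hQ⟩

theorem real {a : ℕ} {i : IntExpr} {e : RealExpr}
    (hQ : Q (s.setReal a (i.val s) (e.val s))) : Tri B (.realStore a i e) s 1 Q :=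
  ⟨1, _, .realStore, le_rfl, hQ⟩

theorem seq (h : Tri B p s T₁ Q') (h' : ∀ s', Same p s s' → Q' s' → Tri B q s' T₂ Q) :
    Tri B (.seq p q) s (T₁ + T₂) Q := by
  obtain ⟨t, s', hr, ht, hq⟩ := h
  obtain ⟨t', s'', hr', ht', hq'⟩ := h' s' hr.same hq
  exact ⟨_, _, .seq hr hr', by omega, hq'⟩

/-- An assignment to an integer cell, followed by another program. -/
theorem intSeq {a : ℕ} {i e : IntExpr} (he : e.val s ≤ B)
    (h : Tri B q (s.setInt a (i.val s) (e.val s)) T Q) :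
    Tri B (.seq (.intStore a i e) q) s (1 + T) Q := by
  obtain ⟨t', s'', hr', ht', hq'⟩ := h
  exact ⟨_, _, .seq (.intStore he) hr', by omega, hq'⟩

/-- An assignment to a real cell, followed by another program. -/
theorem realSeq {a : ℕ} {i : IntExpr} {e : RealExpr}
    (h : Tri B q (s.setReal a (i.val s) (e.val s)) T Q) :
    Tri B (.seq (.realStore a i e) q) s (1 + T) Q := by
  obtain ⟨t', s'', hr', ht', hq'⟩ := h
  exact ⟨_, _, .seq .realStore hr', by omega, hq'⟩

theorem ite {b : BoolExpr} (h : b.val s → Tri B p s T Q) (h' : ¬ b.val s → Tri B q s T Q) :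
    Tri B (.ite b p q) s (1 + T) Q := by
  by_cases hb : b.val s
  · obtain ⟨t, s', hr, ht, hq⟩ := h hb
    exact ⟨_, s', .ite_true hb hr, by omega, hq⟩
  · obtain ⟨t, s', hr, ht, hq⟩ := h' hb
    exact ⟨_, s', .ite_false hb hr, by omega, hq⟩

/-- A loop whose invariant carries a number that decreases with every round. -/
theorem whileLoop {b : BoolExpr} (Inv : ℕ → Store → Prop) {K : ℕ} (h0 : Inv K s)
    (step : ∀ k s', Same p s s' → Inv k s' → b.val s' →
      Tri B p s' T fun s'' => ∃ k' < k, Inv k' s'') :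
    Tri B (.loop b p) s (K * (T + 1) + 1) fun s' => (∃ k, Inv k s') ∧ ¬ b.val s' := by
  suffices H : ∀ K s', Same p s s' → Inv K s' →
      Tri B (.loop b p) s' (K * (T + 1) + 1) fun s' => (∃ k, Inv k s') ∧ ¬ b.val s' from
    H K s (.refl _ _) h0
  intro K
  induction K using Nat.strong_induction_on with
  | _ K ih =>
    intro s' hs hI
    by_cases hb : b.val s'
    · obtain ⟨t, s₁, hr, ht, k', hk', hI'⟩ := step K s' hs hI hb
      obtain ⟨t', s₂, hr', ht', hq⟩ := ih k' hk' s₁ (hs.trans hr.same) hI'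
      refine ⟨_, _, .loop_true hb hr hr', ?_, hq⟩
      have : (k' + 1) * (T + 1) ≤ K * (T + 1) := Nat.mul_le_mul_right _ hk'
      rw [add_mul] at this
      omega
    · exact ⟨1, s', .loop_false hb, by omega, ⟨K, hI⟩, hb⟩

end Tri

/-- The cell `a[0]`, used as an integer variable. -/
abbrev var (a : ℕ) : IntExpr := .load a (.lit 0)

/-- Assignment to an integer variable. There is no empty program, so a branch that does nothing
is written as an assignment `setVar a (var a)`. -/
abbrev setVar (a : ℕ) (e : IntExpr) : Prog := .intStore a (.lit 0) e

/-- `for v = 0, …, e - 1 do p`. -/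
def forLoop (v : ℕ) (e : IntExpr) (p : Prog) : Prog :=
  .seq (setVar v (.lit 0)) (.loop (.not (.intLe e (var v)))
    (.seq p (setVar v (var v + .lit 1))))

/-- The invariant `Inv k` holds before the round in which the loop variable is `k`. The number of
rounds is fixed, since the bound `e` does not change during the loop. -/
theorem Tri.forLoop {B T : ℕ} {p : Prog} {s : Store} {v : ℕ} {e : IntExpr} {K : ℕ}
    (Inv : ℕ → Store → Prop) (hp : p.wI v = false) (hKB : K ≤ B) (h0 : Inv 0 (s.setInt v 0 0))
    (hK : ∀ s', Same (forLoop v e p) s s' → e.val s' = K)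
    (step : ∀ k < K, ∀ s', Same (GETSPReduction.forLoop v e p) s s' → s'.int v 0 = k → Inv k s' →
      Tri B p s' T fun s'' => Inv (k + 1) (s''.setInt v 0 (k + 1))) :
    Tri B (GETSPReduction.forLoop v e p) s (K * (T + 2) + 2) (Inv K) := by
  have hsub : ∀ s₁ s₂, Same (.seq p (setVar v (var v + .lit 1))) s₁ s₂ →
      Same (GETSPReduction.forLoop v e p) s₁ s₂ := fun s₁ s₂ h => h.mono
    (by simp +contextual [GETSPReduction.forLoop, Prog.wI])
    (by simp +contextual [GETSPReduction.forLoop, Prog.wR])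
  have h00 : Same (GETSPReduction.forLoop v e p) s (s.setInt v 0 0) := by
    refine ⟨fun a ha => Store.setInt_int_ne _ ?_ _ _, fun _ _ => rfl⟩
    rintro rfl; simp [GETSPReduction.forLoop, Prog.wI] at ha
  have := Tri.whileLoop (B := B) (s := s.setInt v 0 0) (b := .not (.intLe e (var v)))
    (p := .seq p (setVar v (var v + .lit 1))) (T := T + 1) (K := K)
    (fun k s' => k ≤ K ∧ s'.int v 0 = K - k ∧ Inv (K - k) s') ⟨le_rfl, by simp, by simpa using h0⟩
    (by
      rintro k s' hs ⟨hk, hv, hI⟩ hb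
      have hs' := h00.trans (hsub _ _ hs)
      have he := hK s' hs'
      simp only [BoolExpr.val_not, BoolExpr.val_intLe, he, IntExpr.val_load, IntExpr.val_lit,
        hv] at hb
      refine Tri.seq (step (K - k) (by omega) s' hs' hv hI) fun s₁ hs₁ hI₁ => ?_
      have hv₁ : s₁.int v 0 = K - k := by rw [hs₁.1 v hp, hv]
      refine Tri.int (by simp [hv₁]; omega) ⟨k - 1, by omega, by omega, by simp [hv₁]; omega, ?_⟩
      have e1 : K - (k - 1) = K - k + 1 := by omega
      simpa [hv₁, e1] using hI₁)
  obtain ⟨t, s', hr, ht, ⟨k, hk, hv, hI⟩, hb⟩ := this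
  have he := hK s' (h00.trans (Same.mono hr.same (by simp +contextual [GETSPReduction.forLoop, Prog.wI])
    (by simp +contextual [GETSPReduction.forLoop, Prog.wR])))
  simp only [BoolExpr.val_not, BoolExpr.val_intLe, he, IntExpr.val_load, IntExpr.val_lit,
    hv, not_not] at hb
  have : K - k = K := by omega
  rw [this] at hI
  refine ⟨_, _, .seq (.intStore (i := .lit 0) (e := .lit 0) (by simp)) hr, ?_, hI⟩
  have : K * (T + 1 + 1) = K * (T + 2) := rfl
  omega

/-! ### The assignment problem: potentials and augmentation -/

/-- `mu` matches the rows `0, …, r - 1` injectively to columns below `m`; the columns that are not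
used are the free ones. -/
structure IsMatching (m r : ℕ) (mu : ℕ → ℕ) (fr : ℕ → Prop) : Prop where
  lt : ∀ x < r, mu x < m
  inj : ∀ x < r, ∀ y < r, mu x = mu y → x = y
  free : ∀ j, fr j ↔ j < m ∧ ∀ x < r, mu x ≠ j

/-- `u, v` are feasible potentials for the rows below `R`, tight on the matched rows below `r`;
the column potentials are nonpositive, and zero on the free columns. -/
structure IsPotential (c : ℕ → ℕ → ℝ) (m R r : ℕ) (mu : ℕ → ℕ) (fr : ℕ → Prop) (u v : ℕ → ℝ) :
    Prop where
  feas : ∀ x < R, ∀ j < m, u x + v j ≤ c x j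
  tight : ∀ x < r, u x + v (mu x) = c x (mu x)
  nonpos : ∀ j < m, v j ≤ 0
  free : ∀ j, fr j → v j = 0

/-- The column by which the tree row at position `i` reaches the node `x`: the column matched to
`x` if `x < r`, and the best free column of the row if `x` is the sink `r`. -/
def colTo (r : ℕ) (mu best ord : ℕ → ℕ) (i x : ℕ) : ℕ :=
  if x < r then mu x else best (ord i)

/-- The slack (reduced cost) of the edge from the tree row at position `i` to the node `x`. -/
def slack (c : ℕ → ℕ → ℝ) (r : ℕ) (mu best ord : ℕ → ℕ) (u v : ℕ → ℝ) (i x : ℕ) : ℝ :=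
  c (ord i) (colTo r mu best ord i x) - u (ord i) - v (colTo r mu best ord i x)

/-- The alternating tree of the search for an augmenting path from the unmatched row `r`: the row
at position `i` is `ord i`, and its parent is at position `par i`, along an edge without slack. -/
structure IsTree (c : ℕ → ℕ → ℝ) (r : ℕ) (mu best : ℕ → ℕ) (u v : ℕ → ℝ) (k : ℕ)
    (ord par : ℕ → ℕ) : Prop where
  root : ord 0 = r
  lt : ∀ i, 1 ≤ i → i ≤ k → ord i < r
  inj : ∀ i i', 1 ≤ i → i ≤ k → 1 ≤ i' → i' ≤ k → ord i = ord i' → i = i'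
  par : ∀ i, 1 ≤ i → i ≤ k → par i < i ∧ slack c r mu best ord u v (par i) (ord i) = 0

open Classical in
/-- The row potentials after a dual step by `δ`. -/
noncomputable def stepU (k : ℕ) (ord : ℕ → ℕ) (δ : ℝ) (u : ℕ → ℝ) (y : ℕ) : ℝ :=
  if ∃ i ≤ k, ord i = y then u y + δ else u y

open Classical in
/-- The column potentials after a dual step by `δ`. -/
noncomputable def stepV (k : ℕ) (mu ord : ℕ → ℕ) (δ : ℝ) (v : ℕ → ℝ) (j : ℕ) : ℝ :=
  if ∃ i, 1 ≤ i ∧ i ≤ k ∧ mu (ord i) = j then v j - δ else v j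

section
variable {c : ℕ → ℕ → ℝ} {m r k : ℕ} {mu best ord par : ℕ → ℕ} {fr : ℕ → Prop}
  {u v : ℕ → ℝ} {δ : ℝ}

theorem IsPotential.slack_nonneg (hM : IsMatching m r mu fr)
    (hP : IsPotential c m (r + 1) r mu fr u v) (hb : ∀ x ≤ r, fr (best x)) {i x : ℕ}
    (hi : ord i ≤ r) : 0 ≤ slack c r mu best ord u v i x := by
  have : colTo r mu best ord i x < m := by
    unfold colTo; split_ifs with h
    · exact hM.lt x h
    · exact ((hM.free _).1 (hb _ hi)).1
  have := hP.feas (ord i) (by omega) _ this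
  unfold slack; linarith

theorem IsTree.le (hT : IsTree c r mu best u v k ord par) {i : ℕ} (hi : i ≤ k) : ord i ≤ r := by
  rcases Nat.eq_zero_or_pos i with rfl | h
  · exact hT.root.le
  · exact (hT.lt i h hi).le

/-- A dual step by at most the least slack of an edge that leaves the tree keeps the potentials
feasible. -/
theorem IsPotential.step (hM : IsMatching m r mu fr) (hP : IsPotential c m (r + 1) r mu fr u v)
    (hT : IsTree c r mu best u v k ord par)
    (hb : ∀ x ≤ r, fr (best x) ∧ ∀ j, fr j → c x (best x) ≤ c x j) (hδ : 0 ≤ δ)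
    (hmin : ∀ i ≤ k, ∀ x ≤ r, (∀ i', 1 ≤ i' → i' ≤ k → ord i' ≠ x) →
      δ ≤ slack c r mu best ord u v i x) :
    IsPotential c m (r + 1) r mu fr (stepU k ord δ u) (stepV k mu ord δ v) where
  feas x hx j hj := by
    unfold stepU stepV
    have h0 := hP.feas x hx j hj
    split_ifs with h1 h2 h2
    · linarith
    · obtain ⟨i, hi, rfl⟩ := h1
      by_cases hf : fr j
      · have h3 := hmin i hi r le_rfl fun i' h1 h2 => (hT.lt i' h1 h2).ne
        have h4 := (hb _ (hT.le hi)).2 j hf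
        have h5 := hP.free _ (hb _ (hT.le hi)).1
        have h6 := hP.free _ hf
        simp only [slack, colTo, lt_irrefl, if_false] at h3
        linarith
      · rw [hM.free] at hf
        push Not at hf
        obtain ⟨y, hy, rfl⟩ := hf hj
        have h3 := hmin i hi y hy.le fun i' h1' h2' h3' => h2 ⟨i', h1', h2', by rw [h3']⟩
        simp only [slack, colTo, hy, if_true] at h3
        linarith
    · linarith
    · exact h0
  tight x hx := by
    have h0 := hP.tight x hx
    unfold stepU stepV
    split_ifs with h1 h2 h2
    · linarith
    · obtain ⟨i, hi, rfl⟩ := h1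
      refine absurd ⟨i, ?_, hi, rfl⟩ h2
      rcases Nat.eq_zero_or_pos i with rfl | h
      · rw [hT.root] at hx; omega
      · exact h
    · obtain ⟨i, h1', hi, h3⟩ := h2
      exact absurd ⟨i, hi, hM.inj _ (hT.lt i h1' hi) _ hx h3⟩ h1
    · exact h0
  nonpos j hj := by
    have := hP.nonpos j hj
    unfold stepV; split_ifs <;> linarith
  free j hj := by
    unfold stepV
    rw [if_neg, hP.free j hj]
    rintro ⟨i, h1, h2, rfl⟩
    exact ((hM.free _).1 hj).2 _ (hT.lt i h1 h2) rfl

theorem slack_step (hM : IsMatching m r mu fr) (hT : IsTree c r mu best u v k ord par)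
    (hb : ∀ x ≤ r, fr (best x)) {i x : ℕ} (hi : i ≤ k)
    (hv : ∀ i', 1 ≤ i' → i' ≤ k → ord i' ≠ x) :
    slack c r mu best ord (stepU k ord δ u) (stepV k mu ord δ v) i x =
      slack c r mu best ord u v i x - δ := by
  have h1 : stepU k ord δ u (ord i) = u (ord i) + δ := if_pos ⟨i, hi, rfl⟩
  have h2 : stepV k mu ord δ v (colTo r mu best ord i x) = v (colTo r mu best ord i x) := by
    apply if_neg
    rintro ⟨i', h1', h2', h3⟩
    unfold colTo at h3
    split_ifs at h3 with h
    · exact hv i' h1' h2' (hM.inj _ (hT.lt i' h1' h2') _ h h3)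
    · exact ((hM.free _).1 (hb _ (hT.le hi))).2 _ (hT.lt i' h1' h2') h3
  simp only [slack, h1, h2]; ring

theorem IsTree.step (hT : IsTree c r mu best u v k ord par) :
    IsTree c r mu best (stepU k ord δ u) (stepV k mu ord δ v) k ord par where
  root := hT.root
  lt := hT.lt
  inj := hT.inj
  par i h1 h2 := by
    obtain ⟨h3, h4⟩ := hT.par i h1 h2
    refine ⟨h3, ?_⟩
    have e1 : stepU k ord δ u (ord (_root_.id (par i))) = u (ord (par i)) + δ :=
      if_pos ⟨par i, by omega, rfl⟩
    have e2 : stepV k mu ord δ v (mu (ord i)) = v (mu (ord i)) - δ := if_pos ⟨i, h1, h2, rfl⟩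
    simp only [slack, colTo, hT.lt i h1 h2, if_true, id] at h4 e1 ⊢
    rw [e1, e2]; linarith

theorem slack_congr {ord' : ℕ → ℕ} {i x : ℕ} (h : ord' i = ord i) :
    slack c r mu best ord' u v i x = slack c r mu best ord u v i x := by
  simp only [slack, colTo, h]

theorem IsTree.congr (hT : IsTree c r mu best u v k ord par) {ord' par' : ℕ → ℕ}
    (ho : ∀ i ≤ k, ord' i = ord i) (hp : ∀ i ≤ k, par' i = par i) :
    IsTree c r mu best u v k ord' par' where
  root := by rw [ho 0 (by omega), hT.root]
  lt i h1 h2 := by rw [ho i h2]; exact hT.lt i h1 h2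
  inj i i' h1 h2 h3 h4 h := hT.inj i i' h1 h2 h3 h4 (by rwa [ho i h2, ho i' h4] at h)
  par i h1 h2 := by
    obtain ⟨h3, h4⟩ := hT.par i h1 h2
    rw [hp i h2, ho i h2, slack_congr (ho _ (by omega))]
    exact ⟨h3, h4⟩

theorem IsTree.size_le (hT : IsTree c r mu best u v k ord par) : k ≤ r := by
  have := Finset.card_le_card_of_injOn (s := Finset.Icc 1 k) (t := Finset.range r) ord
    (fun i hi => by
      simp only [Finset.coe_Icc, Set.mem_Icc] at hi
      simpa using hT.lt i hi.1 hi.2)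
    (fun i hi j hj h => by
      simp only [Finset.coe_Icc, Set.mem_Icc] at hi hj
      exact hT.inj i j hi.1 hi.2 hj.1 hj.2 h)
  simpa using this

/-- Adding a node to the tree. -/
theorem IsTree.push (hT : IsTree c r mu best u v k ord par) {ord' par' : ℕ → ℕ} {y p : ℕ}
    (hy : y < r) (hnew : ∀ i, 1 ≤ i → i ≤ k → ord i ≠ y) (hp : p ≤ k)
    (hs : slack c r mu best ord u v p y = 0) (ho : ∀ i ≤ k, ord' i = ord i)
    (ho' : ord' (k + 1) = y) (hp' : ∀ i ≤ k, par' i = par i) (hp'' : par' (k + 1) = p) :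
    IsTree c r mu best u v (k + 1) ord' par' where
  root := by rw [ho 0 (by omega), hT.root]
  lt i h1 h2 := by
    rcases Nat.lt_or_ge k i with h | h
    · obtain rfl : i = k + 1 := by omega
      rwa [ho']
    · rw [ho i h]; exact hT.lt i h1 h
  inj i i' h1 h2 h3 h4 h := by
    rcases Nat.lt_or_ge k i with h5 | h5 <;> rcases Nat.lt_or_ge k i' with h6 | h6
    · omega
    · obtain rfl : i = k + 1 := by omega
      rw [ho', ho i' h6] at h
      exact absurd h.symm (hnew i' h3 h6)
    · obtain rfl : i' = k + 1 := by omega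
      rw [ho', ho i h5] at h
      exact absurd h (hnew i h1 h5)
    · rw [ho i h5, ho i' h6] at h
      exact hT.inj i i' h1 h5 h3 h6 h
  par i h1 h2 := by
    rcases Nat.lt_or_ge k i with h | h
    · obtain rfl : i = k + 1 := by omega
      rw [hp'', ho', slack_congr (ho p hp)]
      exact ⟨by omega, hs⟩
    · obtain ⟨h3, h4⟩ := hT.par i h1 h
      rw [hp' i h, ho i h, slack_congr (ho _ (by omega))]
      exact ⟨h3, h4⟩

end

/-- The state of the augmentation along the tree path from position `i` to the root: the rows
below `r` are matched along tight edges, the column `mu' r` is waiting for the row `ord i` with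
which it forms a tight edge, and the positions up to `i` still have their old columns. -/
structure AugInv (c : ℕ → ℕ → ℝ) (r : ℕ) (mu : ℕ → ℕ) (ord : ℕ → ℕ) (u v : ℕ → ℝ) (i : ℕ)
    (mu' : ℕ → ℕ) (cols : ℕ → Prop) : Prop where
  tight : ∀ x < r, u x + v (mu' x) = c x (mu' x)
  wait : u (ord i) + v (mu' r) = c (ord i) (mu' r)
  old : ∀ i', 1 ≤ i' → i' ≤ i → mu' (ord i') = mu (ord i')
  inj : ∀ x ≤ r, ∀ y ≤ r, mu' x = mu' y → x = y
  range : ∀ j, cols j ↔ ∃ x ≤ r, mu' x = j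

theorem AugInv.step {c : ℕ → ℕ → ℝ} {r k : ℕ} {mu best ord par mu' mu'' : ℕ → ℕ} {u v : ℕ → ℝ}
    {i : ℕ} {cols : ℕ → Prop} (hT : IsTree c r mu best u v k ord par) (h1 : 1 ≤ i) (h2 : i ≤ k)
    (h : AugInv c r mu ord u v i mu' cols)
    (hsw : ∀ x, mu'' x = if x = r then mu' (ord i) else if x = ord i then mu' r else mu' x) :
    AugInv c r mu ord u v (par i) mu'' cols := by
  have hlt := hT.lt i h1 h2
  obtain ⟨hp, hs⟩ := hT.par i h1 h2
  have hsw' : ∀ x, mu'' x = mu' (Equiv.swap r (ord i) x) := by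
    intro x; rw [hsw, Equiv.swap_apply_def]; split_ifs <;> rfl
  have hle : ∀ x ≤ r, Equiv.swap r (ord i) x ≤ r := by
    intro x hx; rw [Equiv.swap_apply_def]; split_ifs <;> omega
  refine ⟨fun x hx => ?_, ?_, fun i' h1' h2' => ?_, fun x hx y hy hxy => ?_, fun j => ?_⟩
  · rw [hsw]; rw [if_neg hx.ne]
    split_ifs with h3
    · rw [h3]; exact h.wait
    · exact h.tight x hx
  · rw [hsw, if_pos rfl, h.old i h1 le_rfl]
    simp only [slack, colTo, hlt, if_true] at hs
    linarith
  · have h3 := hT.lt i' h1' (by omega)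
    rw [hsw, if_neg h3.ne, if_neg, h.old i' h1' (by omega)]
    intro h4
    have := hT.inj i' i h1' (by omega) h1 h2 h4
    omega
  · rw [hsw', hsw'] at hxy
    exact (Equiv.swap r (ord i)).injective (h.inj _ (hle x hx) _ (hle y hy) hxy)
  · rw [h.range]
    constructor
    · rintro ⟨x, hx, rfl⟩
      exact ⟨Equiv.swap r (ord i) x, hle x hx, by rw [hsw', Equiv.swap_apply_self]⟩
    · rintro ⟨x, hx, rfl⟩
      exact ⟨Equiv.swap r (ord i) x, hle x hx, by rw [hsw']⟩

/-- The column `b` is a cheapest one among the free columns in `J` (and it is not free if there is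
none). -/
def IsBest (w : ℕ → ℝ) (fr J : ℕ → Prop) (b : ℕ) : Prop :=
  (fr b → J b) ∧ ∀ j, J j → fr j → fr b ∧ w b ≤ w j

theorem IsBest.single (w : ℕ → ℝ) (fr : ℕ → Prop) (j : ℕ) : IsBest w fr (· = j) j :=
  ⟨fun _ => rfl, by rintro _ rfl h; exact ⟨h, le_rfl⟩⟩

theorem IsBest.merge {w : ℕ → ℝ} {fr J J' : ℕ → Prop} {a b : ℕ} (ha : IsBest w fr J a)
    (hb : IsBest w fr J' b) :
    (fr b ∧ ¬ (fr a ∧ w a ≤ w b) → IsBest w fr (fun j => J j ∨ J' j) b) ∧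
    (¬ (fr b ∧ ¬ (fr a ∧ w a ≤ w b)) → IsBest w fr (fun j => J j ∨ J' j) a) := by
  constructor
  · rintro ⟨h1, h2⟩
    refine ⟨fun h => Or.inr (hb.1 h), ?_⟩
    rintro j (hj | hj) hf
    · obtain ⟨h3, h4⟩ := ha.2 j hj hf
      refine ⟨h1, ?_⟩
      by_contra h5
      exact h2 ⟨h3, by linarith⟩
    · exact hb.2 j hj hf
  · intro h1
    refine ⟨fun h => Or.inl (ha.1 h), ?_⟩
    rintro j (hj | hj) hf
    · exact ha.2 j hj hf
    · obtain ⟨h3, h4⟩ := hb.2 j hj hf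
      have : fr a ∧ w a ≤ w b := by by_contra h5; exact h1 ⟨h3, h5⟩
      exact ⟨this.1, this.2.trans h4⟩

theorem IsBest.congr {w : ℕ → ℝ} {fr J J' : ℕ → Prop} {b : ℕ} (h : IsBest w fr J b)
    (hJ : ∀ j, J j ↔ J' j) : IsBest w fr J' b := by
  obtain rfl : J = J' := funext fun j => propext (hJ j)
  exact h

/-- Removing free columns outside `J` does not change the best column in `J`. -/
theorem IsBest.remove {w : ℕ → ℝ} {fr fr' J : ℕ → Prop} {b : ℕ} (h : IsBest w fr J b)
    (hsub : ∀ j, fr' j → fr j) (hJ : ∀ j, J j → fr j → fr' j) : IsBest w fr' J b := by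
  refine ⟨fun hb => h.1 (hsub _ hb), fun j hj hf => ?_⟩
  obtain ⟨h1, h2⟩ := h.2 j hj (hsub _ hf)
  exact ⟨hJ _ (h.1 h1) h1, h2⟩

/-! ### The program for the assignment problem: costs and best free columns -/

/-- The distance of the points with the given coordinates. -/
def distE (x₁ y₁ x₂ y₂ : RealExpr) : RealExpr :=
  .sqrt ((x₁ - x₂) * (x₁ - x₂) + (y₁ - y₂) * (y₁ - y₂))

/-- The distance of the points with the given coordinates. -/
noncomputable def dist2 (x₁ y₁ x₂ y₂ : ℝ) : ℝ :=
  Real.sqrt ((x₁ - x₂) * (x₁ - x₂) + (y₁ - y₂) * (y₁ - y₂))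

/-- The cost of the row `x = u * n + v` and the column `j`: by this amount, up to the length of a
given path from the inner point `u` to the inner point `v`, the total length increases if the
redundant path on the terminal pair `j` is replaced by a path that visits `u, …, v`. The summand
`|uv|` makes all costs nonnegative. -/
def costE (x j : IntExpr) : RealExpr :=
  let u := x / var 0
  let v := x - x / var 0 * var 0
  distE (.load 2 j) (.load 3 j) (.load 0 u) (.load 1 u) +
    distE (.load 0 u) (.load 1 u) (.load 0 v) (.load 1 v) +
    distE (.load 0 v) (.load 1 v) (.load 4 j) (.load 5 j) -
    distE (.load 2 j) (.load 3 j) (.load 4 j) (.load 5 j)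

/-- The value of `costE`. -/
noncomputable def costOf (s : Store) (x j : ℕ) : ℝ :=
  let u := x / s.int 0 0
  let v := x - x / s.int 0 0 * s.int 0 0
  dist2 (s.real 2 j) (s.real 3 j) (s.real 0 u) (s.real 1 u) +
    dist2 (s.real 0 u) (s.real 1 u) (s.real 0 v) (s.real 1 v) +
    dist2 (s.real 0 v) (s.real 1 v) (s.real 4 j) (s.real 5 j) -
    dist2 (s.real 2 j) (s.real 3 j) (s.real 4 j) (s.real 5 j)

@[simp] theorem val_costE (s : Store) (x j : IntExpr) :
    (costE x j).val s = costOf s (x.val s) (j.val s) := rfl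

theorem dist2_eq (x₁ y₁ x₂ y₂ : ℝ) :
    dist2 x₁ y₁ x₂ y₂ = dist (!₂[x₁, y₁] : Plane) !₂[x₂, y₂] := by
  simp [dist2, EuclideanSpace.dist_eq, Real.dist_eq, sq]

theorem dist2_eq_dist (p q : Plane) : dist2 (p 0) (p 1) (q 0) (q 1) = dist p q := by
  simp [dist2, EuclideanSpace.dist_eq, Real.dist_eq, sq]

theorem costOf_nonneg (s : Store) (x j : ℕ) : 0 ≤ costOf s x j := by
  simp only [costOf, dist2_eq]
  generalize (!₂[_, _] : Plane) = a
  generalize (!₂[_, _] : Plane) = b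
  generalize (!₂[s.real 0 (x - _), _] : Plane) = d
  generalize (!₂[_, _] : Plane) = e
  linarith [dist_triangle a b e, dist_triangle b d e]

/-- The part of the store that stays fixed: the input, the number `q` of rows, and the number `K`
of blocks of columns. -/
structure Env (n m q K : ℕ) (c : ℕ → ℕ → ℝ) (s : Store) : Prop where
  n : s.int 0 0 = n
  m : s.int 1 0 = m
  q : s.int 10 0 = q
  K : s.int 11 0 = K
  c : costOf s = c

/-- The program does not write the arrays that `Env` depends on. -/
def Prog.keepsEnv (p : Prog) : Bool :=
  !(p.wI 0 || p.wI 1 || p.wI 10 || p.wI 11 || p.wR 0 || p.wR 1 || p.wR 2 || p.wR 3 || p.wR 4 ||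
    p.wR 5)

theorem costOf_congr {s s' : Store} (h0 : s'.int 0 0 = s.int 0 0)
    (h : ∀ a < 6, s'.real a = s.real a) : costOf s' = costOf s := by
  funext x j
  simp only [costOf, h0, h 0 (by omega), h 1 (by omega), h 2 (by omega), h 3 (by omega),
    h 4 (by omega), h 5 (by omega)]

theorem Env.same {n m q K : ℕ} {c : ℕ → ℕ → ℝ} {s s' : Store} {p : Prog} (h : Env n m q K c s)
    (hs : Same p s s') (hp : p.keepsEnv = true) : Env n m q K c s' := by
  simp only [Prog.keepsEnv, Bool.not_eq_true', Bool.or_eq_false_iff] at hp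
  obtain ⟨⟨⟨⟨⟨⟨⟨⟨⟨i0, i1⟩, i10⟩, i11⟩, r0⟩, r1⟩, r2⟩, r3⟩, r4⟩, r5⟩ := hp
  refine ⟨by rw [hs.1 _ i0, h.n], by rw [hs.1 _ i1, h.m], by rw [hs.1 _ i10, h.q],
    by rw [hs.1 _ i11, h.K], ?_⟩
  rw [← h.c]
  refine costOf_congr (by rw [hs.1 _ i0]) fun a ha => ?_
  interval_cases a
  exacts [hs.2 _ r0, hs.2 _ r1, hs.2 _ r2, hs.2 _ r3, hs.2 _ r4, hs.2 _ r5]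

theorem Env.setInt {n m q K : ℕ} {c : ℕ → ℕ → ℝ} {s : Store} (h : Env n m q K c s) {a : ℕ}
    (ha : a ≠ 0 ∧ a ≠ 1 ∧ a ≠ 10 ∧ a ≠ 11) (i v : ℕ) : Env n m q K c (s.setInt a i v) := by
  obtain ⟨h1, h2, h3, h4⟩ := ha
  refine ⟨?_, ?_, ?_, ?_, ?_⟩
  · rw [Store.setInt_int_ne _ (Ne.symm h1), h.n]
  · rw [Store.setInt_int_ne _ (Ne.symm h2), h.m]
  · rw [Store.setInt_int_ne _ (Ne.symm h3), h.q]
  · rw [Store.setInt_int_ne _ (Ne.symm h4), h.K]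
  · rw [← h.c]; exact costOf_congr (by rw [Store.setInt_int_ne _ (Ne.symm h1)]) fun _ _ => rfl

/-- The column `j` is free. -/
def Store.free (s : Store) (j : ℕ) : Prop := 1 ≤ s.int 2 j

/-- Replaces the column in the variable `17` by `j`, if `j` is free and better. -/
def consider (x j : IntExpr) : Prog :=
  .ite (.and (.intLe (.lit 1) (.load 2 j))
      (.not (.and (.intLe (.lit 1) (.load 2 (var 17))) (.realLe (costE x (var 17)) (costE x j)))))
    (setVar 17 j) (setVar 17 (var 17))

theorem consider_spec {B : ℕ} {s : Store} {x j : IntExpr} {J J' : ℕ → Prop}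
    (hJ : IsBest (costOf s (x.val s)) s.free J (s.int 17 0))
    (hJ' : IsBest (costOf s (x.val s)) s.free J' (j.val s)) (hB : s.int 17 0 ≤ B)
    (hB' : j.val s ≤ B) :
    Tri B (consider x j) s 2 fun s' =>
      IsBest (costOf s (x.val s)) s.free (fun i => J i ∨ J' i) (s'.int 17 0) ∧
        s'.int 17 0 ≤ B := by
  have h := hJ.merge hJ'
  refine Tri.ite (T := 1) (fun hb => Tri.int hB' ?_) (fun hb => Tri.int hB ?_)
  · simp only [IntExpr.val_lit, Store.setInt_int, and_self, if_true]
    exact ⟨h.1 hb, hB'⟩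
  · simp only [IntExpr.val_lit, Store.setInt_int, and_self, if_true]
    exact ⟨h.2 hb, hB⟩

/-- Finds the best column for the row `x` (variable `13`) among the `q` columns from the one in the
variable `16` on. -/
def scanBlock : Prog :=
  .seq (setVar 17 (var 1)) (forLoop 15 (var 10) (consider (var 13) (var 16 + var 15)))

theorem scanBlock_spec {B n m q K : ℕ} {c : ℕ → ℕ → ℝ} {s : Store} (hE : Env n m q K c s)
    (hm : m ≤ B) (hB : s.int 16 0 + q ≤ B) (hfm : ¬ s.free m) :
    Tri B scanBlock s (q * 4 + 3) fun s' =>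
      IsBest (c (s.int 13 0)) s.free (fun j => s.int 16 0 ≤ j ∧ j < s.int 16 0 + q) (s'.int 17 0) ∧
        s'.int 17 0 ≤ B := by
  have h1 : (var 1).val s ≤ B := by simpa [hE.m] using hm
  refine (Tri.intSeq h1 (T := q * (2 + 2) + 2) ?_).time (by omega)
  have hE1 := hE.setInt (a := 17) (by decide) 0 m
  simp only [IntExpr.val_load, IntExpr.val_lit, hE.m]
  set s₁ := s.setInt 17 0 m with hs₁
  refine (Tri.forLoop (T := 2) (K := q) (fun t s' => IsBest (c (s.int 13 0)) s.free
    (fun j => s.int 16 0 ≤ j ∧ j < s.int 16 0 + t) (s'.int 17 0) ∧ s'.int 17 0 ≤ B)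
    rfl (by omega) ?_ ?_ ?_).time le_rfl
  · simp only [hs₁, Store.setInt_int]
    simp only [Nat.reduceEqDiff, false_and, if_false, and_self, if_true]
    exact ⟨⟨fun h => absurd h hfm, fun j hj => by omega⟩, hm⟩
  · intro s' hs'
    simp [(hE1.same hs' rfl).q]
  · rintro t ht s' hs' ht' ⟨hI, hI'⟩
    have hE' := hE1.same hs' rfl
    have e2 : s'.int 2 = s.int 2 := hs'.1 2 rfl
    have e13 : s'.int 13 = s.int 13 := hs'.1 13 rfl
    have e16 : s'.int 16 = s.int 16 := hs'.1 16 rfl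
    have hfr : s'.free = s.free := by funext j; simp only [Store.free, e2]
    refine (consider_spec (x := var 13) (j := var 16 + var 15) (s := s')
      (J := fun j => s.int 16 0 ≤ j ∧ j < s.int 16 0 + t) (J' := fun j => j = s.int 16 0 + t)
      ?_ ?_ hI' ?_).conseq le_rfl ?_
    · simp only [hE'.c, IntExpr.val_load, IntExpr.val_lit, e13, hfr]; exact hI
    · simp only [IntExpr.val_add, IntExpr.val_load, IntExpr.val_lit, e16, ht']
      exact IsBest.single _ _ _
    · simp only [IntExpr.val_add, IntExpr.val_load, IntExpr.val_lit, e16, ht']; omega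
    · rintro s'' hs'' ⟨h, h'⟩
      simp only [hE'.c, IntExpr.val_load, IntExpr.val_lit, e13, hfr] at h
      simp only [Store.setInt_int, Nat.reduceEqDiff, false_and, if_false]
      exact ⟨h.congr fun j => by omega, h'⟩

/-- Stores the best column of the block in the variable `14` for the row in the variable `13`. -/
def fillCell : Prog :=
  .seq (setVar 16 (var 14 * var 10)) (.seq scanBlock
    (.seq (setVar 30 (var 13 * var 11)) (.intStore 20 (var 30 + var 14) (var 17))))

/-- The columns of the block `b`, for blocks of size `q`. -/
def InBlock (q b j : ℕ) : Prop := b * q ≤ j ∧ j < b * q + q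

theorem fillCell_spec {B n m q K : ℕ} {c : ℕ → ℕ → ℝ} {s : Store} (hE : Env n m q K c s)
    (hm : m ≤ B) (hB : s.int 14 0 * q + q ≤ B) (hB' : s.int 13 0 * K ≤ B) (hfm : ¬ s.free m) :
    Tri B fillCell s (q * 4 + 6) fun s' => ∃ b ≤ B,
      IsBest (c (s.int 13 0)) s.free (InBlock q (s.int 14 0)) b ∧
        s'.int 20 = Function.update (s.int 20) (s.int 13 0 * K + s.int 14 0) b := by
  have h1 : (var 14 * var 10).val s ≤ B := by simp [hE.q]; omega
  refine (Tri.intSeq h1 (T := (q * 4 + 3) + (1 + 1)) ?_).time (by omega)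
  simp only [IntExpr.val_mul, IntExpr.val_load, IntExpr.val_lit, hE.q]
  set s₁ := s.setInt 16 0 (s.int 14 0 * q) with hs₁
  have hE1 : Env n m q K c s₁ := hE.setInt (by decide) _ _
  have e16 : s₁.int 16 0 = s.int 14 0 * q := by simp [hs₁]
  have e2 : s₁.free = s.free := by funext j; simp [hs₁, Store.free]
  refine Tri.seq (scanBlock_spec hE1 hm (by rw [e16]; omega) (by rwa [e2])) ?_
  rintro s₂ hs₂ ⟨hb, hbB⟩
  have hE2 := hE1.same hs₂ rfl
  have e13 : s₂.int 13 0 = s.int 13 0 := by rw [hs₂.1 13 rfl]; simp [hs₁]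
  have e14 : s₂.int 14 0 = s.int 14 0 := by rw [hs₂.1 14 rfl]; simp [hs₁]
  have e20 : s₂.int 20 = s.int 20 := by
    rw [hs₂.1 20 rfl]; exact Store.setInt_int_ne _ (by decide) _ _
  have h2 : (var 13 * var 11).val s₂ ≤ B := by simpa [hE2.K, e13] using hB'
  refine Tri.intSeq h2 (Tri.int (by simpa using hbB) ⟨s₂.int 17 0, hbB, ?_, ?_⟩)
  · rw [e2, e16] at hb
    have e13' : s₁.int 13 0 = s.int 13 0 := by simp [hs₁]
    rw [e13'] at hb
    exact hb
  · funext j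
    simp [hE2.K, e13, e14, e20, Function.update_apply]

/-- The table `bm` holds the best column of every row below `q` in every block `b < K` with `G b`. -/
def TableOn (c : ℕ → ℕ → ℝ) (q K B : ℕ) (fr G : ℕ → Prop) (bm : ℕ → ℕ) : Prop :=
  ∀ x < q, ∀ b < K, G b →
    IsBest (c x) fr (InBlock q b) (bm (x * K + b)) ∧ bm (x * K + b) ≤ B

theorem pair_index_inj {K x b x' b' : ℕ} (hb : b < K) (hb' : b' < K)
    (h : x * K + b = x' * K + b') : x = x' ∧ b = b' := by
  have hK : 0 < K := by omega
  have h1 : x = x' := by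
    have := congrArg (· / K) h
    simpa [Nat.mul_comm _ K, Nat.mul_add_div hK, Nat.div_eq_of_lt hb, Nat.div_eq_of_lt hb'] using this
  subst h1
  exact ⟨rfl, by omega⟩

/-- Computes the best column of the block in the variable `14` for all rows. -/
def fillBlock : Prog := forLoop 13 (var 10) fillCell

theorem fillBlock_spec {B n m q K : ℕ} {c : ℕ → ℕ → ℝ} {s : Store} {G : ℕ → Prop}
    (hE : Env n m q K c s) (hm : m ≤ B) (hK : K * q ≤ B) (hq : q ≤ B) (hb : s.int 14 0 < K)
    (hfm : ¬ s.free m)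
    (hT : TableOn c q K B s.free (fun b => b ≠ s.int 14 0 ∧ G b) (s.int 20)) :
    Tri B fillBlock s (q * (q * 4 + 8) + 2) fun s' =>
      TableOn c q K B s.free (fun b => b = s.int 14 0 ∨ G b) (s'.int 20) := by
  refine (Tri.forLoop (T := q * 4 + 6) (K := q) (fun k s' => ∀ x < q, ∀ b < K,
    (b ≠ s.int 14 0 ∧ G b) ∨ (x < k ∧ b = s.int 14 0) →
      IsBest (c x) s.free (InBlock q b) (s'.int 20 (x * K + b)) ∧
      s'.int 20 (x * K + b) ≤ B) rfl hq ?_ ?_ ?_).conseq le_rfl ?_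
  · intro x hx b hb h
    simpa using hT x hx b hb (by simpa using h)
  · intro s' hs'
    simp [(hE.same hs' rfl).q]
  · intro k hk s' hs' hk' hI
    have hE' := hE.same hs' rfl
    have e2 : s'.int 2 = s.int 2 := hs'.1 2 rfl
    have e14 : s'.int 14 = s.int 14 := hs'.1 14 rfl
    have hfr : s'.free = s.free := by funext j; simp only [Store.free, e2]
    refine (fillCell_spec hE' hm ?_ ?_ (by rwa [hfr])).conseq le_rfl ?_
    · rw [e14]
      calc s.int 14 0 * q + q = (s.int 14 0 + 1) * q := by ring
        _ ≤ K * q := Nat.mul_le_mul_right _ hb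
        _ ≤ B := hK
    · rw [hk']
      calc k * K ≤ q * K := Nat.mul_le_mul_right _ hk.le
        _ ≤ B := by rw [Nat.mul_comm]; exact hK
    · rintro s'' hs'' ⟨b₀, hb₀, hbest, hupd⟩ x hx b hbK hor
      simp only [Store.setInt_int, Nat.reduceEqDiff, false_and, if_false, hupd, e14, hk', hfr]
        at hbest ⊢
      rw [Function.update_apply]
      split_ifs with h
      · obtain ⟨rfl, rfl⟩ := pair_index_inj hbK hb h
        exact ⟨hbest, hb₀⟩
      · refine hI x hx b hbK ?_
        rcases hor with h' | ⟨h', h3⟩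
        · exact Or.inl h'
        · have : x ≠ k := by rintro rfl; exact h (by rw [h3])
          exact Or.inr ⟨by omega, h3⟩
  · intro s' _ h x hx b hb hor
    refine h x hx b hb ?_
    by_cases hbb : b = s.int 14 0
    · exact Or.inr ⟨hx, hbb⟩
    · exact Or.inl ⟨hbb, hor.resolve_left hbb⟩

/-- Computes the whole table. -/
def fillTable : Prog := forLoop 14 (var 11) fillBlock

theorem fillTable_spec {B n m q K : ℕ} {c : ℕ → ℕ → ℝ} {s : Store} (hE : Env n m q K c s)
    (hm : m ≤ B) (hK : K * q ≤ B) (hKB : K ≤ B) (hq : q ≤ B) (hfm : ¬ s.free m) :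
    Tri B fillTable s (K * (q * (q * 4 + 8) + 4) + 2) fun s' =>
      TableOn c q K B s.free (fun _ => True) (s'.int 20) := by
  refine (Tri.forLoop (T := q * (q * 4 + 8) + 2) (K := K) (fun k s' =>
    TableOn c q K B s.free (fun b => b < k) (s'.int 20)) rfl hKB ?_ ?_ ?_).conseq le_rfl ?_
  · intro x hx b hb h; omega
  · intro s' hs'
    simp [(hE.same hs' rfl).K]
  · intro k hk s' hs' hk' hI
    have hE' := hE.same hs' rfl
    have e2 : s'.int 2 = s.int 2 := hs'.1 2 rfl
    have hfr : s'.free = s.free := by funext j; simp only [Store.free, e2]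
    refine (fillBlock_spec (G := fun b => b < k) hE' hm hK hq (by omega) (by rwa [hfr])
      ?_).conseq le_rfl ?_
    · intro x hx b hb h
      rw [hfr]; exact hI x hx b hb h.2
    · intro s'' _ h x hx b hb hbk
      rw [hk', hfr] at h
      simpa using h x hx b hb (by omega)
  · intro s' _ h x hx b hb _
    exact h x hx b hb hb

/-- Computes the best free column (array `21`) of every row up to `r` (variable `12`). -/
def bestRows : Prog :=
  forLoop 13 (var 12 + .lit 1) (.seq (setVar 17 (var 1)) (.seq (setVar 30 (var 13 * var 11))
    (.seq (forLoop 14 (var 11) (consider (var 13) (.load 20 (var 30 + var 14))))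
      (.intStore 21 (var 13) (var 17)))))

theorem bestRows_spec {B n m q K : ℕ} {c : ℕ → ℕ → ℝ} {s : Store} (hE : Env n m q K c s)
    (hm : m ≤ B) (hK : K * q ≤ B) (hKB : K ≤ B) (hq : q ≤ B) (hfm : ¬ s.free m)
    (hr : s.int 12 0 < q) (hT : TableOn c q K B s.free (fun _ => True) (s.int 20))
    (hcov : ∀ j, s.free j → ∃ b < K, InBlock q b j) (hex : ∃ j, s.free j) :
    Tri B bestRows s (q * (K * 4 + 7) + 2) fun s' =>
      ∀ x ≤ s.int 12 0, s.free (s'.int 21 x) ∧ ∀ j, s.free j → c x (s'.int 21 x) ≤ c x j := by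
  have hrB : s.int 12 0 + 1 ≤ B := by omega
  refine (Tri.forLoop (T := K * 4 + 5) (K := s.int 12 0 + 1) (fun k s' => ∀ x < k,
    s.free (s'.int 21 x) ∧ ∀ j, s.free j → c x (s'.int 21 x) ≤ c x j) rfl hrB ?_ ?_ ?_).conseq
    ?_ ?_
  · intro x hx; omega
  · intro s' hs'
    simp [hs'.1 12 rfl]
  · intro k hk s' hs' hk' hI
    have hE' := hE.same hs' rfl
    have e2 : s'.int 2 = s.int 2 := hs'.1 2 rfl
    have e20 : s'.int 20 = s.int 20 := hs'.1 20 rfl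
    refine (Tri.intSeq (by simpa [hE'.m] using hm) (T := 1 + ((K * 4 + 2) + 1)) ?_).time (by omega)
    simp only [IntExpr.val_load, IntExpr.val_lit, hE'.m]
    have hkK : k * K ≤ B := calc
      k * K ≤ q * K := Nat.mul_le_mul_right _ (by omega)
      _ ≤ B := by rw [Nat.mul_comm]; exact hK
    refine Tri.intSeq (by simpa [hE'.K, hk'] using hkK) ?_
    simp only [IntExpr.val_load, IntExpr.val_lit, IntExpr.val_mul, Store.setInt_int,
      Nat.reduceEqDiff, false_and, if_false, hk', hE'.K]
    set s₁ := (s'.setInt 17 0 m).setInt 30 0 (k * K) with hs₁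
    have hE1 : Env n m q K c s₁ := (hE'.setInt (by decide) _ _).setInt (by decide) _ _
    refine Tri.seq (Tri.forLoop (T := 2) (K := K) (fun b s₂ => IsBest (c k) s.free
      (fun j => ∃ b' < b, InBlock q b' j) (s₂.int 17 0) ∧ s₂.int 17 0 ≤ B) rfl hKB ?_ ?_ ?_) ?_
    · simp only [hs₁, Store.setInt_int]
      simp only [Nat.reduceEqDiff, false_and, if_false, and_self, if_true]
      exact ⟨⟨fun h => absurd h hfm, by rintro j ⟨b', hb', _⟩; omega⟩, hm⟩
    · intro s₂ hs₂
      simp [(hE1.same hs₂ rfl).K]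
    · rintro b hb s₂ hs₂ hb₂ ⟨hI₂, hI₂'⟩
      have hE2 := hE1.same hs₂ rfl
      have f2 : s₂.free = s.free := by
        funext j; simp only [Store.free, hs₂.1 2 rfl, hs₁]; simp [e2]
      have f20 : s₂.int 20 = s.int 20 := by
        funext j; simp only [hs₂.1 20 rfl, hs₁]; simp [e20]
      have f13 : s₂.int 13 0 = k := by simp only [hs₂.1 13 rfl, hs₁]; simp [hk']
      have f30 : s₂.int 30 0 = k * K := by simp only [hs₂.1 30 rfl, hs₁]; simp
      have hTb := hT k (by omega) b hb trivial
      refine (consider_spec (s := s₂) (J := fun j => ∃ b' < b, InBlock q b' j)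
        (J' := InBlock q b) ?_ ?_ hI₂' ?_).conseq le_rfl ?_
      · simp only [IntExpr.val_load, IntExpr.val_lit, hE2.c, f13, f2]; exact hI₂
      · simp only [IntExpr.val_load, IntExpr.val_lit, IntExpr.val_add, hE2.c, f13, f2, f20, f30,
          hb₂]
        exact hTb.1
      · simp only [IntExpr.val_load, IntExpr.val_lit, IntExpr.val_add, f20, f30, hb₂]
        exact hTb.2
      · rintro s₃ _ ⟨h, h'⟩
        simp only [IntExpr.val_load, IntExpr.val_lit, hE2.c, f13, f2] at h
        simp only [Store.setInt_int, Nat.reduceEqDiff, false_and, if_false]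
        refine ⟨h.congr fun j => ⟨?_, ?_⟩, h'⟩
        · rintro (⟨b', hb', h⟩ | h)
          exacts [⟨b', by omega, h⟩, ⟨b, by omega, h⟩]
        · rintro ⟨b', hb', h2⟩
          rcases Nat.lt_succ_iff_lt_or_eq.1 hb' with h1 | rfl
          exacts [Or.inl ⟨b', h1, h2⟩, Or.inr h2]
    · rintro s₂ hs₂ ⟨hb, hb'⟩
      have f13 : s₂.int 13 0 = k := by simp only [hs₂.1 13 rfl, hs₁]; simp [hk']
      have f21 : s₂.int 21 = s'.int 21 := by
        funext j; simp only [hs₂.1 21 rfl, hs₁]; simp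
      refine Tri.int (by simpa using hb') ?_
      intro x hx
      simp only [Store.setInt_int, IntExpr.val_load, IntExpr.val_lit, f13, f21, true_and]
      split_ifs with h
      · subst h
        obtain ⟨j, hj⟩ := hex
        exact ⟨(hb.2 j (hcov j hj) hj).1, fun j hj => (hb.2 j (hcov j hj) hj).2⟩
      · exact hI x (by omega)
  · have : (s.int 12 0 + 1) * (K * 4 + 5 + 2) ≤ q * (K * 4 + 7) := Nat.mul_le_mul_right _ hr
    omega
  · intro s' _ h x hx
    exact h x (by omega)

/-! ### The program for the assignment problem: the search for an augmenting path -/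

/-- The slack of the edge from the tree row at position `i` to the node `x`, for the current
content of the arrays. -/
noncomputable def Store.slack (s : Store) (i x : ℕ) : ℝ :=
  GETSPReduction.slack (costOf s) (s.int 12 0) (s.int 19) (s.int 21) (s.int 22) (s.real 7)
    (s.real 8) i x

/-- Stores a slack in the real cell `d[0]`. -/
def slackTo (d : ℕ) (i x : IntExpr) : Prog :=
  .seq (.ite (.intLe (x + .lit 1) (var 12)) (setVar 18 (.load 19 x))
      (setVar 18 (.load 21 (.load 22 i))))
    (.realStore d (.lit 0) (costE (.load 22 i) (var 18) - .load 7 (.load 22 i) - .load 8 (var 18)))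

theorem slackTo_spec {B : ℕ} {s : Store} {d : ℕ} {i x : IntExpr}
    (hi : ∀ v, i.val (s.setInt 18 0 v) = i.val s)
    (hB : colTo (s.int 12 0) (s.int 19) (s.int 21) (s.int 22) (i.val s) (x.val s) ≤ B) :
    Tri B (slackTo d i x) s 3 fun s' =>
      s'.real = (s.setReal d 0 (s.slack (i.val s) (x.val s))).real := by
  have key : Tri B (.ite (.intLe (x + .lit 1) (var 12)) (setVar 18 (.load 19 x))
      (setVar 18 (.load 21 (.load 22 i)))) s (1 + 1) fun s' => s' = s.setInt 18 0
        (colTo (s.int 12 0) (s.int 19) (s.int 21) (s.int 22) (i.val s) (x.val s)) := by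
    unfold colTo at hB ⊢
    refine Tri.ite (fun h => ?_) fun h => ?_
    · simp only [BoolExpr.val_intLe, IntExpr.val_add, IntExpr.val_lit, IntExpr.val_load,
        Nat.succ_le_iff] at h
      rw [if_pos h] at hB ⊢
      exact Tri.int hB rfl
    · simp only [BoolExpr.val_intLe, IntExpr.val_add, IntExpr.val_lit, IntExpr.val_load,
        Nat.succ_le_iff] at h
      rw [if_neg h] at hB ⊢
      exact Tri.int hB rfl
  refine (key.seq (T₂ := 1) ?_).time le_rfl
  rintro s' _ rfl
  refine Tri.real ?_
  set col := colTo (s.int 12 0) (s.int 19) (s.int 21) (s.int 22) (i.val s) (x.val s) with hcol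
  have hc : ∀ v, costOf (s.setInt 18 0 v) = costOf s := fun v => costOf_congr (by simp) fun _ _ => rfl
  have : (costE (.load 22 i) (var 18) - .load 7 (.load 22 i) - .load 8 (var 18)).val
      (s.setInt 18 0 col) = s.slack (i.val s) (x.val s) := by
    simp only [RealExpr.val_sub, val_costE, RealExpr.val_load, IntExpr.val_load, hi, hc,
      IntExpr.val_lit, Store.setInt_int, Store.setInt_real, Nat.reduceEqDiff, false_and, if_false,
      and_self, if_true, Store.slack, GETSPReduction.slack, hcol]
  rw [this]; rfl

/-- The data of the tree are in range: the rows and the columns that occur are at most `B`. -/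
structure TreeBdd (s : Store) (m B : ℕ) : Prop where
  mu : ∀ x < s.int 12 0, s.int 19 x < m
  best : ∀ x ≤ s.int 12 0, s.int 21 x < m
  ord : ∀ i ≤ s.int 26 0, s.int 22 i ≤ s.int 12 0
  mB : m ≤ B
  rB : s.int 12 0 + 2 ≤ B

theorem TreeBdd.colTo_le {s : Store} {m B : ℕ} (h : TreeBdd s m B) {i : ℕ} (hi : i ≤ s.int 26 0)
    (x : ℕ) : colTo (s.int 12 0) (s.int 19) (s.int 21) (s.int 22) i x ≤ B := by
  unfold colTo
  have := h.mB
  split_ifs with hx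
  · exact (h.mu x hx).le.trans this
  · exact (h.best _ (h.ord i hi)).le.trans this

/-- The program does not write the arrays that the slacks depend on. -/
def Prog.keepsSlack (p : Prog) : Bool :=
  p.keepsEnv && !(p.wI 12 || p.wI 19 || p.wI 21 || p.wI 22 || p.wI 26 || p.wR 7 || p.wR 8)

theorem Store.slack_same {n m q K : ℕ} {c : ℕ → ℕ → ℝ} {s s' : Store} {p : Prog}
    (hE : Env n m q K c s) (hs : Same p s s') (hp : p.keepsSlack = true) :
    s'.slack = s.slack ∧ ∀ m B, TreeBdd s m B → TreeBdd s' m B := by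
  simp only [Prog.keepsSlack, Bool.and_eq_true, Bool.not_eq_true', Bool.or_eq_false_iff] at hp
  obtain ⟨h0, ⟨⟨⟨⟨⟨⟨h12, h19⟩, h21⟩, h22⟩, h26⟩, h7⟩, h8⟩⟩ := hp
  constructor
  · funext i x
    simp only [Store.slack, hs.1 _ h12, hs.1 _ h19, hs.1 _ h21, hs.1 _ h22, hs.2 _ h7, hs.2 _ h8,
      (hE.same hs h0).c, hE.c]
  · rintro m B ⟨a1, a2, a3, a4, a5⟩
    constructor <;> try simp only [hs.1 _ h12, hs.1 _ h19, hs.1 _ h21, hs.1 _ h22, hs.1 _ h26]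
    all_goals assumption

/-- Finds (in the variable `27`) the node outside the tree that can be reached with the least
slack (in the real cell `10[0]`). -/
def findMin : Prog :=
  .seq (setVar 27 (var 12)) (.seq (slackTo 10 (.load 25 (var 27)) (var 27))
    (forLoop 13 (var 12) (.ite (.intLe (.load 24 (var 13)) (.lit 0))
      (.seq (slackTo 9 (.load 25 (var 13)) (var 13))
        (.ite (.realLe (.load 10 (.lit 0)) (.load 9 (.lit 0))) (setVar 27 (var 27))
          (.seq (setVar 27 (var 13)) (.realStore 10 (.lit 0) (.load 9 (.lit 0))))))
      (setVar 27 (var 27)))))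

theorem findMin_spec {B n m q K : ℕ} {c : ℕ → ℕ → ℝ} {s : Store} (hE : Env n m q K c s)
    (hb : TreeBdd s m B) (hvis : s.int 24 (s.int 12 0) = 0)
    (hspar : ∀ x ≤ s.int 12 0, s.int 24 x = 0 → s.int 25 x ≤ s.int 26 0) :
    Tri B findMin s (s.int 12 0 * 9 + 6) fun s' =>
      s'.int 27 0 ≤ s.int 12 0 ∧ s.int 24 (s'.int 27 0) = 0 ∧
      s'.real 10 0 = s.slack (s.int 25 (s'.int 27 0)) (s'.int 27 0) ∧
      ∀ x ≤ s.int 12 0, s.int 24 x = 0 → s'.real 10 0 ≤ s.slack (s.int 25 x) x := by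
  have hrB := hb.rB
  set r := s.int 12 0 with hr
  refine (Tri.intSeq (by simpa [← hr] using by omega) (T := 3 + (r * 9 + 2)) ?_).time (by omega)
  simp only [IntExpr.val_load, IntExpr.val_lit, ← hr]
  set s₁ := s.setInt 27 0 r with hs₁
  have hE1 : Env n m q K c s₁ := hE.setInt (by decide) _ _
  have hS1 : Same (setVar 27 (.lit 0)) s s₁ := by
    refine ⟨fun a ha => Store.setInt_int_ne _ ?_ _ _, fun _ _ => rfl⟩
    rintro rfl; simp [Prog.wI] at ha
  obtain ⟨hsl1, hb1⟩ := Store.slack_same hE hS1 rfl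
  replace hb1 := hb1 _ _ hb
  have e24 : s₁.int 24 = s.int 24 := hS1.1 24 rfl
  have e25 : s₁.int 25 = s.int 25 := hS1.1 25 rfl
  have e26 : s₁.int 26 = s.int 26 := hS1.1 26 rfl
  have e12 : s₁.int 12 = s.int 12 := hS1.1 12 rfl
  have e27 : s₁.int 27 0 = r := by simp [hs₁]
  refine Tri.seq (slackTo_spec (by intro v; simp) (hb1.colTo_le ?_ _)) ?_
  · simp only [IntExpr.val_load, IntExpr.val_lit, e27, e25, e26]; exact hspar r le_rfl hvis
  intro s₂ hs₂ h₂
  simp only [IntExpr.val_load, IntExpr.val_lit, e27, e25, hsl1] at h₂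
  have hE2 := hE1.same hs₂ rfl
  obtain ⟨hsl2, hb2⟩ := Store.slack_same hE1 hs₂ rfl
  replace hb2 := hb2 _ _ hb1
  rw [hsl1] at hsl2
  have f24 : s₂.int 24 = s.int 24 := (hs₂.1 24 rfl).trans e24
  have f25 : s₂.int 25 = s.int 25 := (hs₂.1 25 rfl).trans e25
  have f26 : s₂.int 26 = s.int 26 := (hs₂.1 26 rfl).trans e26
  have f12 : s₂.int 12 = s.int 12 := (hs₂.1 12 rfl).trans e12
  have f27 : s₂.int 27 0 = r := by rw [hs₂.1 27 rfl, e27]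
  have f10 : s₂.real 10 0 = s.slack (s.int 25 r) r := by rw [h₂]; simp
  refine (Tri.forLoop (T := 7) (K := r) (fun k s' => s'.int 27 0 ≤ r ∧ s.int 24 (s'.int 27 0) = 0 ∧
      s'.real 10 0 = s.slack (s.int 25 (s'.int 27 0)) (s'.int 27 0) ∧
      ∀ x ≤ r, (x < k ∨ x = r) → s.int 24 x = 0 → s'.real 10 0 ≤ s.slack (s.int 25 x) x)
      rfl (by omega) ?_ ?_ ?_).conseq le_rfl ?_
  · simp only [Store.setInt_int, Store.setInt_real, Nat.reduceEqDiff, false_and, if_false, f27, f10]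
    refine ⟨le_rfl, hvis, trivial, ?_⟩
    rintro x hx (h | rfl) _
    · omega
    · exact le_rfl
  · intro s' hs'
    simp [hs'.1 12 rfl, f12, ← hr]
  · rintro k hk s' hs' hk' ⟨g1, g2, g3, g4⟩
    have hE' := hE2.same hs' rfl
    obtain ⟨hsl', hb'⟩ := Store.slack_same hE2 hs' rfl
    replace hb' := hb' _ _ hb2
    rw [hsl2] at hsl'
    have k24 : s'.int 24 = s.int 24 := (hs'.1 24 rfl).trans f24
    have k25 : s'.int 25 = s.int 25 := (hs'.1 25 rfl).trans f25
    have k26 : s'.int 26 = s.int 26 := (hs'.1 26 rfl).trans f26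
    refine Tri.ite (T := 6) (fun hv => ?_) fun hv => ?_
    · simp only [BoolExpr.val_intLe, IntExpr.val_load, IntExpr.val_lit, hk', k24,
        Nat.le_zero] at hv
      refine (Tri.seq (slackTo_spec (d := 9) (by intro v; simp) (hb'.colTo_le ?_ _)) (T₂ := 3)
        ?_).time (by omega)
      · simp only [IntExpr.val_load, IntExpr.val_lit, hk', k25, k26]
        exact hspar k (by omega) hv
      intro s₃ hs₃ h₃
      simp only [IntExpr.val_load, IntExpr.val_lit, hk', k25, hsl'] at h₃
      have l27 : s₃.int 27 = s'.int 27 := hs₃.1 27 rfl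
      have l13 : s₃.int 13 0 = k := by rw [hs₃.1 13 rfl, hk']
      have l10 : s₃.real 10 0 = s'.real 10 0 := by rw [h₃]; simp
      have l9 : s₃.real 9 0 = s.slack (s.int 25 k) k := by rw [h₃]; simp
      refine Tri.ite (T := 2) (fun hc => (Tri.int (by simp [l27]; omega) ?_).time (by omega))
        fun hc => Tri.intSeq (by simp [l13]; omega) (Tri.real ?_)
      · simp only [BoolExpr.val_realLe, RealExpr.val_load, IntExpr.val_lit, l10, l9] at hc
        simp only [Store.setInt_int, Store.setInt_real, Nat.reduceEqDiff, false_and, if_false,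
          IntExpr.val_load, IntExpr.val_lit, l27, l10, and_self, if_true]
        refine ⟨g1, g2, g3, ?_⟩
        intro x hx hor hvx
        by_cases hxk : x = k
        · rw [hxk]; exact hc
        · exact g4 x hx (by omega) hvx
      · simp only [BoolExpr.val_realLe, RealExpr.val_load, IntExpr.val_lit, l10, l9] at hc
        simp only [Store.setInt_int, Store.setInt_real, Store.setReal_int, Store.setReal_real,
          Nat.reduceEqDiff, false_and, if_false, IntExpr.val_load, IntExpr.val_lit,
          RealExpr.val_load, l13, l9, and_self, if_true]
        refine ⟨hk.le, hv, trivial, ?_⟩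
        intro x hx hor hvx
        by_cases hxk : x = k
        · rw [hxk]
        · exact (not_le.1 hc).le.trans (g4 x hx (by omega) hvx)
    · simp only [BoolExpr.val_intLe, IntExpr.val_load, IntExpr.val_lit, hk', k24,
        Nat.le_zero] at hv
      refine (Tri.int (by simp; omega) ?_).time (by omega)
      simp only [Store.setInt_int, Store.setInt_real, Nat.reduceEqDiff, false_and, if_false,
          IntExpr.val_load, IntExpr.val_lit, and_self, if_true]
      refine ⟨g1, g2, g3, ?_⟩
      intro x hx hor hvx
      by_cases hxk : x = k
      · rw [hxk] at hvx; exact absurd hvx hv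
      · exact g4 x hx (by omega) hvx
  · rintro s' _ ⟨g1, g2, g3, g4⟩
    exact ⟨g1, g2, g3, fun x hx => g4 x hx (by omega)⟩

/-- The dual step by the amount in the real cell `10[0]`. -/
def updateDuals : Prog :=
  forLoop 28 (var 26 + .lit 1)
    (.seq (.realStore 7 (.load 22 (var 28)) (.load 7 (.load 22 (var 28)) + .load 10 (.lit 0)))
      (.ite (.intLe (.lit 1) (var 28))
        (.realStore 8 (.load 19 (.load 22 (var 28)))
          (.load 8 (.load 19 (.load 22 (var 28))) - .load 10 (.lit 0)))
        (setVar 18 (.lit 0))))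

theorem updateDuals_spec {B : ℕ} {s : Store} (hkB : s.int 26 0 + 1 ≤ B)
    (hord : ∀ i i', i ≤ s.int 26 0 → i' ≤ s.int 26 0 → s.int 22 i = s.int 22 i' → i = i')
    (hmu : ∀ i i', 1 ≤ i → 1 ≤ i' → i ≤ s.int 26 0 → i' ≤ s.int 26 0 →
      s.int 19 (s.int 22 i) = s.int 19 (s.int 22 i') → i = i') :
    Tri B updateDuals s ((s.int 26 0 + 1) * 5 + 2) fun s' =>
      s'.real 7 = stepU (s.int 26 0) (s.int 22) (s.real 10 0) (s.real 7) ∧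
      s'.real 8 = stepV (s.int 26 0) (s.int 19) (s.int 22) (s.real 10 0) (s.real 8) := by
  classical
  refine (Tri.forLoop (T := 3) (K := s.int 26 0 + 1) (fun k s' =>
      (∀ y, s'.real 7 y = if ∃ i < k, s.int 22 i = y then s.real 7 y + s.real 10 0
        else s.real 7 y) ∧
      (∀ j, s'.real 8 j = if ∃ i, 1 ≤ i ∧ i < k ∧ s.int 19 (s.int 22 i) = j then
        s.real 8 j - s.real 10 0 else s.real 8 j)) rfl hkB ?_ ?_ ?_).conseq le_rfl ?_
  · constructor
    · intro y; rw [if_neg (by rintro ⟨i, h, _⟩; omega)]; rfl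
    · intro y; rw [if_neg (by rintro ⟨i, h, h', _⟩; omega)]; rfl
  · intro s' hs'
    simp [hs'.1 26 rfl]
  · rintro k hk s' hs' hk' ⟨h7, h8⟩
    have e22 : s'.int 22 = s.int 22 := hs'.1 22 rfl
    have e19 : s'.int 19 = s.int 19 := hs'.1 19 rfl
    have e10 : s'.real 10 = s.real 10 := hs'.2 10 rfl
    have n7 : ¬ ∃ i < k, s.int 22 i = s.int 22 k := by
      rintro ⟨i, hi, h⟩
      have := hord i k (by omega) (by omega) h; omega
    have n8 : 1 ≤ k → ¬ ∃ i, 1 ≤ i ∧ i < k ∧ s.int 19 (s.int 22 i) = s.int 19 (s.int 22 k) := by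
      rintro hk1 ⟨i, hi, hi', h⟩
      have := hmu i k hi hk1 (by omega) (by omega) h; omega
    have h7' : ∀ y, (if y = s.int 22 k then s'.real 7 (s.int 22 k) + s.real 10 0
        else s'.real 7 y) = if ∃ i < k + 1, s.int 22 i = y then s.real 7 y + s.real 10 0
        else s.real 7 y := by
      intro y
      split_ifs with h1 h2 h2
      · rw [h7, if_neg n7, h1]
      · exact absurd ⟨k, by omega, h1.symm⟩ h2
      · obtain ⟨i, hi, h3⟩ := h2
        have : i ≠ k := by rintro rfl; exact h1 h3.symm
        rw [h7, if_pos ⟨i, by omega, h3⟩]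
      · rw [h7, if_neg]
        rintro ⟨i, hi, h3⟩
        exact h2 ⟨i, by omega, h3⟩
    have hstep : ∀ j, j ≠ s.int 19 (s.int 22 k) ∨ k = 0 → s'.real 8 j =
        if ∃ i, 1 ≤ i ∧ i < k + 1 ∧ s.int 19 (s.int 22 i) = j then
        s.real 8 j - s.real 10 0 else s.real 8 j := by
      intro j hj
      rw [h8]
      congr 1
      apply propext
      constructor
      · rintro ⟨i, a1, a2, a3⟩; exact ⟨i, a1, by omega, a3⟩
      · rintro ⟨i, a1, a2, a3⟩
        refine ⟨i, a1, ?_, a3⟩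
        rcases hj with hj | hj
        · have : i ≠ k := by rintro rfl; exact hj a3.symm
          omega
        · omega
    refine (Tri.realSeq (T := 2) ?_).time (by omega)
    refine Tri.ite (fun hc => Tri.real ?_) fun hc => Tri.int (by simp) ?_
    all_goals simp only [BoolExpr.val_intLe, IntExpr.val_lit, IntExpr.val_load,
      Store.setReal_int, hk'] at hc
    all_goals simp only [Store.setInt_real, Store.setReal_real, Store.setReal_int,
      Nat.reduceEqDiff, false_and, if_false, IntExpr.val_load, IntExpr.val_lit, RealExpr.val_add,
      RealExpr.val_sub, RealExpr.val_load, hk', e22, e10, e19, true_and]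
    · refine ⟨h7', fun j => ?_⟩
      split_ifs with h1 h2 h2
      · rw [h8, if_neg (n8 hc), h1]
      · exact absurd ⟨k, hc, by omega, h1.symm⟩ h2
      · rw [hstep j (Or.inl h1), if_pos h2]
      · rw [hstep j (Or.inl h1), if_neg h2]
    · exact ⟨h7', fun j => hstep j (Or.inr (by omega))⟩
  · rintro s' _ ⟨h7, h8⟩
    constructor
    · funext y
      rw [h7, stepU]
      simp only [Nat.lt_succ_iff]
    · funext y
      rw [h8, stepV]
      simp only [Nat.lt_succ_iff]

/-- Appends the node in the variable `27` to the tree. -/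
def push : Prog :=
  .seq (.intStore 24 (var 27) (.lit 1)) (.seq (setVar 26 (var 26 + .lit 1))
    (.seq (.intStore 22 (var 26) (var 27)) (.intStore 23 (var 26) (.load 25 (var 27)))))

theorem push_spec {B : ℕ} {s : Store} (hB : 1 ≤ B) (hk : s.int 26 0 + 1 ≤ B)
    (hx : s.int 27 0 ≤ B) (hp : s.int 25 (s.int 27 0) ≤ B) :
    Tri B push s 4 fun s' =>
      s'.int 24 = Function.update (s.int 24) (s.int 27 0) 1 ∧ s'.int 26 0 = s.int 26 0 + 1 ∧
      s'.int 22 = Function.update (s.int 22) (s.int 26 0 + 1) (s.int 27 0) ∧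
      s'.int 23 = Function.update (s.int 23) (s.int 26 0 + 1) (s.int 25 (s.int 27 0)) := by
  refine (Tri.intSeq (by simpa using hB) (T := 1 + (1 + 1)) (Tri.intSeq (by simpa using hk)
    (Tri.intSeq (by simpa using hx) (Tri.int (by simpa using hp) ?_)))).time le_rfl
  refine ⟨?_, by simp, ?_, ?_⟩ <;> funext j <;> simp [Function.update_apply]

/-- After a row has been appended to the tree: updates the best parent positions (array `25`). -/
def updateParents : Prog :=
  forLoop 13 (var 12 + .lit 1) (.seq (slackTo 9 (.load 25 (var 13)) (var 13))
    (.seq (slackTo 10 (var 26) (var 13))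
      (.ite (.realLe (.load 9 (.lit 0)) (.load 10 (.lit 0)))
        (setVar 18 (.lit 0)) (.intStore 25 (var 13) (var 26)))))

theorem updateParents_spec {B n m q K : ℕ} {c : ℕ → ℕ → ℝ} {s : Store} (hE : Env n m q K c s)
    (hb : TreeBdd s m B) (hkB : s.int 26 0 ≤ B)
    (hspar : ∀ x ≤ s.int 12 0, s.int 25 x ≤ s.int 26 0) :
    Tri B updateParents s ((s.int 12 0 + 1) * 10 + 2) fun s' =>
      ∀ x ≤ s.int 12 0, s'.int 25 x ≤ s.int 26 0 ∧
        s.slack (s'.int 25 x) x ≤ s.slack (s.int 25 x) x ∧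
        s.slack (s'.int 25 x) x ≤ s.slack (s.int 26 0) x := by
  have hrB := hb.rB
  refine (Tri.forLoop (T := 8) (K := s.int 12 0 + 1) (fun k s' =>
    (∀ x ≤ s.int 12 0, k ≤ x → s'.int 25 x = s.int 25 x) ∧ ∀ x < k,
    s'.int 25 x ≤ s.int 26 0 ∧ s.slack (s'.int 25 x) x ≤ s.slack (s.int 25 x) x ∧
    s.slack (s'.int 25 x) x ≤ s.slack (s.int 26 0) x) rfl (by omega) ?_ ?_ ?_).conseq le_rfl ?_
  · exact ⟨fun x _ _ => by simp, fun x hx => by omega⟩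
  · intro s' hs'
    simp [hs'.1 12 rfl]
  · rintro k hk s' hs' hk' ⟨g1, g2⟩
    have hE' := hE.same hs' rfl
    obtain ⟨hsl', hb'⟩ := Store.slack_same hE hs' rfl
    replace hb' := hb' _ _ hb
    have e26 : s'.int 26 = s.int 26 := hs'.1 26 rfl
    have e25 : s'.int 25 k = s.int 25 k := g1 k (by omega) le_rfl
    refine (Tri.seq (slackTo_spec (d := 9) (by intro v; simp) (hb'.colTo_le ?_ _)) (T₂ := 3 + 2)
      ?_).time (by omega)
    · simp only [IntExpr.val_load, IntExpr.val_lit, hk', e25, e26]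
      exact hspar k (by omega)
    intro s₂ hs₂ h₂
    simp only [IntExpr.val_load, IntExpr.val_lit, hk', e25, hsl'] at h₂
    have hE2 := hE'.same hs₂ rfl
    obtain ⟨hsl2, hb2⟩ := Store.slack_same hE' hs₂ rfl
    replace hb2 := hb2 _ _ hb'
    rw [hsl'] at hsl2
    have f26 : s₂.int 26 = s.int 26 := (hs₂.1 26 rfl).trans e26
    have f13 : s₂.int 13 0 = k := (congrFun (hs₂.1 13 rfl) 0).trans hk'
    have f9 : s₂.real 9 0 = s.slack (s.int 25 k) k := by rw [h₂]; simp
    refine Tri.seq (slackTo_spec (d := 10) (by intro v; simp) (hb2.colTo_le ?_ _)) ?_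
    · simp only [IntExpr.val_load, IntExpr.val_lit, le_refl]
    intro s₃ hs₃ h₃
    simp only [IntExpr.val_load, IntExpr.val_lit, f13, f26, hsl2] at h₃
    have l13 : s₃.int 13 0 = k := (congrFun (hs₃.1 13 rfl) 0).trans f13
    have l26 : s₃.int 26 = s.int 26 := (hs₃.1 26 rfl).trans f26
    have l25 : s₃.int 25 = s'.int 25 := (hs₃.1 25 rfl).trans (hs₂.1 25 rfl)
    have l9 : s₃.real 9 0 = s.slack (s.int 25 k) k := by rw [h₃]; simp [f9]
    have l10 : s₃.real 10 0 = s.slack (s.int 26 0) k := by rw [h₃]; simp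
    refine Tri.ite (T := 1) (fun hc => Tri.int (by simp) ?_) fun hc =>
      Tri.int (by simpa [l26] using hkB) ?_
    all_goals simp only [BoolExpr.val_realLe, RealExpr.val_load, IntExpr.val_lit, l9, l10] at hc
    all_goals simp only [Store.setInt_int, IntExpr.val_load, IntExpr.val_lit, l13, l25, l26,
      Nat.reduceEqDiff, false_and, if_false, true_and]
    · refine ⟨fun x hx hkx => g1 x hx (by omega), fun x hx => ?_⟩
      by_cases hxk : x = k
      · subst hxk
        rw [e25]
        exact ⟨hspar x (by omega), le_rfl, hc⟩
      · exact g2 x (by omega)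
    · refine ⟨fun x hx hkx => ?_, fun x hx => ?_⟩
      · rw [if_neg (by omega)]; exact g1 x hx (by omega)
      · split_ifs with hxk
        · subst hxk
          exact ⟨le_rfl, (not_le.1 hc).le, le_rfl⟩
        · exact g2 x (by omega)
  · rintro s' _ ⟨_, g⟩ x hx
    exact g x (by omega)

/-- The data that do not change during the search: the matching of the rows below `r`, the free
columns, and the best free column of every row. -/
structure PhaseEnv (n m q K : ℕ) (c : ℕ → ℕ → ℝ) (r : ℕ) (mu : ℕ → ℕ) (fr : ℕ → Prop)
    (best : ℕ → ℕ) (s : Store) : Prop extends Env n m q K c s where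
  r : s.int 12 0 = r
  mu : s.int 19 = mu
  fr : s.free = fr
  best : s.int 21 = best

theorem PhaseEnv.same {n m q K : ℕ} {c : ℕ → ℕ → ℝ} {r : ℕ} {mu : ℕ → ℕ} {fr : ℕ → Prop}
    {best : ℕ → ℕ} {s s' : Store} {p : Prog} (h : PhaseEnv n m q K c r mu fr best s)
    (hs : Same p s s')
    (hp : (p.keepsEnv && !(p.wI 2 || p.wI 12 || p.wI 19 || p.wI 21)) = true) :
    PhaseEnv n m q K c r mu fr best s' := by
  simp only [Bool.and_eq_true, Bool.not_eq_true', Bool.or_eq_false_iff] at hp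
  obtain ⟨h0, ⟨⟨⟨h2, h12⟩, h19⟩, h21⟩⟩ := hp
  refine ⟨h.toEnv.same hs h0, by rw [hs.1 _ h12, h.r], by rw [hs.1 _ h19, h.mu], ?_,
    by rw [hs.1 _ h21, h.best]⟩
  rw [← h.fr]; funext j; simp only [Store.free, hs.1 _ h2]

theorem PhaseEnv.slack {n m q K : ℕ} {c : ℕ → ℕ → ℝ} {r : ℕ} {mu : ℕ → ℕ} {fr : ℕ → Prop}
    {best : ℕ → ℕ} {s : Store} (h : PhaseEnv n m q K c r mu fr best s) (i x : ℕ) :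
    s.slack i x = GETSPReduction.slack c r mu best (s.int 22) (s.real 7) (s.real 8) i x := by
  simp only [Store.slack, h.c, h.r, h.mu, h.best]

/-- The invariant of the search while the sink has not been reached. -/
structure Running (c : ℕ → ℕ → ℝ) (m r : ℕ) (mu : ℕ → ℕ) (fr : ℕ → Prop) (best : ℕ → ℕ)
    (s : Store) : Prop where
  pot : IsPotential c m (r + 1) r mu fr (s.real 7) (s.real 8)
  tree : IsTree c r mu best (s.real 7) (s.real 8) (s.int 26 0) (s.int 22) (s.int 23)
  vis : ∀ x ≤ r, s.int 24 x = 0 ↔ ∀ i, 1 ≤ i → i ≤ s.int 26 0 → s.int 22 i ≠ x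
  parent_le : ∀ x ≤ r, s.int 25 x ≤ s.int 26 0
  parent : ∀ x ≤ r, s.int 24 x = 0 → ∀ i ≤ s.int 26 0,
    slack c r mu best (s.int 22) (s.real 7) (s.real 8) (s.int 25 x) x ≤
      slack c r mu best (s.int 22) (s.real 7) (s.real 8) i x

/-- The result of the search: the sink has been reached along an edge without slack. -/
structure Found (c : ℕ → ℕ → ℝ) (m r : ℕ) (mu : ℕ → ℕ) (fr : ℕ → Prop) (best : ℕ → ℕ)
    (s : Store) : Prop where
  pot : IsPotential c m (r + 1) r mu fr (s.real 7) (s.real 8)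
  pos : 1 ≤ s.int 26 0
  tree : IsTree c r mu best (s.real 7) (s.real 8) (s.int 26 0 - 1) (s.int 22) (s.int 23)
  par_lt : s.int 23 (s.int 26 0) < s.int 26 0
  tight : slack c r mu best (s.int 22) (s.real 7) (s.real 8) (s.int 23 (s.int 26 0)) r = 0

/-- One round of the search: a dual step makes the least slack zero, and the node that attains it is
appended to the tree. -/
def searchStep : Prog := .seq findMin (.seq updateDuals (.seq push updateParents))

/-- A round keeps the invariant, unless the appended node is the sink; then the search is finished. -/
theorem searchStep_spec {B n m q K r : ℕ} {c : ℕ → ℕ → ℝ} {mu best : ℕ → ℕ} {fr : ℕ → Prop}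
    {s : Store} (hE : PhaseEnv n m q K c r mu fr best s) (hM : IsMatching m r mu fr)
    (hbest : ∀ x ≤ r, fr (best x) ∧ ∀ j, fr j → c x (best x) ≤ c x j)
    (hmB : m ≤ B) (hrB : r + 2 ≤ B) (hI : Running c m r mu fr best s) (hv : s.int 24 r = 0) :
    Tri B searchStep s (r * 24 + 29) fun s' => s'.int 26 0 = s.int 26 0 + 1 ∧
      ((s'.int 24 r = 0 ∧ Running c m r mu fr best s') ∨
        (s'.int 24 r ≠ 0 ∧ Found c m r mu fr best s')) := by
  have hk : s.int 26 0 ≤ r := hI.tree.size_le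
  have hb : TreeBdd s m B := ⟨by rw [hE.r, hE.mu]; exact hM.lt,
    by rw [hE.r, hE.best]; exact fun x hx => ((hM.free _).1 (hbest x hx).1).1,
    by rw [hE.r]; exact fun i hi => hI.tree.le hi, hmB, by rw [hE.r]; exact hrB⟩
  refine (Tri.seq (findMin_spec hE.toEnv hb (by rwa [hE.r])
    (by rw [hE.r]; exact fun x hx _ => hI.parent_le x hx))
    (T₂ := (r * 5 + 7) + (4 + (r * 10 + 12))) ?_).time (by rw [hE.r]; omega)
  intro s₁ hs₁ h₁
  rw [hE.r] at h₁
  obtain ⟨hx, hvx, hδ, hmin⟩ := h₁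
  have hE1 := hE.same hs₁ rfl
  have a22 : s₁.int 22 = s.int 22 := hs₁.1 22 rfl
  have a23 : s₁.int 23 = s.int 23 := hs₁.1 23 rfl
  have a24 : s₁.int 24 = s.int 24 := hs₁.1 24 rfl
  have a25 : s₁.int 25 = s.int 25 := hs₁.1 25 rfl
  have a26 : s₁.int 26 = s.int 26 := hs₁.1 26 rfl
  have a7 : s₁.real 7 = s.real 7 := hs₁.2 7 rfl
  have a8 : s₁.real 8 = s.real 8 := hs₁.2 8 rfl
  set k := s.int 26 0 with hkdef
  set y := s₁.int 27 0 with hy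
  set δ := s₁.real 10 0 with hδdef
  simp only [hE.slack] at hδ hmin
  have hδ0 : 0 ≤ δ := by
    rw [hδ]
    exact hI.pot.slack_nonneg hM (fun x hx => (hbest x hx).1)
      (hI.tree.le (hI.parent_le y hx))
  -- `δ` is the least slack of all edges that leave the tree, since array `25` holds best parents
  have hmin' : ∀ i ≤ k, ∀ x ≤ r, (∀ i', 1 ≤ i' → i' ≤ k → s.int 22 i' ≠ x) →
      δ ≤ slack c r mu best (s.int 22) (s.real 7) (s.real 8) i x := by
    intro i hi x hx hxv
    have hv0 := (hI.vis x hx).2 hxv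
    exact (hmin x hx hv0).trans (hI.parent x hx hv0 i hi)
  refine (Tri.seq (updateDuals_spec (s := s₁) (by rw [a26]; omega) ?_ ?_) (T₂ := 4 + (r * 10 + 12))
    ?_).time (by rw [a26]; omega)
  · rw [a22, a26]
    intro i i' hi hi' h
    rcases Nat.eq_zero_or_pos i with rfl | h1 <;> rcases Nat.eq_zero_or_pos i' with rfl | h2
    · rfl
    · have := hI.tree.lt i' h2 hi'; rw [hI.tree.root] at h; omega
    · have := hI.tree.lt i h1 hi; rw [hI.tree.root] at h; omega
    · exact hI.tree.inj i i' h1 hi h2 hi' h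
  · rw [a22, a26, hE1.mu]
    intro i i' h1 h2 hi hi' h
    exact hI.tree.inj i i' h1 hi h2 hi' (hM.inj _ (hI.tree.lt i h1 hi) _ (hI.tree.lt i' h2 hi') h)
  intro s₂ hs₂ h₂
  rw [a26, a22, a7, a8, hE1.mu] at h₂
  obtain ⟨b7, b8⟩ := h₂
  have hE2 := hE1.same hs₂ rfl
  have b22 : s₂.int 22 = s.int 22 := (hs₂.1 22 rfl).trans a22
  have b23 : s₂.int 23 = s.int 23 := (hs₂.1 23 rfl).trans a23
  have b24 : s₂.int 24 = s.int 24 := (hs₂.1 24 rfl).trans a24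
  have b25 : s₂.int 25 = s.int 25 := (hs₂.1 25 rfl).trans a25
  have b26 : s₂.int 26 = s.int 26 := (hs₂.1 26 rfl).trans a26
  have b27 : s₂.int 27 0 = y := congrFun (hs₂.1 27 rfl) 0
  have hpot := hI.pot.step hM hI.tree hbest hδ0 hmin'
  have htree := hI.tree.step (δ := δ)
  have hsl : ∀ i ≤ k, ∀ x ≤ r, (∀ i', 1 ≤ i' → i' ≤ k → s.int 22 i' ≠ x) →
      slack c r mu best (s.int 22) (s₂.real 7) (s₂.real 8) i x =
        slack c r mu best (s.int 22) (s.real 7) (s.real 8) i x - δ := by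
    intro i hi x hx hxv
    rw [b7, b8]
    exact slack_step hM hI.tree (fun x hx => (hbest x hx).1) hi hxv
  rw [← b7, ← b8] at hpot htree
  refine Tri.seq (push_spec (by omega) (by rw [b26]; omega) (by rw [b27]; omega)
    (by rw [b25, b27]; have := hI.parent_le y hx; omega)) ?_
  rintro s₃ hs₃ ⟨c24, c26, c22, c23⟩
  rw [b27, b24] at c24
  rw [b26, ← hkdef] at c26
  rw [b26, b27, b22, ← hkdef] at c22
  rw [b26, b27, b23, b25, ← hkdef] at c23
  have hE3 := hE2.same hs₃ rfl
  have c25 : s₃.int 25 = s.int 25 := (hs₃.1 25 rfl).trans b25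
  have c7 : s₃.real 7 = s₂.real 7 := hs₃.2 7 rfl
  have c8 : s₃.real 8 = s₂.real 8 := hs₃.2 8 rfl
  rw [← c7, ← c8] at hpot htree hsl
  have ho : ∀ i ≤ k, s₃.int 22 i = s.int 22 i := by
    intro i hi; rw [c22, Function.update_of_ne (by omega)]
  have ho' : s₃.int 22 (k + 1) = y := by rw [c22, Function.update_self]
  have hp : ∀ i ≤ k, s₃.int 23 i = s.int 23 i := by
    intro i hi; rw [c23, Function.update_of_ne (by omega)]
  have hp' : s₃.int 23 (k + 1) = s.int 25 y := by rw [c23, Function.update_self]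
  have hb3 : TreeBdd s₃ m B := ⟨by rw [hE3.r, hE3.mu]; exact hM.lt,
    by rw [hE3.r, hE3.best]; exact fun x hx => ((hM.free _).1 (hbest x hx).1).1,
    by
      rw [hE3.r, c26]
      intro i hi
      rcases Nat.lt_or_ge k i with h | h
      · obtain rfl : i = k + 1 := by omega
        rwa [ho']
      · rw [ho i h]; exact hI.tree.le h, hmB, by rw [hE3.r]; exact hrB⟩
  refine (updateParents_spec hE3.toEnv hb3 (by rw [c26]; omega) (by
    rw [hE3.r, c26, c25]; intro x hx; exact (hI.parent_le x hx).trans (by omega))).conseq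
    (by rw [hE3.r]; omega) ?_
  intro s₄ hs₄ h₄
  rw [hE3.r, c26, c25] at h₄
  simp only [hE3.slack] at h₄
  have hE4 := hE3.same hs₄ rfl
  have d22 : s₄.int 22 = s₃.int 22 := hs₄.1 22 rfl
  have d23 : s₄.int 23 = s₃.int 23 := hs₄.1 23 rfl
  have d24 : s₄.int 24 = s₃.int 24 := hs₄.1 24 rfl
  have d26 : s₄.int 26 0 = k + 1 := (congrFun (hs₄.1 26 rfl) 0).trans c26
  have d7 : s₄.real 7 = s₃.real 7 := hs₄.2 7 rfl
  have d8 : s₄.real 8 = s₃.real 8 := hs₄.2 8 rfl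
  refine ⟨d26, ?_⟩
  have hynew := (hI.vis y hx).1 hvx
  -- the dual step by the least slack `δ` makes the edge from the best parent of `y` tight
  have hty : slack c r mu best (s.int 22) (s₃.real 7) (s₃.real 8) (s.int 25 y) y = 0 := by
    rw [hsl _ (hI.parent_le y hx) y hx hynew, hδ]; ring
  by_cases hyr : y = r
  · right
    refine ⟨by rw [d24, c24, hyr, Function.update_self]; omega, ?_⟩
    refine ⟨by rw [d7, d8]; exact hpot, by omega, ?_, ?_, ?_⟩
    · rw [d7, d8, d26, d22, d23]
      exact htree.congr ho hp
    · rw [d23, d26, hp']; have := hI.parent_le y hx; omega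
    · rw [d22, d7, d8, d23, d26, hp', ← hyr, ← hty, slack_congr (ho _ (hI.parent_le y hx))]
      rw [hyr]
  · left
    have hylt : y < r := by omega
    refine ⟨by rw [d24, c24, Function.update_of_ne (Ne.symm hyr), hv], ?_⟩
    refine ⟨by rw [d7, d8]; exact hpot, ?_, ?_, ?_, ?_⟩
    · rw [d7, d8, d26, d22, d23]
      exact htree.push hylt hynew (hI.parent_le y hx) hty ho ho' hp hp'
    · intro x hx'
      rw [d24, c24, d26, d22, Function.update_apply]
      split_ifs with h
      · subst h
        simp only [one_ne_zero, false_iff]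
        intro h; exact h (k + 1) (by omega) le_rfl ho'
      · rw [hI.vis x hx']
        constructor
        · intro h1 i hi hi'
          rcases Nat.lt_or_ge k i with h2 | h2
          · obtain rfl : i = k + 1 := by omega
            rw [ho']; exact Ne.symm h
          · rw [ho i h2]; exact h1 i hi h2
        · intro h1 i hi hi'
          rw [← ho i hi']; exact h1 i hi (by omega)
    · rw [d26]; exact fun x hx => (h₄ x hx).1
    · rw [d26, d24, d22, d7, d8, c24]
      intro x hx' hxv i hi
      rw [Function.update_apply] at hxv
      split_ifs at hxv with hxy
      have hxnew := (hI.vis x hx').1 hxv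
      obtain ⟨g1, g2, g3⟩ := h₄ x hx'
      rcases Nat.lt_or_ge k i with h2 | h2
      · obtain rfl : i = k + 1 := by omega
        exact g3
      · refine g2.trans ?_
        rw [slack_congr (ho _ (hI.parent_le x hx')), slack_congr (ho i h2),
          hsl _ (hI.parent_le x hx') x hx' hxnew, hsl i h2 x hx' hxnew]
        have := hI.parent x hx' hxv i h2
        linarith

/-- Starts the search from the row `r` (variable `12`). -/
def searchInit : Prog :=
  .seq (.realStore 7 (var 12) (.ofInt (.lit 0))) (.seq (setVar 26 (.lit 0))
    (.seq (.intStore 22 (.lit 0) (var 12)) (forLoop 13 (var 12 + .lit 1)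
      (.seq (.intStore 24 (var 13) (.lit 0)) (.intStore 25 (var 13) (.lit 0))))))

theorem searchInit_spec {B n m q K r : ℕ} {c : ℕ → ℕ → ℝ} {mu best : ℕ → ℕ} {fr : ℕ → Prop}
    {s : Store} (hE : PhaseEnv n m q K c r mu fr best s) (hrB : r + 2 ≤ B)
    (hc : ∀ x j, 0 ≤ c x j) (hP : IsPotential c m r r mu fr (s.real 7) (s.real 8)) :
    Tri B searchInit s (r * 4 + 9) fun s' => s'.int 24 r = 0 ∧ s'.int 26 0 = 0 ∧
      Running c m r mu fr best s' := by
  refine (Tri.realSeq (T := 1 + (1 + ((r + 1) * 4 + 2))) (Tri.intSeq (by simp)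
    (Tri.intSeq (by simp [hE.r]; omega) ?_))).time (by omega)
  simp only [RealExpr.val_ofInt, IntExpr.val_load, IntExpr.val_lit, Store.setReal_int, hE.r,
    Store.setInt_int, Nat.reduceEqDiff, false_and, if_false, Nat.cast_zero]
  set s₁ := ((s.setReal 7 r 0).setInt 26 0 0).setInt 22 0 r with hs₁
  have e7 : s₁.real 7 = fun x => if x = r then 0 else s.real 7 x := by
    funext x; simp [hs₁]
  have e8 : s₁.real 8 = s.real 8 := by funext x; simp [hs₁]
  have e26 : s₁.int 26 0 = 0 := by simp [hs₁]
  have e22 : s₁.int 22 0 = r := by simp [hs₁]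
  have e12 : s₁.int 12 0 = r := by simp [hs₁, hE.r]
  refine (Tri.forLoop (T := 2) (K := r + 1) (fun k s' => ∀ x < k, s'.int 24 x = 0 ∧
    s'.int 25 x = 0) rfl (by omega) (by intro x hx; omega) ?_ ?_).conseq le_rfl ?_
  · intro s' hs'
    simp [hs'.1 12 rfl, e12]
  · intro k hk s' hs' hk' hI
    refine Tri.intSeq (by simp) (Tri.int (by simp) ?_)
    intro x hx
    simp only [Store.setInt_int, IntExpr.val_load, IntExpr.val_lit, hk', Nat.reduceEqDiff,
      false_and, if_false, true_and]
    by_cases h : x = k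
    · simp [h]
    · simpa [h] using hI x (by omega)
  · intro s' hs' hI
    have f7 : s'.real 7 = _ := (hs'.2 7 rfl).trans e7
    have f8 : s'.real 8 = _ := (hs'.2 8 rfl).trans e8
    have f26 : s'.int 26 0 = 0 := (congrFun (hs'.1 26 rfl) 0).trans e26
    have f22 : s'.int 22 0 = r := (congrFun (hs'.1 22 rfl) 0).trans e22
    refine ⟨(hI r (by omega)).1, f26, ⟨?_, ?_, ?_, ?_, ?_⟩⟩
    · rw [f7, f8]
      refine ⟨fun x hx j hj => ?_, fun x hx => ?_, hP.nonpos, hP.free⟩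
      · split_ifs with h
        · have := hP.nonpos j hj; have := hc x j; linarith
        · exact hP.feas x (by omega) j hj
      · rw [if_neg hx.ne]; exact hP.tight x hx
    · rw [f26]
      exact ⟨f22, fun i h1 h2 => by omega, fun i i' h1 h2 => by omega, fun i h1 h2 => by omega⟩
    · intro x hx
      rw [f26]
      exact ⟨fun _ i h1 h2 => by omega, fun _ => (hI x (by omega)).1⟩
    · intro x hx; rw [(hI x (by omega)).2]; omega
    · intro x hx _ i hi
      rw [f26] at hi
      obtain rfl : i = 0 := by omega
      rw [(hI x (by omega)).2]

/-- The search for an augmenting path. -/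
def search : Prog :=
  .seq searchInit (.loop (.intLe (.load 24 (var 12)) (.lit 0)) searchStep)

theorem search_spec {B n m q K r : ℕ} {c : ℕ → ℕ → ℝ} {mu best : ℕ → ℕ} {fr : ℕ → Prop}
    {s : Store} (hE : PhaseEnv n m q K c r mu fr best s) (hM : IsMatching m r mu fr)
    (hbest : ∀ x ≤ r, fr (best x) ∧ ∀ j, fr j → c x (best x) ≤ c x j)
    (hmB : m ≤ B) (hrB : r + 2 ≤ B) (hc : ∀ x j, 0 ≤ c x j)
    (hP : IsPotential c m r r mu fr (s.real 7) (s.real 8)) :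
    Tri B search s (r * 4 + 9 + ((r + 2) * (r * 24 + 30) + 1)) fun s' =>
      s'.int 26 0 ≤ r + 1 ∧ Found c m r mu fr best s' := by
  refine Tri.seq (searchInit_spec hE hrB hc hP) ?_
  rintro s₁ hs₁ ⟨h24, h26, hR⟩
  have hE1 := hE.same hs₁ rfl
  refine (Tri.whileLoop (T := r * 24 + 29) (K := r + 2) (fun k s' => s'.int 26 0 ≤ r + 1 ∧
    s'.int 26 0 + k = r + 2 ∧ ((s'.int 24 r = 0 ∧ Running c m r mu fr best s') ∨
        (s'.int 24 r ≠ 0 ∧ Found c m r mu fr best s'))) ⟨by omega, by omega, Or.inl ⟨h24, hR⟩⟩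
        ?_).conseq le_rfl ?_
  · rintro k s' hs' ⟨_, hk, hI⟩ hb
    have hE' := hE1.same hs' rfl
    simp only [BoolExpr.val_intLe, IntExpr.val_load, IntExpr.val_lit, hE'.r, Nat.le_zero] at hb
    rcases hI with ⟨_, hI⟩ | ⟨h, _⟩
    · have := hI.tree.size_le
      refine (searchStep_spec hE' hM hbest hmB hrB hI hb).conseq le_rfl ?_
      rintro s'' _ ⟨h1, h2⟩
      exact ⟨k - 1, by omega, by omega, by omega, h2⟩
    · exact absurd hb h
  · rintro s' hs' ⟨⟨k, h1, _, hI⟩, hb⟩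
    have hE' := hE1.same hs' rfl
    simp only [BoolExpr.val_intLe, IntExpr.val_load, IntExpr.val_lit, hE'.r, Nat.le_zero] at hb
    rcases hI with ⟨h, _⟩ | ⟨_, h⟩
    · exact absurd h hb
    · exact ⟨h1, h⟩

/-- Augments the matching along the path that has been found. -/
def augment : Prog :=
  .seq (setVar 28 (.load 23 (var 26))) (.seq (.intStore 19 (var 12) (.load 21 (.load 22 (var 28))))
    (.seq (setVar 31 (.load 19 (var 12))) (.loop (.intLe (.lit 1) (var 28))
      (.seq (setVar 29 (.load 19 (.load 22 (var 28))))
        (.seq (.intStore 19 (.load 22 (var 28)) (.load 19 (var 12)))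
          (.seq (.intStore 19 (var 12) (var 29)) (setVar 28 (.load 23 (var 28)))))))))

/-- After the augmentation the row `r` is matched as well, and the column `s'.int 31 0` is no longer
free. The potentials remain tight, since the new edges have no slack. -/
theorem augment_spec {B n m q K r : ℕ} {c : ℕ → ℕ → ℝ} {mu best : ℕ → ℕ} {fr : ℕ → Prop}
    {s : Store} (hE : PhaseEnv n m q K c r mu fr best s) (hM : IsMatching m r mu fr)
    (hbest : ∀ x ≤ r, fr (best x)) (hmB : m ≤ B) (hrB : r + 2 ≤ B) (hk : s.int 26 0 ≤ r + 1)
    (hF : Found c m r mu fr best s) :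
    Tri B augment s (r * 5 + 9) fun s' => fr (s'.int 31 0) ∧
      IsMatching m (r + 1) (s'.int 19) (fun j => fr j ∧ j ≠ s'.int 31 0) ∧
      IsPotential c m (r + 1) (r + 1) (s'.int 19) (fun j => fr j ∧ j ≠ s'.int 31 0)
        (s.real 7) (s.real 8) := by
  obtain ⟨hpot, hpos, hT, hpar, ht⟩ := hF
  set k := s.int 26 0 with hkdef
  set p := s.int 23 k with hp
  set ord := s.int 22 with hord
  have hpr : p ≤ r := by omega
  have hordp : ord p ≤ r := hT.le (by omega)
  set j₀ := best (ord p) with hj₀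
  have hfj : fr j₀ := hbest _ hordp
  have hjm := ((hM.free _).1 hfj).1
  have hnj := ((hM.free _).1 hfj).2
  refine (Tri.intSeq (by simp [← hkdef, ← hp]; omega) (T := 1 + (1 + ((r + 1) * 5 + 1)))
    (Tri.intSeq ?_ (Tri.intSeq ?_ ?_))).time (by omega)
  · simp [← hkdef, ← hp, hE.best, ← hord]; omega
  · simp [hE.r, ← hkdef, ← hp, hE.best, ← hord]; omega
  simp only [IntExpr.val_load, IntExpr.val_lit, Store.setInt_int, Nat.reduceEqDiff, false_and,
    if_false, and_self, if_true, ← hkdef, ← hp, hE.r, hE.best, ← hord, ← hj₀]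
  set s₁ := ((s.setInt 28 0 p).setInt 19 r j₀).setInt 31 0 j₀ with hs₁
  have e19 : s₁.int 19 = Function.update mu r j₀ := by
    funext x; simp [hs₁, hE.mu, Function.update_apply]
  have e28 : s₁.int 28 0 = p := by simp [hs₁]
  have e31 : s₁.int 31 0 = j₀ := by simp [hs₁]
  have e12 : s₁.int 12 0 = r := by simp [hs₁, hE.r]
  have e22 : s₁.int 22 = ord := by funext x; simp [hs₁, hord]
  have e23 : s₁.int 23 = s.int 23 := by funext x; simp [hs₁]
  refine (Tri.whileLoop (T := 4) (K := p + 1) (fun i s' => s'.int 28 0 + 1 = i ∧ i ≤ p + 1 ∧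
    AugInv c r mu ord (s.real 7) (s.real 8) (s'.int 28 0) (s'.int 19)
      (fun j => j = j₀ ∨ ∃ x < r, mu x = j)) ?_ ?_).conseq (by omega) ?_
  · rw [e28, e19]
    have hne : ∀ x < r, Function.update mu r j₀ x = mu x := fun x hx =>
      Function.update_of_ne hx.ne _ _
    refine ⟨rfl, le_rfl, fun x hx => ?_, ?_, fun i h1 h2 => ?_, fun x hx y hy h => ?_, fun j => ?_⟩
    · rw [hne x hx]; exact hpot.tight x hx
    · rw [Function.update_self]
      simp only [slack, colTo, lt_irrefl, if_false] at ht
      linarith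
    · exact hne _ (hT.lt i h1 (by omega))
    · rcases Nat.lt_or_ge x r with hx' | hx' <;> rcases Nat.lt_or_ge y r with hy' | hy'
      · rw [hne x hx', hne y hy'] at h; exact hM.inj x hx' y hy' h
      · obtain rfl : y = r := by omega
        rw [hne x hx', Function.update_self] at h; exact absurd h (hnj x hx')
      · obtain rfl : x = r := by omega
        rw [hne y hy', Function.update_self] at h; exact absurd h.symm (hnj y hy')
      · omega
    · constructor
      · rintro (rfl | ⟨x, hx, rfl⟩)
        · exact ⟨r, le_rfl, Function.update_self _ _ _⟩
        · exact ⟨x, hx.le, hne x hx⟩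
      · rintro ⟨x, hx, rfl⟩
        rcases Nat.lt_or_ge x r with hx' | hx'
        · exact Or.inr ⟨x, hx', (hne x hx').symm⟩
        · obtain rfl : x = r := by omega
          exact Or.inl (Function.update_self _ _ _)
  · rintro i s' hs' ⟨h1, h2, hA⟩ hb
    have f12 : s'.int 12 0 = r := (congrFun (hs'.1 12 rfl) 0).trans e12
    have f22 : s'.int 22 = ord := (hs'.1 22 rfl).trans e22
    have f23 : s'.int 23 = s.int 23 := (hs'.1 23 rfl).trans e23
    simp only [BoolExpr.val_intLe, IntExpr.val_load, IntExpr.val_lit] at hb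
    set i₀ := s'.int 28 0 with hi₀
    have hi₀p : i₀ ≤ k - 1 := by omega
    have hlt := hT.lt i₀ hb hi₀p
    have hcol : ∀ x ≤ r, s'.int 19 x ≤ B := by
      intro x hx
      rcases (hA.range _).2 ⟨x, hx, rfl⟩ with h | ⟨y, hy, h⟩
      · rw [h]; omega
      · rw [← h]; exact (hM.lt y hy).le.trans hmB
    obtain ⟨hpi, -⟩ := hT.par i₀ hb hi₀p
    refine (Tri.intSeq ?_ (T := 1 + (1 + 1)) (Tri.intSeq ?_ (Tri.intSeq ?_ (Tri.int ?_ ?_)))).time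
      (by omega)
    · simp only [IntExpr.val_load, IntExpr.val_lit, ← hi₀, f22]
      exact hcol _ hlt.le
    · simp [f12]
      exact hcol r le_rfl
    · simp [← hi₀, f22]
      exact hcol _ hlt.le
    · simp [← hi₀, f23]; omega
    · refine ⟨s.int 23 i₀ + 1, by omega, ?_⟩
      have hsw : ∀ x, ((((s'.setInt 29 0 (s'.int 19 (ord i₀))).setInt 19 (ord i₀)
          (s'.int 19 r)).setInt 19 r (s'.int 19 (ord i₀))).setInt 28 0 (s.int 23 i₀)).int 19 x =
          if x = r then s'.int 19 (ord i₀) else if x = ord i₀ then s'.int 19 r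
          else s'.int 19 x := by
        intro x
        simp
      have := hA.step hT hb hi₀p hsw
      simp only [IntExpr.val_load, IntExpr.val_lit, Store.setInt_int, Nat.reduceEqDiff, false_and,
        if_false, and_self, if_true, ← hi₀, f12, f22, f23]
      exact ⟨trivial, by omega, this⟩
  · rintro s' hs' ⟨⟨i, h1, h2, hA⟩, hb⟩
    simp only [BoolExpr.val_intLe, IntExpr.val_load, IntExpr.val_lit, not_le] at hb
    have f31 : s'.int 31 0 = j₀ := (congrFun (hs'.1 31 rfl) 0).trans e31
    have h0 : s'.int 28 0 = 0 := by omega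
    rw [h0] at hA
    rw [f31]
    have hw := hA.wait
    rw [hT.root] at hw
    refine ⟨hfj, ⟨?_, ?_, ?_⟩, ⟨hpot.feas, ?_, hpot.nonpos, fun j hj => hpot.free j hj.1⟩⟩
    · intro x hx
      rcases (hA.range _).2 ⟨x, by omega, rfl⟩ with h | ⟨y, hy, h⟩
      · omega
      · rw [← h]; exact hM.lt y hy
    · intro x hx y hy; exact hA.inj x (by omega) y (by omega)
    · intro j
      have := hA.range j
      constructor
      · rintro ⟨h1, h2⟩
        have h3 := (hM.free j).1 h1
        refine ⟨h3.1, fun x hx h => ?_⟩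
        rcases this.2 ⟨x, by omega, h⟩ with h4 | ⟨y, hy, h4⟩
        · exact h2 h4
        · exact h3.2 y hy h4
      · rintro ⟨h1, h2⟩
        have h3 : ¬ (j = j₀ ∨ ∃ x < r, mu x = j) := by
          rw [this]; rintro ⟨x, hx, h⟩; exact h2 x (by omega) h
        push Not at h3
        exact ⟨(hM.free j).2 ⟨h1, h3.2⟩, h3.1⟩
    · intro x hx
      rcases Nat.lt_succ_iff_lt_or_eq.1 hx with h | rfl
      · exact hA.tight x h
      · exact hw

/-- The `r`-th phase: a further row is matched. -/
def phase : Prog :=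
  .seq bestRows (.seq search (.seq augment (.seq (.intStore 2 (var 31) (.lit 0))
    (.seq (setVar 14 (var 31 / var 10)) fillBlock))))

/-- The invariant of the phases: an optimal matching of the rows below `r`, with potentials. -/
structure PhaseInv (c : ℕ → ℕ → ℝ) (m q K B r : ℕ) (s : Store) : Prop where
  matching : IsMatching m r (s.int 19) s.free
  pot : IsPotential c m r r (s.int 19) s.free (s.real 7) (s.real 8)
  table : TableOn c q K B s.free (fun _ => True) (s.int 20)
  marks : ∀ j, s.int 2 j ≤ 1

theorem PhaseInv.congr {c : ℕ → ℕ → ℝ} {m q K B r : ℕ} {s s' : Store}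
    (h : PhaseInv c m q K B r s) (h19 : s'.int 19 = s.int 19) (h2 : s'.int 2 = s.int 2)
    (h20 : s'.int 20 = s.int 20) (h7 : s'.real 7 = s.real 7) (h8 : s'.real 8 = s.real 8) :
    PhaseInv c m q K B r s' := by
  have hf : s'.free = s.free := by funext j; simp only [Store.free, h2]
  exact ⟨by rw [h19, hf]; exact h.matching, by rw [h19, hf, h7, h8]; exact h.pot,
    by rw [h20, hf]; exact h.table, by rw [h2]; exact h.marks⟩

/-- A phase takes `O(m + q ^ 2)` steps: it reads and updates the table of the best free columns, which
has `q * K ≤ m + q` cells, and searches among `q` rows. -/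
theorem phase_spec {B n m q K r : ℕ} {c : ℕ → ℕ → ℝ} {s : Store} (hE : Env n m q K c s)
    (hr : s.int 12 0 = r) (hrq : r < q) (hqm : q ≤ m) (hK : K = m / q + 1) (hmB : 4 * m ≤ B)
    (hc : ∀ x j, 0 ≤ c x j) (hI : PhaseInv c m q K B r s) :
    Tri B phase s (4 * m + 200 * (q * q)) fun s' => PhaseInv c m q K B (r + 1) s' := by
  have hKq : K * q ≤ m + q := by
    rw [hK, add_mul, one_mul]; have := Nat.div_mul_le_self m q; omega
  have hKm : K ≤ m + 1 := by rw [hK]; have := Nat.div_le_self m q; omega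
  obtain ⟨hM, hP, hT, hmk⟩ := hI
  have hfm : ¬ s.free m := by rw [hM.free]; omega
  have hex : ∃ j, s.free j := by
    by_contra hno
    push Not at hno
    have : Finset.range m ⊆ (Finset.range r).image (s.int 19) := by
      intro j hj
      have := hno j
      rw [hM.free] at this
      push Not at this
      obtain ⟨x, hx, h⟩ := this (Finset.mem_range.1 hj)
      exact Finset.mem_image.2 ⟨x, Finset.mem_range.2 hx, h⟩
    have := (Finset.card_le_card this).trans Finset.card_image_le
    simp at this; omega
  have hcov : ∀ j, s.free j → ∃ b < K, InBlock q b j := by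
    intro j hj
    have hjm := ((hM.free j).1 hj).1
    refine ⟨j / q, ?_, Nat.div_mul_le_self j q, ?_⟩
    · rw [hK, Nat.lt_succ_iff]; exact Nat.div_le_div_right hjm.le
    · have := Nat.lt_div_mul_add (a := j) (b := q) (by omega); omega
  have htime : (q * (K * 4 + 7) + 2) + ((r * 4 + 9 + ((r + 2) * (r * 24 + 30) + 1)) +
      ((r * 5 + 9) + (1 + (1 + (q * (q * 4 + 8) + 2))))) ≤ 4 * m + 200 * (q * q) := by
    nlinarith
  refine (Tri.seq (bestRows_spec hE (by omega) (by omega) (by omega) (by omega) hfm (by omega) hT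
    hcov hex) ?_).time htime
  intro s₁ hs₁ hbest
  rw [hr] at hbest
  have hf1 : s₁.free = s.free := by funext j; simp only [Store.free, hs₁.1 2 rfl]
  have hE1 : PhaseEnv n m q K c r (s.int 19) s.free (s₁.int 21) s₁ :=
    ⟨hE.same hs₁ rfl, by rw [hs₁.1 12 rfl, hr], hs₁.1 19 rfl, hf1, rfl⟩
  have hP1 : IsPotential c m r r (s.int 19) s.free (s₁.real 7) (s₁.real 8) := by
    rw [hs₁.2 7 rfl, hs₁.2 8 rfl]; exact hP
  refine Tri.seq (search_spec hE1 hM hbest (by omega) (by omega) hc hP1) ?_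
  rintro s₂ hs₂ ⟨hk2, hF⟩
  have hE2 := hE1.same hs₂ rfl
  refine Tri.seq (augment_spec hE2 hM (fun x hx => (hbest x hx).1) (by omega) (by omega) hk2 hF) ?_
  rintro s₃ hs₃ ⟨hfj, hM3, hP3⟩
  have hE3 := hE2.toEnv.same hs₃ rfl
  have e2 : s₃.int 2 = s.int 2 := (hs₃.1 2 rfl).trans ((hs₂.1 2 rfl).trans (hs₁.1 2 rfl))
  have e20 : s₃.int 20 = s.int 20 := (hs₃.1 20 rfl).trans ((hs₂.1 20 rfl).trans (hs₁.1 20 rfl))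
  set j₀ := s₃.int 31 0 with hj₀
  have hjm := ((hM.free _).1 hfj).1
  refine Tri.intSeq (by simp) (Tri.intSeq ?_ ?_)
  · simp only [IntExpr.val_div, IntExpr.val_load, IntExpr.val_lit, Store.setInt_int,
      Nat.reduceEqDiff, false_and, if_false, ← hj₀]
    exact (Nat.div_le_self _ _).trans (by omega)
  simp only [IntExpr.val_div, IntExpr.val_load, IntExpr.val_lit, Store.setInt_int,
      Nat.reduceEqDiff, false_and, if_false, ← hj₀, hE3.q]
  set s₄ := (s₃.setInt 2 j₀ 0).setInt 14 0 (j₀ / q) with hs₄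
  have hE4 : Env n m q K c s₄ := (hE3.setInt (by decide) _ _).setInt (by decide) _ _
  have hf4 : s₄.free = fun j => s.free j ∧ j ≠ j₀ := by
    funext j
    simp only [Store.free, hs₄, Store.setInt_int, Nat.reduceEqDiff, false_and, if_false, e2,
      true_and]
    by_cases h : j = j₀ <;> simp [h]
  have e14 : s₄.int 14 0 = j₀ / q := by simp [hs₄]
  have f20 : s₄.int 20 = s.int 20 := by funext x; simp [hs₄, e20]
  have hblock : j₀ / q < K := by rw [hK, Nat.lt_succ_iff]; exact Nat.div_le_div_right hjm.le
  refine (fillBlock_spec (G := fun _ => True) hE4 (by omega) (by omega) (by omega)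
    (by rwa [e14]) (by rw [hf4]; exact fun h => hfm h.1) ?_).conseq le_rfl ?_
  · intro x hx b hb hne
    rw [e14] at hne
    rw [f20, hf4]
    obtain ⟨h1, h2⟩ := hT x hx b hb trivial
    refine ⟨h1.remove (fun j hj => hj.1) fun j hj hf => ⟨hf, ?_⟩, h2⟩
    rintro rfl
    apply hne.1
    obtain ⟨h3, h4⟩ := hj
    exact ((Nat.div_eq_of_lt_le h3 (by rw [add_mul, one_mul]; exact h4))).symm
  · intro s₅ hs₅ hT5
    have hf5 : s₅.free = fun j => s.free j ∧ j ≠ j₀ := by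
      rw [← hf4]; funext j; simp only [Store.free, hs₅.1 2 rfl]
    have g19 : s₅.int 19 = s₃.int 19 := (hs₅.1 19 rfl).trans (by funext x; simp [hs₄])
    have g7 : s₅.real 7 = s₂.real 7 := (hs₅.2 7 rfl).trans (hs₃.2 7 rfl)
    have g8 : s₅.real 8 = s₂.real 8 := (hs₅.2 8 rfl).trans (hs₃.2 8 rfl)
    refine ⟨by rw [g19, hf5]; exact hM3, by rw [g19, hf5, g7, g8]; exact hP3, ?_, ?_⟩
    · rw [hf5, ← hf4]
      exact fun x hx b hb _ => hT5 x hx b hb (Or.inr trivial)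
    · intro j
      rw [hs₅.1 2 rfl]
      simp only [hs₄, Store.setInt_int, Nat.reduceEqDiff, false_and, if_false, e2]
      split_ifs
      exacts [by omega, hmk j]

/-- Finds an optimal matching of the `n ^ 2` pairs of inner points to the terminal pairs. The
array `2` is `1` on the terminal pairs that remain free. The arrays have the following content.
* The variables `10` and `11`: the number `q = n ^ 2` of rows, and the number `K` of blocks.
* Array `19`: the matching `mu`. Real arrays `7` and `8`: the row and the column potentials.
* Array `20`: at `x * K + b`, the best free column of the row `x` in the block `b`.
* Variable `12`: the row `r` that is matched in the current phase.
* Array `21`: the best free columns of the rows up to `r`.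
* Arrays `22` and `23`, variable `26`: the rows of the tree, their parents, and the last position.
* Arrays `24` and `25`: the marks of the nodes of the tree, and the best parents of the others.

In a phase the nodes below `r` are the matched rows (or their columns), and the node `r`, which is
the root of the tree as a row, serves as the sink for the free columns. -/
def matchingProg : Prog :=
  .seq (setVar 10 (var 0 * var 0)) (.seq (setVar 11 (var 1 / var 10 + .lit 1))
    (.seq (forLoop 13 (var 1) (.seq (.intStore 2 (var 13) (.lit 1))
      (.realStore 8 (var 13) (.ofInt (.lit 0)))))
      (.seq fillTable (forLoop 12 (var 10) phase))))

/-- The potentials certify that the matching is optimal. The time is `O(q * (m + q ^ 2))` for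
`q = n ^ 2`. -/
theorem matchingProg_spec {B n m : ℕ} {s : Store} (hn : s.int 0 0 = n) (hm : s.int 1 0 = m)
    (hnm : n * n ≤ m) (hB : 4 * max m 1 ≤ B) (hz : ∀ j, m ≤ j → s.int 2 j = 0) :
    Tri B matchingProg s (300 * (m * (max n 1) ^ 2 + (max n 1) ^ 6)) fun s' =>
      (∀ j, s'.int 2 j ≤ 1) ∧
      IsMatching m (n * n) (s'.int 19) s'.free ∧
      IsPotential (costOf s) m (n * n) (n * n) (s'.int 19) s'.free (s'.real 7) (s'.real 8) := by
  set q := n * n with hq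
  set K := m / q + 1 with hKdef
  have hKq : K * q ≤ m + q := by
    rw [hKdef, add_mul, one_mul]; have := Nat.div_mul_le_self m q; omega
  have hKm : K ≤ m + 1 := by rw [hKdef]; have := Nat.div_le_self m q; omega
  have htime : 1 + (1 + ((m * 4 + 2) + ((K * (q * (q * 4 + 8) + 4) + 2) +
      (q * (4 * m + 200 * (q * q) + 2) + 2)))) ≤ 300 * (m * (max n 1) ^ 2 + (max n 1) ^ 6) := by
    rcases Nat.eq_zero_or_pos n with h0 | h0
    · have hq0 : q = 0 := by rw [hq, h0]
      rw [h0, hq0, hKdef, hq0]; simp; omega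
    · have e1 : max n 1 = n := max_eq_left h0
      have e2 : n ^ 2 = q := by rw [hq]; ring
      have e6 : n ^ 6 = q * q * q := by rw [hq]; ring
      have hq1 : 1 ≤ q := Nat.mul_pos h0 h0
      have h3 : K * (q * (q * 4 + 8)) ≤ (m + q) * (q * 4 + 8) := by
        rw [← mul_assoc]; exact Nat.mul_le_mul_right _ hKq
      have h4 : m ≤ m * q := Nat.le_mul_of_pos_right _ hq1
      have h5 : q ≤ q * q := Nat.le_mul_of_pos_right _ hq1
      have h6 : q * q ≤ q * q * q := Nat.le_mul_of_pos_right _ hq1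
      rw [e1, e2, e6]
      nlinarith
  have hc : ∀ x j, 0 ≤ costOf s x j := costOf_nonneg s
  set c := costOf s with hcdef
  refine (Tri.intSeq (by simp [hn, ← hq]; omega) (Tri.intSeq (by simp [hn, ← hq, hm]; omega)
    (Tri.seq (Tri.forLoop (T := 2) (K := m) (fun k s' => (∀ j < k, s'.int 2 j = 1 ∧
      s'.real 8 j = 0) ∧ ∀ j, k ≤ j → s'.int 2 j = s.int 2 j) rfl (by omega) ?_ ?_ ?_)
      ?_))).time htime
  · exact ⟨fun j hj => by omega, fun j _ => by simp⟩
  · intro s' hs'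
    simp [hs'.1 1 rfl, hm]
  · rintro k hk s' hs' hk' ⟨h1, h2⟩
    refine Tri.intSeq (by simp; omega) (Tri.real ⟨fun j hj => ?_, fun j hj => ?_⟩)
    · simp only [Store.setInt_int, Store.setInt_real, Store.setReal_int, Store.setReal_real,
        IntExpr.val_load, IntExpr.val_lit, hk', Nat.reduceEqDiff, false_and, if_false, true_and,
        RealExpr.val_ofInt, Nat.cast_zero]
      by_cases h : j = k
      · simp [h]
      · simpa [h] using h1 j (by omega)
    · simp only [Store.setInt_int, Store.setReal_int, IntExpr.val_load, IntExpr.val_lit, hk',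
        Nat.reduceEqDiff, false_and, if_false, true_and]
      rw [if_neg (by omega)]
      exact h2 j (by omega)
  rintro s₁ hs₁ ⟨h1, h2⟩
  have hE1 : Env n m q K c s₁ := by
    refine ⟨?_, ?_, ?_, ?_, ?_⟩
    · rw [hs₁.1 0 rfl]; simp [hn]
    · rw [hs₁.1 1 rfl]; simp [hm]
    · rw [hs₁.1 10 rfl]; simp [hn, hq]
    · rw [hs₁.1 11 rfl]; simp [hn, hm, hKdef, hq]
    · refine costOf_congr ?_ ?_
      · rw [hs₁.1 0 rfl]; simp
      · intro a ha
        interval_cases a <;> exact hs₁.2 _ rfl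
  have hf1 : ∀ j, s₁.free j ↔ j < m := by
    intro j
    rcases Nat.lt_or_ge j m with h | h
    · simp [Store.free, (h1 j h).1, h]
    · simp [Store.free, h2 j h, hz j h, h]
  refine Tri.seq (fillTable_spec hE1 (by omega) (by omega) (by omega) (by omega)
    (by rw [hf1]; omega)) ?_
  intro s₂ hs₂ hT
  have hE2 := hE1.same hs₂ rfl
  have hf2 : s₂.free = s₁.free := by funext j; simp only [Store.free, hs₂.1 2 rfl]
  refine (Tri.forLoop (T := 4 * m + 200 * (q * q)) (K := q) (fun r s' => PhaseInv c m q K B r s')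
    rfl (by omega) ?_ ?_ ?_).conseq le_rfl ?_
  -- at first there are no matched rows, all columns are free, and all column potentials are zero
  · refine PhaseInv.congr (s := s₂) ⟨⟨?_, ?_, ?_⟩, ⟨?_, ?_, ?_, ?_⟩, ?_, ?_⟩ ?_ ?_ ?_ ?_ ?_
    · intro x hx; omega
    · intro x hx; omega
    · intro j; rw [hf2, hf1]; simp
    · intro x hx; omega
    · intro x hx; omega
    · intro j hj; rw [hs₂.2 8 rfl, (h1 j hj).2]
    · intro j hj; rw [hf2, hf1] at hj; rw [hs₂.2 8 rfl, (h1 j hj).2]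
    · rw [hf2]; exact hT
    · intro j
      rw [hs₂.1 2 rfl]
      rcases Nat.lt_or_ge j m with h | h
      · rw [(h1 j h).1]
      · rw [h2 j h, hz j h]; omega
    all_goals rfl
  · intro s' hs'
    simp [(hE2.same hs' rfl).q]
  · intro r hr s' hs' hr' hI
    refine (phase_spec (hE2.same hs' rfl) hr' hr hnm rfl (by omega) hc hI).conseq le_rfl ?_
    intro s'' _ h
    exact h.congr (Store.setInt_int_ne _ (by decide) _ _) (Store.setInt_int_ne _ (by decide) _ _)
      (Store.setInt_int_ne _ (by decide) _ _) rfl rfl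
  · rintro s' _ ⟨g1, g2, -, g4⟩
    exact ⟨g4, g1, g2⟩

theorem matchingProg_ok : matchingProg.ok 10 60 = true := by decide +kernel

/-! ### Lengths of polygonal paths -/

@[simp] theorem polyLength_nil : polyLength [] = 0 := rfl
@[simp] theorem polyLength_singleton (a : Plane) : polyLength [a] = 0 := rfl
@[simp] theorem polyLength_cons_cons (a b : Plane) (l : List Plane) :
    polyLength (a :: b :: l) = dist a b + polyLength (b :: l) := rfl

theorem polyLength_append_cons (l : List Plane) (a : Plane) (r : List Plane) :
    polyLength (l ++ a :: r) = polyLength (l ++ [a]) + polyLength (a :: r) := by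
  induction l with
  | nil => simp
  | cons x l ih =>
    cases l with
    | nil => simp
    | cons y l => simp only [List.cons_append, polyLength_cons_cons] at ih ⊢; rw [ih]; ring

theorem polyLength_concat {l : List Plane} (hl : l ≠ []) (a : Plane) :
    polyLength (l ++ [a]) = polyLength l + dist (l.getLast hl) a := by
  induction l with
  | nil => exact absurd rfl hl
  | cons x l ih =>
    cases l with
    | nil => simp
    | cons y l =>
      simp only [List.cons_append, polyLength_cons_cons] at ih ⊢
      rw [ih (by simp), List.getLast_cons_cons]; ring

theorem polyLength_cons {l : List Plane} (hl : l ≠ []) (a : Plane) :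
    polyLength (a :: l) = dist a (l.head hl) + polyLength l := by
  cases l with
  | nil => exact absurd rfl hl
  | cons x l => rfl

theorem polyLength_append {l l' : List Plane} (hl : l ≠ []) (hl' : l' ≠ []) :
    polyLength (l ++ l') = polyLength l + dist (l.getLast hl) (l'.head hl') + polyLength l' := by
  cases l' with
  | nil => exact absurd rfl hl'
  | cons x l' => rw [polyLength_append_cons, polyLength_concat hl]; rfl

theorem polyLength_reverse (l : List Plane) : polyLength l.reverse = polyLength l := by
  induction l with
  | nil => rfl
  | cons x l ih =>
    cases l with
    | nil => rfl
    | cons y l =>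
      rw [List.reverse_cons, polyLength_concat (by simp), ih, List.getLast_reverse]
      simp [dist_comm, add_comm]

theorem polyLength_nonneg (l : List Plane) : 0 ≤ polyLength l := by
  induction l with
  | nil => simp
  | cons x l ih =>
    cases l with
    | nil => simp
    | cons y l => rw [polyLength_cons_cons]; positivity

/-! ### Exchange of terminal pairs -/

section Exchange
variable {c : ℕ → ℕ → ℝ} {m q : ℕ} {mu : ℕ → ℕ} {fr : ℕ → Prop} {u v : ℕ → ℝ}

/-- A row `x` can be inserted into a partial matching `g` of the rows `Y`, at the price of its
potential: if its column `mu x` is occupied by a row `x₁`, then `x₁` is displaced and inserted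
in turn. -/
theorem exists_insert (hM : IsMatching m q mu fr) (hP : IsPotential c m q q mu fr u v) (N : ℕ) :
    ∀ (Y : Finset ℕ) (g : ℕ → ℕ) (x : ℕ), (∀ y ∈ Y, y < q) → (∀ y ∈ Y, g y < m) →
      Set.InjOn g Y → x < q → x ∉ Y → (Y.filter fun y => g y ≠ mu y).card < N →
      ∃ (g' : ℕ → ℕ) (t : ℕ), Set.InjOn g' ((insert x Y : Finset ℕ) : Set ℕ) ∧
        (insert x Y).image g' = insert t (Y.image g) ∧ t < m ∧ ¬ fr t ∧
        ∑ y ∈ insert x Y, c y (g' y) ≤ ∑ y ∈ Y, c y (g y) + u x + v t := by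
  induction N with
  | zero => intro Y g x _ _ _ _ _ hN; omega
  | succ N ih =>
    intro Y g x hY hg hinj hx hxY hN
    have hmx := hM.lt x hx
    have hfx : ¬ fr (mu x) := fun h => ((hM.free _).1 h).2 x hx rfl
    have htx := hP.tight x hx
    have hupd : ∀ (a : ℕ) (Z : Finset ℕ), x ∉ Z → ∀ y ∈ Z, Function.update g x a y = g y :=
      fun a Z hZ y hy => Function.update_of_ne (by rintro rfl; exact hZ hy) _ _
    have himg : ∀ (a : ℕ) (Z : Finset ℕ), x ∉ Z →
        Z.image (Function.update g x a) = Z.image g := fun a Z hZ =>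
      Finset.image_congr fun y hy => hupd a Z hZ y hy
    have hinjU : ∀ Z : Finset ℕ, x ∉ Z → Set.InjOn g Z → mu x ∉ Z.image g →
        Set.InjOn (Function.update g x (mu x)) ((insert x Z : Finset ℕ) : Set ℕ) := by
      intro Z hZ hi hnot
      rw [Finset.coe_insert, Set.injOn_insert (by simpa using hZ)]
      refine ⟨fun y hy z hz h => ?_, ?_⟩
      · rw [hupd _ Z hZ y hy, hupd _ Z hZ z hz] at h; exact hi hy hz h
      · rw [Function.update_self]
        rintro ⟨y, hy, h⟩
        rw [hupd _ Z hZ y hy] at h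
        exact hnot (Finset.mem_image.2 ⟨y, hy, h⟩)
    by_cases hocc : mu x ∈ Y.image g
    · obtain ⟨x₁, hx₁, hgx⟩ := Finset.mem_image.1 hocc
      have hne : x₁ ≠ x := by rintro rfl; exact hxY hx₁
      set Z := Y.erase x₁ with hZ
      have hxZ : x ∉ Z := fun h => hxY (Finset.mem_of_mem_erase h)
      have hZY : ∀ y ∈ Z, y ∈ Y := fun y hy => Finset.mem_of_mem_erase hy
      have hmZ : mu x ∉ Z.image g := by
        intro h
        obtain ⟨y, hy, h⟩ := Finset.mem_image.1 h
        exact (Finset.ne_of_mem_erase hy) (hinj (hZY y hy) hx₁ (h.trans hgx.symm))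
      have himg2 : (insert x Z).image (Function.update g x (mu x)) = Y.image g := by
        rw [Finset.image_insert, Function.update_self, himg _ Z hxZ, ← hgx, ← Finset.image_insert,
          hZ, Finset.insert_erase hx₁]
      have hins : insert x₁ (insert x Z) = insert x Y := by
        rw [Finset.insert_comm, hZ, Finset.insert_erase hx₁]
      refine Exists.elim (ih (insert x Z) (Function.update g x (mu x)) x₁ ?_ ?_
        (hinjU Z hxZ (fun y hy z hz => hinj (hZY y hy) (hZY z hz)) hmZ) (hY x₁ hx₁) ?_ ?_) ?_
      rotate_right
      · rintro g' ⟨t, h1, h2, h3, h4, h5⟩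
        rw [hins] at h1 h2 h5
        refine ⟨g', t, h1, by rw [h2, himg2], h3, h4, h5.trans ?_⟩
        rw [Finset.sum_insert hxZ, Function.update_self,
          Finset.sum_congr rfl fun y hy => by rw [hupd _ Z hxZ y hy],
          ← Finset.add_sum_erase Y _ hx₁, hgx, ← htx]
        have := hP.feas x₁ (hY x₁ hx₁) _ hmx
        linarith
      · intro y hy
        rcases Finset.mem_insert.1 hy with rfl | hy
        exacts [hx, hY y (hZY y hy)]
      · intro y hy
        rcases Finset.mem_insert.1 hy with rfl | hy
        · rwa [Function.update_self]
        · rw [hupd _ Z hxZ y hy]; exact hg y (hZY y hy)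
      · simp [hZ, hne]
      · have hsub : ((insert x Z).filter fun y => Function.update g x (mu x) y ≠ mu y) ⊆
            (Y.filter fun y => g y ≠ mu y).erase x₁ := by
          intro y hy
          obtain ⟨hy, hy'⟩ := Finset.mem_filter.1 hy
          rcases Finset.mem_insert.1 hy with rfl | hy
          · rw [Function.update_self] at hy'; exact absurd rfl hy'
          · rw [hupd _ Z hxZ y hy] at hy'
            exact Finset.mem_erase.2 ⟨Finset.ne_of_mem_erase hy,
              Finset.mem_filter.2 ⟨hZY y hy, hy'⟩⟩
        have hmem : x₁ ∈ Y.filter fun y => g y ≠ mu y := by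
          refine Finset.mem_filter.2 ⟨hx₁, fun h => hne ?_⟩
          exact hM.inj _ (hY x₁ hx₁) _ hx (h.symm.trans hgx)
        have := Finset.card_le_card hsub
        rw [Finset.card_erase_of_mem hmem] at this
        have : 0 < (Y.filter fun y => g y ≠ mu y).card := Finset.card_pos.2 ⟨_, hmem⟩
        omega
    · refine ⟨Function.update g x (mu x), mu x, hinjU Y hxY hinj hocc, ?_, hmx, hfx, ?_⟩
      · rw [Finset.image_insert, Function.update_self, himg _ Y hxY]
      · rw [Finset.sum_insert hxY, Function.update_self,
          Finset.sum_congr rfl fun y hy => by rw [hupd _ Y hxY y hy]]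
        linarith

/-- Every partial matching can be replaced by one that is not more expensive and uses only columns
of the optimal matching `mu`. -/
theorem exists_matching_not_free (hM : IsMatching m q mu fr) (hP : IsPotential c m q q mu fr u v)
    (Y : Finset ℕ) (hY : ∀ y ∈ Y, y < q) :
    ∀ g : ℕ → ℕ, (∀ y ∈ Y, g y < m) → Set.InjOn g Y →
      ∃ g' : ℕ → ℕ, Set.InjOn g' Y ∧ (∀ y ∈ Y, g' y < m ∧ ¬ fr (g' y)) ∧
        ∑ y ∈ Y, c y (g' y) ≤ ∑ y ∈ Y, c y (g y) := by
  classical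
  suffices H : ∀ (N : ℕ) (g : ℕ → ℕ), (∀ y ∈ Y, g y < m) → Set.InjOn g Y →
      ((Y.image g).filter fr).card ≤ N →
      ∃ g' : ℕ → ℕ, Set.InjOn g' Y ∧ (∀ y ∈ Y, g' y < m ∧ ¬ fr (g' y)) ∧
        ∑ y ∈ Y, c y (g' y) ≤ ∑ y ∈ Y, c y (g y) from
    fun g hg hi => H _ g hg hi le_rfl
  intro N
  induction N with
  | zero =>
    intro g hg hi hN
    refine ⟨g, hi, fun y hy => ⟨hg y hy, fun h => ?_⟩, le_rfl⟩
    have : g y ∈ (Y.image g).filter fr := Finset.mem_filter.2 ⟨Finset.mem_image_of_mem _ hy, h⟩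
    rw [Nat.le_zero, Finset.card_eq_zero] at hN
    rw [hN] at this; simp at this
  | succ N ih =>
    intro g hg hi hN
    by_cases hex : ∃ x ∈ Y, fr (g x)
    · obtain ⟨x, hx, hfx⟩ := hex
      obtain ⟨g₁, t, h1, h2, h3, h4, h5⟩ := exists_insert hM hP _ (Y.erase x) g x
        (fun y hy => hY y (Finset.mem_of_mem_erase hy))
        (fun y hy => hg y (Finset.mem_of_mem_erase hy))
        (fun y hy z hz => hi (Finset.mem_of_mem_erase hy) (Finset.mem_of_mem_erase hz))
        (hY x hx) (by simp) (Nat.lt_succ_self _)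
      rw [Finset.insert_erase hx] at h1 h2 h5
      refine Exists.elim (ih g₁ ?_ h1 ?_) ?_
      rotate_right
      · rintro g₂ ⟨k1, k2, k3⟩
        refine ⟨g₂, k1, k2, k3.trans (h5.trans ?_)⟩
        rw [← Finset.add_sum_erase Y _ hx]
        have e1 := hP.feas x (hY x hx) _ (hg x hx)
        have e2 := hP.free _ hfx
        have e3 := hP.nonpos t h3
        linarith
      · intro y hy
        have : g₁ y ∈ insert t ((Y.erase x).image g) := h2 ▸ Finset.mem_image_of_mem _ hy
        rcases Finset.mem_insert.1 this with h | h
        · rwa [h]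
        · obtain ⟨z, hz, h⟩ := Finset.mem_image.1 h
          rw [← h]; exact hg z (Finset.mem_of_mem_erase hz)
      · have hsub : (Y.image g₁).filter fr ⊆ ((Y.image g).filter fr).erase (g x) := by
          rw [h2]
          intro j hj
          obtain ⟨hj, hj'⟩ := Finset.mem_filter.1 hj
          rcases Finset.mem_insert.1 hj with rfl | hj
          · exact absurd hj' h4
          · obtain ⟨z, hz, rfl⟩ := Finset.mem_image.1 hj
            have hz' := Finset.mem_of_mem_erase hz
            exact Finset.mem_erase.2 ⟨fun h => Finset.ne_of_mem_erase hz (hi hz' hx h),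
              Finset.mem_filter.2 ⟨Finset.mem_image_of_mem _ hz', hj'⟩⟩
        have hmem : g x ∈ (Y.image g).filter fr :=
          Finset.mem_filter.2 ⟨Finset.mem_image_of_mem _ hx, hfx⟩
        have := Finset.card_le_card hsub
        rw [Finset.card_erase_of_mem hmem] at this
        omega
    · push Not at hex
      exact ⟨g, hi, fun y hy => ⟨hg y hy, hex y hy⟩, le_rfl⟩

end Exchange

/-! ### Optimal solutions -/

/-- If there is a solution at all, then there is an optimal one. -/
theorem Points.exists_isOptimal {n m : ℕ} (D : Points n m)
    (h : ∃ R : Fin m → List (Fin n), IsSolution R) : ∃ R, D.IsOptimal R := by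
  let S : Set (Fin m → List (Fin n)) := {R | IsSolution R}
  have hfin : S.Finite := by
    refine Set.Finite.subset (Set.finite_range
      fun (f : Fin m → {l : List (Fin n) // l.Nodup}) j => (f j).1) ?_
    intro R hR
    exact ⟨fun j => ⟨R j, hR.1 j⟩, rfl⟩
  obtain ⟨R, hR, hmin⟩ := hfin.exists_minimalFor D.cost S h
  refine ⟨R, hR, fun R' hR' => ?_⟩
  rcases le_total (D.cost R) (D.cost R') with h | h
  exacts [h, hmin hR' h]

theorem exists_isSolution {n m : ℕ} (h : n = 0 ∨ 0 < m) :
    ∃ R : Fin m → List (Fin n), IsSolution R := by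
  rcases h with rfl | h
  · exact ⟨fun _ => [], fun _ => List.nodup_nil, fun v => v.elim0⟩
  · refine ⟨fun j => if j = ⟨0, h⟩ then List.finRange n else [], fun j => ?_, fun v => ?_⟩
    · dsimp only; split_ifs
      exacts [List.nodup_finRange n, List.nodup_nil]
    · refine ⟨⟨0, h⟩, by simp, fun j hj => ?_⟩
      by_contra hne
      simp [hne] at hj

/-- Moving the nonredundant routes of a solution to other terminal pairs. -/
theorem IsSolution.move {n m : ℕ} {R : Fin m → List (Fin n)} (hR : IsSolution R) (σ : Fin m → Fin m)
    (hσ : Set.InjOn σ {j | R j ≠ []}) :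
    ∃ R' : Fin m → List (Fin n), IsSolution R' ∧ (∀ j, R j ≠ [] → R' (σ j) = R j) ∧
      ∀ j', (∀ j, R j ≠ [] → σ j ≠ j') → R' j' = [] := by
  classical
  let R' : Fin m → List (Fin n) := fun j' =>
    if h : ∃ j, R j ≠ [] ∧ σ j = j' then R h.choose else []
  have h1 : ∀ j, R j ≠ [] → R' (σ j) = R j := by
    intro j hj
    have h : ∃ i, R i ≠ [] ∧ σ i = σ j := ⟨j, hj, rfl⟩
    have : h.choose = j := hσ h.choose_spec.1 hj h.choose_spec.2
    simp only [R', dif_pos h, this]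
  have h2 : ∀ j', (∀ j, R j ≠ [] → σ j ≠ j') → R' j' = [] := by
    intro j' h
    exact dif_neg (by rintro ⟨j, hj, hj'⟩; exact h j hj hj')
  have h3 : ∀ j', R' j' ≠ [] → ∃ j, R j ≠ [] ∧ σ j = j' := by
    intro j' h
    by_contra hno
    push Not at hno
    exact h (h2 j' hno)
  refine ⟨R', ⟨fun j' => ?_, fun x => ?_⟩, h1, h2⟩
  · by_cases h : R' j' = []
    · rw [h]; exact List.nodup_nil
    · obtain ⟨j, hj, rfl⟩ := h3 j' h
      rw [h1 j hj]; exact hR.1 j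
  · obtain ⟨j, hj, huniq⟩ := hR.2 x
    have hj0 : R j ≠ [] := List.ne_nil_of_mem hj
    refine ⟨σ j, by simpa only [h1 j hj0] using hj, fun j' hj' => ?_⟩
    obtain ⟨i, hi, rfl⟩ := h3 j' (List.ne_nil_of_mem hj')
    rw [h1 i hi] at hj'
    rw [huniq i hj']

namespace Points
variable {n m : ℕ} (D : Points n m)

/-- The cost of the pair `(a, b)` of inner points on the terminal pair `j`. -/
noncomputable def pairCost (a b : Fin n) (j : Fin m) : ℝ :=
  dist (D.pair j).1 (D.inner a) + dist (D.inner a) (D.inner b) + dist (D.inner b) (D.pair j).2 -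
    dist (D.pair j).1 (D.pair j).2

/-- By this much the path along a route is longer than the direct edge. -/
noncomputable def extra (j : Fin m) (l : List (Fin n)) : ℝ :=
  polyLength ((D.pair j).1 :: (l.map D.inner ++ [(D.pair j).2])) - dist (D.pair j).1 (D.pair j).2

theorem extra_nil (j : Fin m) : D.extra j [] = 0 := by simp [extra]

theorem extra_of_ne_nil (j : Fin m) {l : List (Fin n)} (h : l ≠ []) :
    D.extra j l = polyLength (l.map D.inner) - dist (D.inner (l.head h)) (D.inner (l.getLast h)) +
      D.pairCost (l.head h) (l.getLast h) j := by
  have h' : l.map D.inner ≠ [] := by simpa using h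
  rw [extra, polyLength_cons (by simp), polyLength_concat h', pairCost,
    List.head_append_of_ne_nil h', List.head_map, List.getLast_map]
  ring

theorem cost_eq (R : Fin m → List (Fin n)) :
    D.cost R = ∑ j, dist (D.pair j).1 (D.pair j).2 + ∑ j, D.extra j (R j) := by
  rw [cost, ← Finset.sum_add_distrib]
  refine Finset.sum_congr rfl fun j _ => ?_
  rw [path, extra]; ring

/-- An optimal matching of the pairs of inner points to the terminal pairs leaves only terminal
pairs free on which some optimal solution is redundant. -/
theorem exists_isOptimal_redundant {c : ℕ → ℕ → ℝ} {mu : ℕ → ℕ} {fr : ℕ → Prop} {u v : ℕ → ℝ}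
    (hc : ∀ (a b : Fin n) (j : Fin m), c (a * n + b) j = D.pairCost a b j)
    (hM : IsMatching m (n * n) mu fr) (hP : IsPotential c m (n * n) (n * n) mu fr u v)
    (hsol : ∃ R : Fin m → List (Fin n), IsSolution R) :
    ∃ R, D.IsOptimal R ∧ ∀ j : Fin m, fr j → R j = [] := by
  classical
  obtain ⟨R, hR, hopt⟩ := D.exists_isOptimal hsol
  -- the row of a nonredundant route; different routes have different first points, so `g` is
  -- the partial matching of the rows to the terminal pairs
  let key : Fin m → ℕ := fun j => if h : R j ≠ [] then
    ((R j).head h : ℕ) * n + (R j).getLast h else 0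
  have hkey : ∀ j (h : R j ≠ []), key j = ((R j).head h : ℕ) * n + (R j).getLast h :=
    fun j h => dif_pos h
  let J : Finset (Fin m) := Finset.univ.filter fun j => R j ≠ []
  have hJ : ∀ j, j ∈ J ↔ R j ≠ [] := by simp [J]
  have hinj : Set.InjOn key J := by
    intro i hi j hj h
    rw [Finset.mem_coe, hJ] at hi hj
    rw [hkey i hi, hkey j hj] at h
    have := (pair_index_inj ((R i).getLast hi).2 ((R j).getLast hj).2 h).1
    have h1 : (R i).head hi ∈ R j := by rw [Fin.ext this]; exact List.head_mem hj
    exact (hR.2 _).unique (List.head_mem hi) h1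
  let g : ℕ → ℕ := fun x => if h : ∃ j ∈ J, key j = x then (h.choose : ℕ) else 0
  have hg : ∀ j ∈ J, g (key j) = j := by
    intro j hj
    have h : ∃ i ∈ J, key i = key j := ⟨j, hj, rfl⟩
    have : h.choose = j := hinj h.choose_spec.1 hj h.choose_spec.2
    simp only [g, dif_pos h, this]
  refine Exists.elim (exists_matching_not_free hM hP (J.image key) ?_ g ?_ ?_) ?_
  rotate_right
  · rintro g' ⟨k1, k2, k3⟩
    -- the route on `j` is moved to the terminal pair `σ j`
    let σ : Fin m → Fin m := fun j => if h : g' (key j) < m then ⟨g' (key j), h⟩ else j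
    have hσ : ∀ j ∈ J, (σ j : ℕ) = g' (key j) := by
      intro j hj
      simp only [σ, dif_pos (k2 _ (Finset.mem_image_of_mem _ hj)).1]
    have hσinj : Set.InjOn σ {j | R j ≠ []} := by
      intro i hi j hj h
      have hi' := (hJ i).2 hi
      have hj' := (hJ j).2 hj
      have := congrArg Fin.val h
      rw [hσ i hi', hσ j hj'] at this
      exact hinj hi' hj' (k1 (Finset.mem_image_of_mem _ hi') (Finset.mem_image_of_mem _ hj') this)
    obtain ⟨R', s1, s2, s3⟩ := hR.move σ hσinj
    refine ⟨R', ⟨s1, fun R'' h'' => le_trans ?_ (hopt R'' h'')⟩, fun j hj => s3 j ?_⟩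
    · rw [cost_eq, cost_eq]
      refine add_le_add_right ?_ _
      have e1 : ∑ j, D.extra j (R j) = ∑ j ∈ J, D.extra j (R j) := by
        refine (Finset.sum_subset (Finset.subset_univ _) fun j _ hj => ?_).symm
        rw [hJ, not_not] at hj
        rw [hj, extra_nil]
      have e2 : ∑ j, D.extra j (R' j) = ∑ j ∈ J, D.extra (σ j) (R j) := by
        rw [← Finset.sum_subset (Finset.subset_univ (J.image σ)), Finset.sum_image]
        · exact Finset.sum_congr rfl fun j hj => by rw [s2 j ((hJ j).1 hj)]
        · intro i hi j hj h
          exact hσinj ((hJ i).1 hi) ((hJ j).1 hj) h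
        · intro j _ hj
          rw [s3 j, extra_nil]
          intro i hi h
          exact hj (Finset.mem_image.2 ⟨i, (hJ i).2 hi, h⟩)
      rw [Finset.sum_image hinj, Finset.sum_image hinj] at k3
      -- the part of the additional length that does not depend on the terminal pair
      let w : Fin m → ℝ := fun j => if h : R j ≠ [] then polyLength ((R j).map D.inner) -
        dist (D.inner ((R j).head h)) (D.inner ((R j).getLast h)) else 0
      have e3 : ∀ j ∈ J, ∀ i : Fin m, D.extra i (R j) = w j + c (key j) i := by
        intro j hj i
        have hj' := (hJ j).1 hj
        rw [extra_of_ne_nil D i hj', hkey j hj', hc]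
        simp only [w, dif_pos hj']
      rw [e1, e2, Finset.sum_congr rfl fun j hj => e3 j hj (σ j),
        Finset.sum_congr rfl fun j hj => e3 j hj j, Finset.sum_add_distrib,
        Finset.sum_add_distrib]
      refine add_le_add_right ?_ _
      calc ∑ j ∈ J, c (key j) (σ j) = ∑ j ∈ J, c (key j) (g' (key j)) :=
            Finset.sum_congr rfl fun j hj => by rw [hσ j hj]
        _ ≤ ∑ j ∈ J, c (key j) (g (key j)) := k3
        _ = ∑ j ∈ J, c (key j) j := Finset.sum_congr rfl fun j hj => by rw [hg j hj]
    · rintro i hi rfl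
      have hi' := (hJ i).2 hi
      rw [hσ i hi'] at hj
      exact (k2 _ (Finset.mem_image_of_mem _ hi')).2 hj
  · intro x hx
    obtain ⟨j, hj, rfl⟩ := Finset.mem_image.1 hx
    have hj' := (hJ j).1 hj
    rw [hkey j hj']
    have h1 := ((R j).head hj').2
    have h2 := ((R j).getLast hj').2
    nlinarith
  · intro x hx
    obtain ⟨j, hj, rfl⟩ := Finset.mem_image.1 hx
    rw [hg j hj]; exact j.2
  · intro x hx y hy h
    obtain ⟨i, hi, rfl⟩ := Finset.mem_image.1 hx
    obtain ⟨j, hj, rfl⟩ := Finset.mem_image.1 hy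
    rw [hg i hi, hg j hj] at h
    rw [Fin.ext h]

end Points

theorem costOf_eq_pairCost {n m : ℕ} {D : Points n m} {s : Store} (hs : D.StoredIn s)
    (a b : Fin n) (j : Fin m) : costOf s (a * n + b) j = D.pairCost a b j := by
  obtain ⟨h0, -, hi, hp⟩ := hs
  have hn : 0 < n := a.pos
  have e1 : (a * n + b : ℕ) / n = a := by
    rw [Nat.add_comm, Nat.add_mul_div_right _ _ hn, Nat.div_eq_of_lt b.2, Nat.zero_add]
  have e2 : (a * n + b : ℕ) - a * n = b := by omega
  simp only [costOf, h0, e1, e2, (hi a).1, (hi a).2, (hi b).1, (hi b).2, (hp j).1, (hp j).2.1,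
    (hp j).2.2.1, (hp j).2.2.2, dist2_eq_dist, Points.pairCost]

/-- The columns that the matching leaves free are the terminal pairs on which some optimal solution
is redundant. -/
theorem matchingProg_correct {B n m : ℕ} {s : Store} {D : Points n m} (hs : D.StoredIn s)
    (hnm : n ^ 2 ≤ m) (hB : 4 * max m 1 ≤ B) (hz : ∀ j, m ≤ j → s.int 2 j = 0) :
    Tri B matchingProg s (300 * (m * (max n 1) ^ 2 + (max n 1) ^ 6)) fun s' =>
      ∃ T₀ : Finset (Fin m), (∀ j : Fin m, s'.int 2 j = if j ∈ T₀ then 1 else 0) ∧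
        T₀.card = m - n ^ 2 ∧
        ∃ R : Fin m → List (Fin n), D.IsOptimal R ∧ ∀ j ∈ T₀, R j = [] := by
  classical
  rw [sq] at hnm
  refine (matchingProg_spec hs.1 hs.2.1 hnm hB hz).conseq le_rfl ?_
  rintro s' _ ⟨hmk, hM, hP⟩
  have hsol : ∃ R : Fin m → List (Fin n), IsSolution R := by
    refine exists_isSolution ?_
    rcases Nat.eq_zero_or_pos n with h | h
    · exact Or.inl h
    · exact Or.inr (lt_of_lt_of_le (Nat.mul_pos h h) hnm)
  obtain ⟨R, hR, hR0⟩ := D.exists_isOptimal_redundant (costOf_eq_pairCost hs) hM hP hsol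
  refine ⟨Finset.univ.filter fun j : Fin m => s'.free j, fun j => ?_, ?_, R, hR, fun j hj => ?_⟩
  · have := hmk j
    by_cases h : s'.free j
    · rw [if_pos (by simpa using h)]; unfold Store.free at h; omega
    · rw [if_neg (by simpa using h)]; unfold Store.free at h; omega
  · have h1 : (Finset.univ.filter fun j : Fin m => ¬ s'.free j).card = n * n := by
      rw [← Finset.card_range (n * n)]
      symm
      refine Finset.card_bij (fun x hx => ⟨s'.int 19 x, hM.lt x (Finset.mem_range.1 hx)⟩) ?_ ?_ ?_
      · intro x hx
        simp only [Finset.mem_filter, Finset.mem_univ, true_and]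
        intro h
        exact ((hM.free _).1 h).2 x (Finset.mem_range.1 hx) rfl
      · intro x hx y hy h
        exact hM.inj x (Finset.mem_range.1 hx) y (Finset.mem_range.1 hy) (congrArg Fin.val h)
      · intro j hj
        simp only [Finset.mem_filter, Finset.mem_univ, true_and] at hj
        rw [hM.free] at hj
        push Not at hj
        obtain ⟨x, hx, h⟩ := hj j.2
        exact ⟨x, Finset.mem_range.2 hx, Fin.ext h⟩
    have h2 := Finset.card_filter_add_card_filter_not (s := (Finset.univ : Finset (Fin m)))
      (fun j : Fin m => s'.free j)
    rw [Finset.card_univ, Fintype.card_fin] at h2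
    rw [sq]; omega
  · exact hR0 j (by simpa using hj)

theorem Points.input_storedIn {n m : ℕ} (D : Points n m) : D.StoredIn D.input := by
  refine ⟨by simp [Points.input], by simp [Points.input], fun v => ?_, fun j => ?_⟩
  · simp [Points.input, tab]
  · simp [Points.input, tab]

/-- Redundant terminal pairs can be found in time `O(m * n ^ 2 + n ^ 6)` and space `O(m)`. -/
theorem exists_redundancy_prog :
    ∃ (P : Prog) (C : ℕ), ∀ (n m : ℕ) (I : GETSP n m), n ^ 2 ≤ m →
      ∃ (t : ℕ) (s : Store) (T₀ : Finset (Fin m)),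
        Exec ⟨C * max m 1, (n + m + 2) ^ C⟩ P I.input t s ∧
        t ≤ C * (m * (max n 1) ^ 2 + (max n 1) ^ 6) ∧
        (∀ j : Fin m, s.int 2 j = if j ∈ T₀ then 1 else 0) ∧
        T₀.card = m - n ^ 2 ∧
        ∃ R : Fin m → List (Fin n), I.IsOptimal R ∧ ∀ j ∈ T₀, R j = [] := by
  refine ⟨matchingProg, 300, fun n m I hnm => ?_⟩
  obtain ⟨t, s, hr, ht, T₀, h1, h2, h3⟩ := matchingProg_correct (B := 10 * max m 1)
    I.toPoints.input_storedIn hnm (by omega) (fun j _ => by simp [Points.input])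
  refine ⟨t, s, T₀, hr.exec (K := 10) (S := 60) ?_ (by omega) (by omega) ?_ ?_ matchingProg_ok,
    ht, h1, h2, h3⟩
  · intro a i
    have : n ≤ n ^ 2 := Nat.le_self_pow (by norm_num) n
    simp only [Points.input]
    split_ifs <;> omega
  · show 10 * (10 * max m 1) < 300 * max m 1
    omega
  · show (10 * max m 1) ^ 60 ≤ (n + m + 2) ^ 300
    calc (10 * max m 1) ^ 60 ≤ ((n + m + 2) ^ 5) ^ 60 := by
          refine Nat.pow_le_pow_left ?_ 60
          calc 10 * max m 1 ≤ 2 ^ 4 * (n + m + 2) := by omega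
            _ ≤ (n + m + 2) ^ 4 * (n + m + 2) :=
              Nat.mul_le_mul_right _ (Nat.pow_le_pow_left (by omega) 4)
            _ = (n + m + 2) ^ 5 := by ring
      _ = (n + m + 2) ^ 300 := by rw [← pow_mul]

/-! ### Optimal closed polygons do not cross themselves -/

/-- Length of the closed polygon through a list of points. -/
noncomputable def closedLength : List Plane → ℝ
  | [] => 0
  | a :: l => polyLength (a :: (l ++ [a]))

theorem closedLength_append {A B : List Plane} (hA : A ≠ []) (hB : B ≠ []) :
    closedLength (A ++ B) = polyLength A + dist (A.getLast hA) (B.head hB) + polyLength B +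
      dist (B.getLast hB) (A.head hA) := by
  cases A with
  | nil => exact absurd rfl hA
  | cons a A =>
    have : closedLength (a :: A ++ B) = polyLength ((a :: A ++ B) ++ [a]) := by
      simp [closedLength]
    rw [this, polyLength_concat (by simp), polyLength_append hA hB,
      List.getLast_append_of_ne_nil _ hB]
    rfl

theorem closedLength_rotate (A B : List Plane) :
    closedLength (A ++ B) = closedLength (B ++ A) := by
  by_cases hA : A = []
  · simp [hA]
  by_cases hB : B = []
  · simp [hB]
  rw [closedLength_append hA hB, closedLength_append hB hA]; ring

theorem closedLength_reverse (l : List Plane) : closedLength l.reverse = closedLength l := by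
  cases l with
  | nil => rfl
  | cons a l =>
    rw [List.reverse_cons, closedLength_rotate]
    show polyLength (a :: (l.reverse ++ [a])) = polyLength (a :: (l ++ [a]))
    rw [← polyLength_reverse (a :: (l ++ [a]))]
    simp

/-- The closed polygon through `l` is a shortest one through these (distinct) points. -/
def IsShortest (l : List Plane) : Prop :=
  l.Nodup ∧ ∀ l', l'.Perm l → closedLength l ≤ closedLength l'

theorem IsShortest.of_perm {l l' : List Plane} (h : IsShortest l) (hp : l'.Perm l)
    (hl : closedLength l' ≤ closedLength l) : IsShortest l' :=
  ⟨hp.nodup_iff.2 h.1, fun l'' h'' => hl.trans (h.2 l'' (h''.trans hp))⟩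

theorem IsShortest.rotate {A B : List Plane} (h : IsShortest (A ++ B)) : IsShortest (B ++ A) :=
  h.of_perm List.perm_append_comm (closedLength_rotate _ _).le

theorem IsShortest.reverse {l : List Plane} (h : IsShortest l) : IsShortest l.reverse :=
  h.of_perm (List.reverse_perm l) (closedLength_reverse l).le

theorem dist_line (o e : Plane) (s t : ℝ) : dist (o + s • e) (o + t • e) = |s - t| * ‖e‖ := by
  rw [dist_add_left, dist_eq_norm, ← sub_smul, norm_smul, Real.norm_eq_abs]

theorem wbtw_ray {p x q : Plane} (h : Wbtw ℝ p x q) (hx : x ≠ p) :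
    ∃ κ : ℝ, 0 ≤ κ ∧ q = x + κ • (x - p) := by
  obtain ⟨τ, ⟨h0, h1⟩, rfl⟩ := h
  rw [AffineMap.lineMap_apply_module] at *
  have hτ : τ ≠ 0 := by rintro rfl; simp at hx
  refine ⟨(1 - τ) / τ, by have : 0 ≤ 1 - τ := by linarith
                          positivity, ?_⟩
  have : ((1 - τ) • p + τ • q) - p = τ • (q - p) := by module
  rw [this, smul_smul, div_mul_cancel₀ _ hτ]
  module

theorem wbtw_of_dist {p x q : Plane} (h : dist p x + dist x q ≤ dist p q) : Wbtw ℝ p x q :=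
  dist_add_dist_eq_iff.1 (le_antisymm h (dist_triangle _ _ _))

/-- If, in a shortest closed polygon through `A` and `B`, the edges from `B` to `A` and back overlap
in the direction `e`, then all points of `A` are on the line of the overlap. Indeed the end of `A`
that is nearer to the overlap lies on the edge at the other end; the visit to it can be moved to
that edge, so its neighbour in `A` is on the line as well. -/
theorem IsShortest.collinear_of_overlap (N : ℕ) : ∀ (A B : List Plane) (o e : Plane) (s t s' t' : ℝ)
    (hA : A ≠ []) (hB : B ≠ []), A.length ≤ N → IsShortest (A ++ B) → e ≠ 0 → 0 < s → 0 < t →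
    0 ≤ s' → 0 ≤ t' → A.head hA = o + s • e → A.getLast hA = o + t • e →
    B.getLast hB = o + (-s') • e → B.head hB = o + (-t') • e →
    ∀ z ∈ A, ∃ r : ℝ, z = o + r • e := by
  induction N with
  | zero =>
    intro A B o e s t s' t' hA _ hl
    exact absurd (List.length_eq_zero_iff.1 (Nat.le_zero.1 hl)) hA
  | succ N ih =>
    have key : ∀ (A B : List Plane) (o e : Plane) (s t s' t' : ℝ)
        (hA : A ≠ []) (hB : B ≠ []), A.length ≤ N + 1 → IsShortest (A ++ B) → e ≠ 0 → 0 < s →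
        s < t → 0 ≤ s' → 0 ≤ t' → A.head hA = o + s • e → A.getLast hA = o + t • e →
        B.getLast hB = o + (-s') • e → B.head hB = o + (-t') • e →
        ∀ z ∈ A, ∃ r : ℝ, z = o + r • e := by
      intro A B o e s t s' t' hA hB hl hS he hs hst hs' ht' hq ha hp hb
      cases A with
      | nil => exact absurd rfl hA
      | cons q A =>
        simp only [List.head_cons] at hq
        by_cases hA' : A = []
        · subst hA'
          intro z hz
          simp only [List.mem_singleton] at hz
          exact ⟨s, hz.trans hq⟩
        rw [List.getLast_cons hA'] at ha
        have hperm : (A ++ q :: B).Perm (q :: A ++ B) := List.perm_middle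
        have h2 := hS.2 _ hperm
        rw [closedLength_append hA hB, closedLength_append hA' (by simp), polyLength_cons hA',
          polyLength_cons hB, List.getLast_cons hA', List.getLast_cons hB] at h2
        simp only [List.head_cons] at h2
        have h3 : dist (A.getLast hA') q + dist q (B.head hB) =
            dist (A.getLast hA') (B.head hB) := by
          rw [ha, hb, hq, dist_line, dist_line, dist_line, abs_of_pos (by linarith),
            abs_of_pos (by linarith), abs_of_pos (by linarith)]
          ring
        have h4 : Wbtw ℝ (B.getLast hB) q (A.head hA') := wbtw_of_dist (by linarith)
        have hqp : q ≠ B.getLast hB := by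
          intro h
          have := hS.1
          rw [List.nodup_append] at this
          exact this.2.2 q (by simp) _ (List.getLast_mem hB) h
        obtain ⟨κ, hκ, hr⟩ := wbtw_ray h4 hqp
        have hκ' : κ ≠ 0 := by
          rintro rfl
          rw [zero_smul, add_zero] at hr
          have := hS.1
          rw [List.cons_append, List.nodup_cons] at this
          exact this.1 (List.mem_append_left _ (hr ▸ List.head_mem hA'))
        have hr' : A.head hA' = q + (κ * (s + s')) • e := by
          rw [hr, hp, hq]; module
        have hrot : IsShortest (A ++ (B ++ [q])) := by
          have : IsShortest ([q] ++ (A ++ B)) := hS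
          simpa using this.rotate
        have hpos : 0 < κ * (s + s') := mul_pos (lt_of_le_of_ne hκ (Ne.symm hκ')) (by linarith)
        have := ih A (B ++ [q]) q e (κ * (s + s')) (t - s) 0 (s + t') hA' (by simp)
          (by simpa using hl) hrot he hpos (by linarith) le_rfl (by linarith) hr'
          (by rw [ha, hq]; module) (by simp) (by rw [List.head_append_of_ne_nil hB, hb, hq]; module)
        intro z hz
        rcases List.mem_cons.1 hz with rfl | hz
        · exact ⟨s, hq⟩
        · obtain ⟨r, rfl⟩ := this z hz
          exact ⟨s + r, by rw [hq]; module⟩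
    intro A B o e s t s' t' hA hB hl hS he hs ht hs' ht' hq ha hp hb
    rcases lt_trichotomy s t with h | h | h
    · exact key A B o e s t s' t' hA hB hl hS he hs h hs' ht' hq ha hp hb
    · cases A with
      | nil => exact absurd rfl hA
      | cons q A =>
        by_cases hA' : A = []
        · subst hA'
          intro z hz
          simp only [List.mem_singleton] at hz
          exact ⟨s, hz.trans (by simpa using hq)⟩
        · have := hS.1
          rw [List.cons_append, List.nodup_cons] at this
          refine absurd (List.mem_append_left _ ?_) this.1
          simp only [List.head_cons] at hq
          rw [List.getLast_cons hA'] at ha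
          rw [hq, h, ← ha]; exact List.getLast_mem hA'
    · have hrev : IsShortest (A.reverse ++ B.reverse) := by
        have := hS.reverse
        rw [List.reverse_append] at this
        exact this.rotate
      have := key A.reverse B.reverse o e t s t' s' (by simpa using hA) (by simpa using hB)
        (by simpa using hl) hrev he ht h ht' hs' (by rw [List.head_reverse, ha])
        (by rw [List.getLast_reverse, hq]) (by rw [List.getLast_reverse, hb])
        (by rw [List.head_reverse, hp])
      intro z hz
      exact this z (by simpa using hz)

/-- Twice the signed area of the triangle `a b c`. -/
def area (a b c : Plane) : ℝ := (b 0 - a 0) * (c 1 - a 1) - (b 1 - a 1) * (c 0 - a 0)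

/-- The points of the list are not all on one line. -/
def NotCollinear (l : List Plane) : Prop := ∃ a ∈ l, ∃ b ∈ l, ∃ c ∈ l, area a b c ≠ 0

theorem IsShortest.not_overlap {A B : List Plane} {o e : Plane} {s t s' t' : ℝ}
    (hA : A ≠ []) (hB : B ≠ []) (hS : IsShortest (A ++ B)) (hN : NotCollinear (A ++ B)) (he : e ≠ 0)
    (hs : 0 < s) (ht : 0 < t) (hs' : 0 ≤ s') (ht' : 0 ≤ t') (hq : A.head hA = o + s • e)
    (ha : A.getLast hA = o + t • e) (hp : B.getLast hB = o + (-s') • e)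
    (hb : B.head hB = o + (-t') • e) : False := by
  set μ := min s t / 2 with hμ
  have h1 : 0 < min s t := lt_min hs ht
  have h2 := min_le_left s t
  have h3 := min_le_right s t
  have hAl := hS.collinear_of_overlap A.length A B (o + μ • e) e (s - μ) (t - μ) (s' + μ) (t' + μ)
    hA hB le_rfl he (by linarith) (by linarith) (by linarith) (by linarith) (by rw [hq]; module)
    (by rw [ha]; module) (by rw [hp]; module) (by rw [hb]; module)
  have hBl := hS.rotate.collinear_of_overlap B.length B A (o + μ • e) (-e) (t' + μ) (s' + μ)
    (t - μ) (s - μ) hB hA le_rfl (neg_ne_zero.2 he) (by linarith) (by linarith) (by linarith)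
    (by linarith) (by rw [hb]; module) (by rw [hp]; module) (by rw [ha]; module)
    (by rw [hq]; module)
  have hall : ∀ z ∈ A ++ B, ∃ r : ℝ, z = o + r • e := by
    intro z hz
    rcases List.mem_append.1 hz with hz | hz
    · obtain ⟨r, rfl⟩ := hAl z hz; exact ⟨μ + r, by module⟩
    · obtain ⟨r, rfl⟩ := hBl z hz; exact ⟨μ - r, by module⟩
  obtain ⟨a, ha, b, hb, c, hc, h⟩ := hN
  obtain ⟨ra, rfl⟩ := hall a ha
  obtain ⟨rb, rfl⟩ := hall b hb
  obtain ⟨rc, rfl⟩ := hall c hc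
  apply h
  simp only [area, PiLp.add_apply, PiLp.smul_apply, smul_eq_mul]
  ring

theorem NotCollinear.perm {l l' : List Plane} (h : NotCollinear l) (hp : l.Perm l') :
    NotCollinear l' := by
  obtain ⟨a, ha, b, hb, c, hc, h⟩ := h
  exact ⟨a, hp.subset ha, b, hp.subset hb, c, hp.subset hc, h⟩

theorem IsShortest.not_touch {A B : List Plane} (hA : A ≠ []) (hB : B ≠ [])
    (hS : IsShortest (A ++ B)) (hN : NotCollinear (A ++ B)) {x : Plane}
    (hq : Wbtw ℝ (B.getLast hB) x (A.head hA)) (hb : Wbtw ℝ (A.getLast hA) x (B.head hB))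
    (ha : Wbtw ℝ (B.getLast hB) x (A.getLast hA)) (hqb : Wbtw ℝ (A.head hA) x (B.head hB))
    (hxq : x ≠ A.head hA) (hxa : x ≠ A.getLast hA)
    (hx : x ≠ B.getLast hB ∨ x ≠ B.head hB) : False := by
  rcases hx with hx | hx
  · obtain ⟨s, hs, hs'⟩ := wbtw_ray hq hx
    obtain ⟨t, ht, ht'⟩ := wbtw_ray ha hx
    obtain ⟨r, hr, hr'⟩ := wbtw_ray hb hxa
    have hs0 : s ≠ 0 := by rintro rfl; apply hxq; rw [hs']; module
    have ht0 : t ≠ 0 := by rintro rfl; apply hxa; rw [ht']; module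
    refine hS.not_overlap hA hB hN (o := x) (e := x - B.getLast hB) (s := s) (t := t) (s' := 1)
      (t' := r * t) (sub_ne_zero.2 hx) (by positivity) (by positivity) zero_le_one (by positivity)
      hs' ht' (by module) ?_
    rw [hr', ht']
    module
  · obtain ⟨s, hs, hs'⟩ := wbtw_ray hqb.symm hx
    obtain ⟨t, ht, ht'⟩ := wbtw_ray hb.symm hx
    obtain ⟨r, hr, hr'⟩ := wbtw_ray hq.symm hxq
    have hs0 : s ≠ 0 := by rintro rfl; apply hxq; rw [hs']; module
    have ht0 : t ≠ 0 := by rintro rfl; apply hxa; rw [ht']; module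
    refine hS.not_overlap hA hB hN (o := x) (e := x - B.head hB) (s := s) (t := t) (s' := r * s)
      (t' := 1) (sub_ne_zero.2 hx) (by positivity) (by positivity) (by positivity) zero_le_one
      hs' ht' ?_ (by module)
    rw [hr', hs']
    module

/-- In a shortest closed polygon that is not on one line, two edges have at most a common end
in common: otherwise the tour could be shortened by reversing one of the two parts between the
edges, or the edges overlap. -/
theorem IsShortest.noncrossing {A B : List Plane} (hA : A ≠ []) (hB : B ≠ [])
    (hS : IsShortest (A ++ B)) (hN : NotCollinear (A ++ B)) {x : Plane}
    (hq : x ∈ segment ℝ (B.getLast hB) (A.head hA)) (hb : x ∈ segment ℝ (A.getLast hA) (B.head hB)) :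
    (A.length = 1 ∧ x = A.head hA) ∨ (B.length = 1 ∧ x = B.getLast hB) := by
  rw [mem_segment_iff_wbtw] at hq hb
  have hone : ∀ (L : List Plane) (hL : L ≠ []), L.Nodup → L.head hL = L.getLast hL →
      L.length = 1 := by
    intro L hL hn h
    cases L with
    | nil => exact absurd rfl hL
    | cons a L =>
      by_cases hL' : L = []
      · simp [hL']
      · rw [List.getLast_cons hL', List.head_cons] at h
        rw [List.nodup_cons] at hn
        exact absurd (h ▸ List.getLast_mem hL') hn.1
  have hn := hS.1
  rw [List.nodup_append] at hn
  obtain ⟨hnA, hnB, hdis⟩ := hn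
  have htwo : Wbtw ℝ (B.getLast hB) x (A.getLast hA) ∧ Wbtw ℝ (A.head hA) x (B.head hB) := by
    have hp : (A.reverse ++ B).Perm (A ++ B) := (List.reverse_perm A).append_right B
    have h2 := hS.2 _ hp
    rw [closedLength_append hA hB, closedLength_append (by simpa using hA) hB,
      polyLength_reverse, List.getLast_reverse, List.head_reverse] at h2
    have e1 := hq.dist_add_dist
    have e2 := hb.dist_add_dist
    have e3 := dist_triangle (B.getLast hB) x (A.getLast hA)
    have e4 := dist_triangle (A.head hA) x (B.head hB)
    rw [dist_comm (A.getLast hA) x] at e2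
    rw [dist_comm x (A.head hA)] at e1
    exact ⟨wbtw_of_dist (by linarith), wbtw_of_dist (by linarith)⟩
  by_contra hcon
  push Not at hcon
  by_cases h1 : x ≠ A.head hA ∧ x ≠ A.getLast hA
  · refine hS.not_touch hA hB hN hq hb htwo.1 htwo.2 h1.1 h1.2 ?_
    by_contra h
    push Not at h
    exact hcon.2 (hone B hB hnB (h.2.symm.trans h.1)) h.1
  · have hxA : x ∈ A := by
      by_contra h
      exact h1 ⟨fun e => h (e ▸ List.head_mem hA), fun e => h (e ▸ List.getLast_mem hA)⟩
    refine hS.rotate.not_touch hB hA (hN.perm List.perm_append_comm) hb hq htwo.1.symm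
      htwo.2.symm (fun e => hdis x hxA _ (List.head_mem hB) e)
      (fun e => hdis x hxA _ (List.getLast_mem hB) e) ?_
    by_contra h
    push Not at h
    exact hcon.1 (hone A hA hnA (h.2.symm.trans h.1)) h.2

/-! ### Crossing paths in a convex region -/

/-- The vector from `b` to `p` as a complex number. -/
def vec (b p : Plane) : ℂ := ⟨p 0 - b 0, p 1 - b 1⟩

/-- The vector from `b` to `p` as a complex number, in the coordinates in which `n` is a positive
real number. -/
def rel (n : ℂ) (b p : Plane) : ℂ := vec b p * (starRingEnd ℂ) n

theorem rel_re (n : ℂ) (b p : Plane) :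
    (rel n b p).re = (p 0 - b 0) * n.re + (p 1 - b 1) * n.im := by
  simp [rel, vec]

theorem rel_im (n : ℂ) (b p : Plane) :
    (rel n b p).im = (p 1 - b 1) * n.re - (p 0 - b 0) * n.im := by
  simp [rel, vec]; ring

theorem vec_ne_zero {b p : Plane} (h : p ≠ b) : vec b p ≠ 0 := by
  intro h0
  apply h
  have h1 := congrArg Complex.re h0
  have h2 := congrArg Complex.im h0
  simp only [vec, Complex.zero_re, Complex.zero_im] at h1 h2
  ext i
  fin_cases i
  · simpa using sub_eq_zero.1 h1
  · simpa using sub_eq_zero.1 h2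

theorem rel_ne_zero {n : ℂ} (hn : n ≠ 0) {b p : Plane} (h : p ≠ b) : rel n b p ≠ 0 :=
  mul_ne_zero (vec_ne_zero h) (by simpa using hn)

theorem vec_div_vec {n : ℂ} (hn : n ≠ 0) (b p q : Plane) :
    vec b q / vec b p = rel n b q / rel n b p := by
  rw [rel, rel, mul_div_mul_right _ _ (by simpa using hn)]

theorem vec_div_vec_comm (p b c : Plane) : vec p c / vec p b = vec c p / vec b p := by
  have h : ∀ x, vec p x = - vec x p := by
    intro x; apply Complex.ext <;> simp [vec]
  rw [h, h, neg_div_neg_eq]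

theorem arg_div_of_mem {z w : ℂ} (hz : z ≠ 0) (hw : w ≠ 0) (h1 : -Real.pi < w.arg - z.arg)
    (h2 : w.arg - z.arg ≤ Real.pi) : (w / z).arg = w.arg - z.arg := by
  have := Complex.arg_div_coe_angle hw hz
  rw [← Real.Angle.coe_sub] at this
  rw [← Complex.arg_coe_angle_toReal_eq_arg, this, Real.Angle.toReal_coe_eq_self_iff]
  exact ⟨h1, h2⟩

theorem cross_eq_sin (z w : ℂ) :
    z.re * w.im - z.im * w.re = ‖z‖ * ‖w‖ * Real.sin (w.arg - z.arg) := by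
  rw [Real.sin_sub]
  have h1 := Complex.norm_mul_cos_arg z
  have h2 := Complex.norm_mul_sin_arg z
  have h3 := Complex.norm_mul_cos_arg w
  have h4 := Complex.norm_mul_sin_arg w
  rw [← h1, ← h2, ← h3, ← h4]
  ring

theorem arg_lt_of_cross {z w : ℂ} (hz : 0 ≤ z.re) (hw : 0 ≤ w.re)
    (h : 0 < z.re * w.im - z.im * w.re) : z.arg < w.arg := by
  by_contra! hc
  have h1 := abs_le.1 (Complex.abs_arg_le_pi_div_two_iff.2 hz)
  have h2 := abs_le.1 (Complex.abs_arg_le_pi_div_two_iff.2 hw)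
  rw [cross_eq_sin] at h
  have h3 : Real.sin (w.arg - z.arg) ≤ 0 :=
    Real.sin_nonpos_of_nonpos_of_neg_pi_le (by linarith) (by linarith)
  have : ‖z‖ * ‖w‖ * Real.sin (w.arg - z.arg) ≤ 0 :=
    mul_nonpos_of_nonneg_of_nonpos (by positivity) h3
  linarith

/-- If two points of the closed right half plane are in clockwise order, but not in direction, then
they are on opposite halves of the imaginary axis. -/
theorem eq_of_arg_lt_of_cross {z w : ℂ} (hz : 0 ≤ z.re) (hw : 0 ≤ w.re) (hz0 : z ≠ 0) (hw0 : w ≠ 0)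
    (h : 0 ≤ z.re * w.im - z.im * w.re) (hc : w.arg < z.arg) :
    z.arg = Real.pi / 2 ∧ w.arg = -(Real.pi / 2) := by
  have h1 := abs_le.1 (Complex.abs_arg_le_pi_div_two_iff.2 hz)
  have h2 := abs_le.1 (Complex.abs_arg_le_pi_div_two_iff.2 hw)
  rw [cross_eq_sin] at h
  have h3 : 0 ≤ Real.sin (w.arg - z.arg) :=
    nonneg_of_mul_nonneg_right h (mul_pos (norm_pos_iff.2 hz0) (norm_pos_iff.2 hw0))
  have h4 : ¬ -Real.pi < w.arg - z.arg := fun h4 => by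
    have := Real.sin_neg_of_neg_of_neg_pi_lt (by linarith : w.arg - z.arg < 0) h4
    linarith
  constructor <;> linarith

theorem arg_le_of_cross {z w w' : ℂ} (hz : 0 ≤ z.re) (hw : 0 ≤ w.re) (hw' : 0 ≤ w'.re) (hz0 : z ≠ 0)
    (hw0 : w ≠ 0) (h : 0 ≤ z.re * w.im - z.im * w.re)
    (hne : 0 < z.re * w.im - z.im * w.re ∨ 0 < z.re * w'.im - z.im * w'.re) : z.arg ≤ w.arg := by
  by_contra! hc
  have hz1 := (eq_of_arg_lt_of_cross hz hw hz0 hw0 h hc).1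
  rcases hne with hne | hne
  · exact (arg_lt_of_cross hz hw hne).not_gt hc
  · have := arg_lt_of_cross hz hw' hne
    have h2 := abs_le.1 (Complex.abs_arg_le_pi_div_two_iff.2 hw')
    linarith

theorem arg_le_of_cross' {z w w' : ℂ} (hz : 0 ≤ z.re) (hw : 0 ≤ w.re) (hw' : 0 ≤ w'.re) (hz0 : z ≠ 0)
    (hw0 : w ≠ 0) (h : 0 ≤ z.re * w.im - z.im * w.re)
    (hne : 0 < z.re * w.im - z.im * w.re ∨ 0 < w'.re * w.im - w'.im * w.re) : z.arg ≤ w.arg := by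
  by_contra! hc
  have hw1 := (eq_of_arg_lt_of_cross hz hw hz0 hw0 h hc).2
  rcases hne with hne | hne
  · exact (arg_lt_of_cross hz hw hne).not_gt hc
  · have := arg_lt_of_cross hw' hw hne
    have h2 := abs_le.1 (Complex.abs_arg_le_pi_div_two_iff.2 hw')
    linarith

theorem mem_trace_cons_cons {x p q : Plane} {l : List Plane} :
    x ∈ trace (p :: q :: l) ↔ x ∈ segment ℝ p q ∨ x ∈ trace (q :: l) := by
  constructor
  · rintro ⟨i, hi, hx⟩
    cases i with
    | zero => exact Or.inl hx
    | succ i => exact Or.inr ⟨i, by simpa using hi, hx⟩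
  · rintro (h | ⟨i, hi, hx⟩)
    · exact ⟨0, by simp, h⟩
    · exact ⟨i + 1, by simpa using hi, hx⟩

theorem exists_of_mem_trace {x : Plane} {l : List Plane} (h : x ∈ trace l) :
    ∃ l₁ u v l₂, l = l₁ ++ u :: v :: l₂ ∧ x ∈ segment ℝ u v := by
  obtain ⟨i, hi, hx⟩ := h
  refine ⟨l.take i, l[i], l[i + 1], l.drop (i + 2), ?_, hx⟩
  rw [List.getElem_cons_drop, List.getElem_cons_drop, List.take_append_drop]

theorem mem_trace_of_mem {x : Plane} : ∀ {l : List Plane}, 2 ≤ l.length → x ∈ l → x ∈ trace l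
  | [p, q], _, hx => by
    rw [mem_trace_cons_cons]
    left
    simp only [List.mem_cons, List.not_mem_nil, or_false] at hx
    rcases hx with rfl | rfl
    · exact left_mem_segment ..
    · exact right_mem_segment ..
  | p :: q :: r :: l, _, hx => by
    rw [mem_trace_cons_cons]
    rcases List.mem_cons.1 hx with rfl | hx
    · exact Or.inl (left_mem_segment ..)
    · exact Or.inr (mem_trace_of_mem (by simp) hx)

/-- The angle by which the direction from `b` turns along the path. -/
noncomputable def wind (b : Plane) : List Plane → ℝ
  | p :: q :: l => (vec b q / vec b p).arg + wind b (q :: l)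
  | _ => 0

theorem wind_cons_cons (b p q : Plane) (l : List Plane) :
    wind b (p :: q :: l) = (vec b q / vec b p).arg + wind b (q :: l) := rfl

/-- Around the parallelogram of the differences between the points of two disjoint segments, the
argument returns to its value. -/
theorem turn_parallelogram {p q s t : Plane} (h : Disjoint (segment ℝ p q) (segment ℝ s t)) :
    (vec s q / vec s p).arg + (vec q t / vec q s).arg =
      (vec t q / vec t p).arg + (vec p t / vec p s).arg := by
  obtain ⟨f, u, v, h1, huv, h2⟩ := geometric_hahn_banach_compact_closed (convex_segment (𝕜 := ℝ) s t)
    (by rw [segment_eq_image]; exact isCompact_Icc.image (by fun_prop))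
    (convex_segment p q)
    ((by rw [segment_eq_image]; exact isCompact_Icc.image (by fun_prop) :
      IsCompact (segment ℝ p q)).isClosed) h.symm
  set n : ℂ := ⟨f (EuclideanSpace.single 0 1), f (EuclideanSpace.single 1 1)⟩ with hn
  have hf : ∀ b x : Plane, (rel n b x).re = f x - f b := by
    intro b x
    have h0 : ∀ x : Plane, f x = x 0 * f (EuclideanSpace.single 0 1) +
        x 1 * f (EuclideanSpace.single 1 1) := by
      intro x
      have : x = x 0 • EuclideanSpace.single 0 (1 : ℝ) + x 1 • EuclideanSpace.single 1 (1 : ℝ) := by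
        ext i; fin_cases i <;> simp
      conv_lhs => rw [this]
      simp
    rw [rel_re, h0 x, h0 b, hn]
    ring
  have hs := left_mem_segment ℝ s t
  have ht := right_mem_segment ℝ s t
  have hp := left_mem_segment ℝ p q
  have hq := right_mem_segment ℝ p q
  have key : ∀ b x y, b ∈ segment ℝ s t → x ∈ segment ℝ p q → y ∈ segment ℝ p q →
      (vec b y / vec b x).arg = (rel n b y).arg - (rel n b x).arg := by
    intro b x y hb hx hy
    have hx0 : 0 < (rel n b x).re := by rw [hf]; linarith [h1 b hb, h2 x hx]
    have hy0 : 0 < (rel n b y).re := by rw [hf]; linarith [h1 b hb, h2 y hy]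
    have hx1 : rel n b x ≠ 0 := fun h => by simp [h] at hx0
    have hy1 : rel n b y ≠ 0 := fun h => by simp [h] at hy0
    have hn0 : n ≠ 0 := by rintro h; simp [rel, h] at hx1
    have a1 := abs_lt.1 (Complex.abs_arg_lt_pi_div_two_iff.2 (Or.inl hx0))
    have a2 := abs_lt.1 (Complex.abs_arg_lt_pi_div_two_iff.2 (Or.inl hy0))
    rw [vec_div_vec hn0]
    exact arg_div_of_mem hx1 hy1 (by linarith) (by linarith)
  have key' : ∀ x, x ∈ segment ℝ p q →
      (vec x t / vec x s).arg = (rel n t x).arg - (rel n s x).arg := by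
    intro x hx
    have hx0 : 0 < (rel n s x).re := by rw [hf]; linarith [h1 s hs, h2 x hx]
    have hy0 : 0 < (rel n t x).re := by rw [hf]; linarith [h1 t ht, h2 x hx]
    have hx1 : rel n s x ≠ 0 := fun h => by simp [h] at hx0
    have hy1 : rel n t x ≠ 0 := fun h => by simp [h] at hy0
    have hn0 : n ≠ 0 := by rintro h; simp [rel, h] at hx1
    have a1 := abs_lt.1 (Complex.abs_arg_lt_pi_div_two_iff.2 (Or.inl hx0))
    have a2 := abs_lt.1 (Complex.abs_arg_lt_pi_div_two_iff.2 (Or.inl hy0))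
    rw [vec_div_vec_comm, ← mul_div_mul_right (c := (starRingEnd ℂ) n) _ _ (by simpa using hn0)]
    exact arg_div_of_mem hx1 hy1 (by rw [← rel, ← rel]; linarith) (by rw [← rel, ← rel]; linarith)
  rw [key s p q hs hp hq, key t p q ht hp hq, key' q hq, key' p hp]
  ring

/-- The argument of the difference of two points on disjoint paths is a function on the product of
the paths, so that its changes around the boundary of the product add up to zero. -/
theorem wind_boundary {p : Plane} (P : List Plane) {s : Plane} (S : List Plane)
    (h : Disjoint (trace (p :: P)) (trace (s :: S))) :
    wind s (p :: P) + wind ((p :: P).getLast (by simp)) (s :: S) =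
      wind ((s :: S).getLast (by simp)) (p :: P) + wind p (s :: S) := by
  induction P generalizing p with
  | nil => simp [wind]
  | cons q P ih =>
    have hq : Disjoint (trace (q :: P)) (trace (s :: S)) :=
      h.mono_left fun x hx => mem_trace_cons_cons.2 (Or.inr hx)
    have ih' := ih hq
    have hone : (vec s q / vec s p).arg + wind q (s :: S) =
        (vec ((s :: S).getLast (by simp)) q / vec ((s :: S).getLast (by simp)) p).arg +
          wind p (s :: S) := by
      have hpq : Disjoint (segment ℝ p q) (trace (s :: S)) :=
        h.mono_left fun x hx => mem_trace_cons_cons.2 (Or.inl hx)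
      clear ih ih' hq h
      induction S generalizing s with
      | nil => simp [wind]
      | cons t S ihS =>
        have h1 := turn_parallelogram (hpq.mono_right
          (fun x hx => mem_trace_cons_cons.2 (Or.inl hx) : segment ℝ s t ≤ _))
        have h2 := ihS (hpq.mono_right (fun x hx => mem_trace_cons_cons.2 (Or.inr hx)))
        rw [wind_cons_cons, wind_cons_cons]
        rw [List.getLast_cons (by simp)]
        linarith
    rw [wind_cons_cons, wind_cons_cons, List.getLast_cons (by simp)]
    linarith

/-- If all points of a path that avoids `b` are on one side of a line through `b`, then the turn of
the direction from `b` can be read off from the ends of the path. -/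
theorem wind_eq {n : ℂ} (hn : n ≠ 0) {b p : Plane} (P : List Plane)
    (h : ∀ x ∈ p :: P, 0 ≤ (rel n b x).re) (hb : b ∉ trace (p :: P)) :
    wind b (p :: P) = (rel n b ((p :: P).getLast (by simp))).arg - (rel n b p).arg := by
  induction P generalizing p with
  | nil => simp [wind]
  | cons q P ih =>
    rw [mem_trace_cons_cons] at hb
    push Not at hb
    have hp0 : rel n b p ≠ 0 := rel_ne_zero hn fun e => hb.1 (e ▸ left_mem_segment ..)
    have hq0 : rel n b q ≠ 0 := rel_ne_zero hn fun e => hb.1 (e ▸ right_mem_segment ..)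
    have hp := h p (by simp)
    have hq := h q (by simp)
    have a1 := abs_le.1 (Complex.abs_arg_le_pi_div_two_iff.2 hp)
    have a2 := abs_le.1 (Complex.abs_arg_le_pi_div_two_iff.2 hq)
    rw [wind_cons_cons, ih (fun x hx => h x (List.mem_cons_of_mem _ hx)) hb.2,
      List.getLast_cons (List.cons_ne_nil q P), vec_div_vec hn, arg_div_of_mem hp0 hq0 ?_ (by linarith)]
    · ring
    refine lt_of_le_of_ne (by linarith) fun e => hb.1 ?_
    have e1 : (rel n b p).re = 0 ∧ 0 < (rel n b p).im := by
      rw [← Complex.arg_eq_pi_div_two_iff]; linarith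
    have e2 : (rel n b q).re = 0 ∧ (rel n b q).im < 0 := by
      rw [← Complex.arg_eq_neg_pi_div_two_iff]; linarith
    -- `b` divides the segment in the ratio of the imaginary parts
    have hpos : 0 < (rel n b p).im - (rel n b q).im := by linarith
    have hcomb : -(rel n b q).im • rel n b p + (rel n b p).im • rel n b q = 0 := by
      apply Complex.ext <;> simp [e1.1, e2.1]; ring
    have hvec : -(rel n b q).im • vec b p + (rel n b p).im • vec b q = 0 := by
      have : (-(rel n b q).im • vec b p + (rel n b p).im • vec b q) * (starRingEnd ℂ) n = 0 := by
        rw [add_mul, smul_mul_assoc, smul_mul_assoc]; exact hcomb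
      exact (mul_eq_zero.1 this).resolve_right (by simpa using hn)
    refine ⟨-(rel n b q).im / ((rel n b p).im - (rel n b q).im),
      (rel n b p).im / ((rel n b p).im - (rel n b q).im), ?_, ?_, ?_, ?_⟩
    · exact div_nonneg (by linarith) hpos.le
    · exact div_nonneg e1.2.le hpos.le
    · field_simp; ring
    · have h1 := congrArg Complex.re hvec
      have h2 := congrArg Complex.im hvec
      simp only [vec, Complex.add_re, Complex.add_im, Complex.real_smul, Complex.mul_re,
        Complex.mul_im, Complex.ofReal_re, Complex.ofReal_im, Complex.zero_re, Complex.zero_im] at h1 h2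
      ext i
      fin_cases i
      · simp; field_simp; linarith
      · simp; field_simp; linarith

theorem rel_cross (n : ℂ) (c d x : Plane) :
    (rel n c d).re * (rel n c x).im - (rel n c d).im * (rel n c x).re =
      (n.re ^ 2 + n.im ^ 2) * area c d x := by
  rw [rel_re, rel_im, rel_re, rel_im, area]; ring

/-- All points of the list are on the side of a line through `c` to which `n` points. -/
def Supports (n : ℂ) (c : Plane) (l : List Plane) : Prop := n ≠ 0 ∧ ∀ x ∈ l, 0 ≤ (rel n c x).re

/-- Disjoint paths from `a` to `c` and from `b` to `d` are impossible if the ends are in this order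
on the boundary of a convex region that contains both paths. Here `a b` is an edge of the boundary,
and the position of `c` and `d` is given by the orientation of two triangles. The direction from
each end turns clockwise along the other path, so these turns cannot cancel. -/
theorem not_disjoint_trace {n₁ n₂ : ℂ} {l P S : List Plane} {a b c d : Plane}
    (hP : P ⊆ l) (hS : S ⊆ l) (hP2 : 2 ≤ P.length) (hS2 : 2 ≤ S.length) (ha : P.head? = some a)
    (hc : P.getLast? = some c) (hb : S.head? = some b) (hd : S.getLast? = some d)
    (hab : ∀ x ∈ l, 0 ≤ area a b x)
    (hn₁ : Supports n₁ c l) (hn₂ : Supports n₂ d l) (h1 : 0 ≤ area a c d) (h2 : 0 ≤ area b c d)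
    (h12 : 0 < area a c d ∨ 0 < area b c d) : ¬ Disjoint (trace P) (trace S) := by
  intro hdis
  cases P with
  | nil => simp at ha
  | cons p P =>
  cases S with
  | nil => simp at hb
  | cons s S =>
  simp only [List.head?_cons, Option.some.injEq] at ha hb
  subst ha hb
  have hc' : (p :: P).getLast (by simp) = c := by
    rw [List.getLast?_eq_some_getLast (by simp)] at hc; exact Option.some.inj hc
  have hd' : (s :: S).getLast (by simp) = d := by
    rw [List.getLast?_eq_some_getLast (by simp)] at hd; exact Option.some.inj hd
  have haP : p ∈ p :: P := by simp
  have hbS : s ∈ s :: S := by simp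
  have hcP : c ∈ p :: P := hc' ▸ List.getLast_mem _
  have hdS : d ∈ s :: S := hd' ▸ List.getLast_mem _
  have nS : ∀ x ∈ p :: P, x ∉ trace (s :: S) := fun x hx h =>
    Set.disjoint_left.1 hdis (mem_trace_of_mem hP2 hx) h
  have nP : ∀ x ∈ s :: S, x ∉ trace (p :: P) := fun x hx h =>
    Set.disjoint_left.1 hdis h (mem_trace_of_mem hS2 hx)
  have hne : ∀ x ∈ p :: P, ∀ y ∈ s :: S, x ≠ y := fun x hx y hy e =>
    nS x hx (mem_trace_of_mem hS2 (e ▸ hy))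
  have hB := wind_boundary P S hdis
  rw [hc', hd'] at hB
  -- the normal vector of the edge `p s`
  set n : ℂ := ⟨-(s 1 - p 1), s 0 - p 0⟩ with hn
  have hn0 : n ≠ 0 := by
    intro h
    have h1 := congrArg Complex.re h
    have h2 := congrArg Complex.im h
    simp only [hn, Complex.zero_re, Complex.zero_im] at h1 h2
    exact vec_ne_zero (hne p haP s hbS).symm (Complex.ext h2 (by simp only [vec, Complex.zero_im]; linarith))
  have hna : ∀ x ∈ l, 0 ≤ (rel n p x).re := by
    intro x hx
    have := hab x hx
    rw [rel_re, hn]; unfold area at this; simp only; linarith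
  have hnb : ∀ x ∈ l, 0 ≤ (rel n s x).re := by
    intro x hx
    have := hab x hx
    rw [rel_re, hn]; unfold area at this; simp only; linarith
  have hsq : 0 < (s 0 - p 0) ^ 2 + (s 1 - p 1) ^ 2 := by
    have := Complex.normSq_pos.2 hn0
    rw [Complex.normSq_apply, hn] at this
    simp only at this
    nlinarith
  have ea : (rel n p s).arg = -(Real.pi / 2) := by
    rw [Complex.arg_eq_neg_pi_div_two_iff, rel_re, rel_im, hn]
    simp only
    constructor
    · ring
    · nlinarith
  have eb : (rel n s p).arg = Real.pi / 2 := by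
    rw [Complex.arg_eq_pi_div_two_iff, rel_re, rel_im, hn]
    simp only
    constructor
    · ring
    · nlinarith
  rw [wind_eq hn0 P (fun x hx => hnb x (hP hx)) (nP s hbS), hc',
    wind_eq hn0 S (fun x hx => hna x (hS hx)) (nS p haP), hd',
    wind_eq hn₁.1 S (fun x hx => hn₁.2 x (hS hx)) (nS c hcP), hd',
    wind_eq hn₂.1 P (fun x hx => hn₂.2 x (hP hx)) (nP d hdS), hc', ea, eb] at hB
  have a1 := abs_le.1 (Complex.abs_arg_le_pi_div_two_iff.2 (hnb c (hP hcP)))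
  have a2 := abs_le.1 (Complex.abs_arg_le_pi_div_two_iff.2 (hna d (hS hdS)))
  have hsq₁ : 0 < n₁.re ^ 2 + n₁.im ^ 2 := by
    have := Complex.normSq_pos.2 hn₁.1
    rw [Complex.normSq_apply] at this; nlinarith
  have hsq₂ : 0 < n₂.re ^ 2 + n₂.im ^ 2 := by
    have := Complex.normSq_pos.2 hn₂.1
    rw [Complex.normSq_apply] at this; nlinarith
  have r1 : area c d s = area s c d := by unfold area; ring
  have r2 : area c d p = area p c d := by unfold area; ring
  have r3 : area d p c = area p c d := by unfold area; ring
  have r4 : area d s c = area s c d := by unfold area; ring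
  have c1 : (rel n₁ c d).arg ≤ (rel n₁ c s).arg := by
    refine arg_le_of_cross (w' := rel n₁ c p) (hn₁.2 d (hS hdS)) (hn₁.2 s (hS hbS))
      (hn₁.2 p (hP haP)) (rel_ne_zero hn₁.1 (hne c hcP d hdS).symm)
      (rel_ne_zero hn₁.1 (hne c hcP s hbS).symm) ?_ ?_
    · rw [rel_cross, r1]; positivity
    · rw [rel_cross, rel_cross, r1, r2]
      rcases h12 with h | h
      · exact Or.inr (by positivity)
      · exact Or.inl (by positivity)
  have c2 : (rel n₂ d p).arg ≤ (rel n₂ d c).arg := by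
    refine arg_le_of_cross' (w' := rel n₂ d s) (hn₂.2 p (hP haP)) (hn₂.2 c (hP hcP))
      (hn₂.2 s (hS hbS)) (rel_ne_zero hn₂.1 (hne p haP d hdS))
      (rel_ne_zero hn₂.1 (hne c hcP d hdS)) ?_ ?_
    · rw [rel_cross, r3]; positivity
    · rw [rel_cross, rel_cross, r3, r4]
      rcases h12 with h | h
      · exact Or.inl (by positivity)
      · exact Or.inr (by positivity)
  rcases h12 with h | h
  · have := arg_lt_of_cross (hn₂.2 p (hP haP)) (hn₂.2 c (hP hcP))
      (by rw [rel_cross, r3]; positivity)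
    linarith
  · have := arg_lt_of_cross (hn₁.2 d (hS hdS)) (hn₁.2 s (hS hbS))
      (by rw [rel_cross, r1]; positivity)
    linarith

/-! ### Neighbours on the convex hull are neighbours in the tour -/

/-- The scalar product of the vectors from `a` to `b` and to `c`. -/
def dot (a b c : Plane) : ℝ := (b 0 - a 0) * (c 0 - a 0) + (b 1 - a 1) * (c 1 - a 1)

/-- `b` is the counterclockwise successor of `a` on the boundary of the convex hull of `l`: all
points are on the left of the line from `a` to `b`, and the points on this line are not between
`a` and `b`. -/
def HullEdge (l : List Plane) (a b : Plane) : Prop :=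
  b ≠ a ∧ ∀ x ∈ l, 0 ≤ area a b x ∧ (area a b x = 0 → x ≠ a → dot a b x < 0 ∨ dot a b b ≤ dot a b x)

theorem plane_ext {a b : Plane} (h0 : a 0 = b 0) (h1 : a 1 = b 1) : a = b := by
  ext i; fin_cases i
  · exact h0
  · exact h1

theorem sq_add_sq_pos {a b : Plane} (h : b ≠ a) : 0 < (b 0 - a 0) ^ 2 + (b 1 - a 1) ^ 2 := by
  by_contra! hc
  have h0 : (b 0 - a 0) ^ 2 = 0 := by nlinarith [sq_nonneg (b 0 - a 0), sq_nonneg (b 1 - a 1)]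
  have h1 : (b 1 - a 1) ^ 2 = 0 := by nlinarith [sq_nonneg (b 0 - a 0), sq_nonneg (b 1 - a 1)]
  exact h (plane_ext (by simpa [sub_eq_zero] using h0) (by simpa [sub_eq_zero] using h1))

theorem area_eq_of_collinear {a b x y z : Plane} (hab : b ≠ a) (hx : area a b x = 0)
    (hy : area a b y = 0) (hz : area a b z = 0) : area x y z = 0 := by
  have h := sq_add_sq_pos hab
  have : area x y z * ((b 0 - a 0) ^ 2 + (b 1 - a 1) ^ 2) = 0 := by
    unfold area at *
    linear_combination ((b 0 - a 0) * (z 0 - y 0) + (b 1 - a 1) * (z 1 - y 1)) * hx +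
      ((b 0 - a 0) * (x 0 - z 0) + (b 1 - a 1) * (x 1 - z 1)) * hy +
      ((b 0 - a 0) * (y 0 - x 0) + (b 1 - a 1) * (y 1 - x 1)) * hz
  exact (mul_eq_zero.1 this).resolve_right h.ne'

/-- The point `y` of the boundary is not in the triangle `a b z`, nor in the segment `a b`. -/
theorem HullEdge.not_inside {l : List Plane} {a b y z : Plane} {n : ℂ} (h : HullEdge l a b)
    (ha : a ∈ l) (hb : b ∈ l) (hy : y ∈ l) (hz : z ∈ l) (hya : y ≠ a) (hn : Supports n y l)
    (h1 : 0 < area a y z) (h2 : area b y z < 0) : False := by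
  have hfy := (h.2 y hy).1
  have ga := hn.2 a ha
  have gb := hn.2 b hb
  have gz := hn.2 z hz
  have hcomb : -area b y z * (rel n y a).re + area a y z * (rel n y b).re +
      area a b y * (rel n y z).re = 0 := by
    rw [rel_re, rel_re, rel_re]; unfold area; ring
  have p1 := mul_nonneg (neg_pos.2 h2).le ga
  have p2 := mul_nonneg h1.le gb
  have p3 := mul_nonneg hfy gz
  have ea : (rel n y a).re = 0 :=
    (mul_eq_zero.1 (by linarith : -area b y z * (rel n y a).re = 0)).resolve_left (by linarith)
  have eb : (rel n y b).re = 0 :=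
    (mul_eq_zero.1 (by linarith : area a y z * (rel n y b).re = 0)).resolve_left (by linarith)
  rw [rel_re] at ea eb
  -- `y` is a convex combination of `a`, `b`, `z`, so the supporting line at `y` contains `a` and `b`
  rcases hfy.eq_or_lt with hf | hf
  · have e0 : -area b y z * (a 0 - y 0) + area a y z * (b 0 - y 0) = 0 := by
      have : -area b y z * (a 0 - y 0) + area a y z * (b 0 - y 0) + area a b y * (z 0 - y 0) = 0 := by
        unfold area; ring
      rwa [← hf, zero_mul, add_zero] at this
    have e1 : -area b y z * (a 1 - y 1) + area a y z * (b 1 - y 1) = 0 := by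
      have : -area b y z * (a 1 - y 1) + area a y z * (b 1 - y 1) + area a b y * (z 1 - y 1) = 0 := by
        unfold area; ring
      rwa [← hf, zero_mul, add_zero] at this
    have hd : dot a b y * (area a y z - area b y z) = area a y z * dot a b b := by
      unfold dot
      linear_combination (-(b 0 - a 0)) * e0 - (b 1 - a 1) * e1
    have hbb : 0 < dot a b b := by
      have := sq_add_sq_pos h.1; unfold dot; nlinarith
    rcases (h.2 y hy).2 hf.symm hya with hc | hc
    · nlinarith [mul_pos h1 hbb]
    · nlinarith [mul_pos h1 hbb, mul_pos (neg_pos.2 h2) hbb]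
  · apply hn.1
    have q0 : area a b y * n.re = 0 := by
      unfold area; linear_combination (b 1 - y 1) * ea - (a 1 - y 1) * eb
    have q1 : area a b y * n.im = 0 := by
      unfold area; linear_combination (-(b 0 - y 0)) * ea + (a 0 - y 0) * eb
    exact Complex.ext ((mul_eq_zero.1 q0).resolve_left hf.ne')
      ((mul_eq_zero.1 q1).resolve_left hf.ne')

theorem HullEdge.perm {l l' : List Plane} {a b : Plane} (h : HullEdge l a b) (hp : l'.Perm l) :
    HullEdge l' a b := ⟨h.1, fun x hx => h.2 x (hp.subset hx)⟩

theorem Supports.perm {l l' : List Plane} {n : ℂ} {a : Plane} (h : Supports n a l)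
    (hp : l'.Perm l) : Supports n a l' := ⟨h.1, fun x hx => h.2 x (hp.subset hx)⟩

/-- The case of a tour that visits `a`, `y`, `b`, `z` in this order although the boundary has the
order `a`, `b`, `y`, `z`. -/
theorem IsShortest.not_interlaced_of_nonneg {l₁ l₂ l₃ l₄ : List Plane} {a y b z : Plane} {n₁ n₂ : ℂ}
    (hS : IsShortest (a :: (l₁ ++ y :: (l₂ ++ b :: (l₃ ++ z :: l₄)))))
    (hN : NotCollinear (a :: (l₁ ++ y :: (l₂ ++ b :: (l₃ ++ z :: l₄)))))
    (he : HullEdge (a :: (l₁ ++ y :: (l₂ ++ b :: (l₃ ++ z :: l₄)))) a b)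
    (hy : Supports n₁ y (a :: (l₁ ++ y :: (l₂ ++ b :: (l₃ ++ z :: l₄)))))
    (hz : Supports n₂ z (a :: (l₁ ++ y :: (l₂ ++ b :: (l₃ ++ z :: l₄)))))
    (h1 : 0 ≤ area a y z) (h2 : 0 ≤ area b y z) (h12 : 0 < area a y z ∨ 0 < area b y z) :
    False := by
  refine not_disjoint_trace (P := a :: (l₁ ++ [y])) (S := b :: (l₃ ++ [z])) ?_ ?_ (by simp)
    (by simp) (by simp) (by rw [← List.cons_append, List.getLast?_concat]) (by simp)
    (by rw [← List.cons_append, List.getLast?_concat]) (fun x hx => (he.2 x hx).1) hy hz h1 h2 h12 ?_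
  · intro x hx; simp only [List.mem_cons, List.mem_append, List.not_mem_nil] at hx ⊢; tauto
  · intro x hx; simp only [List.mem_cons, List.mem_append, List.not_mem_nil] at hx ⊢; tauto
  rw [Set.disjoint_left]
  intro x hxP hxS
  obtain ⟨P₁, u, v, P₂, hP, hx1⟩ := exists_of_mem_trace hxP
  obtain ⟨S₁, w, t, S₂, hS', hx2⟩ := exists_of_mem_trace hxS
  have hT : a :: (l₁ ++ y :: (l₂ ++ b :: (l₃ ++ z :: l₄))) =
      (P₁ ++ [u]) ++ ((v :: (P₂ ++ l₂ ++ S₁ ++ [w])) ++ (t :: (S₂ ++ l₄))) := by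
    have : a :: (l₁ ++ y :: (l₂ ++ b :: (l₃ ++ z :: l₄))) =
      (a :: (l₁ ++ [y])) ++ (l₂ ++ ((b :: (l₃ ++ [z])) ++ l₄)) := by simp
    rw [this, hP, hS']; simp
  rw [hT] at hS hN
  have hS2 := hS.rotate
  have hN2 := hN.perm (List.perm_append_comm)
  rw [List.append_assoc] at hS2 hN2
  have := hS2.noncrossing (A := v :: (P₂ ++ l₂ ++ S₁ ++ [w])) (B := t :: (S₂ ++ l₄) ++ (P₁ ++ [u]))
    (by simp) (by simp) hN2 (x := x) (by simpa using hx1) (by simpa using hx2)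
  simp at this

/-- If `a` and `b` are not both on the line through `y` and `z`, then `y` is before `z` on the boundary,
or this holds with `y` and `z` exchanged, for the reversed tour. -/
theorem IsShortest.not_interlaced_of_ne {l₁ l₂ l₃ l₄ : List Plane} {a y b z : Plane} {n₁ n₂ : ℂ}
    (hS : IsShortest (a :: (l₁ ++ y :: (l₂ ++ b :: (l₃ ++ z :: l₄)))))
    (hN : NotCollinear (a :: (l₁ ++ y :: (l₂ ++ b :: (l₃ ++ z :: l₄)))))
    (he : HullEdge (a :: (l₁ ++ y :: (l₂ ++ b :: (l₃ ++ z :: l₄)))) a b)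
    (hy : Supports n₁ y (a :: (l₁ ++ y :: (l₂ ++ b :: (l₃ ++ z :: l₄)))))
    (hz : Supports n₂ z (a :: (l₁ ++ y :: (l₂ ++ b :: (l₃ ++ z :: l₄)))))
    (h : area a y z ≠ 0 ∨ area b y z ≠ 0) : False := by
  have s1 : ∀ c, area c z y = - area c y z := by intro c; unfold area; ring
  have hn := hS.1
  simp only [List.nodup_cons, List.mem_append, List.mem_cons] at hn
  have hya : y ≠ a := by rintro rfl; tauto
  have hza : z ≠ a := by rintro rfl; tauto
  -- the points `a` and `b` are not on different sides of the line through `y` and `z`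
  have hopp1 : ¬ (0 < area a y z ∧ area b y z < 0) := fun hc =>
    he.not_inside (by simp) (by simp) (by simp) (by simp) hya hy hc.1 hc.2
  have hopp2 : ¬ (area a y z < 0 ∧ 0 < area b y z) := fun hc =>
    he.not_inside (y := z) (z := y) (by simp) (by simp) (by simp) (by simp) hza hz
      (by rw [s1]; linarith) (by rw [s1]; linarith)
  have hp : (a :: (l₄.reverse ++ z :: (l₃.reverse ++ b :: (l₂.reverse ++ y :: l₁.reverse)))).Perm
      (a :: (l₁ ++ y :: (l₂ ++ b :: (l₃ ++ z :: l₄)))) := by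
    have := (List.reverse_perm (l₁ ++ y :: (l₂ ++ b :: (l₃ ++ z :: l₄)))).cons a
    simpa using this
  have hS' : IsShortest
      (a :: (l₄.reverse ++ z :: (l₃.reverse ++ b :: (l₂.reverse ++ y :: l₁.reverse)))) := by
    have := hS.reverse
    rw [List.reverse_cons] at this
    simpa using this.rotate
  by_cases hc : 0 ≤ area a y z ∧ 0 ≤ area b y z
  · refine hS.not_interlaced_of_nonneg hN he hy hz hc.1 hc.2 ?_
    rcases h with h | h
    · exact Or.inl (lt_of_le_of_ne hc.1 h.symm)
    · exact Or.inr (lt_of_le_of_ne hc.2 h.symm)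
  · have hc' : area a y z ≤ 0 ∧ area b y z ≤ 0 := by
      by_contra hcc
      rw [not_and_or, not_le, not_le] at hc hcc
      rcases hc with hc | hc <;> rcases hcc with hcc | hcc
      · linarith
      · exact hopp2 ⟨hc, hcc⟩
      · exact hopp1 ⟨hcc, hc⟩
      · linarith
    refine hS'.not_interlaced_of_nonneg (hN.perm hp.symm) (he.perm hp) (hz.perm hp) (hy.perm hp)
      (by rw [s1]; linarith) (by rw [s1]; linarith) ?_
    rw [s1, s1]
    rcases h with h | h
    · exact Or.inl (neg_pos.2 (lt_of_le_of_ne hc'.1 h))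
    · exact Or.inr (neg_pos.2 (lt_of_le_of_ne hc'.2 h))

/-- A point of the boundary that is not on the line of the edge `a b`. -/
theorem HullEdge.exists_off_line {l : List Plane} {a b : Plane} (h : HullEdge l a b)
    (hN : NotCollinear l) : ∃ w ∈ l, 0 < area a b w ∧ ∃ n, Supports n w l := by
  obtain ⟨x, hx, y, hy, z, hz, hxyz⟩ := hN
  obtain ⟨w, hw, hmax⟩ := Finset.exists_max_image l.toFinset (fun x => area a b x)
    ⟨x, by simpa using hx⟩
  refine ⟨w, by simpa using hw, ?_, ⟨b 1 - a 1, -(b 0 - a 0)⟩, ?_, ?_⟩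
  · by_contra! hc
    have h0 : ∀ x ∈ l, area a b x = 0 := fun x hx =>
      le_antisymm ((hmax x (by simpa using hx)).trans hc) (h.2 x hx).1
    exact hxyz (area_eq_of_collinear h.1 (h0 x hx) (h0 y hy) (h0 z hz))
  · intro h0
    have h1 := congrArg Complex.re h0
    have h2 := congrArg Complex.im h0
    simp only [Complex.zero_re, Complex.zero_im] at h1 h2
    exact h.1 (plane_ext (by linarith) (by linarith))
  · intro x hx
    have := hmax x (by simpa using hx)
    rw [rel_re]
    unfold area at this
    simp only
    linarith

/-- If `b` is the successor of `a` on the boundary of the convex hull, then a shortest tour does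
not visit points of the boundary both on the way from `a` to `b` and on the way back. -/
theorem IsShortest.not_interlaced {l₁ l₂ : List Plane} {a y b z : Plane} {n₁ n₂ : ℂ}
    (hS : IsShortest (a :: (l₁ ++ b :: l₂))) (hN : NotCollinear (a :: (l₁ ++ b :: l₂)))
    (he : HullEdge (a :: (l₁ ++ b :: l₂)) a b)
    (hy : Supports n₁ y (a :: (l₁ ++ b :: l₂))) (hz : Supports n₂ z (a :: (l₁ ++ b :: l₂)))
    (hyl : y ∈ l₁) (hzl : z ∈ l₂) : False := by
  have key : ∀ y ∈ l₁, ∀ z ∈ l₂, (∃ n, Supports n y (a :: (l₁ ++ b :: l₂))) →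
      (∃ n, Supports n z (a :: (l₁ ++ b :: l₂))) → area a y z = 0 ∧ area b y z = 0 := by
    rintro y hym z hzm ⟨n₁, h1⟩ ⟨n₂, h2⟩
    by_contra hc
    rw [not_and_or] at hc
    obtain ⟨p₁, p₂, rfl⟩ := List.append_of_mem hym
    obtain ⟨p₃, p₄, rfl⟩ := List.append_of_mem hzm
    have e : a :: (p₁ ++ y :: p₂ ++ b :: (p₃ ++ z :: p₄)) =
      a :: (p₁ ++ y :: (p₂ ++ b :: (p₃ ++ z :: p₄))) := by simp
    rw [e] at hS hN he h1 h2
    exact hS.not_interlaced_of_ne hN he h1 h2 hc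
  obtain ⟨h1, h2⟩ := key y hyl z hzl ⟨_, hy⟩ ⟨_, hz⟩
  have hyz : z ≠ y := by
    rintro rfl
    have := hS.1
    simp only [List.nodup_cons, List.nodup_append, List.mem_cons] at this
    exact this.2.2.2 z hyl z (Or.inr hzl) rfl
  have hid : ∀ w v, area a b w + area a w v - area b w v = area a b v := by
    intro w v; unfold area; ring
  have r : ∀ c, area y z c = area c y z := by intro c; unfold area; ring
  have hyab : area a b y = 0 :=
    area_eq_of_collinear hyz (by rw [r, h1]) (by rw [r, h2]) (by unfold area; ring)
  have hzab : area a b z = 0 := by rw [← hid y z, hyab, h1, h2]; ring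
  obtain ⟨w, hw, hpos, n, hn⟩ := he.exists_off_line hN
  have hwa : w ≠ a := by rintro rfl; apply hpos.ne'; unfold area; ring
  have hwb : w ≠ b := by rintro rfl; apply hpos.ne'; unfold area; ring
  simp only [List.mem_cons, List.mem_append, hwa, hwb, false_or] at hw
  rcases hw with hw | hw
  · obtain ⟨g1, g2⟩ := key w hw z hzl ⟨_, hn⟩ ⟨_, hz⟩
    have := hid w z
    linarith
  · obtain ⟨g1, g2⟩ := key y hyl w hw ⟨_, hy⟩ ⟨_, hn⟩
    have := hid y w
    linarith

/-! ### Outer points -/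

section Outer

variable {N : ℕ} {V : Fin N → Plane}

/-- There is a line through the point such that all points are on one side of it. -/
def OnHull (V : Fin N → Plane) (i : Fin N) : Prop :=
  ∃ n : ℂ, n ≠ 0 ∧ ∀ k, 0 ≤ (rel n (V i) (V k)).re

/-- `HullEdge` for an indexed family of points. -/
def HullStep (V : Fin N → Plane) (i j : Fin N) : Prop :=
  j ≠ i ∧ ∀ k, k ≠ i → 0 ≤ area (V i) (V j) (V k) ∧ (area (V i) (V j) (V k) = 0 →
    dot (V i) (V j) (V k) < 0 ∨ dot (V i) (V j) (V j) ≤ dot (V i) (V j) (V k))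

/-- The points are on one line. -/
def OneLine (V : Fin N → Plane) : Prop := ∀ i j k, area (V i) (V j) (V k) = 0

theorem isOpen_area_pos (a b : Plane) : IsOpen {x : Plane | 0 < area a b x} := by
  unfold area
  exact isOpen_lt continuous_const (by fun_prop)

theorem mem_convexHull_of_area {s : Set Plane} {a b c x : Plane} (ha : a ∈ s) (hb : b ∈ s)
    (hc : c ∈ s) (h1 : 0 < area a b x) (h2 : 0 < area b c x) (h3 : 0 < area c a x) :
    x ∈ convexHull ℝ s := by
  have hd : 0 < area a b c := by
    have : area a b c = area a b x + area b c x + area c a x := by unfold area; ring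
    linarith
  have hx : x = (area b c x / area a b c) • a + (area c a x / area a b c) • b +
      (area a b x / area a b c) • c := by
    apply plane_ext
    · simp only [PiLp.add_apply, PiLp.smul_apply, smul_eq_mul]
      field_simp; unfold area; ring
    · simp only [PiLp.add_apply, PiLp.smul_apply, smul_eq_mul]
      field_simp; unfold area; ring
  have hsum : area b c x / area a b c + area c a x / area a b c + area a b x / area a b c = 1 := by
    field_simp; unfold area; ring
  rw [hx]
  have := (convex_convexHull ℝ s).sum_mem (t := Finset.univ)
    (w := ![area b c x / area a b c, area c a x / area a b c, area a b x / area a b c])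
    (z := ![a, b, c]) (by
      intro i _; fin_cases i
      · exact (div_pos h2 hd).le
      · exact (div_pos h3 hd).le
      · exact (div_pos h1 hd).le)
    (by simp [Fin.sum_univ_three, hsum])
    (by
      intro i _; fin_cases i
      · exact subset_convexHull ℝ s ha
      · exact subset_convexHull ℝ s hb
      · exact subset_convexHull ℝ s hc)
  simpa [Fin.sum_univ_three] using this

theorem interior_convexHull_nonempty (hV : ¬ OneLine V) :
    (interior (convexHull ℝ (Set.range V))).Nonempty := by
  have key : ∀ i j k, 0 < area (V i) (V j) (V k) →
      (interior (convexHull ℝ (Set.range V))).Nonempty := by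
    intro i j k h
    refine ⟨(1 / 3 : ℝ) • (V i + V j + V k), ?_⟩
    rw [mem_interior]
    refine ⟨{x | 0 < area (V i) (V j) x} ∩ {x | 0 < area (V j) (V k) x} ∩
      {x | 0 < area (V k) (V i) x}, fun x hx => mem_convexHull_of_area (Set.mem_range_self i)
        (Set.mem_range_self j) (Set.mem_range_self k) hx.1.1 hx.1.2 hx.2,
      ((isOpen_area_pos _ _).inter (isOpen_area_pos _ _)).inter (isOpen_area_pos _ _), ?_⟩
    refine ⟨⟨?_, ?_⟩, ?_⟩ <;>
      · simp only [Set.mem_ofPred_eq, area, PiLp.add_apply, PiLp.smul_apply, smul_eq_mul]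
        unfold area at h
        linarith
  unfold OneLine at hV
  push Not at hV
  obtain ⟨i, j, k, h⟩ := hV
  rcases lt_or_gt_of_ne h with h | h
  · refine key j i k ?_
    unfold area at h ⊢; linarith
  · exact key i j k h

theorem OnHull.notMem {i : Fin N} (h : OnHull V i) : i ∉ innerSet V := by
  obtain ⟨n, hn, h⟩ := h
  intro hi
  have hsub : convexHull ℝ (Set.range V) ⊆ {x | 0 ≤ (rel n (V i) x).re} := by
    refine convexHull_min ?_ ?_
    · rintro _ ⟨k, rfl⟩; exact h k
    · intro x hx y hy s t hs ht hst
      simp only [Set.mem_ofPred_eq, rel_re] at hx hy ⊢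
      simp only [PiLp.add_apply, PiLp.smul_apply, smul_eq_mul]
      have e : (s * x 0 + t * y 0 - V i 0) * n.re + (s * x 1 + t * y 1 - V i 1) * n.im =
          s * ((x 0 - V i 0) * n.re + (x 1 - V i 1) * n.im) +
          t * ((y 0 - V i 0) * n.re + (y 1 - V i 1) * n.im) := by
        obtain rfl : t = 1 - s := by linarith
        ring
      rw [e]; positivity
  have hi' : V i ∈ interior {x | 0 ≤ (rel n (V i) x).re} := interior_mono hsub hi
  rw [mem_interior_iff_mem_nhds] at hi'
  -- a small step from the point against the normal vector leaves the half plane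
  have hcont : Filter.Tendsto (fun t : ℝ => V i - t • (!₂[n.re, n.im] : Plane))
      (nhdsWithin 0 (Set.Ioi 0)) (nhds (V i)) := by
    have : Continuous fun t : ℝ => V i - t • (!₂[n.re, n.im] : Plane) := by fun_prop
    have := this.tendsto 0
    simp only [zero_smul, sub_zero] at this
    exact this.mono_left nhdsWithin_le_nhds
  have hev := hcont.eventually hi'
  obtain ⟨t, ht, ht0⟩ := (hev.and self_mem_nhdsWithin).exists
  rw [rel_re] at ht
  simp only [PiLp.sub_apply, PiLp.smul_apply, smul_eq_mul] at ht
  simp at ht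
  have hpos := Complex.normSq_pos.2 hn
  rw [Complex.normSq_apply] at hpos
  have ht0' : (0 : ℝ) < t := ht0
  nlinarith [mul_pos ht0' hpos]

theorem onHull_of_notMem (hV : ¬ OneLine V) {i : Fin N} (h : i ∉ innerSet V) : OnHull V i := by
  obtain ⟨p, hp⟩ := interior_convexHull_nonempty hV
  have hconv := convex_convexHull ℝ (Set.range V)
  obtain ⟨f, hf⟩ := geometric_hahn_banach_open_point hconv.interior isOpen_interior h
  have hle : ∀ k, f (V k) ≤ f (V i) := by
    intro k
    have h1 : V k ∈ closure (interior (convexHull ℝ (Set.range V))) := by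
      rw [hconv.closure_interior_eq_closure_of_nonempty_interior ⟨p, hp⟩]
      exact subset_closure (subset_convexHull ℝ _ (Set.mem_range_self k))
    exact closure_minimal (fun x hx => (hf x hx).le)
      (isClosed_le f.continuous continuous_const) h1
  have h0 : ∀ x : Plane, f x = x 0 * f (EuclideanSpace.single 0 1) +
      x 1 * f (EuclideanSpace.single 1 1) := by
    intro x
    have : x = x 0 • EuclideanSpace.single 0 (1 : ℝ) + x 1 • EuclideanSpace.single 1 (1 : ℝ) := by
      ext i; fin_cases i <;> simp
    conv_lhs => rw [this]
    simp
  refine ⟨⟨-f (EuclideanSpace.single 0 1), -f (EuclideanSpace.single 1 1)⟩, ?_, ?_⟩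
  · intro hz
    have h1 := congrArg Complex.re hz
    have h2 := congrArg Complex.im hz
    simp only [Complex.zero_re, Complex.zero_im, neg_eq_zero] at h1 h2
    have := hf p hp
    rw [h0 p, h0 (V i), h1, h2] at this
    simp at this
  · intro k
    have := hle k
    rw [h0, h0 (V i)] at this
    rw [rel_re]; simp only; linarith

theorem notMem_innerSet_iff (hV : ¬ OneLine V) {i : Fin N} : i ∉ innerSet V ↔ OnHull V i :=
  ⟨onHull_of_notMem hV, OnHull.notMem⟩

theorem exists_normal {a b : Plane} (h : b ≠ a) :
    ∃ n : ℂ, n ≠ 0 ∧ (∀ x, (rel n a x).re = area a b x) ∧ ∀ x, (rel n b x).re = area a b x := by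
  refine ⟨⟨-(b 1 - a 1), b 0 - a 0⟩, ?_, fun x => ?_, fun x => ?_⟩
  · intro h0
    have h1 := congrArg Complex.re h0
    have h2 := congrArg Complex.im h0
    simp only [Complex.zero_re, Complex.zero_im] at h1 h2
    exact h (plane_ext (by linarith) (by linarith))
  · rw [rel_re]; unfold area; ring
  · rw [rel_re]; unfold area; ring

theorem HullStep.nonneg {i j : Fin N} (h : HullStep V i j) (k : Fin N) :
    0 ≤ area (V i) (V j) (V k) := by
  by_cases hk : k = i
  · subst hk; unfold area; linarith
  · exact (h.2 k hk).1

theorem HullStep.onHull (hV : Function.Injective V) {i j : Fin N} (h : HullStep V i j) :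
    OnHull V i ∧ OnHull V j := by
  obtain ⟨n, hn, h1, h2⟩ := exists_normal (hV.ne h.1)
  exact ⟨⟨n, hn, fun k => (h1 _).symm ▸ h.nonneg k⟩, ⟨n, hn, fun k => (h2 _).symm ▸ h.nonneg k⟩⟩

theorem OneLine.innerSet_eq (h : OneLine V) (hV : Function.Injective V) : innerSet V = ∅ := by
  rw [Set.eq_empty_iff_forall_notMem]
  intro i
  apply OnHull.notMem
  by_cases h1 : ∃ j, j ≠ i
  · obtain ⟨j, hj⟩ := h1
    obtain ⟨n, hn, h1, -⟩ := exists_normal (hV.ne hj)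
    exact ⟨n, hn, fun k => by rw [h1, h]⟩
  · push Not at h1
    refine ⟨1, one_ne_zero, fun k => ?_⟩
    rw [h1 k, rel_re]; simp

theorem HullStep.not_symm (hV : Function.Injective V) (hL : ¬ OneLine V) {i j : Fin N}
    (h : HullStep V i j) (h' : HullStep V j i) : False := by
  apply hL
  have h0 : ∀ k, area (V i) (V j) (V k) = 0 := by
    intro k
    have h1 := h.nonneg k
    have h2 := h'.nonneg k
    unfold area at *
    linarith
  intro a b c
  exact area_eq_of_collinear (hV.ne h.1) (h0 a) (h0 b) (h0 c)

theorem dot_eq_cos (n : ℂ) (c d x : Plane) :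
    (n.re ^ 2 + n.im ^ 2) * dot c d x =
      ‖rel n c d‖ * ‖rel n c x‖ * Real.cos ((rel n c x).arg - (rel n c d).arg) := by
  have h1 := Complex.norm_mul_cos_arg (rel n c d)
  have h2 := Complex.norm_mul_sin_arg (rel n c d)
  have h3 := Complex.norm_mul_cos_arg (rel n c x)
  have h4 := Complex.norm_mul_sin_arg (rel n c x)
  have : ‖rel n c d‖ * ‖rel n c x‖ * Real.cos ((rel n c x).arg - (rel n c d).arg) =
      (rel n c d).re * (rel n c x).re + (rel n c d).im * (rel n c x).im := by
    rw [Real.cos_sub, ← h1, ← h2, ← h3, ← h4]; ring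
  rw [this, rel_re, rel_im, rel_re, rel_im, dot]; ring

/-- Every point on the hull has a successor: the nearest one of the points in the first direction
in counterclockwise order. -/
theorem OnHull.exists_hullStep (hV : Function.Injective V) (hL : ¬ OneLine V) {i : Fin N}
    (h : OnHull V i) : ∃ j, HullStep V i j := by
  classical
  obtain ⟨n, hn, h⟩ := h
  have hne : (Finset.univ.filter fun k : Fin N => k ≠ i).Nonempty := by
    by_contra hc
    rw [Finset.not_nonempty_iff_eq_empty, Finset.filter_eq_empty_iff] at hc
    apply hL
    intro a b c
    have ha := hc (Finset.mem_univ a)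
    have hb := hc (Finset.mem_univ b)
    rw [not_not] at ha hb
    rw [ha, hb]; unfold area; ring
  obtain ⟨j, hj, hmin⟩ := Finset.exists_min_image _
    (fun k => toLex ((rel n (V i) (V k)).arg, ‖rel n (V i) (V k)‖)) hne
  simp only [Finset.mem_filter, Finset.mem_univ, true_and] at hj hmin
  refine ⟨j, hj, fun k hk => ?_⟩
  have hm := hmin k hk
  rw [Prod.Lex.toLex_le_toLex] at hm
  simp only at hm
  have a1 := abs_le.1 (Complex.abs_arg_le_pi_div_two_iff.2 (h j))
  have a2 := abs_le.1 (Complex.abs_arg_le_pi_div_two_iff.2 (h k))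
  have p1 : 0 < ‖rel n (V i) (V j)‖ := norm_pos_iff.2 (rel_ne_zero hn (hV.ne hj))
  have p2 : 0 < ‖rel n (V i) (V k)‖ := norm_pos_iff.2 (rel_ne_zero hn (hV.ne hk))
  have hle : (rel n (V i) (V j)).arg ≤ (rel n (V i) (V k)).arg := by
    rcases hm with hm | hm
    · exact hm.le
    · exact hm.1.le
  have hsq : 0 < n.re ^ 2 + n.im ^ 2 := by
    have := Complex.normSq_pos.2 hn
    rw [Complex.normSq_apply] at this; nlinarith
  have hc := rel_cross n (V i) (V j) (V k)
  rw [cross_eq_sin] at hc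
  have hd := dot_eq_cos n (V i) (V j) (V k)
  have hd' := dot_eq_cos n (V i) (V j) (V j)
  rw [sub_self, Real.cos_zero, mul_one] at hd'
  have hs0 := Real.sin_nonneg_of_nonneg_of_le_pi
    (by linarith : 0 ≤ (rel n (V i) (V k)).arg - (rel n (V i) (V j)).arg) (by linarith)
  constructor
  · have : 0 ≤ (n.re ^ 2 + n.im ^ 2) * area (V i) (V j) (V k) := hc ▸ by positivity
    exact nonneg_of_mul_nonneg_right this hsq
  · intro h0
    rw [h0, mul_zero] at hc
    have hsin := (mul_eq_zero.1 hc).resolve_left (by positivity)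
    rcases hm with hm | hm
    · left
      have hpi : (rel n (V i) (V k)).arg - (rel n (V i) (V j)).arg = Real.pi := by
        by_contra hne
        have := Real.sin_pos_of_pos_of_lt_pi
          (by linarith : 0 < (rel n (V i) (V k)).arg - (rel n (V i) (V j)).arg)
          (lt_of_le_of_ne (by linarith) hne)
        linarith
      rw [hpi, Real.cos_pi] at hd
      by_contra hcon
      push Not at hcon
      have := mul_nonneg hsq.le hcon
      nlinarith [mul_pos p1 p2]
    · right
      rw [hm.1, sub_self, Real.cos_zero, mul_one] at hd
      have : ‖rel n (V i) (V j)‖ * ‖rel n (V i) (V j)‖ ≤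
        ‖rel n (V i) (V j)‖ * ‖rel n (V i) (V k)‖ := mul_le_mul_of_nonneg_left hm.2 p1.le
      rw [← hd, ← hd'] at this
      exact le_of_mul_le_mul_left this hsq

theorem exists_hullStep_iff (hV : Function.Injective V) (hL : ¬ OneLine V) {i : Fin N} :
    (∃ j, HullStep V i j) ↔ i ∉ innerSet V := by
  rw [notMem_innerSet_iff hL]
  exact ⟨fun ⟨j, hj⟩ => (hj.onHull hV).1, fun h => h.exists_hullStep hV hL⟩

end Outer

/-! ### The order of the outer points in optimal tours -/

section Order

variable {N : ℕ} {V : Fin N → Plane}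

theorem tourLength_eq (V : Fin N → Plane) (l : List (Fin N)) :
    tourLength V l = closedLength (l.map V) := by
  cases l with
  | nil => rfl
  | cons a l => simp [tourLength, closedLength]

theorem IsTour.of_perm {l l' : List (Fin N)} (h : IsTour l) (hp : l'.Perm l) : IsTour l' :=
  ⟨hp.nodup_iff.2 h.1, fun i => hp.mem_iff.2 (h.2 i)⟩

theorem IsTour.perm {l l' : List (Fin N)} (h : IsTour l) (h' : IsTour l') : l.Perm l' :=
  (List.perm_ext_iff_of_nodup h.1 h'.1).2 fun i => by simp [h.2 i, h'.2 i]

theorem IsOptimalTour.of_perm {l l' : List (Fin N)} (h : IsOptimalTour V l) (hp : l'.Perm l)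
    (hl : tourLength V l' ≤ tourLength V l) : IsOptimalTour V l' :=
  ⟨h.1.of_perm hp, fun l'' h'' => hl.trans (h.2 l'' h'')⟩

theorem IsOptimalTour.rotate {l₁ l₂ : List (Fin N)} (h : IsOptimalTour V (l₁ ++ l₂)) :
    IsOptimalTour V (l₂ ++ l₁) :=
  h.of_perm List.perm_append_comm (by
    rw [tourLength_eq, tourLength_eq, List.map_append, List.map_append, closedLength_rotate])

theorem IsOptimalTour.reverse {l : List (Fin N)} (h : IsOptimalTour V l) :
    IsOptimalTour V l.reverse :=
  h.of_perm (List.reverse_perm l) (by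
    rw [tourLength_eq, tourLength_eq, List.map_reverse, closedLength_reverse])

theorem exists_isOptimalTour (V : Fin N → Plane) : ∃ l, IsOptimalTour V l := by
  have hfin : IsTour (List.finRange N) := ⟨List.nodup_finRange N, List.mem_finRange⟩
  obtain ⟨l, hl, hmin⟩ := Finset.exists_min_image (List.finRange N).permutations.toFinset
    (tourLength V) ⟨List.finRange N, by simp⟩
  refine ⟨l, hfin.of_perm (by simpa using hl), fun l' hl' => hmin l' ?_⟩
  simpa using hl'.perm hfin

theorem IsOptimalTour.isShortest (hV : Function.Injective V) {l : List (Fin N)}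
    (h : IsOptimalTour V l) : IsShortest (l.map V) := by
  refine ⟨h.1.1.map hV, fun l' hl' => ?_⟩
  have hr : l' ∈ Set.range (List.map V) := by
    rw [Set.range_list_map]
    intro x hx
    obtain ⟨i, -, rfl⟩ := List.mem_map.1 (hl'.subset hx)
    exact ⟨i, rfl⟩
  obtain ⟨l'', rfl⟩ := hr
  rw [← tourLength_eq, ← tourLength_eq]
  exact h.2 l'' (h.1.of_perm ((List.map_perm_map_iff hV).1 hl'))

theorem IsTour.notCollinear {l : List (Fin N)} (h : IsTour l) (hL : ¬ OneLine V) :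
    NotCollinear (l.map V) := by
  unfold OneLine at hL
  push Not at hL
  obtain ⟨i, j, k, hijk⟩ := hL
  exact ⟨_, List.mem_map_of_mem (h.2 i), _, List.mem_map_of_mem (h.2 j), _,
    List.mem_map_of_mem (h.2 k), hijk⟩

open Classical in
/-- `y` lists the outer points in the order of an optimal tour. -/
def OptOrder (V : Fin N → Plane) (y : List (Fin N)) : Prop :=
  ∃ l, IsOptimalTour V l ∧ l.filter (· ∉ innerSet V) = y

theorem OptOrder.rotate {y₁ y₂ : List (Fin N)} (h : OptOrder V (y₁ ++ y₂)) :
    OptOrder V (y₂ ++ y₁) := by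
  obtain ⟨l, hl, hy⟩ := h
  obtain ⟨l₁, l₂, rfl, rfl, rfl⟩ := List.filter_eq_append_iff.1 hy
  exact ⟨l₂ ++ l₁, hl.rotate, by simp⟩

theorem OptOrder.reverse {y : List (Fin N)} (h : OptOrder V y) : OptOrder V y.reverse := by
  obtain ⟨l, hl, rfl⟩ := h
  exact ⟨l.reverse, hl.reverse, by rw [List.filter_reverse]⟩

theorem OptOrder.mem_iff {y : List (Fin N)} (h : OptOrder V y) {i : Fin N} :
    i ∈ y ↔ i ∉ innerSet V := by
  obtain ⟨l, hl, rfl⟩ := h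
  simp [hl.1.2 i]

theorem OptOrder.nodup {y : List (Fin N)} (h : OptOrder V y) : y.Nodup := by
  obtain ⟨l, hl, rfl⟩ := h
  exact hl.1.1.filter _

theorem OptOrder.length_eq {y : List (Fin N)} (h : OptOrder V y) :
    y.length = N - innerCount V := by
  classical
  rw [← List.toFinset_card_of_nodup h.nodup]
  have : y.toFinset = (Finset.univ.filter fun i => i ∈ innerSet V)ᶜ := by
    ext i; simp [h.mem_iff]
  rw [this, Finset.card_compl, Fintype.card_fin, innerCount,
    Set.ncard_eq_toFinset_card' (innerSet V)]
  congr 2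
  ext i; simp

/-- A way to enter an optimal tour: it starts with a given outer point. -/
theorem OptOrder.exists_cons {a : Fin N} {y : List (Fin N)} (h : OptOrder V (a :: y)) :
    ∃ l, IsOptimalTour V (a :: l) ∧
      ∀ y₁ b y₂, y = y₁ ++ b :: y₂ → ∃ l₁ l₂, l = l₁ ++ b :: l₂ ∧
        (∀ i ∈ y₁, i ∈ l₁) ∧ ∀ i ∈ y₂, i ∈ l₂ := by
  obtain ⟨l, hl, hy⟩ := h
  obtain ⟨l₁, l₂, rfl, h1, ha, h2⟩ := List.filter_eq_cons_iff.1 hy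
  refine ⟨l₂ ++ l₁, by simpa using hl.rotate, ?_⟩
  rintro y₁ b y₂ rfl
  obtain ⟨p₁, p₂, rfl, e1, e2⟩ := List.filter_eq_append_iff.1 h2
  obtain ⟨p₃, p₄, rfl, h3, hb, h4⟩ := List.filter_eq_cons_iff.1 e2
  refine ⟨p₁ ++ p₃, p₄ ++ l₁, by simp, fun i hi => ?_, fun i hi => ?_⟩
  · rw [← e1] at hi
    exact List.mem_append_left _ (List.mem_of_mem_filter hi)
  · rw [← h4] at hi
    exact List.mem_append_left _ (List.mem_of_mem_filter hi)

/-- A point and its successor on the hull are neighbours in the order of an optimal tour. -/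
theorem OptOrder.adjacent (hV : Function.Injective V) (hL : ¬ OneLine V) {a b : Fin N}
    {y₁ y₂ : List (Fin N)} (h : OptOrder V (a :: (y₁ ++ b :: y₂))) (hab : HullStep V a b) :
    y₁ = [] ∨ y₂ = [] := by
  obtain ⟨l, hl, hd⟩ := h.exists_cons
  obtain ⟨l₁, l₂, rfl, h1, h2⟩ := hd y₁ b y₂ rfl
  by_contra hc
  rw [not_or] at hc
  obtain ⟨c, hc1⟩ := List.exists_mem_of_ne_nil _ hc.1
  obtain ⟨d, hd2⟩ := List.exists_mem_of_ne_nil _ hc.2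
  have hS := hl.isShortest hV
  have hN := hl.1.notCollinear hL
  have hsup : ∀ i, i ∉ innerSet V → ∃ n, Supports n (V i) ((a :: (l₁ ++ b :: l₂)).map V) := by
    intro i hi
    obtain ⟨n, hn, hk⟩ := onHull_of_notMem hL hi
    refine ⟨n, hn, fun x hx => ?_⟩
    obtain ⟨k, -, rfl⟩ := List.mem_map.1 hx
    exact hk k
  obtain ⟨n₁, hn₁⟩ := hsup c (h.mem_iff.1 (by simp [hc1]))
  obtain ⟨n₂, hn₂⟩ := hsup d (h.mem_iff.1 (by simp [hd2]))
  have he : HullEdge ((a :: (l₁ ++ b :: l₂)).map V) (V a) (V b) := by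
    refine ⟨hV.ne hab.1, fun x hx => ?_⟩
    obtain ⟨k, -, rfl⟩ := List.mem_map.1 hx
    exact ⟨hab.nonneg k, fun h0 hka => (hab.2 k fun e => hka (e ▸ rfl)).2 h0⟩
  simp only [List.map_cons, List.map_append] at hS hN hn₁ hn₂ he
  exact hS.not_interlaced hN he hn₁ hn₂ (List.mem_map_of_mem (h1 c hc1))
    (List.mem_map_of_mem (h2 d hd2))

theorem OptOrder.eq_map (hV : Function.Injective V) (hL : ¬ OneLine V) {x : ℕ → Fin N}
    (hx : ∀ t, HullStep V (x t) (x (t + 1))) (r : List (Fin N)) : ∀ (p : List (Fin N)) (t : ℕ),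
    OptOrder V (p ++ x t :: x (t + 1) :: r) →
      r = (List.range r.length).map fun i => x (t + 2 + i) := by
  induction r with
  | nil => intro p t _; rfl
  | cons w r ih =>
    intro p t h
    have h' : OptOrder V (x (t + 1) :: (w :: r ++ (p ++ [x t]))) := by
      have : p ++ x t :: x (t + 1) :: (w :: r) = (p ++ [x t]) ++ x (t + 1) :: (w :: r) := by simp
      rw [this] at h
      exact h.rotate
    have hmem := h'.mem_iff.2 ((hx (t + 1)).onHull hV).2.notMem
    have hw : x (t + 2) = w := by
      rcases List.mem_cons.1 hmem with hm | hm
      · exact absurd hm (hx (t + 1)).1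
      obtain ⟨y₁, y₂, hy⟩ := List.append_of_mem hm
      rw [hy] at h'
      rcases h'.adjacent hV hL (hx (t + 1)) with rfl | rfl
      · simp at hy; exact hy.1.symm
      · have := congrArg List.getLast? hy
        rw [← List.append_assoc, List.getLast?_concat, List.getLast?_concat] at this
        have h2 := hx (t + 1)
        rw [← Option.some.inj this] at h2
        exact ((hx t).not_symm hV hL h2).elim
    have := ih (p ++ [x t]) (t + 1) (by rw [hw]; simpa using h)
    rw [List.length_cons, List.range_succ_eq_map, List.map_cons, List.map_map, Nat.add_zero, hw]
    congr 1
    conv_lhs => rw [this]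
    refine List.map_congr_left fun i _ => ?_
    simp only [Function.comp]
    congr 1; omega

/-- Walking along the hull enumerates the outer points in the order of an optimal tour. -/
theorem optOrder_of_hullStep (hV : Function.Injective V) (hL : ¬ OneLine V) {x : ℕ → Fin N}
    (hx : ∀ t, HullStep V (x t) (x (t + 1))) :
    OptOrder V ((List.range (N - innerCount V)).map x) := by
  obtain ⟨l, hl⟩ := exists_isOptimalTour V
  obtain ⟨y, hy⟩ : ∃ y, OptOrder V y := ⟨_, l, hl, rfl⟩
  have h0 := hy.mem_iff.2 ((hx 0).onHull hV).1.notMem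
  obtain ⟨p, q, rfl⟩ := List.append_of_mem h0
  have hy := hy.rotate
  have h1 := hy.mem_iff.2 ((hx 0).onHull hV).2.notMem
  rw [List.cons_append, List.mem_cons] at h1
  obtain ⟨y₁, y₂, he⟩ := List.append_of_mem (h1.resolve_left (hx 0).1)
  rw [List.cons_append, he] at hy
  have key : ∃ r, OptOrder V (x 0 :: x 1 :: r) := by
    rcases hy.adjacent hV hL (hx 0) with rfl | rfl
    · exact ⟨y₂, hy⟩
    · refine ⟨y₁.reverse, ?_⟩
      have := hy.reverse
      rw [List.reverse_cons] at this
      simpa using this.rotate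
  obtain ⟨r, hr⟩ := key
  have h2 := OptOrder.eq_map hV hL hx r [] 0 (by simpa using hr)
  have h3 := hr.length_eq
  convert hr using 1
  rw [← h3, List.length_cons, List.length_cons, List.range_succ_eq_map, List.range_succ_eq_map]
  simp only [List.map_cons, List.map_map]
  congr 2
  conv_rhs => rw [h2]
  refine List.map_congr_left fun i _ => ?_
  simp only [Function.comp]
  congr 1; omega

end Order

/-! ### Points on one line -/

theorem dist_head_getLast_le (l : List Plane) (hl : l ≠ []) :
    dist (l.head hl) (l.getLast hl) ≤ polyLength l := by
  induction l with
  | nil => exact absurd rfl hl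
  | cons a l ih =>
    by_cases h : l = []
    · subst h; simp
    · rw [polyLength_cons h, List.getLast_cons h, List.head_cons]
      exact (dist_triangle _ _ _).trans (add_le_add_right (ih h) _)

theorem two_mul_dist_le_closedLength {l : List Plane} {p q : Plane} (hp : p ∈ l) (hq : q ∈ l) :
    2 * dist p q ≤ closedLength l := by
  obtain ⟨l₁, l₂, rfl⟩ := List.append_of_mem hp
  rw [closedLength_rotate, List.cons_append]
  by_cases hpq : q = p
  · subst hpq
    rw [dist_self, mul_zero]
    exact polyLength_nonneg _
  have hq' : q ∈ l₂ ++ l₁ := by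
    simp only [List.mem_append, List.mem_cons, hpq, false_or] at hq ⊢
    exact hq.symm
  obtain ⟨A, B, h⟩ := List.append_of_mem hq'
  rw [h, ← List.cons_append, closedLength_append (by simp) (by simp)]
  have h1 := dist_head_getLast_le (p :: A) (by simp)
  have h2 := dist_head_getLast_le (q :: B) (by simp)
  simp only [List.head_cons] at h1 h2 ⊢
  have h3 := dist_triangle p ((p :: A).getLast (by simp)) q
  have h4 := dist_triangle q ((q :: B).getLast (by simp)) p
  rw [dist_comm q p] at h4
  linarith

theorem polyLength_line (o e : Plane) (a : ℝ) (l : List ℝ) (h : (a :: l).Pairwise (· < ·)) :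
    polyLength ((a :: l).map fun s => o + s • e) = ((a :: l).getLast (by simp) - a) * ‖e‖ := by
  induction l generalizing a with
  | nil => simp
  | cons b l ih =>
    have h' := List.pairwise_cons.1 h
    have hab := h'.1 b (by simp)
    have := ih b h'.2
    simp only [List.map_cons, polyLength_cons_cons] at this ⊢
    rw [this, dist_line, abs_of_neg (by linarith), List.getLast_cons (List.cons_ne_nil b l)]
    ring

section

variable {N : ℕ} {V : Fin N → Plane}

theorem OneLine.eq_line (h : OneLine V) {a b : Fin N} (hab : V b ≠ V a) (i : Fin N) :
    V i = V a + (dot (V a) (V b) (V i) / dot (V a) (V b) (V b)) • (V b - V a) := by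
  have h0 := h a b i
  have hd : 0 < dot (V a) (V b) (V b) := by
    have := sq_add_sq_pos hab; unfold dot; nlinarith
  apply plane_ext
  · simp only [PiLp.add_apply, PiLp.smul_apply, PiLp.sub_apply, smul_eq_mul]
    field_simp
    unfold area at h0
    unfold dot
    linear_combination (-(V b 1 - V a 1)) * h0
  · simp only [PiLp.add_apply, PiLp.smul_apply, PiLp.sub_apply, smul_eq_mul]
    field_simp
    unfold area at h0
    unfold dot
    linear_combination (V b 0 - V a 0) * h0

/-- For points on one line it is optimal to visit them from left to right. -/
theorem optOrder_of_oneLine (hV : Function.Injective V) (hL : OneLine V) {a b : Fin N}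
    (hab : b ≠ a) {l : List (Fin N)} (hl : IsTour l)
    (hs : l.Pairwise fun i j => dot (V a) (V b) (V i) < dot (V a) (V b) (V j)) : OptOrder V l := by
  refine ⟨l, ⟨hl, fun l' hl' => ?_⟩, by simp [hL.innerSet_eq hV]⟩
  have hne := hV.ne hab
  have hd : 0 < dot (V a) (V b) (V b) := by
    have := sq_add_sq_pos hne; unfold dot; nlinarith
  cases l with
  | nil => exact absurd (hl.2 a) (by simp)
  | cons c l =>
    set f : Fin N → ℝ := fun i => dot (V a) (V b) (V i) / dot (V a) (V b) (V b) with hf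
    have hmap : ∀ l : List (Fin N), l.map V = (l.map f).map fun s => V a + s • (V b - V a) := by
      intro l
      rw [List.map_map]
      exact List.map_congr_left fun i _ => hL.eq_line hne i
    have hpw : (f c :: l.map f).Pairwise (· < ·) := by
      rw [← List.map_cons, List.pairwise_map]
      exact hs.imp fun h => div_lt_div_of_pos_right h hd
    have h1 : polyLength ((c :: l).map V) =
        (((c :: l).map f).getLast (by simp) - f c) * ‖V b - V a‖ := by
      rw [hmap]
      exact polyLength_line (V a) (V b - V a) (f c) (l.map f) hpw
    have hlast : ∃ d, V d = ((c :: l).map V).getLast (by simp) ∧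
        f d = ((c :: l).map f).getLast (by simp) :=
      ⟨(c :: l).getLast (by simp), by rw [List.getLast_map], by rw [List.getLast_map]⟩
    obtain ⟨d, hd1, hd2⟩ := hlast
    have hcd : f c ≤ f d := by
      rw [hd2]
      have := List.getLast_mem (l := (c :: l).map f) (by simp)
      simp only [List.map_cons, List.mem_cons] at this
      rcases this with h | h
      · simp only [List.map_cons]; rw [h]
      · exact ((List.pairwise_cons.1 hpw).1 _ h).le
    have hdist : dist (V c) (V d) = (f d - f c) * ‖V b - V a‖ := by
      rw [hL.eq_line hne c, hL.eq_line hne d, dist_line, abs_sub_comm, abs_of_nonneg]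
      exact sub_nonneg.2 hcd
    have h2 : tourLength V (c :: l) = 2 * dist (V c) (V d) := by
      have : tourLength V (c :: l) = polyLength ((c :: l).map V ++ [V c]) := by simp [tourLength]
      rw [this, polyLength_concat (by simp), h1, ← hd1, ← hd2, ← hdist, dist_comm (V d)]
      ring
    rw [h2, tourLength_eq]
    exact two_mul_dist_le_closedLength (List.mem_map_of_mem (hl'.2 c)) (List.mem_map_of_mem (hl'.2 d))

end

/-! ### Tours as sequences of blocks -/

/-- The edges of a shortest closed polygon, numbered along the polygon, meet at most in the common
end of consecutive edges. -/
theorem IsShortest.edges {T : List Plane} (hT : T ≠ []) (hS : IsShortest T) (hN : NotCollinear T)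
    {i j : ℕ} (hij : i < j) (hj : j < T.length) {p q r s x : Plane}
    (hp : (T ++ [T.head hT])[i]? = some p) (hq : (T ++ [T.head hT])[i + 1]? = some q)
    (hr : (T ++ [T.head hT])[j]? = some r) (hs : (T ++ [T.head hT])[j + 1]? = some s)
    (h1 : x ∈ segment ℝ p q) (h2 : x ∈ segment ℝ r s) :
    (j = i + 1 ∧ x = r ∧ x = q) ∨ (i = 0 ∧ j + 1 = T.length ∧ x = p ∧ x = s) := by
  have hT0 : T.head? = some (T.head hT) := List.head?_eq_some_head hT
  set A := (T.drop (i + 1)).take (j - i) with hA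
  set B := T.drop (j + 1) ++ T.take (i + 1) with hB
  have hdec : T = T.take (i + 1) ++ (A ++ T.drop (j + 1)) := by
    have : T.drop (j + 1) = (T.drop (i + 1)).drop (j - i) := by
      rw [List.drop_drop]; congr 1; omega
    rw [this, hA, List.take_append_drop, List.take_append_drop]
  have hAl : A.length = j - i := by rw [hA, List.length_take, List.length_drop]; omega
  have hBl : B.length = T.length - (j - i) := by
    rw [hB, List.length_append, List.length_take, List.length_drop]; omega
  have hA0 : A ≠ [] := by rw [← List.length_pos_iff]; omega
  have hB0 : B ≠ [] := by rw [← List.length_pos_iff]; omega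
  rw [List.getElem?_append_left (by omega)] at hp hq hr
  have eAh : A.head hA0 = q := by
    have : A.head? = some q := by
      rw [← hq, List.head?_eq_getElem?, hA, List.getElem?_take_of_lt (by omega),
        List.getElem?_drop]
    rw [List.head?_eq_some_head hA0] at this
    exact Option.some.inj this
  have eAl : A.getLast hA0 = r := by
    have : A.getLast? = some r := by
      rw [← hr, List.getLast?_eq_getElem?, hAl, hA, List.getElem?_take_of_lt (by omega),
        List.getElem?_drop]
      congr 1; omega
    rw [List.getLast?_eq_some_getLast hA0] at this
    exact Option.some.inj this
  have eBl : B.getLast hB0 = p := by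
    have hne : T.take (i + 1) ≠ [] := by
      rw [← List.length_pos_iff, List.length_take]; omega
    have : (T.take (i + 1)).getLast? = some p := by
      rw [← hp, List.getLast?_eq_getElem?, List.length_take, Nat.min_eq_left (by omega),
        List.getElem?_take_of_lt (by omega)]
      rfl
    rw [List.getLast?_eq_some_getLast hne] at this
    rw [← Option.some.inj this]
    exact List.getLast_append_of_ne_nil _ hne
  have eBh : B.head hB0 = s := by
    have : B.head? = some s := by
      rw [← hs, hB, List.head?_append, List.head?_drop, List.getElem?_append]
      by_cases h : j + 1 < T.length
      · rw [if_pos h, List.getElem?_eq_getElem h]; rfl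
      · have e : j + 1 = T.length := by omega
        rw [if_neg h, e, List.getElem?_eq_none le_rfl]
        simp [List.head?_take, hT0]
    rw [List.head?_eq_some_head hB0] at this
    exact Option.some.inj this
  have hp1 : (A ++ B).Perm T := by
    conv_rhs => rw [hdec]
    rw [hB, ← List.append_assoc]
    exact List.perm_append_comm
  have hS' : IsShortest (A ++ B) := by
    have h := hS
    rw [hdec] at h
    have := h.rotate
    rwa [List.append_assoc] at this
  rcases hS'.noncrossing hA0 hB0 (hN.perm hp1.symm) (by rw [eBl, eAh]; exact h1)
    (by rw [eAl, eBh]; exact h2) with ⟨h, hx⟩ | ⟨h, hx⟩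
  · left
    have hji : j = i + 1 := by omega
    rw [eAh] at hx
    refine ⟨hji, ?_, hx⟩
    rw [hji, hq] at hr
    rw [hx]; exact Option.some.inj hr
  · right
    have h0 : i = 0 := by omega
    have h1 : j + 1 = T.length := by omega
    rw [eBl] at hx
    refine ⟨h0, h1, hx, ?_⟩
    rw [h1, List.getElem?_append_right le_rfl] at hs
    rw [h0, ← List.head?_eq_getElem?, hT0] at hp
    simp at hs
    rw [hx, ← Option.some.inj hp, hs]

/-- The concatenation of the first `k` blocks `y i :: L i`. -/
def blocks {α : Type*} (y : ℕ → α) (L : ℕ → List α) (k : ℕ) : List α :=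
  ((List.range k).map fun i => y i :: L i).flatten

section Blocks

variable {α : Type*} {y : ℕ → α} {L : ℕ → List α}

theorem blocks_succ (k : ℕ) : blocks y L (k + 1) = blocks y L k ++ y k :: L k := by
  simp [blocks, List.range_succ]

theorem map_blocks {β : Type*} (f : α → β) (k : ℕ) :
    (blocks y L k).map f = blocks (fun i => f (y i)) (fun i => (L i).map f) k := by
  simp [blocks, List.map_flatten, Function.comp_def]

theorem blocks_split {i k : ℕ} (h : i < k) :
    ∃ rest, blocks y L k ++ [y k] = blocks y L i ++ (y i :: (L i ++ [y (i + 1)]) ++ rest) := by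
  induction k, h using Nat.le_induction with
  | base => exact ⟨[], by simp [blocks_succ]⟩
  | succ k h ih =>
    obtain ⟨rest, hr⟩ := ih
    refine ⟨rest ++ (L k ++ [y (k + 1)]), ?_⟩
    have : blocks y L (k + 1) ++ [y (k + 1)] =
        (blocks y L k ++ [y k]) ++ (L k ++ [y (k + 1)]) := by simp [blocks_succ]
    rw [this, hr]; simp

theorem length_blocks_succ (k : ℕ) :
    (blocks y L (k + 1)).length = (blocks y L k).length + (L k).length + 1 := by
  simp [blocks_succ]; omega

theorem length_blocks_mono {i k : ℕ} (h : i ≤ k) :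
    (blocks y L i).length ≤ (blocks y L k).length := by
  induction k, h using Nat.le_induction with
  | base => exact le_rfl
  | succ k h ih => rw [length_blocks_succ]; omega

theorem getElem?_blocks {i k : ℕ} (h : i < k) {t : ℕ} (ht : t < (L i).length + 2) :
    (blocks y L k ++ [y k])[(blocks y L i).length + t]? = (y i :: (L i ++ [y (i + 1)]))[t]? := by
  obtain ⟨rest, hr⟩ := blocks_split (y := y) (L := L) h
  rw [hr, List.getElem?_append_right (by omega), Nat.add_sub_cancel_left,
    List.getElem?_append_left (by simp; omega)]

end Blocks

theorem polyLength_blocks (y : ℕ → Plane) (L : ℕ → List Plane) (k : ℕ) :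
    polyLength (blocks y L k ++ [y k]) =
      ∑ i ∈ Finset.range k, polyLength (y i :: (L i ++ [y (i + 1)])) := by
  induction k with
  | zero => simp [blocks]
  | succ k ih =>
    rw [Finset.sum_range_succ, ← ih, ← polyLength_append_cons]
    simp [blocks_succ]

theorem head_blocks {α : Type*} {y : ℕ → α} {L : ℕ → List α} {k : ℕ} (hk : 0 < k) :
    (blocks y L k).head? = some (y 0) := by
  induction k, hk using Nat.le_induction with
  | base => simp [blocks_succ, blocks]
  | succ k h ih => rw [blocks_succ, List.head?_append, ih]; rfl

theorem closedLength_blocks {y : ℕ → Plane} {L : ℕ → List Plane} {k : ℕ} (hk : 0 < k)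
    (h0 : y k = y 0) : closedLength (blocks y L k) =
      ∑ i ∈ Finset.range k, polyLength (y i :: (L i ++ [y (i + 1)])) := by
  rw [← polyLength_blocks, h0]
  have := head_blocks (y := y) (L := L) hk
  cases h : blocks y L k with
  | nil => rw [h] at this; simp at this
  | cons a l =>
    rw [h] at this
    simp only [List.head?_cons, Option.some.injEq] at this
    rw [← this]; rfl

/-- The paths that make up a shortest closed polygon have no self-intersections. -/
theorem selfAvoiding_of_blocks {y : ℕ → Plane} {L : ℕ → List Plane} {k i : ℕ} (hi : i < k)
    (h0 : y k = y 0) (hS : IsShortest (blocks y L k)) (hN : NotCollinear (blocks y L k)) :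
    SelfAvoiding (y i :: (L i ++ [y (i + 1)])) := by
  have hhead := head_blocks (y := y) (L := L) (by omega : 0 < k)
  have hT : blocks y L k ≠ [] := by intro h; rw [h] at hhead; simp at hhead
  have hh : (blocks y L k).head hT = y k := by
    rw [List.head?_eq_some_head hT] at hhead; rw [h0]; exact Option.some.inj hhead
  have hm := length_blocks_mono (y := y) (L := L) (by omega : i + 1 ≤ k)
  rw [length_blocks_succ] at hm
  intro s t hst ht x hx1 hx2
  have hlen : (y i :: (L i ++ [y (i + 1)])).length = (L i).length + 2 := by simp
  rw [hlen] at ht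
  have he : ∀ u, u < (L i).length + 2 → ∀ (hu : u < (y i :: (L i ++ [y (i + 1)])).length),
      (blocks y L k ++ [(blocks y L k).head hT])[(blocks y L i).length + u]? =
        some (y i :: (L i ++ [y (i + 1)]))[u] := by
    intro u hu hu'
    rw [hh, getElem?_blocks hi hu, List.getElem?_eq_getElem]
  rcases hS.edges hT hN (i := (blocks y L i).length + s) (j := (blocks y L i).length + t) (by omega)
    (by omega) (he s (by omega) (by omega)) (he (s + 1) (by omega) (by omega))
    (he t (by omega) (by omega)) (he (t + 1) (by omega) (by omega)) hx1 hx2 with h | h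
  · exact Or.inl ⟨by omega, h.2.1⟩
  · right
    obtain ⟨h1, h2, h3, h4⟩ := h
    obtain rfl : s = 0 := by omega
    have ht' : t = (L i).length := by omega
    constructor
    · rw [h3]; rfl
    · rw [h4, List.getLast?_eq_getElem?, hlen]
      simp only [ht']
      rw [List.getElem?_eq_getElem (by simp)]
      rfl

theorem meetOnlyAtEnds_comm {p q : List Plane} (h : MeetOnlyAtEnds p q) : MeetOnlyAtEnds q p :=
  fun x hx => (h x hx.symm).symm

/-- The paths that make up a shortest closed polygon meet at most at their ends. -/
theorem meetOnlyAtEnds_of_blocks {y : ℕ → Plane} {L : ℕ → List Plane} {k i j : ℕ} (hij : i < j)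
    (hj : j < k) (h0 : y k = y 0) (hS : IsShortest (blocks y L k))
    (hN : NotCollinear (blocks y L k)) :
    MeetOnlyAtEnds (y i :: (L i ++ [y (i + 1)])) (y j :: (L j ++ [y (j + 1)])) := by
  have hhead := head_blocks (y := y) (L := L) (by omega : 0 < k)
  have hT : blocks y L k ≠ [] := by intro h; rw [h] at hhead; simp at hhead
  have hh : (blocks y L k).head hT = y k := by
    rw [List.head?_eq_some_head hT] at hhead; rw [h0]; exact Option.some.inj hhead
  have hm := length_blocks_mono (y := y) (L := L) (by omega : i + 1 ≤ j)
  have hm' := length_blocks_mono (y := y) (L := L) (by omega : j + 1 ≤ k)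
  rw [length_blocks_succ] at hm hm'
  rintro x ⟨⟨s, hs, hx1⟩, ⟨t, ht, hx2⟩⟩
  have hlen : ∀ i, (y i :: (L i ++ [y (i + 1)])).length = (L i).length + 2 := by simp
  rw [hlen] at hs ht
  have he : ∀ i < k, ∀ u, u < (L i).length + 2 →
      ∀ (hu : u < (y i :: (L i ++ [y (i + 1)])).length),
      (blocks y L k ++ [(blocks y L k).head hT])[(blocks y L i).length + u]? =
        some (y i :: (L i ++ [y (i + 1)]))[u] := by
    intro i hi u hu hu'
    rw [hh, getElem?_blocks hi hu, List.getElem?_eq_getElem]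
  have hi : i < k := by omega
  have hlast : ∀ i, (y i :: (L i ++ [y (i + 1)]))[(L i).length + 1]? =
      (y i :: (L i ++ [y (i + 1)])).getLast? := by
    intro i; rw [List.getLast?_eq_getElem?, hlen]; rfl
  rcases hS.edges hT hN (i := (blocks y L i).length + s) (j := (blocks y L j).length + t) (by omega)
    (by omega) (he i hi s (by omega) (by rw [hlen]; omega))
    (he i hi (s + 1) (by omega) (by rw [hlen]; omega))
    (he j hj t (by omega) (by rw [hlen]; omega))
    (he j hj (t + 1) (by omega) (by rw [hlen]; omega)) hx1 hx2 with h | h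
  · obtain ⟨h1, h2, h3⟩ := h
    obtain rfl : t = 0 := by omega
    have hs' : s = (L i).length := by omega
    constructor
    · right
      rw [h3, ← hlast]
      simp only [hs']
      rw [List.getElem?_eq_getElem]
    · left; rw [h2]; rfl
  · obtain ⟨h1, h2, h3, h4⟩ := h
    obtain rfl : s = 0 := by omega
    have ht' : t = (L j).length := by omega
    constructor
    · left; rw [h3]; rfl
    · right
      rw [h4, ← hlast]
      simp only [ht']
      rw [List.getElem?_eq_getElem]

/-! ### The reduction to a part of the terminal pairs -/

theorem isSolution_iff_count {n m : ℕ} {R : Fin m → List (Fin n)} :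
    IsSolution R ↔ ∀ v, ∑ j, (R j).count v = 1 := by
  constructor
  · rintro ⟨hn, he⟩ v
    obtain ⟨j, hj, huniq⟩ := he v
    rw [Finset.sum_eq_single j]
    · exact List.count_eq_one_of_mem (hn j) hj
    · intro i _ hij
      exact List.count_eq_zero.2 fun h => hij (huniq i h)
    · simp
  · intro h
    have hle : ∀ j v, (R j).count v ≤ 1 := fun j v =>
      (Finset.single_le_sum (f := fun j => (R j).count v) (fun _ _ => Nat.zero_le _)
        (Finset.mem_univ j)).trans (h v).le
    refine ⟨fun j => List.nodup_iff_count_le_one.2 (hle j), fun v => ?_⟩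
    have hex : ∃ j, v ∈ R j := by
      by_contra hc
      push Not at hc
      have := h v
      rw [Finset.sum_eq_zero fun j _ => List.count_eq_zero.2 (hc j)] at this
      omega
    obtain ⟨j, hj⟩ := hex
    refine ⟨j, hj, fun i hi => ?_⟩
    by_contra hij
    have h2 := Finset.sum_le_sum_of_subset (f := fun j => (R j).count v)
      (Finset.subset_univ ({i, j} : Finset (Fin m)))
    rw [h v, Finset.sum_pair hij] at h2
    have := List.count_pos_iff.2 hi
    have := List.count_pos_iff.2 hj
    omega

theorem isTour_iff_count {N : ℕ} {l : List (Fin N)} : IsTour l ↔ ∀ i, l.count i = 1 := by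
  constructor
  · rintro ⟨h1, h2⟩ i
    exact List.count_eq_one_of_mem h1 (h2 i)
  · intro h
    exact ⟨List.nodup_iff_count_le_one.2 fun i => (h i).le,
      fun i => List.count_pos_iff.1 (by rw [h i]; exact one_pos)⟩

theorem finRotate_val {M : ℕ} (i : Fin M) : (finRotate M i : ℕ) = (i + 1) % M := by
  cases M with
  | zero => exact i.elim0
  | succ M => rw [finRotate_apply, Fin.val_add, Fin.val_one', Nat.add_mod_mod]

section

variable {N k M : ℕ} (V : Fin N → Plane) (idx : Fin k → Fin N) (x : Fin M → Fin N)

/-- The instance with the terminal pairs of cyclically consecutive points. -/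
def fullInst : Points k M where
  inner v := V (idx v)
  pair i := (V (x i), V (x (finRotate _ i)))

/-- The closed tour that consists of the paths of a solution. -/
def fullTour (R : Fin M → List (Fin k)) : List (Fin N) :=
  (List.ofFn fun i => x i :: (R i).map idx).flatten

variable {V idx x}

theorem fullTour_eq (hM : 0 < M) (R : Fin M → List (Fin k)) :
    fullTour idx x R = blocks (fun t => x ⟨t % M, Nat.mod_lt _ hM⟩)
      (fun t => (R ⟨t % M, Nat.mod_lt _ hM⟩).map idx) M := by
  unfold fullTour blocks
  congr 1
  refine List.ext_getElem (by simp) fun t h1 h2 => ?_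
  have ht : t < M := by simpa using h1
  simp [Nat.mod_eq_of_lt ht]

theorem map_fullTour (hM : 0 < M) (R : Fin M → List (Fin k)) :
    (fullTour idx x R).map V = blocks (fun t => V (x ⟨t % M, Nat.mod_lt _ hM⟩))
      (fun t => (R ⟨t % M, Nat.mod_lt _ hM⟩).map fun v => V (idx v)) M := by
  rw [fullTour_eq hM, map_blocks]
  simp [Function.comp_def]

theorem path_fullInst (hM : 0 < M) (R : Fin M → List (Fin k)) (i : Fin M) :
    (fullInst V idx x).path R i = V (x ⟨i % M, Nat.mod_lt _ hM⟩) ::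
      (((R ⟨i % M, Nat.mod_lt _ hM⟩).map fun v => V (idx v)) ++
        [V (x ⟨(i + 1) % M, Nat.mod_lt _ hM⟩)]) := by
  have e : (⟨i % M, Nat.mod_lt _ hM⟩ : Fin M) = i := Fin.ext (Nat.mod_eq_of_lt i.2)
  have e' : (⟨(i + 1) % M, Nat.mod_lt _ hM⟩ : Fin M) = finRotate M i :=
    Fin.ext (finRotate_val i).symm
  rw [e, e']; rfl

theorem tourLength_fullTour (R : Fin M → List (Fin k)) :
    tourLength V (fullTour idx x R) = (fullInst V idx x).cost R := by
  rcases Nat.eq_zero_or_pos M with rfl | hM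
  · simp [fullTour, tourLength, Points.cost]
  · rw [tourLength_eq, map_fullTour hM, closedLength_blocks hM (by simp), Points.cost,
      Finset.sum_range]
    exact Finset.sum_congr rfl fun i _ => by rw [path_fullInst hM]

/-- Both sides say that every point occurs once; this is counted separately for the outer points and
for the inner points. -/
theorem isTour_fullTour (hidx : Function.Injective idx) (hx : Function.Injective x)
    (hr : Set.range x = (Set.range idx)ᶜ) {R : Fin M → List (Fin k)} :
    IsTour (fullTour idx x R) ↔ IsSolution R := by
  have hcount : ∀ i, (fullTour idx x R).count i =
      (∑ j, if x j = i then 1 else 0) + ∑ j, ((R j).map idx).count i := by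
    intro i
    rw [fullTour, List.count_flatten, List.map_ofFn, List.sum_ofFn, ← Finset.sum_add_distrib]
    refine Finset.sum_congr rfl fun j _ => ?_
    simp only [Function.comp, List.count_cons, beq_iff_eq]
    ring
  rw [isTour_iff_count, isSolution_iff_count]
  have hin : ∀ v, (fullTour idx x R).count (idx v) = ∑ j, (R j).count v := by
    intro v
    rw [hcount, Finset.sum_eq_zero, zero_add]
    · exact Finset.sum_congr rfl fun j _ => List.count_map_of_injective _ _ hidx _
    · intro j _
      rw [if_neg]
      intro h
      have : x j ∈ (Set.range idx)ᶜ := hr ▸ Set.mem_range_self j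
      exact this ⟨v, h.symm⟩
  constructor
  · intro h v
    rw [← hin, h]
  · intro h i
    by_cases hi : i ∈ Set.range idx
    · obtain ⟨v, rfl⟩ := hi
      rw [hin, h]
    · have : i ∈ Set.range x := by rw [hr]; exact hi
      obtain ⟨j, rfl⟩ := this
      rw [hcount]
      have h0 : ∑ j', ((R j').map idx).count (x j) = 0 := by
        refine Finset.sum_eq_zero fun j' _ => List.count_eq_zero.2 fun hm => ?_
        obtain ⟨v, -, hv⟩ := List.mem_map.1 hm
        exact hi ⟨v, hv⟩
      rw [h0, add_zero, Finset.sum_eq_single j]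
      · simp
      · intro j' _ hne
        rw [if_neg fun e => hne (hx e)]
      · simp

/-- A list is cut before each of the entries that satisfy `p`; the pieces between them are routes. -/
theorem exists_eq_fullTour_aux {p : Fin N → Bool} (hp : ∀ i, p i = false → i ∈ Set.range idx) :
    ∀ {M : ℕ} (x : Fin M → Fin N) (l : List (Fin N)), l.filter p = List.ofFn x →
      ∃ (l₀ : List (Fin N)) (R : Fin M → List (Fin k)), l = l₀ ++ fullTour idx x R ∧
        ∀ i ∈ l₀, p i = false := by
  intro M
  induction M with
  | zero =>
    intro x l hl
    refine ⟨l, fun i => i.elim0, by simp [fullTour], ?_⟩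
    simp only [List.ofFn_zero, List.filter_eq_nil_iff] at hl
    exact fun i hi => by simpa using hl i hi
  | succ M ih =>
    intro x l hl
    rw [List.ofFn_succ] at hl
    obtain ⟨l₁, l₂, rfl, h1, -, h2⟩ := List.filter_eq_cons_iff.1 hl
    obtain ⟨l₀, R, rfl, h0⟩ := ih (fun i => x i.succ) l₂ h2
    have hr : l₀ ∈ Set.range (List.map idx) := by
      rw [Set.range_list_map]
      exact fun i hi => hp i (h0 i hi)
    obtain ⟨r, rfl⟩ := hr
    refine ⟨l₁, Fin.cons r R, ?_, fun i hi => by simpa using h1 i hi⟩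
    simp [fullTour, List.ofFn_succ]

theorem exists_notMem_innerSet (h : 0 < N) : ∃ i, i ∉ innerSet V := by
  obtain ⟨i, -, hi⟩ := Finset.exists_max_image (Finset.univ : Finset (Fin N)) (fun i => V i 0)
    ⟨⟨0, h⟩, Finset.mem_univ _⟩
  refine ⟨i, OnHull.notMem ⟨-1, by simp, fun k => ?_⟩⟩
  have := hi k (Finset.mem_univ k)
  rw [rel_re]; simp; linarith

/-- If `x` lists the outer points in the order of an optimal tour, then some optimal tour is made
from a solution of the instance with all pairs of consecutive outer points. -/
theorem exists_optimal_fullTour (hridx : Set.range idx = innerSet V)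
    (ho : OptOrder V (List.ofFn x)) :
    ∃ R : Fin M → List (Fin k), IsOptimalTour V (fullTour idx x R) := by
  classical
  rcases Nat.eq_zero_or_pos M with rfl | hM
  · obtain ⟨l, hl, -⟩ := id ho
    refine ⟨fun i => i.elim0, ?_⟩
    have hN : N = 0 := by
      by_contra h
      obtain ⟨i, hi⟩ := exists_notMem_innerSet (V := V) (Nat.pos_of_ne_zero h)
      have := ho.mem_iff.2 hi
      simp at this
    subst hN
    have : l = [] := List.eq_nil_iff_forall_not_mem.2 fun i => i.elim0
    rw [this] at hl
    simpa [fullTour] using hl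
  obtain ⟨M, rfl⟩ : ∃ M', M = M' + 1 := ⟨M - 1, by omega⟩
  obtain ⟨l, hl, p, hp, hf⟩ : ∃ l, IsOptimalTour V l ∧ ∃ p : Fin N → Bool,
      (∀ i, p i = false → i ∈ innerSet V) ∧ l.filter p = List.ofFn x := by
    obtain ⟨l, hl, hf⟩ := ho
    exact ⟨l, hl, _, by simp, hf⟩
  rw [List.ofFn_succ] at hf
  obtain ⟨l₁, l₂, rfl, h1, h2, h3⟩ := List.filter_eq_cons_iff.1 hf
  have hf' : (x 0 :: (l₂ ++ l₁)).filter p = List.ofFn x := by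
    rw [List.filter_cons_of_pos h2, List.filter_append, h3, List.filter_eq_nil_iff.2 h1,
      List.append_nil, List.ofFn_succ]
  obtain ⟨l₀, R, he, h0⟩ := exists_eq_fullTour_aux (k := k) (idx := idx)
    (fun i hi => by rw [hridx]; exact hp i hi) x _ hf'
  have hl0 : l₀ = [] := by
    cases l₀ with
    | nil => rfl
    | cons a l₀ =>
      simp only [List.cons_append, List.cons.injEq] at he
      have := h0 a (by simp)
      rw [← he.1, h2] at this
      exact absurd this (by simp)
  refine ⟨R, ?_⟩
  rw [hl0, List.nil_append] at he
  rw [← he]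
  simpa using hl.rotate

end

theorem flatten_ofFn_single {α : Type*} {m : ℕ} (g : Fin m → List α) (j : Fin m)
    (h : ∀ i, i ≠ j → g i = []) : (List.ofFn g).flatten = g j := by
  induction m with
  | zero => exact j.elim0
  | succ m ih =>
    rw [List.ofFn_succ, List.flatten_cons]
    refine Fin.cases ?_ (fun j => ?_) j (motive := fun j => (∀ i, i ≠ j → g i = []) →
      g 0 ++ (List.ofFn fun i => g i.succ).flatten = g j) h
    · intro h
      have : (List.ofFn fun i : Fin m => g i.succ).flatten = [] := by
        rw [List.flatten_eq_nil_iff]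
        intro l hl
        obtain ⟨i, rfl⟩ := (List.mem_ofFn' _ _).1 hl
        exact h _ (Fin.succ_ne_zero i)
      rw [this, List.append_nil]
    · intro h
      rw [h 0 (Fin.succ_ne_zero j).symm, List.nil_append]
      exact ih (fun i => g i.succ) j fun i hi => h _ fun e => hi (Fin.succ_injective _ e)

/-- The family of routes that is empty outside of the selected pairs. -/
def extend {n m M : ℕ} (kept : Fin m → Fin M) (R : Fin m → List (Fin n)) (i : Fin M) :
    List (Fin n) := (List.ofFn fun j => if kept j = i then R j else []).flatten

section Extend

variable {n m M : ℕ} {kept : Fin m → Fin M}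

theorem extend_kept (hk : Function.Injective kept) (R : Fin m → List (Fin n)) (j : Fin m) :
    extend kept R (kept j) = R j := by
  unfold extend
  rw [flatten_ofFn_single _ j]
  · simp
  · intro i hi; rw [if_neg fun e => hi (hk e)]

theorem extend_of_ne (R : Fin m → List (Fin n)) {i : Fin M} (hi : ∀ j, kept j ≠ i) :
    extend kept R i = [] := by
  unfold extend
  rw [List.flatten_eq_nil_iff]
  intro l hl
  obtain ⟨j, rfl⟩ := (List.mem_ofFn' _ _).1 hl
  exact if_neg (hi j)

theorem sum_split (hk : Function.Injective kept) {β : Type*} [AddCommMonoid β] (f : Fin M → β) :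
    ∑ i, f i = ∑ j, f (kept j) + ∑ i with ∀ j, kept j ≠ i, f i := by
  classical
  rw [← Finset.sum_filter_add_sum_filter_not Finset.univ (fun i => ∃ j, kept j = i)]
  congr 1
  · rw [← Finset.sum_image (f := f) (g := kept) (s := Finset.univ) (fun a _ b _ h => hk h)]
    refine Finset.sum_congr ?_ fun _ _ => rfl
    ext i; simp
  · refine Finset.sum_congr ?_ fun _ _ => rfl
    ext i; simp

theorem isSolution_extend (hk : Function.Injective kept) {R : Fin m → List (Fin n)} :
    IsSolution (extend kept R) ↔ IsSolution R := by
  rw [isSolution_iff_count, isSolution_iff_count]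
  refine forall_congr' fun v => ?_
  rw [sum_split hk, Finset.sum_congr rfl fun j _ => by rw [extend_kept hk],
    Finset.sum_eq_zero (s := Finset.univ.filter _), add_zero]
  intro i hi
  rw [extend_of_ne R (by simpa using hi)]; rfl

theorem extend_comp (hk : Function.Injective kept) {R : Fin M → List (Fin n)}
    (hR : ∀ i, (∀ j, kept j ≠ i) → R i = []) : extend kept (fun j => R (kept j)) = R := by
  funext i
  by_cases hi : ∃ j, kept j = i
  · obtain ⟨j, rfl⟩ := hi
    exact extend_kept hk _ j
  · push Not at hi
    rw [extend_of_ne _ hi, hR i hi]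

end Extend

section

variable {N : ℕ} {V : Fin N → Plane}

/-- The data of a reduction: an order of the outer points in which some optimal tour visits them,
and a choice of terminal pairs such that some optimal solution of the instance with all pairs of
consecutive outer points has redundant paths on the other pairs. -/
structure Selection (V : Fin N → Plane) where
  m : ℕ
  innerIdx : Fin (innerCount V) → Fin N
  outer : Fin (N - innerCount V) → Fin N
  kept : Fin m → Fin (N - innerCount V)
  innerIdx_injective : Function.Injective innerIdx
  range_innerIdx : Set.range innerIdx = innerSet V
  optOrder : OptOrder V (List.ofFn outer)
  kept_injective : Function.Injective kept
  le_sq : m ≤ innerCount V ^ 2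
  exists_redundant : ∃ R, (fullInst V innerIdx outer).IsOptimal R ∧
    ∀ i, (∀ j, kept j ≠ i) → R i = []

namespace Selection

variable (S : Selection V)

theorem outer_injective : Function.Injective S.outer := List.nodup_ofFn.1 S.optOrder.nodup

theorem range_outer : Set.range S.outer = (innerSet V)ᶜ := by
  ext i
  rw [Set.mem_compl_iff, ← S.optOrder.mem_iff, List.mem_ofFn']

/-- The instance with the selected terminal pairs. -/
noncomputable def points : Points (innerCount V) S.m where
  inner v := V (S.innerIdx v)
  pair j := (V (S.outer (S.kept j)), V (S.outer (finRotate _ (S.kept j))))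

/-- Total length of the edges between the pairs that are not selected. -/
noncomputable def fixed : ℝ :=
  ∑ i with ∀ j, S.kept j ≠ i, dist (V (S.outer i)) (V (S.outer (finRotate _ i)))

/-- The tour made of a solution for the selected pairs. -/
noncomputable def tour (R : Fin S.m → List (Fin (innerCount V))) : List (Fin N) :=
  fullTour S.innerIdx S.outer (extend S.kept R)

theorem isTour_fullTour {R : Fin (N - innerCount V) → List (Fin (innerCount V))} :
    IsTour (fullTour S.innerIdx S.outer R) ↔ IsSolution R :=
  GETSPReduction.isTour_fullTour S.innerIdx_injective S.outer_injective
    (by rw [S.range_outer, S.range_innerIdx])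

theorem isTour_tour {R : Fin S.m → List (Fin (innerCount V))} :
    IsTour (S.tour R) ↔ IsSolution R := by
  rw [tour, S.isTour_fullTour, isSolution_extend S.kept_injective]

theorem tourLength_tour (R : Fin S.m → List (Fin (innerCount V))) :
    tourLength V (S.tour R) = S.points.cost R + S.fixed := by
  rw [tour, tourLength_fullTour, Points.cost, sum_split S.kept_injective, fixed, Points.cost]
  congr 1
  · refine Finset.sum_congr rfl fun j _ => ?_
    rw [Points.path, extend_kept S.kept_injective]; rfl
  · refine Finset.sum_congr rfl fun i hi => ?_
    rw [Points.path, extend_of_ne R (by simpa using hi)]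
    simp [fullInst]

theorem exists_isOptimalTour : ∃ R, IsSolution R ∧ IsOptimalTour V (S.tour R) := by
  obtain ⟨R, hR, h0⟩ := S.exists_redundant
  obtain ⟨R', hR'⟩ := exists_optimal_fullTour S.range_innerIdx S.optOrder
  have he := extend_comp S.kept_injective h0
  refine ⟨fun j => R (S.kept j), ?_, ?_⟩
  · rw [← isSolution_extend S.kept_injective, he]; exact hR.1
  · rw [tour, he]
    refine ⟨S.isTour_fullTour.2 hR.1, fun l hl => ?_⟩
    refine le_trans ?_ (hR'.2 l hl)
    rw [tourLength_fullTour, tourLength_fullTour]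
    exact hR.2 R' (S.isTour_fullTour.1 hR'.1)

theorem isOptimalTour_tour {R : Fin S.m → List (Fin (innerCount V))} (h : S.points.IsOptimal R) :
    IsOptimalTour V (S.tour R) := by
  obtain ⟨R', h1, h2⟩ := S.exists_isOptimalTour
  refine ⟨S.isTour_tour.2 h.1, fun l hl => le_trans ?_ (h2.2 l hl)⟩
  rw [S.tourLength_tour, S.tourLength_tour]
  exact add_le_add_left (h.2 R' h1) _

theorem exists_isTour_iff (b : ℝ) : (∃ l, IsTour l ∧ tourLength V l ≤ b) ↔
    ∃ R, IsSolution R ∧ S.points.cost R ≤ b - S.fixed := by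
  constructor
  · rintro ⟨l, hl, hb⟩
    obtain ⟨R, h1, h2⟩ := S.exists_isOptimalTour
    have := h2.2 l hl
    rw [S.tourLength_tour] at this
    exact ⟨R, h1, by linarith⟩
  · rintro ⟨R, hR, hb⟩
    exact ⟨S.tour R, S.isTour_tour.2 hR, by rw [S.tourLength_tour]; linarith⟩

theorem not_oneLine (hV : Function.Injective V) (j : Fin S.m) : ¬ OneLine V := by
  intro h
  have h0 : innerCount V = 0 := by rw [innerCount, h.innerSet_eq hV, Set.ncard_empty]
  have := S.le_sq
  rw [h0] at this
  exact absurd j.2 (by omega)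

theorem path_points (hM : 0 < N - innerCount V) (R : Fin S.m → List (Fin (innerCount V)))
    (j : Fin S.m) : S.points.path R j =
      V (S.outer ⟨S.kept j % (N - innerCount V), Nat.mod_lt _ hM⟩) ::
      (((extend S.kept R ⟨S.kept j % (N - innerCount V), Nat.mod_lt _ hM⟩).map
        fun v => V (S.innerIdx v)) ++
        [V (S.outer ⟨(S.kept j + 1) % (N - innerCount V), Nat.mod_lt _ hM⟩)]) := by
  rw [← path_fullInst hM (extend S.kept R) (S.kept j), Points.path, Points.path,
    extend_kept S.kept_injective]
  rfl

/-- The instance of GETSP given by the selected pairs. -/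
noncomputable def inst (hV : Function.Injective V) : GETSP (innerCount V) S.m where
  toPoints := S.points
  inner_injective := hV.comp S.innerIdx_injective
  selfAvoiding R hR j := by
    have hM : 0 < N - innerCount V := (S.kept j).pos
    have hl := S.isOptimalTour_tour hR
    have hS := hl.isShortest hV
    have hN := hl.1.notCollinear (S.not_oneLine hV j)
    rw [tour, map_fullTour hM] at hS hN
    rw [S.path_points hM]
    exact selfAvoiding_of_blocks (S.kept j).2 (by simp) hS hN
  meetOnlyAtEnds R hR i j hij := by
    have hM : 0 < N - innerCount V := (S.kept j).pos
    have hl := S.isOptimalTour_tour hR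
    have hS := hl.isShortest hV
    have hN := hl.1.notCollinear (S.not_oneLine hV j)
    rw [tour, map_fullTour hM] at hS hN
    rw [S.path_points hM, S.path_points hM]
    rcases lt_or_gt_of_ne (S.kept_injective.ne hij) with h | h
    · exact meetOnlyAtEnds_of_blocks h (S.kept j).2 (by simp) hS hN
    · exact meetOnlyAtEnds_comm (meetOnlyAtEnds_of_blocks h (S.kept i).2 (by simp) hS hN)

/-- The reduction given by the selected pairs. -/
noncomputable def kernel (hV : Function.Injective V) : Kernel V where
  m := S.m
  inst := S.inst hV
  innerIdx := S.innerIdx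
  outer := S.outer
  kept := S.kept
  innerIdx_injective := S.innerIdx_injective
  range_innerIdx := S.range_innerIdx
  outer_injective := S.outer_injective
  range_outer := S.range_outer
  kept_injective := S.kept_injective
  inst_inner _ := rfl
  inst_pair _ := rfl

theorem kernel_tour (hV : Function.Injective V) (R : Fin S.m → List (Fin (innerCount V))) :
    (S.kernel hV).tour R = S.tour R := by
  unfold Kernel.tour tour fullTour
  congr 2
  funext i
  congr 1
  unfold extend
  rw [List.map_flatten, List.map_ofFn]
  congr 2
  funext j
  simp only [Function.comp]
  show (if S.kept j = i then List.map S.innerIdx (R j) else []) = _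
  split_ifs <;> simp

theorem kernel_correct (hV : Function.Injective V) : (S.kernel hV).Correct :=
  ⟨S.exists_isTour_iff, fun R hR =>
    (S.kernel_tour hV R).symm ▸ S.isOptimalTour_tour hR⟩

end Selection

end

/-! ### The program for the reduction: the outer points -/

section

variable {N : ℕ} {V : Fin N → Plane} {B : ℕ}

/-- Twice the area of the triangle of three points of the real arrays `40, 41`. -/
def areaE (i j k : IntExpr) : RealExpr :=
  (.load 40 j - .load 40 i) * (.load 41 k - .load 41 i) -
    (.load 41 j - .load 41 i) * (.load 40 k - .load 40 i)

/-- The value of `areaE`. -/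
def Store.area (s : Store) (i j k : ℕ) : ℝ :=
  (s.real 40 j - s.real 40 i) * (s.real 41 k - s.real 41 i) -
    (s.real 41 j - s.real 41 i) * (s.real 40 k - s.real 40 i)

/-- The expression for `dot`. -/
def dotE (i j k : IntExpr) : RealExpr :=
  (.load 40 j - .load 40 i) * (.load 40 k - .load 40 i) +
    (.load 41 j - .load 41 i) * (.load 41 k - .load 41 i)

/-- The value of `dotE`. -/
def Store.dot (s : Store) (i j k : ℕ) : ℝ :=
  (s.real 40 j - s.real 40 i) * (s.real 40 k - s.real 40 i) +
    (s.real 41 j - s.real 41 i) * (s.real 41 k - s.real 41 i)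

@[simp] theorem val_areaE (s : Store) (i j k : IntExpr) :
    (areaE i j k).val s = s.area (i.val s) (j.val s) (k.val s) := rfl

@[simp] theorem val_dotE (s : Store) (i j k : IntExpr) :
    (dotE i j k).val s = s.dot (i.val s) (j.val s) (k.val s) := rfl

/-- The store holds the points of `V` in the real arrays `40, 41`, and their number in `40[0]`. -/
structure Coords (V : Fin N → Plane) (s : Store) : Prop where
  n : s.int 40 0 = N
  x : ∀ i : Fin N, s.real 40 i = V i 0
  y : ∀ i : Fin N, s.real 41 i = V i 1

theorem Coords.area {s : Store} (h : Coords V s) (i j k : Fin N) :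
    s.area i j k = GETSPReduction.area (V i) (V j) (V k) := by
  simp [Store.area, GETSPReduction.area, h.x, h.y]

theorem Coords.dot {s : Store} (h : Coords V s) (i j k : Fin N) :
    s.dot i j k = GETSPReduction.dot (V i) (V j) (V k) := by
  simp [Store.dot, GETSPReduction.dot, h.x, h.y]

theorem Coords.congr {s s' : Store} (h : Coords V s) (h1 : s'.int 40 0 = s.int 40 0)
    (h2 : s'.real 40 = s.real 40) (h3 : s'.real 41 = s.real 41) : Coords V s' :=
  ⟨h1 ▸ h.n, fun i => by rw [h2, h.x], fun i => by rw [h3, h.y]⟩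

theorem Coords.same {s s' : Store} {p : Prog} (h : Coords V s) (hs : Same p s s')
    (hp : (p.wI 40 || p.wR 40 || p.wR 41) = false) : Coords V s' := by
  simp only [Bool.or_eq_false_iff] at hp
  exact h.congr (by rw [hs.1 _ hp.1.1]) (hs.2 _ hp.1.2) (hs.2 _ hp.2)

theorem Coords.setInt {s : Store} (h : Coords V s) {a : ℕ} (ha : 40 ≠ a) (i v : ℕ) :
    Coords V (s.setInt a i v) := h.congr (by rw [Store.setInt_int_ne _ ha]) rfl rfl

/-- Sets the variable `f` to `1` if the test succeeds for some `v < e`, and to `0` otherwise. -/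
def flagLoop (v f : ℕ) (e : IntExpr) (b : BoolExpr) : Prog :=
  .seq (setVar f (.lit 0)) (forLoop v e (.ite b (setVar f (.lit 1)) (setVar f (var f))))

theorem flagLoop_spec {v f : ℕ} {e : IntExpr} {b : BoolExpr} {s : Store} {K : ℕ} {P : ℕ → Prop}
    (hvf : v ≠ f) (hB : 1 ≤ B) (hKB : K ≤ B)
    (hK : ∀ s', Same (flagLoop v f e b) s s' → e.val s' = K)
    (hb : ∀ k < K, ∀ s', Same (flagLoop v f e b) s s' → s'.int v 0 = k → (b.val s' ↔ P k)) :
    Tri B (flagLoop v f e b) s (K * 4 + 3) fun s' =>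
      s'.int f 0 = 0 ↔ ∀ k < K, ¬ P k := by
  have hsub : ∀ s', Same (forLoop v e (.ite b (setVar f (.lit 1)) (setVar f (var f))))
      (s.setInt f 0 0) s' → Same (flagLoop v f e b) s s' := by
    intro s' h
    constructor
    · intro a ha
      simp only [flagLoop, Prog.wI, Bool.or_eq_false_iff] at ha
      rw [h.1 a ha.2, Store.setInt_int_ne]
      simpa using ha.1
    · intro a ha
      simp only [flagLoop, Prog.wR, Bool.or_eq_false_iff] at ha
      rw [h.2 a ha.2]; rfl
  refine (Tri.intSeq (by simp) ((Tri.forLoop (T := 2) (K := K)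
    (fun k s' => s'.int f 0 ≤ 1 ∧ (s'.int f 0 = 0 ↔ ∀ k' < k, ¬ P k'))
    ?_ hKB ?_ ?_ ?_).conseq le_rfl fun s' _ h => h.2)).time (by omega)
  · simp [Prog.wI, hvf]
  · constructor
    · rw [Store.setInt_int_ne _ hvf.symm]; simp
    · rw [Store.setInt_int_ne _ hvf.symm]; simp
  · intro s' h; exact hK s' (hsub s' h)
  · rintro k hk s' hs hv ⟨h1, h2⟩
    have hb' := hb k hk s' (hsub s' hs) hv
    refine Tri.ite (T := 1) (fun h => Tri.int (by simpa using hB) ?_) fun h => Tri.int (by simp; omega) ?_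
    · rw [Store.setInt_int_ne _ hvf.symm]
      simp only [IntExpr.val_lit, Store.setInt_int, and_self, if_true]
      refine ⟨le_rfl, by simp, fun h3 => absurd (hb'.1 h) (h3 k (by omega))⟩
    · rw [Store.setInt_int_ne _ hvf.symm]
      simp only [IntExpr.val_lit, IntExpr.val_load, Store.setInt_int, and_self, if_true]
      refine ⟨h1, h2.trans ⟨fun h3 k' hk' => ?_, fun h3 k' hk' => h3 k' (by omega)⟩⟩
      rcases Nat.lt_succ_iff_lt_or_eq.1 hk' with h4 | h4
      · exact h3 k' h4
      · rw [h4]; exact fun h5 => h (hb'.2 h5)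

/-- The real number zero. -/
abbrev zeroE : RealExpr := .ofInt (.lit 0)

/-- Copies the points to the arrays `40, 41`. -/
def copyPoints : Prog :=
  .seq (setVar 40 (var 0)) (forLoop 50 (var 40)
    (.seq (.realStore 40 (var 50) (.load 0 (var 50))) (.realStore 41 (var 50) (.load 1 (var 50)))))

theorem copyPoints_spec {s : Store} (hN : s.int 0 0 = N) (hB : N ≤ B)
    (hx : ∀ i : Fin N, s.real 0 i = V i 0) (hy : ∀ i : Fin N, s.real 1 i = V i 1) :
    Tri B copyPoints s (N * 4 + 3) fun s' => Coords V s' := by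
  refine (Tri.intSeq (by simpa [hN] using hB) ((Tri.forLoop (T := 2) (K := N)
    (fun k s' => s'.int 40 0 = N ∧ ∀ i : Fin N, (i : ℕ) < k → s'.real 40 i = V i 0 ∧ s'.real 41 i = V i 1)
    rfl hB ?_ ?_ ?_).conseq le_rfl fun s' _ h => ⟨h.1, fun i => (h.2 i i.2).1,
      fun i => (h.2 i i.2).2⟩)).time (by omega)
  · exact ⟨by simp [hN], fun i hi => by omega⟩
  · intro s' hs; simp [hs.1 40 rfl, hN]
  · rintro k hk s' hs hv ⟨h1, h2⟩
    refine Tri.realSeq (Tri.real ⟨by simp [h1], fun i hi => ?_⟩)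
    have e0 : s'.real 0 = s.real 0 := hs.2 0 rfl
    have e1 : s'.real 1 = s.real 1 := hs.2 1 rfl
    by_cases hik : (i : ℕ) = k
    · simp [hv, ← hik, e0, e1, hx, hy]
    · have := h2 i (by omega)
      simp [hv, hik, this]

/-- Sets the variable `41` to `0` if all points are on one line. -/
def testLine : Prog :=
  flagLoop 50 41 (var 40) (.not (.and (.realLe (areaE (.lit 0) (.lit 1) (var 50)) zeroE)
    (.realLe zeroE (areaE (.lit 0) (.lit 1) (var 50)))))

theorem testLine_spec (hV : Function.Injective V) {s : Store} (h : Coords V s) (hB : N + 1 ≤ B) :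
    Tri B testLine s (N * 4 + 3) fun s' => s'.int 41 0 = 0 ↔ OneLine V := by
  refine (flagLoop_spec (K := N) (P := fun k => s.area 0 1 k ≠ 0) (by decide) (by omega) (by omega)
    ?_ ?_).conseq le_rfl ?_
  · intro s' hs; simp [hs.1 40 rfl, h.n]
  · intro k hk s' hs hv
    have e : s'.area = s.area := by
      funext i j k; simp only [Store.area]; rw [hs.2 40 rfl, hs.2 41 rfl]
    simp [hv, e, le_antisymm_iff]
  · intro s' _ hf
    rw [hf]
    constructor
    · intro h0
      rcases Nat.lt_or_ge 1 N with hN | hN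
      · have h1 : ∀ k : Fin N, area (V ⟨0, by omega⟩) (V ⟨1, hN⟩) (V k) = 0 := by
          intro k
          rw [← h.area]
          exact not_not.1 (h0 k k.2)
        have hne : V ⟨1, hN⟩ ≠ V ⟨0, by omega⟩ := hV.ne (by simp)
        exact fun i j k => area_eq_of_collinear hne (h1 i) (h1 j) (h1 k)
      · intro i j k
        have : j = i := Fin.ext (by omega)
        rw [this]; unfold area; ring
    · intro h0 k hk
      rw [not_not]
      rcases Nat.lt_or_ge 1 N with hN | hN
      · have := h.area ⟨0, by omega⟩ ⟨1, hN⟩ ⟨k, hk⟩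
        rw [h0] at this
        exact this
      · obtain rfl : k = 0 := by omega
        unfold Store.area; ring

/-- The pair `i, j` of numbers is a step along the hull. -/
def StepN (V : Fin N → Plane) (i j : ℕ) : Prop :=
  ∃ (hi : i < N) (hj : j < N), HullStep V ⟨i, hi⟩ ⟨j, hj⟩

/-- Tests that the point `k` shows that `j` is not the successor of `i` on the hull. -/
def notStepE (i j k : IntExpr) : BoolExpr :=
  .and (.not (.and (.intLe k i) (.intLe i k)))
    (.not (.and (.realLe zeroE (areaE i j k))
      (.not (.and (.realLe (areaE i j k) zeroE) (.and (.realLe zeroE (dotE i j k))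
        (.not (.realLe (dotE i j j) (dotE i j k))))))))

theorem val_notStepE {s : Store} {i j k : IntExpr} (h : Coords V s) {a b c : Fin N}
    (ha : i.val s = a) (hb : j.val s = b) (hc : k.val s = c) :
    (notStepE i j k).val s ↔ ¬ (c ≠ a → 0 ≤ area (V a) (V b) (V c) ∧ (area (V a) (V b) (V c) = 0 →
    dot (V a) (V b) (V c) < 0 ∨ dot (V a) (V b) (V b) ≤ dot (V a) (V b) (V c))) := by
  simp only [notStepE, BoolExpr.val_and, BoolExpr.val_not, BoolExpr.val_intLe, BoolExpr.val_realLe,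
    val_areaE, val_dotE, RealExpr.val_ofInt, IntExpr.val_lit, Nat.cast_zero, ha, hb, hc, h.area,
    h.dot]
  have e1 : ((c : ℕ) ≤ a ∧ (a : ℕ) ≤ c) ↔ c = a := by rw [← le_antisymm_iff, Fin.ext_iff]
  have e2 : area (V a) (V b) (V c) = 0 ↔
      area (V a) (V b) (V c) ≤ 0 ∧ 0 ≤ area (V a) (V b) (V c) := le_antisymm_iff
  rw [e1, e2, ← not_le (a := (0 : ℝ)) (b := dot (V a) (V b) (V c))]
  tauto

/-- Sets the cells `42[i]` to a successor of `i` on the hull, or to the number of points if there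
is none. -/
def findSteps : Prog :=
  forLoop 50 (var 40) (.seq (.intStore 42 (var 50) (var 40)) (forLoop 51 (var 40)
    (.seq (flagLoop 52 53 (var 40) (notStepE (var 50) (var 51) (var 52)))
      (.ite (.and (.not (.and (.intLe (var 51) (var 50)) (.intLe (var 50) (var 51))))
          (.intLe (var 53) (.lit 0)))
        (.intStore 42 (var 50) (var 51)) (.intStore 42 (var 50) (.load 42 (var 50)))))))

/-- The cell is the number of a successor of `i` among the first `J` points, or `N`. -/
def StepCell (V : Fin N → Plane) (J i c : ℕ) : Prop :=
  (c = N ∧ ∀ j < J, ¬ StepN V i j) ∨ StepN V i c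

theorem findSteps_spec {s : Store} (h : Coords V s) (hB : N + 1 ≤ B) :
    Tri B findSteps s (N * (N * (N * 4 + 7) + 5) + 2) fun s' =>
      ∀ i < N, StepCell V N i (s'.int 42 i) := by
  refine (Tri.forLoop (T := N * (N * 4 + 7) + 3) (K := N)
    (fun I s' => ∀ i < I, StepCell V N i (s'.int 42 i)) rfl (by omega) (by intro i hi; omega)
    (fun s' hs => by simp [(h.same hs rfl).n]) ?_).time (by nlinarith)
  intro i hi s' hs hv hI
  have hc' := h.same hs rfl
  refine (Tri.intSeq (by simp [hc'.n]; omega) ((Tri.forLoop (T := N * 4 + 5) (K := N)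
    (fun J s'' => s''.int 50 0 = i ∧ (∀ i' < i, StepCell V N i' (s''.int 42 i')) ∧
      StepCell V J i (s''.int 42 i)) rfl (by omega) ⟨?_, ?_, ?_⟩ ?_ ?_).conseq le_rfl ?_)).time
      (by nlinarith)
  · simp [hv]
  · intro i' hi'
    simpa [hv, hi'.ne] using hI i' hi'
  · left
    simp [hv, hc'.n]
  · intro s'' hs''
    simp [((hc'.setInt (by decide) _ _).same hs'' rfl).n]
  · rintro j hj s₁ hs₁ hv₁ ⟨h1, h2, h3⟩
    have hc₁ := (hc'.setInt (by decide : 40 ≠ 42) _ _).same hs₁ rfl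
    refine (Tri.seq (flagLoop_spec (K := N) (P := fun k => ∃ hk : k < N, ¬
        ((⟨k, hk⟩ : Fin N) ≠ ⟨i, hi⟩ → 0 ≤ area (V ⟨i, hi⟩) (V ⟨j, hj⟩) (V ⟨k, hk⟩) ∧
        (area (V ⟨i, hi⟩) (V ⟨j, hj⟩) (V ⟨k, hk⟩) = 0 →
        dot (V ⟨i, hi⟩) (V ⟨j, hj⟩) (V ⟨k, hk⟩) < 0 ∨ dot (V ⟨i, hi⟩) (V ⟨j, hj⟩) (V ⟨j, hj⟩) ≤
          dot (V ⟨i, hi⟩) (V ⟨j, hj⟩) (V ⟨k, hk⟩)))) (by decide) (by omega) (by omega) ?_ ?_)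
      (T₂ := 2) ?_).time (by omega)
    · intro s₂ hs₂
      simp [(hc₁.same hs₂ rfl).n]
    · intro k hk s₂ hs₂ hv₂
      rw [val_notStepE (hc₁.same hs₂ rfl) (a := ⟨i, hi⟩) (b := ⟨j, hj⟩) (c := ⟨k, hk⟩)
        (by simp [hs₂.1 50 rfl, h1]) (by simp [hs₂.1 51 rfl, hv₁]) (by simp [hv₂])]
      exact ⟨fun h => ⟨hk, h⟩, fun ⟨_, h⟩ => h⟩
    · intro s₂ hs₂ hf
      have e1 : s₂.int 50 0 = i := by rw [hs₂.1 50 rfl, h1]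
      have e2 : s₂.int 51 0 = j := by rw [hs₂.1 51 rfl, hv₁]
      have e3 : s₂.int 42 = s₁.int 42 := hs₂.1 42 rfl
      have hstep : (j ≠ i ∧ s₂.int 53 0 = 0) ↔ StepN V i j := by
        rw [hf]
        constructor
        · rintro ⟨g1, g2⟩
          exact ⟨hi, hj, fun e => g1 (congrArg Fin.val e), fun k hk =>
            not_not.1 (fun hn => g2 k k.2 ⟨k.2, hn⟩) hk⟩
        · rintro ⟨_, _, g1, g2⟩
          exact ⟨fun e => g1 (Fin.ext e), fun k _ ⟨hk, hn⟩ => hn fun hki => g2 ⟨k, hk⟩ hki⟩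
      refine Tri.ite (T := 1) (fun hb => Tri.int (by simp [e2]; omega) ?_)
        fun hb => Tri.int ?_ ?_
      · have hs : StepN V i j := by
          rw [← hstep]
          simp only [BoolExpr.val_and, BoolExpr.val_not, BoolExpr.val_intLe, IntExpr.val_load,
            IntExpr.val_lit, e1, e2] at hb
          omega
        refine ⟨by simp [e1], fun i' hi' => ?_, ?_⟩
        · simpa [e1, hi'.ne, e3] using h2 i' hi'
        · right; simpa [e1, e2] using hs
      · have : s₁.int 42 i ≤ N := by
          rcases h3 with h3 | ⟨_, h3, _⟩
          · exact h3.1.le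
          · exact h3.le
        simp [e1, e3]; omega
      · have hs : ¬ StepN V i j := by
          rw [← hstep]
          simp only [BoolExpr.val_and, BoolExpr.val_not, BoolExpr.val_intLe, IntExpr.val_load,
            IntExpr.val_lit, e1, e2] at hb
          omega
        refine ⟨by simp [e1], fun i' hi' => ?_, ?_⟩
        · simpa [e1, hi'.ne, e3] using h2 i' hi'
        · simp only [Store.setInt_int, IntExpr.val_load, IntExpr.val_lit, e1, e3]
          norm_num
          rcases h3 with h3 | h3
          · refine Or.inl ⟨h3.1, fun j' hj' => ?_⟩
            rcases Nat.lt_succ_iff_lt_or_eq.1 hj' with h4 | h4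
            · exact h3.2 j' h4
            · rw [h4]; exact hs
          · exact Or.inr h3
  · rintro s'' _ ⟨h1, h2, h3⟩ i' hi'
    simp only [Store.setInt_int]
    norm_num
    rcases Nat.lt_succ_iff_lt_or_eq.1 hi' with h4 | h4
    · exact h2 i' h4
    · rw [h4]; exact h3

end

section

variable {N : ℕ} {V : Fin N → Plane} {B : ℕ}

/-- The array starts with the entries of the list. -/
def Listed (f : ℕ → ℕ) (l : List ℕ) : Prop := ∀ j (h : j < l.length), f j = l[j]

theorem Listed.concat {f f' : ℕ → ℕ} {l : List ℕ} {a : ℕ} (h : Listed f l)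
    (h1 : ∀ j < l.length, f' j = f j) (h2 : f' l.length = a) : Listed f' (l ++ [a]) := by
  intro j hj
  rw [List.length_append, List.length_singleton] at hj
  rcases Nat.lt_succ_iff_lt_or_eq.1 hj with h3 | h3
  · rw [List.getElem_append_left h3, h1 j h3, h j h3]
  · subst h3; simp [h2]

theorem exists_map_val {l : List ℕ} (h : ∀ i ∈ l, i < N) : ∃ L : List (Fin N), L.map Fin.val = l := by
  have : l ∈ Set.range (List.map (Fin.val : Fin N → ℕ)) := by
    rw [Set.range_list_map]
    exact fun i hi => ⟨⟨i, h i hi⟩, rfl⟩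
  exact this

/-- The store holds the inner points, an order of the outer points in which some optimal tour
visits them, and their numbers. The list of the outer points is closed by its first entry. -/
def HasOrder (V : Fin N → Plane) (s : Store) (idx : Fin (innerCount V) → Fin N)
    (x : Fin (N - innerCount V) → Fin N) : Prop :=
  s.int 43 0 = innerCount V ∧ s.int 45 0 = N - innerCount V ∧ (∀ v : Fin _, s.int 44 v = idx v) ∧
    ∀ i : Fin _, s.int 48 i = x i ∧ s.int 48 (i + 1) = x (finRotate _ i)

/-- The order of the points in the store is suitable for a reduction. -/
def IsOrder (V : Fin N → Plane) (idx : Fin (innerCount V) → Fin N)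
    (x : Fin (N - innerCount V) → Fin N) : Prop :=
  Function.Injective idx ∧ Set.range idx = innerSet V ∧ OptOrder V (List.ofFn x)

theorem exists_hasOrder {s : Store} {L y : List (Fin N)} (hL : L.Nodup)
    (hLm : ∀ i, i ∈ L ↔ i ∈ innerSet V) (hy : OptOrder V y) (h1 : s.int 43 0 = L.length)
    (h2 : s.int 45 0 = y.length) (h3 : Listed (s.int 44) (L.map Fin.val))
    (h4 : Listed (s.int 48) (y.map Fin.val)) (h5 : s.int 48 y.length = s.int 48 0) :
    ∃ idx x, HasOrder V s idx x ∧ IsOrder V idx x := by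
  have hk : innerCount V = L.length := by
    classical
    rw [innerCount, ← List.toFinset_card_of_nodup hL, ← Set.ncard_coe_finset]
    congr 1
    ext i; simp [hLm]
  have hM := hy.length_eq
  refine ⟨fun v => L[(v : ℕ)]'(hk ▸ v.2), fun i => y[(i : ℕ)]'(by have := i.2; omega), ⟨h1.trans hk.symm,
    h2.trans hM, fun v => ?_, fun i => ⟨?_, ?_⟩⟩, ?_, ?_, ?_⟩
  · rw [h3 v (by have := v.2; simp; omega)]; simp
  · rw [h4 i (by have := i.2; simp; omega)]; simp
  · have e : s.int 48 (i + 1) = s.int 48 (finRotate _ i : Fin _) := by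
      rw [finRotate_val]
      rcases Nat.lt_or_ge (i + 1 : ℕ) (N - innerCount V) with h | h
      · rw [Nat.mod_eq_of_lt h]
      · have e' : (i + 1 : ℕ) = N - innerCount V := by omega
        rw [e', Nat.mod_self, ← hM, h5]
    rw [e, h4 _ (by have := (finRotate _ i).2; rw [List.length_map]; omega)]; simp
  · intro a b hab
    exact Fin.ext ((List.Nodup.getElem_inj_iff hL).1 hab)
  · ext i
    rw [← hLm, List.mem_iff_getElem]
    constructor
    · rintro ⟨v, rfl⟩
      exact ⟨v, hk ▸ v.2, rfl⟩
    · rintro ⟨j, hj, rfl⟩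
      exact ⟨⟨j, hk.symm ▸ hj⟩, rfl⟩
  · convert hy
    exact List.ext_getElem (by simp [hM]) (by simp)

/-- Lists the inner points, which have no successor on the hull, in the array `44`, and finds an
outer point. -/
def listInner : Prog :=
  .seq (setVar 43 (.lit 0)) (.seq (forLoop 50 (var 40) (.ite (.intLe (var 40) (.load 42 (var 50)))
    (.seq (.intStore 44 (var 43) (var 50)) (setVar 43 (var 43 + .lit 1)))
    (setVar 47 (var 50)))) (setVar 45 (var 40 - var 43)))

theorem listInner_spec {s : Store} (h : s.int 40 0 = N) (hB : N + 1 ≤ B)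
    : Tri B listInner s (N * 5 + 4) fun s' =>
      s'.int 43 0 = ((List.range N).filter (N ≤ s.int 42 ·)).length ∧
      Listed (s'.int 44) ((List.range N).filter (N ≤ s.int 42 ·)) ∧
      s'.int 45 0 = N - s'.int 43 0 ∧
      ∀ i < N, s.int 42 i < N → s'.int 47 0 < N ∧ s.int 42 (s'.int 47 0) < N := by
  set L : ℕ → List ℕ := fun k => (List.range k).filter (N ≤ s.int 42 ·) with hL
  have hLl : ∀ k, (L k).length ≤ k := fun k => (List.length_filter_le _ _).trans (by simp)
  have hLs : ∀ k, L (k + 1) = L k ++ if N ≤ s.int 42 k then [k] else [] := by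
    intro k
    simp only [hL, List.range_succ, List.filter_append]
    congr 1
    split_ifs with h <;> simp [h]
  refine (Tri.intSeq (by simp) (Tri.seq (T₂ := 1) (Tri.forLoop (T := 3) (K := N) (fun k s' =>
    s'.int 43 0 = (L k).length ∧ Listed (s'.int 44) (L k) ∧
    ∀ i < k, s.int 42 i < N → s'.int 47 0 < N ∧ s.int 42 (s'.int 47 0) < N) rfl (by omega)
    ⟨?_, ?_, ?_⟩ ?_ ?_) ?_)).time (by omega)
  · simp [hL]
  · intro j hj; simp [hL] at hj
  · intro i hi; omega
  · intro s' hs'; simp [hs'.1 40 rfl, h]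
  · rintro k hk s' hs' hv ⟨h1, h2, h3⟩
    have e40 : s'.int 40 0 = N := by rw [hs'.1 40 rfl]; simpa using h
    have e42 : s'.int 42 = s.int 42 := by rw [hs'.1 42 rfl]; funext j; simp
    have hl := hLl k
    refine (Tri.ite (T := 2) (fun hb => ?_) fun hb => ?_).time le_rfl
    · simp only [BoolExpr.val_intLe, IntExpr.val_load, IntExpr.val_lit, e40, e42, hv] at hb
      refine (Tri.intSeq (by simp [hv]; omega) (Tri.int (by simp [h1]; omega) ⟨?_, ?_, ?_⟩)).time
        (by omega)
      · rw [hLs, if_pos hb]; simp [h1]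
      · rw [hLs, if_pos hb]
        refine h2.concat (fun j hj => ?_) ?_
        · simp [h1, hj.ne]
        · simp [h1, hv]
      · intro i hi hi'
        simp
        rcases Nat.lt_succ_iff_lt_or_eq.1 hi with h4 | h4
        · exact h3 i h4 hi'
        · rw [h4] at hi'; omega
    · simp only [BoolExpr.val_intLe, IntExpr.val_load, IntExpr.val_lit, e40, e42, hv] at hb
      refine (Tri.int (by simp [hv]; omega) ⟨?_, ?_, ?_⟩).time (by omega)
      · rw [hLs, if_neg hb]; simp [h1]
      · rw [hLs, if_neg hb, List.append_nil]
        intro j hj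
        simp [h2 j hj]
      · intro i hi hi'
        simp [hv]
        exact ⟨hk, by omega⟩
  · rintro s' hs' ⟨h1, h2, h3⟩
    have e40 : s'.int 40 0 = N := by rw [hs'.1 40 rfl]; simpa using h
    have := hLl N
    refine Tri.int (by simp [e40]; omega) ⟨by simpa using h1, ?_, by simp [e40], by simpa using h3⟩
    intro j hj
    rw [Store.setInt_int_ne _ (by decide)]
    exact h2 j hj

/-- Lists the outer points in the array `48`, by walking along the hull. -/
def walkHull : Prog :=
  .seq (.intStore 48 (.lit 0) (var 47)) (forLoop 51 (var 45)
    (.intStore 48 (var 51 + .lit 1) (.load 42 (.load 48 (var 51)))))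

theorem walkHull_spec {s : Store} {M : ℕ} (h : s.int 45 0 = M) (hM : M ≤ B)
    (hb : ∀ t, (s.int 42)^[t] (s.int 47 0) ≤ B) : Tri B walkHull s (M * 3 + 3) fun s' =>
      ∀ t ≤ M, s'.int 48 t = (s.int 42)^[t] (s.int 47 0) := by
  refine (Tri.intSeq (by simpa using hb 0) (Tri.forLoop (T := 1) (K := M) (fun k s' =>
    ∀ t ≤ k, s'.int 48 t = (s.int 42)^[t] (s.int 47 0)) rfl hM ?_ ?_ ?_)).time (by omega)
  · intro t ht
    obtain rfl : t = 0 := by omega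
    simp
  · intro s' hs'; simp [hs'.1 45 rfl, h]
  · rintro k hk s' hs' hv hI
    have e42 : s'.int 42 = s.int 42 := by rw [hs'.1 42 rfl]; funext j; simp
    have hnext : s.int 42 (s'.int 48 k) = (s.int 42)^[k + 1] (s.int 47 0) := by
      rw [hI k le_rfl, Function.iterate_succ_apply']
    have hb' := hb (k + 1)
    rw [← hnext] at hb'
    refine Tri.int (by simpa [hv, e42] using hb') ?_
    intro t ht
    rcases Nat.le_succ_iff.1 ht with h4 | h4
    · have hne : t ≠ k + 1 := by omega
      simpa [hv, hne] using hI t h4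
    · subst h4
      simpa [hv, e42] using hnext

/-- The order of the outer points of points that are not on one line. -/
def hullOrder : Prog := .seq findSteps (.seq listInner walkHull)

/-- What the programs for the order of the outer points achieve. -/
def OrderLists (V : Fin N → Plane) (s : Store) : Prop :=
  ∃ L y : List (Fin N), L.Nodup ∧ (∀ i, i ∈ L ↔ i ∈ innerSet V) ∧ OptOrder V y ∧
    s.int 43 0 = L.length ∧ s.int 45 0 = y.length ∧ Listed (s.int 44) (L.map Fin.val) ∧
    Listed (s.int 48) (y.map Fin.val)

/-- The points without a successor are the inner points, and repeated steps to the successor visit all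
outer points. -/
theorem hullOrder_spec (hV : Function.Injective V) (hL : ¬ OneLine V) {s : Store}
    (h : Coords V s) (hB : N + 1 ≤ B) :
    Tri B hullOrder s (N * (N * (N * 4 + 7) + 5) + 2 + (N * 5 + 4 + (N * 3 + 3))) fun s' =>
      OrderLists V s' := by
  have hN : 0 < N := by
    by_contra hN
    exact hL fun i => absurd i.2 (by omega)
  refine Tri.seq (findSteps_spec h hB) fun s₁ hs₁ h1 => ?_
  have hc₁ := h.same hs₁ rfl
  have hlt : ∀ i (hi : i < N), s₁.int 42 i < N ↔ (⟨i, hi⟩ : Fin N) ∉ innerSet V := by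
    intro i hi
    rw [← exists_hullStep_iff hV hL]
    rcases h1 i hi with ⟨h2, h3⟩ | ⟨h2, h3, h4⟩
    · rw [h2]
      refine ⟨fun h => absurd h (lt_irrefl _), fun ⟨j, hj⟩ => absurd ⟨hi, j.2, hj⟩ (h3 j j.2)⟩
    · exact ⟨fun _ => ⟨_, h4⟩, fun _ => h3⟩
  have hstep : ∀ i (hi : i < N) (h2 : s₁.int 42 i < N), HullStep V ⟨i, hi⟩ ⟨s₁.int 42 i, h2⟩ := by
    intro i hi h2
    rcases h1 i hi with ⟨h3, -⟩ | ⟨_, _, h4⟩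
    · omega
    · exact h4
  refine Tri.seq (listInner_spec hc₁.n hB) fun s₂ hs₂ h2 => ?_
  obtain ⟨h43, h44, h45, h47⟩ := h2
  have e42 : s₂.int 42 = s₁.int 42 := hs₂.1 42 rfl
  obtain ⟨i₀, hi₀⟩ := exists_notMem_innerSet (V := V) hN
  obtain ⟨hst, hst'⟩ := h47 i₀ i₀.2 ((hlt i₀ i₀.2).2 hi₀)
  have hit : ∀ t, (s₁.int 42)^[t] (s₂.int 47 0) < N ∧
      s₁.int 42 ((s₁.int 42)^[t] (s₂.int 47 0)) < N := by
    intro t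
    induction t with
    | zero => exact ⟨hst, hst'⟩
    | succ t ih =>
      rw [Function.iterate_succ_apply']
      exact ⟨ih.2, (hlt _ ih.2).2 ((hstep _ ih.1 ih.2).onHull hV).2.notMem⟩
  have hM : s₂.int 45 0 ≤ N := by rw [h45]; omega
  refine ((walkHull_spec rfl (by omega) (fun t => by
    rw [e42]; have := (hit t).1; omega)).conseq (by omega) ?_)
  rintro s₃ hs₃ h48
  rw [e42] at h48
  obtain ⟨L, hLv⟩ := exists_map_val (N := N)
    (l := (List.range N).filter (N ≤ s₁.int 42 ·)) (by
      intro i hi; simpa using List.mem_of_mem_filter hi)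
  have hLn : L.Nodup := by
    apply List.Nodup.of_map Fin.val
    rw [hLv]; exact List.nodup_range.filter _
  have hLm : ∀ i, i ∈ L ↔ i ∈ innerSet V := by
    intro i
    have : i ∈ L ↔ (i : ℕ) ∈ L.map Fin.val := by simp [Fin.val_inj]
    rw [this, hLv, List.mem_filter]
    have := hlt i i.2
    simp only [List.mem_range, i.2, true_and, decide_eq_true_eq, ← not_lt]
    rw [this, not_not]
  have hlen : L.length = s₂.int 43 0 := by rw [h43, ← hLv, List.length_map]
  have hopt := optOrder_of_hullStep hV hL
    (x := fun t => ⟨(s₁.int 42)^[t] (s₂.int 47 0), (hit t).1⟩) fun t => by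
      have := hstep _ (hit t).1 (hit t).2
      simp only [Function.iterate_succ_apply']
      exact this
  have hk : innerCount V = s₂.int 43 0 := by
    classical
    rw [← hlen, innerCount, ← List.toFinset_card_of_nodup hLn, ← Set.ncard_coe_finset]
    congr 1
    ext i; simp [hLm]
  refine ⟨L, _, hLn, hLm, hopt, ?_, ?_, ?_, ?_⟩
  · rw [hs₃.1 43 rfl, hlen]
  · rw [hs₃.1 45 rfl, h45, hk]; simp
  · rw [hs₃.1 44 rfl, hLv]; exact h44
  · intro j hj
    rw [List.length_map, List.length_map, List.length_range] at hj
    rw [h48 j (by rw [h45, ← hk]; exact hj.le)]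
    simp

/-- The order of points on one line: the number of points on the left of a point is its position. -/
def lineOrder : Prog :=
  .seq (setVar 43 (.lit 0)) (.seq (setVar 45 (var 40)) (forLoop 50 (var 40)
    (.seq (setVar 54 (.lit 0)) (.seq (forLoop 51 (var 40)
      (.ite (.realLe (dotE (.lit 0) (.lit 1) (var 50)) (dotE (.lit 0) (.lit 1) (var 51)))
        (setVar 54 (var 54)) (setVar 54 (var 54 + .lit 1))))
      (.intStore 48 (var 54) (var 50))))))

/-- The number of indices with a smaller key. -/
noncomputable def rank (τ : ℕ → ℝ) (K i : ℕ) : ℕ :=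
  ((Finset.range K).filter fun k => τ k < τ i).card

theorem rank_le (τ : ℕ → ℝ) (K i : ℕ) : rank τ K i ≤ K :=
  (Finset.card_filter_le _ _).trans (by simp)

theorem rank_succ (τ : ℕ → ℝ) (K i : ℕ) :
    rank τ (K + 1) i = rank τ K i + if τ K < τ i then 1 else 0 := by
  unfold rank
  rw [Finset.range_add_one, Finset.filter_insert]
  split_ifs with h
  · rw [Finset.card_insert_of_notMem (by simp)]
  · rfl

theorem rank_lt_rank {τ : ℕ → ℝ} {K i j : ℕ} (hi : i < K) (h : τ i < τ j) :
    rank τ K i < rank τ K j := by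
  refine Finset.card_lt_card ((Finset.ssubset_iff_of_subset ?_).2 ⟨i, by simp [hi, h], by simp⟩)
  intro k hk
  simp only [Finset.mem_filter] at hk ⊢
  exact ⟨hk.1, hk.2.trans h⟩

theorem rank_lt {τ : ℕ → ℝ} {K i : ℕ} (hi : i < K) : rank τ K i < K := by
  have : rank τ K i < (Finset.range K).card :=
    Finset.card_lt_card ((Finset.ssubset_iff_of_subset (Finset.filter_subset _ _)).2
      ⟨i, by simp [hi], by simp⟩)
  simpa using this

/-- The points are sorted by counting, for each point, the points that precede it on the line. -/
theorem lineOrder_spec {s : Store} (h : Coords V s) (hB : N + 1 ≤ B)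
    (hinj : ∀ i < N, ∀ j < N, s.dot 0 1 i = s.dot 0 1 j → i = j) :
    Tri B lineOrder s (N * (N * 4 + 6) + 4) fun s' => s'.int 43 0 = 0 ∧ s'.int 45 0 = N ∧
      ∀ i < N, s'.int 48 (rank (s.dot 0 1) N i) = i := by
  set τ := s.dot 0 1 with hτ
  have hrinj : ∀ i < N, ∀ j < N, rank τ N i = rank τ N j → i = j := by
    intro i hi j hj hij
    rcases lt_trichotomy (τ i) (τ j) with h | h | h
    · exact absurd hij (rank_lt_rank hi h).ne
    · exact hinj i hi j hj h
    · exact absurd hij (rank_lt_rank hj h).ne'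
  have hdot : ∀ s' : Store, s'.real = s.real → s'.dot = s.dot := by
    intro s' hs; funext i j k; simp only [Store.dot, hs]
  have hreal : ∀ {p : Prog} {s₁ s₂ : Store}, Same p s₁ s₂ → (∀ a, p.wR a = false) →
      s₂.real = s₁.real := fun hs hp => funext fun a => hs.2 a (hp a)
  refine (Tri.intSeq (by simp) (Tri.intSeq (by simp [h.n]; omega) ((Tri.forLoop (T := N * 4 + 4)
    (K := N) (fun k s' => s'.real = s.real ∧ s'.int 43 0 = 0 ∧ s'.int 45 0 = N ∧
    ∀ i < k, s'.int 48 (rank τ N i) = i) rfl (by omega)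
    ⟨by simp, by simp, by simp [h.n], by intro i hi; omega⟩ ?_ ?_).conseq le_rfl
      fun s' _ h => h.2))).time (by nlinarith)
  · intro s' hs'; simp [hs'.1 40 rfl, h.n]
  · rintro i hi s₁ hs₁ hv₁ ⟨h1, h2, h3, h4⟩
    have e40 : s₁.int 40 0 = N := by rw [hs₁.1 40 rfl]; simpa using h.n
    refine (Tri.intSeq (by simp) (Tri.seq (T₂ := 1) (Tri.forLoop (T := 2) (K := N)
      (fun k s' => s'.int 54 0 = rank τ k i) rfl (by omega)
      ?_ ?_ ?_) ?_)).time (by omega)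
    · simp [rank]
    · intro s' hs'; simp [hs'.1 40 rfl, e40]
    · rintro k hk s₂ hs₂ hv₂ h5
      have ed : s₂.dot = s.dot := hdot s₂ (by
        rw [hreal hs₂ (fun a => by simp [forLoop, Prog.wR])]; simpa using h1)
      have e50 : s₂.int 50 0 = i := by rw [hs₂.1 50 rfl]; simpa using hv₁
      have := rank_le τ k i
      refine Tri.ite (T := 1) (fun hb => Tri.int (by simp [h5]; omega) ?_) fun hb =>
        Tri.int (by simp [h5]; omega) ?_
      · simp only [BoolExpr.val_realLe, val_dotE, IntExpr.val_lit, IntExpr.val_load, ed, e50,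
          hv₂, ← hτ] at hb
        simp [h5, rank_succ, not_lt.2 hb]
      · simp only [BoolExpr.val_realLe, val_dotE, IntExpr.val_lit, IntExpr.val_load, ed, e50,
          hv₂, ← hτ, not_le] at hb
        simp [h5, rank_succ, hb]
    · rintro s₂ hs₂ h5
      have e50 : s₂.int 50 0 = i := by rw [hs₂.1 50 rfl]; simpa using hv₁
      refine Tri.int (by simp [e50]; omega) ⟨?_, ?_, ?_, ?_⟩
      · simp only [Store.setInt_real]
        rw [hreal hs₂ (fun a => by simp [forLoop, Prog.wR])]; simpa using h1
      · simp [hs₂.1 43 rfl, h2]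
      · simp [hs₂.1 45 rfl, h3]
      · intro i' hi'
        rcases Nat.lt_succ_iff_lt_or_eq.1 hi' with h6 | h6
        · have hne : rank τ N i' ≠ rank τ N i := fun e =>
            absurd (hrinj i' (by omega) i hi e) (by omega)
          simpa [h5, e50, hne, hs₂.1 48 rfl] using h4 i' h6
        · subst h6
          simp [h5, e50]

theorem lineOrder_lists (hV : Function.Injective V) (hL : OneLine V) {s : Store}
    (h : Coords V s) (hB : N + 1 ≤ B) :
    Tri B lineOrder s (N * (N * 4 + 6) + 4) fun s' => OrderLists V s' := by
  have hτ : ∀ (hN : 1 < N) (i : Fin N), s.dot 0 1 i = dot (V ⟨0, by omega⟩) (V ⟨1, hN⟩) (V i) :=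
    fun hN i => h.dot ⟨0, by omega⟩ ⟨1, hN⟩ i
  have hinj : ∀ i < N, ∀ j < N, s.dot 0 1 i = s.dot 0 1 j → i = j := by
    intro i hi j hj hij
    rcases Nat.lt_or_ge 1 N with hN | hN
    · have h1 := hτ hN ⟨i, hi⟩
      have h2 := hτ hN ⟨j, hj⟩
      simp only at h1 h2
      have hne : V ⟨1, hN⟩ ≠ V ⟨0, by omega⟩ := hV.ne (by simp)
      have e1 := hL.eq_line hne ⟨i, hi⟩
      rw [← h1, hij, h2, ← hL.eq_line hne ⟨j, hj⟩] at e1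
      exact congrArg Fin.val (hV e1)
    · omega
  refine (lineOrder_spec h hB hinj).conseq le_rfl ?_
  rintro s' _ ⟨h1, h2, h3⟩
  set τ := s.dot 0 1 with hτd
  have hrinj : Function.Injective fun i : Fin N => (⟨rank τ N i, rank_lt i.2⟩ : Fin N) := by
    intro i j hij
    have hij' : rank τ N i = rank τ N j := congrArg Fin.val hij
    rcases lt_trichotomy (τ i) (τ j) with h | h | h
    · exact absurd hij' (rank_lt_rank i.2 h).ne
    · exact Fin.ext (hinj i i.2 j j.2 h)
    · exact absurd hij' (rank_lt_rank j.2 h).ne'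
  obtain ⟨x, hx⟩ := (Finite.surjective_of_injective hrinj).hasRightInverse
  have hxr : ∀ r, rank τ N (x r) = r := fun r => congrArg Fin.val (hx r)
  have htour : IsTour (List.ofFn x) := by
    refine ⟨List.nodup_ofFn.2 hx.injective, fun i => ?_⟩
    rw [List.mem_ofFn']
    exact ⟨_, hrinj (hx _)⟩
  have hopt : OptOrder V (List.ofFn x) := by
    rcases Nat.lt_or_ge 1 N with hN | hN
    · refine optOrder_of_oneLine hV hL (a := ⟨0, by omega⟩) (b := ⟨1, hN⟩) (by simp) htour ?_
      rw [List.pairwise_ofFn]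
      intro r r' hrr
      rw [← hτ hN, ← hτ hN]
      by_contra hc
      rcases (not_lt.1 hc).eq_or_lt with h4 | h4
      · have h5 : x r' = x r := Fin.ext (hinj _ (x r').2 _ (x r).2 h4)
        rw [hx.injective h5] at hrr
        exact lt_irrefl _ hrr
      · have := rank_lt_rank (K := N) (x r').2 h4
        rw [hxr, hxr] at this
        exact absurd hrr (not_lt.2 (Fin.mk_le_mk.2 this.le))
    · obtain ⟨l, hl⟩ := exists_isOptimalTour V
      have hp := htour.perm hl.1
      have hlen : (List.ofFn x).length ≤ 1 := by simpa using hN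
      have he : List.ofFn x = l := by
        match hq : List.ofFn x, hlen with
        | [], _ => rw [hq] at hp; exact (List.nil_perm.1 hp).symm
        | [a], _ => rw [hq] at hp; exact List.singleton_perm.1 hp
      exact ⟨l, hl, by rw [he]; simp [hL.innerSet_eq hV]⟩
  refine ⟨[], List.ofFn x, List.nodup_nil, fun i => by simp [hL.innerSet_eq hV], hopt, by simpa using h1,
    by simpa using h2, fun j hj => by simp at hj, ?_⟩
  intro j hj
  have hj' : j < N := by simpa using hj
  have := h3 _ (x ⟨j, hj'⟩).2
  rw [hxr] at this
  simpa using this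

/-- Finds the inner points and an order of the outer points. -/
def orderProg : Prog :=
  .seq testLine (.seq (.ite (.intLe (var 41) (.lit 0)) lineOrder hullOrder)
    (.ite (.intLe (.lit 1) (var 45)) (.intStore 48 (var 45) (.load 48 (.lit 0)))
      (setVar 43 (var 43))))

theorem orderProg_spec (hV : Function.Injective V) {s : Store} (h : Coords V s) (hB : N + 1 ≤ B) :
    Tri B orderProg s (100 * (N + 1) ^ 3) fun s' =>
      ∃ idx x, HasOrder V s' idx x ∧ IsOrder V idx x := by
  refine (Tri.seq (testLine_spec hV h hB) fun s₁ hs₁ h1 => Tri.seq (T₂ := 2)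
    (Tri.ite (T := N * (N * (N * 4 + 7) + 5) + 2 + (N * 5 + 4 + (N * 3 + 3)) + N * (N * 4 + 6) + 4)
      (Q := fun s' => OrderLists V s') (fun hb => ?_) fun hb => ?_) ?_).time ?_
  · have hL : OneLine V := h1.1 (by simpa using hb)
    exact (lineOrder_lists hV hL (h.same hs₁ rfl) hB).time (by omega)
  · have hL : ¬ OneLine V := fun hL => hb (by simpa using h1.2 hL)
    exact (hullOrder_spec hV hL (h.same hs₁ rfl) hB).time (by omega)
  · rintro s₂ _ ⟨L, y, hLn, hLm, hy, h43, h45, h44, h48⟩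
    refine Tri.ite (T := 1) (fun hb => ?_) fun hb => ?_
    · have hpos : 0 < y.length := by
        rw [← h45]; simpa [Nat.succ_le_iff] using hb
      have h480 := h48 0 (by simpa using hpos)
      refine Tri.int ?_ (exists_hasOrder hLn hLm hy ?_ ?_ ?_ ?_ ?_)
      · simp at h480 ⊢
        rw [h480]; omega
      · simpa using h43
      · simpa using h45
      · intro j hj; simp [h44 j hj]
      · intro j hj
        have hj' : j < y.length := by simpa using hj
        have := h48 j hj
        simpa [h45, hj'.ne] using this
      · simp [h45, hpos.ne]
    · have h0 : y.length = 0 := by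
        rw [← h45]; simpa using hb
      have hl : L.length ≤ N := by simpa using hLn.length_le_card
      refine Tri.int (by simp [h43]; omega) (exists_hasOrder hLn hLm hy ?_ ?_ ?_ ?_ ?_)
      · simpa using h43
      · simpa using h45
      · intro j hj; simp [h44 j hj]
      · intro j hj; simp [h0] at hj
      · rw [h0]
  · nlinarith [sq_nonneg N]

end

/-! ### The program for the reduction: the selection of the terminal pairs -/

section

variable {N : ℕ} {V : Fin N → Plane} {B : ℕ}

theorem HasOrder.same {s s' : Store} {p : Prog} {idx : Fin (innerCount V) → Fin N}
    {x : Fin (N - innerCount V) → Fin N} (h : HasOrder V s idx x) (hs : Same p s s')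
    (hp : (p.wI 43 || p.wI 44 || p.wI 45 || p.wI 48) = false) : HasOrder V s' idx x := by
  simp only [Bool.or_eq_false_iff] at hp
  obtain ⟨⟨⟨h1, h2⟩, h3⟩, h4⟩ := hp
  unfold HasOrder
  rw [hs.1 _ h1, hs.1 _ h2, hs.1 _ h3, hs.1 _ h4]
  exact h

/-- Stores the instance with all pairs of consecutive outer points. -/
def buildInst : Prog :=
  .seq (setVar 0 (var 43)) (.seq (setVar 1 (var 45)) (.seq
    (forLoop 50 (var 43) (.seq (.realStore 0 (var 50) (.load 40 (.load 44 (var 50))))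
      (.realStore 1 (var 50) (.load 41 (.load 44 (var 50))))))
    (forLoop 50 (var 45) (.seq (.realStore 2 (var 50) (.load 40 (.load 48 (var 50))))
      (.seq (.realStore 3 (var 50) (.load 41 (.load 48 (var 50))))
      (.seq (.realStore 4 (var 50) (.load 40 (.load 48 (var 50 + .lit 1))))
      (.realStore 5 (var 50) (.load 41 (.load 48 (var 50 + .lit 1))))))))))

theorem buildInst_spec {s : Store} {idx : Fin (innerCount V) → Fin N}
    {x : Fin (N - innerCount V) → Fin N} (hc : Coords V s) (ho : HasOrder V s idx x)
    (hk : innerCount V ≤ N) (hB : N ≤ B) :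
    Tri B buildInst s (N * 10 + 6) fun s' => (fullInst V idx x).StoredIn s' := by
  obtain ⟨h43, h45, h44, h48⟩ := id ho
  refine (Tri.intSeq (by simp [h43]; omega) (Tri.intSeq (by simp [h45]; omega) (Tri.seq
    (T₁ := N * 4 + 2) (T₂ := N * 6 + 2) ((Tri.forLoop (T := 2) (K := innerCount V)
    (fun k s' => ∀ v : Fin (innerCount V), (v : ℕ) < k →
      s'.real 0 v = V (idx v) 0 ∧ s'.real 1 v = V (idx v) 1) rfl (by omega) ?_ ?_ ?_).time ?_)
    ?_))).time (by omega)
  · intro v hv; omega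
  · intro s' hs'; simp [hs'.1 43 rfl, h43]
  · intro k hk s' hs' hv hI
    refine Tri.realSeq (Tri.real fun v hvk => ?_)
    have e40 : s'.real 40 = s.real 40 := hs'.2 40 rfl
    have e41 : s'.real 41 = s.real 41 := hs'.2 41 rfl
    have e44 : s'.int 44 = s.int 44 := by rw [hs'.1 44 rfl]; funext j; simp
    by_cases h : (v : ℕ) = k
    · simp [hv, ← h, e40, e41, e44, h44, hc.x, hc.y]
    · have := hI v (by omega)
      simp [hv, h, this]
  · nlinarith
  intro s₁ hs₁ h1
  refine (Tri.forLoop (T := 4) (K := N - innerCount V)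
    (fun k s' => s'.real 0 = s₁.real 0 ∧ s'.real 1 = s₁.real 1 ∧
      ∀ i : Fin (N - innerCount V), (i : ℕ) < k →
      s'.real 2 i = V (x i) 0 ∧ s'.real 3 i = V (x i) 1 ∧
      s'.real 4 i = V (x (finRotate _ i)) 0 ∧ s'.real 5 i = V (x (finRotate _ i)) 1)
    rfl (by omega) ⟨rfl, rfl, fun i hi => by omega⟩ ?_ ?_).conseq ?_ ?_
  · intro s' hs'; simp [hs'.1 45 rfl, hs₁.1 45 rfl, h45]
  · rintro k hk s' hs' hv ⟨g0, g1, hI⟩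
    refine Tri.realSeq (Tri.realSeq (Tri.realSeq (Tri.real ⟨by funext j; simp [g0], by funext j; simp [g1],
      fun i hik => ?_⟩)))
    have e40 : s'.real 40 = s.real 40 := (hs'.2 40 rfl).trans (hs₁.2 40 rfl)
    have e41 : s'.real 41 = s.real 41 := (hs'.2 41 rfl).trans (hs₁.2 41 rfl)
    have e48 : s'.int 48 = s.int 48 := by
      rw [hs'.1 48 rfl, hs₁.1 48 rfl]; funext j; simp
    by_cases h : (i : ℕ) = k
    · obtain ⟨p1, p2⟩ := h48 i
      rw [h] at p1 p2
      simp [hv, h, e40, e41, e48, p1, p2, hc.x, hc.y]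
    · have := hI i (by omega)
      simp [hv, h, this]
  · have : N - innerCount V ≤ N := by omega
    nlinarith
  · rintro s₂ hs₂ ⟨g0, g1, h2⟩
    refine ⟨?_, ?_, fun v => ?_, fun i => h2 i i.2⟩
    · rw [hs₂.1 0 rfl, hs₁.1 0 rfl]; simp [h43]
    · rw [hs₂.1 1 rfl, hs₁.1 1 rfl]; simp [h45]
    · rw [g0, g1]; exact h1 v v.2

/-- Marks redundant terminal pairs, if there are at least `k ^ 2` pairs; otherwise no pair is marked,
and the assignment to the variable `55` has no purpose. -/
def markPairs : Prog :=
  .ite (.intLe (var 43 * var 43) (var 45)) matchingProg (setVar 55 (var 43))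

/-- If there are fewer than `k ^ 2` pairs, then nothing has to be marked, and the program for redundant
pairs would not be applicable. -/
theorem markPairs_spec {s : Store} {idx : Fin (innerCount V) → Fin N}
    {x : Fin (N - innerCount V) → Fin N} (ho : HasOrder V s idx x)
    (hi : IsOrder V idx x) (hs : (fullInst V idx x).StoredIn s) (hz : ∀ j, s.int 2 j = 0)
    (hk : innerCount V ≤ N) (hB : 4 * (N + 1) ≤ B) :
    Tri B markPairs s (1 + 300 * ((N - innerCount V) * (max (innerCount V) 1) ^ 2 +
      (max (innerCount V) 1) ^ 6)) fun s' => ∃ T₀ : Finset (Fin (N - innerCount V)),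
        (∀ j : Fin (N - innerCount V), s'.int 2 j = if j ∈ T₀ then 1 else 0) ∧
        T₀.card = N - innerCount V - innerCount V ^ 2 ∧
        ∃ R, (fullInst V idx x).IsOptimal R ∧ ∀ j ∈ T₀, R j = [] := by
  have hpos : 1 ≤ (max (innerCount V) 1) ^ 6 := Nat.one_le_pow _ _ (by omega)
  refine Tri.ite (fun hb => ?_) fun hb => ?_
  · refine matchingProg_correct hs ?_ (by omega) fun j _ => hz j
    simpa [ho.1, ho.2.1, sq] using hb
  · refine (Tri.int (by simp [ho.1]; omega) ?_).time (by omega)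
    have hlt : N - innerCount V < innerCount V ^ 2 := by
      simpa [ho.1, ho.2.1, sq] using hb
    refine ⟨∅, fun j => by simp [hz], by simp; omega, ?_⟩
    have hopt := hi.2.2
    obtain ⟨R, hR⟩ := exists_optimal_fullTour hi.2.1 hopt
    have hx : Function.Injective x := List.nodup_ofFn.1 hopt.nodup
    have hr : Set.range x = (Set.range idx)ᶜ := by
      ext i
      rw [hi.2.1, Set.mem_compl_iff, ← hopt.mem_iff, List.mem_ofFn']
    obtain ⟨R', hR'⟩ := (fullInst V idx x).exists_isOptimal
      ⟨R, (isTour_fullTour hi.1 hx hr).1 hR.1⟩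
    exact ⟨R', hR', by simp⟩

/-- Replaces the instance by the one with the unmarked pairs, whose numbers are listed in the
array `3`, and computes the total length of the edges between the marked pairs. -/
def keepPairs : Prog :=
  .seq (setVar 55 (.lit 0)) (.seq (.realStore 6 (.lit 0) zeroE) (.seq
    (forLoop 50 (var 45) (.ite (.intLe (.lit 1) (.load 2 (var 50)))
      (.realStore 6 (.lit 0) (.load 6 (.lit 0) +
        distE (.load 40 (.load 48 (var 50))) (.load 41 (.load 48 (var 50)))
          (.load 40 (.load 48 (var 50 + .lit 1))) (.load 41 (.load 48 (var 50 + .lit 1)))))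
      (.seq (.realStore 2 (var 55) (.load 40 (.load 48 (var 50))))
      (.seq (.realStore 3 (var 55) (.load 41 (.load 48 (var 50))))
      (.seq (.realStore 4 (var 55) (.load 40 (.load 48 (var 50 + .lit 1))))
      (.seq (.realStore 5 (var 55) (.load 41 (.load 48 (var 50 + .lit 1))))
      (.seq (.intStore 3 (var 55) (var 50)) (setVar 55 (var 55 + .lit 1)))))))))
    (setVar 1 (var 55))))

/-- In the arrays `40`, `41` and `48` the end points of the `i`-th pair are the entries `i` and `i + 1`
of the closed order. -/
theorem keepPairs_spec {s : Store} {M : ℕ} (h45 : s.int 45 0 = M) (hB : M + 1 ≤ B) :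
    Tri B keepPairs s (M * 9 + 5) fun s' =>
      s'.int 1 0 = ((List.range M).filter (s.int 2 · = 0)).length ∧
      Listed (s'.int 3) ((List.range M).filter (s.int 2 · = 0)) ∧
      (∀ j < ((List.range M).filter (s.int 2 · = 0)).length,
        s'.real 2 j = s.real 40 (s.int 48 (s'.int 3 j)) ∧
        s'.real 3 j = s.real 41 (s.int 48 (s'.int 3 j)) ∧
        s'.real 4 j = s.real 40 (s.int 48 (s'.int 3 j + 1)) ∧
        s'.real 5 j = s.real 41 (s.int 48 (s'.int 3 j + 1))) ∧
      s'.real 6 0 = ∑ i ∈ Finset.range M, if s.int 2 i = 0 then 0 else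
        dist2 (s.real 40 (s.int 48 i)) (s.real 41 (s.int 48 i)) (s.real 40 (s.int 48 (i + 1)))
          (s.real 41 (s.int 48 (i + 1))) := by
  set L : ℕ → List ℕ := fun k => (List.range k).filter (s.int 2 · = 0) with hL
  have hLl : ∀ k, (L k).length ≤ k := fun k => (List.length_filter_le _ _).trans (by simp)
  have hLs : ∀ k, L (k + 1) = L k ++ if s.int 2 k = 0 then [k] else [] := by
    intro k
    simp only [hL, List.range_succ, List.filter_append]
    congr 1
    split_ifs with h <;> simp [h]
  show Tri B keepPairs s (M * 9 + 5) fun s' => s'.int 1 0 = (L M).length ∧ Listed (s'.int 3) (L M) ∧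
    (∀ j < (L M).length, _) ∧ _
  refine (Tri.intSeq (by simp) (Tri.realSeq (Tri.seq (T₂ := 1) (Tri.forLoop (T := 7) (K := M)
    (fun k s' => s'.int 55 0 = (L k).length ∧ Listed (s'.int 3) (L k) ∧
      (∀ j < (L k).length,
        s'.real 2 j = s.real 40 (s.int 48 (s'.int 3 j)) ∧
        s'.real 3 j = s.real 41 (s.int 48 (s'.int 3 j)) ∧
        s'.real 4 j = s.real 40 (s.int 48 (s'.int 3 j + 1)) ∧
        s'.real 5 j = s.real 41 (s.int 48 (s'.int 3 j + 1))) ∧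
      s'.real 6 0 = ∑ i ∈ Finset.range k, if s.int 2 i = 0 then 0 else
        dist2 (s.real 40 (s.int 48 i)) (s.real 41 (s.int 48 i)) (s.real 40 (s.int 48 (i + 1)))
          (s.real 41 (s.int 48 (i + 1)))) rfl (by omega) ⟨?_, ?_, ?_, ?_⟩ ?_ ?_) ?_))).time (by omega)
  · simp [hL]
  · intro j hj; simp [hL] at hj
  · intro j hj; simp [hL] at hj
  · simp
  · intro s' hs'; simp [hs'.1 45 rfl, h45]
  · rintro k hk s' hs' hv ⟨h1, h2, h3, h4⟩
    have e2 : s'.int 2 = s.int 2 := by rw [hs'.1 2 rfl]; funext j; simp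
    have e48 : s'.int 48 = s.int 48 := by rw [hs'.1 48 rfl]; funext j; simp
    have e40 : s'.real 40 = s.real 40 := by rw [hs'.2 40 rfl]; funext j; simp
    have e41 : s'.real 41 = s.real 41 := by rw [hs'.2 41 rfl]; funext j; simp
    have hl := hLl k
    refine Tri.ite (T := 6) (fun hb => ?_) fun hb => ?_
    · have hb' : s.int 2 k ≠ 0 := by
        simp only [BoolExpr.val_intLe, IntExpr.val_load, IntExpr.val_lit, e2, hv] at hb
        omega
      rw [hLs, if_neg hb', List.append_nil, Finset.sum_range_succ, if_neg hb', ← h4]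
      refine (Tri.real ⟨by simpa using h1, ?_, ?_, ?_⟩).time (by omega)
      · intro j hj; simpa using h2 j hj
      · intro j hj; simpa using h3 j hj
      · simp only [Store.setInt_real, Store.setReal_real, IntExpr.val_lit, and_self, if_true,
          RealExpr.val_add, RealExpr.val_load]
        congr 1
        simp only [distE, dist2, RealExpr.val_sqrt, RealExpr.val_add, RealExpr.val_mul,
          RealExpr.val_sub, RealExpr.val_load, IntExpr.val_load, IntExpr.val_lit, IntExpr.val_add,
          e40, e41, e48, hv]
    · have hb' : s.int 2 k = 0 := by
        simp only [BoolExpr.val_intLe, IntExpr.val_load, IntExpr.val_lit, e2, hv] at hb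
        omega
      rw [hLs, if_pos hb', Finset.sum_range_succ, if_pos hb', add_zero, ← h4,
        List.length_append, List.length_singleton]
      refine (Tri.realSeq (Tri.realSeq (Tri.realSeq (Tri.realSeq (Tri.intSeq (by simp [hv]; omega)
        (Tri.int (by simp [h1]; omega) ⟨by simp [h1], ?_, ?_, by simp⟩)))))).time (by omega)
      · refine h2.concat (fun j hj => ?_) ?_
        · simp [h1, hj.ne]
        · simp [h1, hv]
      · intro j hj
        rcases Nat.lt_succ_iff_lt_or_eq.1 hj with h5 | h5
        · simpa [h1, h5.ne] using h3 j h5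
        · subst h5
          simp [h1, hv, e40, e41, e48]
  · rintro s' hs' ⟨h1, h2, h3, h4⟩
    have hl := hLl M
    refine Tri.int (by simp [h1]; omega) ⟨by simp [h1], ?_, ?_, by simpa using h4⟩
    · intro j hj
      rw [Store.setInt_int_ne _ (by decide)]
      exact h2 j hj
    · intro j hj
      rw [Store.setInt_int_ne _ (by decide)]
      exact h3 j hj

/-- Stores the index sequences. -/
def storeIndices : Prog :=
  .seq (forLoop 50 (var 45) (.intStore 2 (var 50) (.load 48 (var 50))))
    (forLoop 50 (var 43) (.intStore 4 (var 50) (.load 44 (var 50))))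

theorem storeIndices_spec {s : Store} {idx : Fin (innerCount V) → Fin N}
    {x : Fin (N - innerCount V) → Fin N} (ho : HasOrder V s idx x) (hk : innerCount V ≤ N)
    (hB : N ≤ B) : Tri B storeIndices s (N * 6 + 4) fun s' =>
      (∀ i : Fin (N - innerCount V), s'.int 2 i = x i) ∧
      (∀ v : Fin (innerCount V), s'.int 4 v = idx v) := by
  obtain ⟨h43, h45, h44, h48⟩ := id ho
  refine (Tri.seq (Tri.forLoop (T := 1) (K := N - innerCount V) (fun k s' =>
    ∀ i : Fin (N - innerCount V), (i : ℕ) < k → s'.int 2 i = x i) rfl (by omega)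
    (fun i hi => by omega) ?_ ?_) fun s₁ hs₁ h1 => (Tri.forLoop (T := 1) (K := innerCount V)
    (fun k s' => s'.int 2 = s₁.int 2 ∧ ∀ i : Fin (innerCount V), (i : ℕ) < k → s'.int 4 i = idx i)
    rfl (by omega) ⟨?_, fun i hi => by omega⟩ ?_ ?_).conseq le_rfl fun s' _ h =>
      ⟨fun i => by rw [h.1]; exact h1 i i.2, fun i => h.2 i i.2⟩).time (by omega)
  · intro s' hs'; simp [hs'.1 45 rfl, h45]
  · intro k hk' s' hs' hv hI
    have e48 : s'.int 48 = s.int 48 := hs'.1 48 rfl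
    have hxk := (h48 ⟨k, hk'⟩).1
    simp only at hxk
    refine Tri.int (by simp [hv, e48, hxk]; omega) fun i hi => ?_
    by_cases h : (i : ℕ) = k
    · simp [hv, ← h, e48, (h48 i).1]
    · simpa [hv, h] using hI i (by omega)
  · funext j; simp
  · intro s' hs'; simp [hs'.1 43 rfl, hs₁.1 43 rfl, h43]
  · rintro k hk' s' hs' hv ⟨h2, hI⟩
    have e44 : s'.int 44 = s.int 44 := (hs'.1 44 rfl).trans (hs₁.1 44 rfl)
    have hxk := h44 ⟨k, hk'⟩
    simp only at hxk
    refine Tri.int (by simp [hv, e44, hxk]; omega) ⟨by funext j; simp [h2], fun i hi => ?_⟩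
    by_cases h : (i : ℕ) = k
    · simp [hv, ← h, e44, h44 i]
    · simpa [hv, h] using hI i (by omega)

/-- The program of the bikernel. The arrays `0` to `6` hold the instance and the output in the cells
that `Points.StoredIn` and `Kernel.StoredIn` prescribe. The other content is the following.
* Variable `40`, real arrays `40` and `41`: the number of points, and their coordinates.
* Variable `41`: zero iff all points are on one line.
* Array `42`: the successors on the hull.
* Variable `43`, array `44`: the number of inner points, and a list of them.
* Variable `45`, array `48`: the number of outer points, and their order, closed by the first one.
* Variable `47`: an outer point.
* Variable `55`: the number of terminal pairs that have been kept so far.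

The points are copied, since the arrays `0` and `1` receive the inner points only. -/
def reduceProg : Prog :=
  .seq copyPoints (.seq orderProg (.seq buildInst (.seq markPairs (.seq keepPairs storeIndices))))

theorem innerCount_le (V : Fin N → Plane) : innerCount V ≤ N := by
  have := Set.ncard_le_ncard (Set.subset_univ (innerSet V)) Set.finite_univ
  rwa [Set.ncard_univ, Nat.card_eq_fintype_card, Fintype.card_fin] at this

theorem reduceProg_spec (hV : Function.Injective V) (hB : 4 * (N + 1) ≤ B) :
    Tri B reduceProg (tspInput V) (N * 4 + 3 + (100 * (N + 1) ^ 3 + (N * 10 + 6 +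
      (1 + 300 * ((N - innerCount V) * (max (innerCount V) 1) ^ 2 + (max (innerCount V) 1) ^ 6) +
      (N * 9 + 5 + (N * 6 + 4)))))) fun s' => ∃ S : Selection V, (S.kernel hV).StoredIn s' := by
  have hk := innerCount_le V
  refine Tri.seq (copyPoints_spec (V := V) (by simp [tspInput]) (by omega)
    (fun i => by simp [tspInput, tab]) (fun i => by simp [tspInput, tab])) fun s₁ hs₁ hc₁ => ?_
  refine Tri.seq (orderProg_spec hV hc₁ (by omega)) fun s₂ hs₂ ⟨idx, x, ho₂, hi⟩ => ?_
  have hc₂ := hc₁.same hs₂ rfl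
  refine Tri.seq (buildInst_spec hc₂ ho₂ hk (by omega)) fun s₃ hs₃ hD₃ => ?_
  have hc₃ := hc₂.same hs₃ rfl
  have ho₃ := ho₂.same hs₃ rfl
  have hz₃ : ∀ j, s₃.int 2 j = 0 := by
    intro j; rw [hs₃.1 2 rfl, hs₂.1 2 rfl, hs₁.1 2 rfl]; simp [tspInput]
  refine Tri.seq (markPairs_spec ho₃ hi hD₃ hz₃ hk hB) fun s₄ hs₄ ⟨T₀, hT, hTc, R, hR, hR0⟩ => ?_
  have hc₄ := hc₃.same hs₄ rfl
  have ho₄ := ho₃.same hs₄ rfl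
  refine Tri.seq (Tri.time (keepPairs_spec (M := N - innerCount V) ho₄.2.1 (by omega)) (by omega))
    fun s₅ hs₅ ⟨h1, h3, hp, h6⟩ => ?_
  have ho₅ := ho₄.same hs₅ rfl
  refine (storeIndices_spec ho₅ hk (by omega)).conseq le_rfl fun s₆ hs₆ ⟨h2, h4⟩ => ?_
  set L := (List.range (N - innerCount V)).filter (s₄.int 2 · = 0) with hL
  have hLt : ∀ j (hj : j < L.length), L[j] < N - innerCount V := fun j hj => by
    have := List.getElem_mem hj
    simpa using List.mem_of_mem_filter this
  have hLn : L.Nodup := List.nodup_range.filter _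
  set kept : Fin L.length → Fin (N - innerCount V) := fun j => ⟨L[j], hLt j j.2⟩ with hkept
  have hkinj : Function.Injective kept := fun a b hab =>
    Fin.ext ((List.Nodup.getElem_inj_iff hLn).1 (congrArg Fin.val hab))
  have hmem : ∀ i, (∃ j, kept j = i) ↔ i ∉ T₀ := by
    intro i
    have h0 : s₄.int 2 i = 0 ↔ i ∉ T₀ := by
      rw [hT]; split_ifs with h <;> simp [h]
    rw [← h0]
    constructor
    · rintro ⟨j, rfl⟩
      have h := (List.mem_filter.1 (List.getElem_mem j.2)).2
      exact of_decide_eq_true h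
    · intro h
      have : (i : ℕ) ∈ L := List.mem_filter.2 ⟨by simp, by simpa using h⟩
      obtain ⟨j, hj, he⟩ := List.mem_iff_getElem.1 this
      exact ⟨⟨j, hj⟩, Fin.ext he⟩
  -- at most `k ^ 2` pairs are kept: exactly `M - (M - k ^ 2)` of `M` pairs
  have hcard : L.length = N - innerCount V - T₀.card := by
    have : Finset.univ.image kept = T₀ᶜ := by
      ext i; simp [hmem]
    rw [← Fintype.card_fin L.length, ← Finset.card_univ, ← Finset.card_image_of_injective _ hkinj,
      this, Finset.card_compl, Fintype.card_fin]
  -- the pairs that are not kept are the marked ones, on which `R` is redundant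
  have hnot : ∀ i, (∀ j, kept j ≠ i) ↔ i ∈ T₀ := by
    intro i
    rw [← not_iff_not, ← hmem]; push Not; rfl
  let S : Selection V :=
    { m := L.length
      innerIdx := idx
      outer := x
      kept := kept
      innerIdx_injective := hi.1
      range_innerIdx := hi.2.1
      optOrder := hi.2.2
      kept_injective := hkinj
      le_sq := by omega
      exists_redundant := ⟨R, hR, fun i hi => hR0 i ((hnot i).1 hi)⟩ }
  have e48 : ∀ j : Fin L.length, s₅.int 3 j = kept j := fun j => h3 j j.2
  refine ⟨S, ⟨?_, ?_, ?_, ?_⟩, h2, ?_, h4, ?_⟩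
  · rw [hs₆.1 0 rfl, hs₅.1 0 rfl, hs₄.1 0 rfl]; exact hD₃.1
  · rw [hs₆.1 1 rfl]; exact h1
  · intro v
    rw [hs₆.2 0 rfl, hs₅.2 0 rfl, hs₄.2 0 rfl, hs₆.2 1 rfl, hs₅.2 1 rfl, hs₄.2 1 rfl]
    exact hD₃.2.2.1 v
  · intro (j : Fin L.length)
    have := hp j j.2
    rw [e48 j, (ho₄.2.2.2 _).1, (ho₄.2.2.2 _).2, hc₄.x, hc₄.x, hc₄.y, hc₄.y] at this
    rw [hs₆.2 2 rfl, hs₆.2 3 rfl, hs₆.2 4 rfl, hs₆.2 5 rfl]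
    exact this
  · intro j
    rw [hs₆.1 3 rfl]; exact e48 j
  · rw [hs₆.2 6 rfl, h6, Finset.sum_range]
    show _ = ∑ i with ∀ j, kept j ≠ i, dist (V (x i)) (V (x (finRotate _ i)))
    rw [Finset.sum_filter]
    refine Finset.sum_congr rfl fun i _ => ?_
    rw [(ho₄.2.2.2 _).1, (ho₄.2.2.2 _).2, hc₄.x, hc₄.x, hc₄.y, hc₄.y, dist2_eq_dist, hT]
    by_cases h : i ∈ T₀
    · rw [if_pos ((hnot i).2 h), if_pos h, if_neg one_ne_zero]
    · rw [if_neg (fun hn => h ((hnot i).1 hn)), if_neg h, if_pos rfl]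

theorem reduceProg_ok : reduceProg.ok 10 60 = true := by decide +kernel

end

/-- The bikernel can be computed in polynomial time. -/
theorem exists_kernel_prog :
    ∃ (Q : Prog) (C : ℕ), ∀ (N : ℕ) (V : Fin N → Plane), Function.Injective V →
      ∃ (t : ℕ) (s : Store) (K : Kernel V),
        Exec ⟨(N + 2) ^ C, (N + 2) ^ C⟩ Q (tspInput V) t s ∧
        t ≤ (N + 2) ^ C ∧
        K.StoredIn s ∧
        K.m ≤ innerCount V ^ 2 ∧
        K.Correct := by
  refine ⟨reduceProg, 300, fun N V hV => ?_⟩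
  have hN : N + 1 ≤ N + 2 := by omega
  have hpow : ∀ a b, a ≤ b → (N + 2) ^ a ≤ (N + 2) ^ b := fun a b h =>
    Nat.pow_le_pow_right (by omega) h
  have h2 : ∀ a, 2 ^ a ≤ (N + 2) ^ a := fun a => Nat.pow_le_pow_left (by omega) a
  have hB : 4 * (N + 1) ≤ (N + 2) ^ 4 := by
    have := h2 3
    calc 4 * (N + 1) ≤ 2 ^ 3 * (N + 2) := by omega
      _ ≤ (N + 2) ^ 3 * (N + 2) := Nat.mul_le_mul_right _ this
      _ = (N + 2) ^ 4 := by ring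
  obtain ⟨t, s, hr, ht, S, hS⟩ := reduceProg_spec (B := (N + 2) ^ 4) hV hB
  refine ⟨t, s, S.kernel hV, hr.exec (K := 10) (S := 60) ?_ ?_ ?_ ?_ ?_ reduceProg_ok, ht.trans ?_,
    hS, S.le_sq, S.kernel_correct hV⟩
  · intro a i
    simp only [tspInput]
    split_ifs <;> omega
  · have := h2 4; omega
  · have := h2 4; omega
  · show 10 * (N + 2) ^ 4 < (N + 2) ^ 300
    have h4 : 16 ≤ (N + 2) ^ 4 := h2 4
    calc 10 * (N + 2) ^ 4 < 16 * (N + 2) ^ 4 := by omega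
      _ ≤ (N + 2) ^ 4 * (N + 2) ^ 4 := Nat.mul_le_mul_right _ h4
      _ = (N + 2) ^ 8 := by ring
      _ ≤ (N + 2) ^ 300 := hpow _ _ (by norm_num)
  · show ((N + 2) ^ 4) ^ 60 ≤ (N + 2) ^ 300
    rw [← pow_mul]
    exact hpow _ _ (by norm_num)
  · have hk := innerCount_le V
    set a := N + 2 with ha
    have h1 : max (innerCount V) 1 ≤ a := by omega
    have h3 : (max (innerCount V) 1) ^ 2 ≤ a ^ 2 := Nat.pow_le_pow_left h1 2
    have h6 : (max (innerCount V) 1) ^ 6 ≤ a ^ 6 := Nat.pow_le_pow_left h1 6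
    have h7 : (N - innerCount V) * (max (innerCount V) 1) ^ 2 ≤ a * a ^ 2 :=
      Nat.mul_le_mul (by omega) h3
    have e3 : a * a ^ 2 = a ^ 3 := by ring
    have h8 : (N + 1) ^ 3 ≤ a ^ 3 := Nat.pow_le_pow_left hN 3
    have h9 : a ^ 3 ≤ a ^ 6 := hpow _ _ (by norm_num)
    have h10 : a ≤ a ^ 6 := by simpa using hpow 1 6 (by norm_num)
    have h11 : 2 ^ 10 ≤ a ^ 10 := h2 10
    calc _ ≤ 1024 * a ^ 6 := by omega
      _ ≤ a ^ 10 * a ^ 6 := Nat.mul_le_mul_right _ h11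
      _ = a ^ 16 := by ring
      _ ≤ a ^ 300 := hpow _ _ (by norm_num)

end GETSPReduction

theorem mainTheorem2 :
    (∃ (P : Prog) (C : ℕ), ∀ (n m : ℕ) (I : GETSP n m), n ^ 2 ≤ m →
      ∃ (t : ℕ) (s : Store) (T₀ : Finset (Fin m)),
        Exec ⟨C * max m 1, (n + m + 2) ^ C⟩ P I.input t s ∧
        t ≤ C * (m * (max n 1) ^ 2 + (max n 1) ^ 6) ∧
        (∀ j : Fin m, s.int 2 j = if j ∈ T₀ then 1 else 0) ∧
        T₀.card = m - n ^ 2 ∧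
        ∃ R : Fin m → List (Fin n), I.IsOptimal R ∧ ∀ j ∈ T₀, R j = []) ∧
    (∃ (Q : Prog) (C : ℕ), ∀ (N : ℕ) (V : Fin N → Plane), Function.Injective V →
      ∃ (t : ℕ) (s : Store) (K : Kernel V),
        Exec ⟨(N + 2) ^ C, (N + 2) ^ C⟩ Q (tspInput V) t s ∧
        t ≤ (N + 2) ^ C ∧
        K.StoredIn s ∧
        K.m ≤ innerCount V ^ 2 ∧
        K.Correct) := by
  exact ⟨exists_redundancy_prog, exists_kernel_prog⟩
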